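/- Let $s\ge 3$. On $\mathbb R^{1+s}$ with the Minkowski form $x\cdot y=x_0y_0-\sum_{i=1}^s x_iy_i$ let $\mathcal P_+^\uparrow$ be the proper orthochronous Poincaré group. For $m\ge 0$ the scalar representation of mass $m$ acts on $L^2$ of the mass hyperboloid $\{(\omega_m(p),p):p\in\mathbb R^s\}$, $\omega_m(p)=\sqrt{m^2+|p|^2}$, with the invariant measure $d^sp/2\omega_m(p)$, by $(U(a,\Lambda)f)(p)=e^{ia\cdot p}f(\Lambda^{-1}p)$. A wedge is a region $W=gW_1$ with $g\in\mathcal P_+^\uparrow$ and $W_1=\{x:|x_0|<x_1\}$; $W'$ is its open causal complement, that is, the interior of the set of points spacelike to all points of $W$; $\Lambda_W(t)=g\Lambda_{W_1}(t)g^{-1}$, where $\Lambda_{W_1}(t)$ maps $(x_0,x_1)$ to $(x_0\cosh t+x_1\sinh t,\;x_0\sinh t+x_1\cosh t)$ and fixes the other coordinates; and $G_W$ is the group generated by all translations and the elements of $\mathcal P_+^\uparrow$ preserving $W$. For a closed real subspace $K$ of a complex Hilbert space, $K'=\{\xi:\operatorname{Im}\langle\eta,\xi\rangle=0\ \forall \eta\in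 K\}$; $K$ is cyclic if $K+iK$ is dense and standard if moreover $K\cap iK=\{0\}$; for standard $K$, $S_K$ is the closure of $\xi+i\eta\mapsto\xi-i\eta$ $(\xi,\eta\in K)$ and $\Delta_K=S_K^*S_K$. Let $\mu$ be a $\sigma$-finite Borel measure on $[0,\infty)$ and let $U=\int_{[0,\infty)}^{\oplus}U_m\,d\mu(m)$ be a direct integral of unitary representations of $\mathcal P_+^\uparrow$ over a measurable field of (separable) Hilbert spaces, where for $\mu$-almost every $m$ the representation $U_m$ is unitarily equivalent to a finite or infinite multiple of the scalar representation of mass $m$. Then $U$ satisfies the modularity condition (M) $U(r)\in U(G_W)''$ for every wedge $W$ and every $r\in\mathcal P_+^\uparrow$ with $rW=W'$. Moreover, let $W\mapsto H(W)$ be any map from wedges to closed real subspaces of the Hilbert space of $U$ such that $H(W_a)\subset H(W_b)$ if $W_a\subset W_b$; $U(g)H(W)=H(gW)$ for $g\in\mathcal P_+^\uparrow$; every $H(W)$ is cyclic; and $H(W_a)\subset H(W_b)'$ if $W_a\subset W_b'$. (Each $H(W)$ is then standard.) Then for every wedge $W$ the Bisognano–Wichmann property $U(\Lambda_W(2\pi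 t))=\Delta_{H(W)}^{-it}$ for all $t\in\mathbb R$, and the duality property $H(W)=H(W')'$ hold. -/

import Mathlib

open MeasureTheory Filter
open scoped NNReal ENNReal InnerProductSpace
noncomputable section
namespace WedgeNets

/-- Minkowski spacetime `ℝ^{1+s}`; coordinate `0` is time. -/
abbrev Spacetime (s : ℕ) : Type := Fin (s + 1) → ℝ

/-- The Minkowski form, of signature `(+,-,…,-)`. -/
def minkowski {s : ℕ} (x y : Spacetime s) : ℝ :=
  x 0 * y 0 - ∑ i : Fin s, x i.succ * y i.succ

/-- The open forward light cone. -/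
def forwardCone (s : ℕ) : Set (Spacetime s) := {x | 0 < minkowski x x ∧ 0 < x 0}

/-- The proper orthochronous Lorentz group. -/
def lorentzGroup (s : ℕ) : Subgroup (Spacetime s ≃ₗ[ℝ] Spacetime s) where
  carrier := {Λ | (∀ x y, minkowski (Λ x) (Λ y) = minkowski x y) ∧
    LinearMap.det (Λ : Spacetime s →ₗ[ℝ] Spacetime s) = 1 ∧
    Λ '' forwardCone s = forwardCone s}
  one_mem' := ⟨fun _ _ => rfl, LinearMap.det_id, Set.image_id _⟩
  mul_mem' := by
    rintro A B ⟨hA, dA, cA⟩ ⟨hB, dB, cB⟩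
    refine ⟨fun x y => (hA _ _).trans (hB _ _), ?_, ?_⟩
    · have : ((A * B : Spacetime s ≃ₗ[ℝ] Spacetime s) : Spacetime s →ₗ[ℝ] Spacetime s) =
        (A : Spacetime s →ₗ[ℝ] Spacetime s) * (B : Spacetime s →ₗ[ℝ] Spacetime s) := rfl
      rw [this, map_mul, dA, dB, one_mul]
    · have : ⇑(A * B) = A ∘ B := rfl
      rw [this, Set.image_comp, cB, cA]
  inv_mem' := by
    rintro A ⟨hA, dA, cA⟩
    have hc : ∀ x, A (A⁻¹ x) = x := fun x => A.apply_symm_apply x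
    refine ⟨fun x y => ?_, ?_, ?_⟩
    · rw [← hA, hc, hc]
    · have h : (A : Spacetime s →ₗ[ℝ] Spacetime s) *
        ((A⁻¹ : Spacetime s ≃ₗ[ℝ] Spacetime s) : Spacetime s →ₗ[ℝ] Spacetime s) = 1 :=
        LinearMap.ext hc
      have := congrArg LinearMap.det h
      rwa [map_mul, dA, one_mul, map_one] at this
    · conv_lhs => rw [← cA]
      rw [← Set.image_comp]
      have : ⇑(A⁻¹) ∘ ⇑A = id := funext fun x => A.symm_apply_apply x
      rw [this, Set.image_id]

/-- The proper orthochronous Poincaré group: the affine bijections of spacetime whose linear part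
is a proper orthochronous Lorentz transformation. -/
def poincareGroup (s : ℕ) : Subgroup (Spacetime s ≃ᵃ[ℝ] Spacetime s) :=
  (lorentzGroup s).comap AffineEquiv.linearHom

/-! ### Wedges -/

/-- The wedge `W₁ = {x : |x₀| < x₁}`. -/
def standardWedge (s : ℕ) : Set (Spacetime s) := {x | |x 0| < x 1}

/-- The image of a region under a Poincaré transformation. -/
def act {s : ℕ} (g : poincareGroup s) (W : Set (Spacetime s)) : Set (Spacetime s) :=
  (g : Spacetime s ≃ᵃ[ℝ] Spacetime s) '' W

/-- Wedges are the Poincaré transforms of `W₁`. -/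
def IsWedge {s : ℕ} (W : Set (Spacetime s)) : Prop :=
  ∃ g : poincareGroup s, W = act g (standardWedge s)

/-- The (open) causal complement: the interior of the set of points that are spacelike separated
from every point of `W`. -/
def causalComplement {s : ℕ} (W : Set (Spacetime s)) : Set (Spacetime s) :=
  interior {x | ∀ y ∈ W, minkowski (x - y) (x - y) < 0}

/-- The boost with rapidity `t` in the `(x₀, x₁)`-plane, as a linear map. -/
def boostMap (s : ℕ) (t : ℝ) : Spacetime s →ₗ[ℝ] Spacetime s where
  toFun x i :=
    if i = 0 then Real.cosh t * x 0 + Real.sinh t * x 1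
    else if i = 1 then Real.sinh t * x 0 + Real.cosh t * x 1
    else x i
  map_add' x y := by
    ext i
    simp only [Pi.add_apply]
    split_ifs <;> ring
  map_smul' c x := by
    ext i
    simp only [Pi.smul_apply, smul_eq_mul, RingHom.id_apply]
    split_ifs <;> ring

theorem boostMap_add (s : ℕ) [NeZero s] (t u : ℝ) (x : Spacetime s) :
    boostMap s t (boostMap s u x) = boostMap s (t + u) x := by
  have h10 : (1 : Fin (s + 1)) ≠ 0 := by
    simp
  ext i
  simp only [boostMap, LinearMap.coe_mk, AddHom.coe_mk, if_neg h10, if_true]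
  split_ifs
  · rw [Real.cosh_add, Real.sinh_add]; ring
  · rw [Real.cosh_add, Real.sinh_add]; ring
  · rfl

theorem boostMap_zero (s : ℕ) (x : Spacetime s) : boostMap s 0 x = x := by
  ext i
  simp only [boostMap, LinearMap.coe_mk, AddHom.coe_mk, Real.cosh_zero, Real.sinh_zero]
  split_ifs with h h'
  · simp [h]
  · simp [h']
  · rfl

theorem minkowski_boostMap (s : ℕ) [NeZero s] (t : ℝ) (x y : Spacetime s) :
    minkowski (boostMap s t x) (boostMap s t y) = minkowski x y := by
  obtain ⟨n, rfl⟩ := Nat.exists_eq_succ_of_ne_zero (NeZero.ne s)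
  have h1 : ∀ i : Fin n, (i.succ.succ : Fin (n + 1 + 1)) ≠ 1 := by
    intro i; simp [Fin.ext_iff]
  have h0 : ∀ i : Fin n, (i.succ.succ : Fin (n + 1 + 1)) ≠ 0 := by
    intro i; simp [Fin.ext_iff]
  simp only [minkowski, Fin.sum_univ_succ, boostMap, LinearMap.coe_mk, AddHom.coe_mk]
  simp only [Nat.succ_eq_add_one, h1, h0, if_false, if_true, Fin.succ_zero_eq_one, one_ne_zero]
  have := Real.cosh_sq t
  linear_combination (x 0 * y 0 - x 1 * y 1) * this

theorem det_boostMap (s : ℕ) [NeZero s] (t : ℝ) : LinearMap.det (boostMap s t) = 1 := by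
  have h10 : (1 : Fin (s + 1)) ≠ 0 := by
    simp
  have hmul : ∀ t u, LinearMap.det (boostMap s t) * LinearMap.det (boostMap s u) =
      LinearMap.det (boostMap s (t + u)) := by
    intro t u
    rw [← map_mul]
    exact congrArg _ (LinearMap.ext (boostMap_add s t u))
  have h0 : LinearMap.det (boostMap s 0) = 1 := by
    rw [show boostMap s 0 = 1 from LinearMap.ext (boostMap_zero s), map_one]
  let R : Spacetime s →ₗ[ℝ] Spacetime s :=
    { toFun := fun x i => if i = 1 then - x i else x i
      map_add' := fun x y => by
        ext i; simp only [Pi.add_apply]; split_ifs <;> ring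
      map_smul' := fun c x => by
        ext i; simp only [Pi.smul_apply, smul_eq_mul, RingHom.id_apply]; split_ifs <;> ring }
  have hR : R * R = 1 := by
    refine LinearMap.ext fun x => funext fun i => ?_
    change (if i = 1 then - (if i = 1 then - x i else x i) else (if i = 1 then - x i else x i)) = x i
    split_ifs <;> ring
  have hRb : R * boostMap s t * R = boostMap s (-t) := by
    refine LinearMap.ext fun x => funext fun i => ?_
    change (if i = 1 then - boostMap s t (R x) i else boostMap s t (R x) i) = _
    have e0 : R x 0 = x 0 := if_neg h10.symm
    have e1 : R x 1 = - x 1 := if_pos rfl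
    simp only [boostMap, LinearMap.coe_mk, AddHom.coe_mk, e0, e1, Real.cosh_neg, Real.sinh_neg]
    split_ifs with h h' h'
    · exact absurd (h.symm.trans h') h10
    · ring
    · ring
    · exact if_neg h
  have hneg : LinearMap.det (boostMap s (-t)) = LinearMap.det (boostMap s t) := by
    have hRR : LinearMap.det R * LinearMap.det R = 1 := by rw [← map_mul, hR, map_one]
    rw [← hRb, map_mul, map_mul]
    linear_combination LinearMap.det (boostMap s t) * hRR
  have hsq : LinearMap.det (boostMap s t) * LinearMap.det (boostMap s t) = 1 := by
    have := hmul t (-t)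
    rwa [hneg, add_neg_cancel, h0] at this
  have hpos : 0 ≤ LinearMap.det (boostMap s t) := by
    have := hmul (t / 2) (t / 2)
    rw [add_halves] at this
    rw [← this]
    exact mul_self_nonneg _
  nlinarith

/-- The boost as a linear equivalence. -/
def boostEquiv (s : ℕ) [NeZero s] (t : ℝ) : Spacetime s ≃ₗ[ℝ] Spacetime s :=
  LinearEquiv.ofLinearMap (boostMap s t) (boostMap s (-t))
    (LinearMap.ext fun x => by
      change boostMap s t (boostMap s (-t) x) = x
      rw [boostMap_add, add_neg_cancel, boostMap_zero])
    (LinearMap.ext fun x => by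
      change boostMap s (-t) (boostMap s t x) = x
      rw [boostMap_add, neg_add_cancel, boostMap_zero])

theorem boostMap_mem_forwardCone (s : ℕ) [NeZero s] (t : ℝ) {x : Spacetime s}
    (hx : x ∈ forwardCone s) : boostMap s t x ∈ forwardCone s := by
  refine ⟨by rw [minkowski_boostMap]; exact hx.1, ?_⟩
  obtain ⟨n, rfl⟩ := Nat.exists_eq_succ_of_ne_zero (NeZero.ne s)
  obtain ⟨h, h0⟩ := hx
  simp only [minkowski, Fin.sum_univ_succ, Fin.succ_zero_eq_one] at h
  have hs : 0 ≤ ∑ i : Fin n, x i.succ.succ * x i.succ.succ :=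
    Finset.sum_nonneg fun i _ => mul_self_nonneg _
  have hlt : |x 1| < x 0 := abs_lt_of_sq_lt_sq (by nlinarith) h0.le
  have hc := Real.cosh_sq t
  have hct := Real.cosh_pos t
  have hst : |Real.sinh t| < Real.cosh t := abs_lt_of_sq_lt_sq (by linarith) hct.le
  change 0 < Real.cosh t * x 0 + Real.sinh t * x 1
  have h3 : -(|Real.sinh t| * |x 1|) ≤ Real.sinh t * x 1 := by
    rw [← abs_mul]; exact neg_abs_le _
  have h4 : |Real.sinh t| * |x 1| < Real.cosh t * x 0 :=
    mul_lt_mul'' hst hlt (abs_nonneg _) (abs_nonneg _)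
  linarith

theorem boostEquiv_mem (s : ℕ) [NeZero s] (t : ℝ) : boostEquiv s t ∈ lorentzGroup s := by
  refine ⟨minkowski_boostMap s t, det_boostMap s t, Set.Subset.antisymm ?_ ?_⟩
  · rintro _ ⟨x, hx, rfl⟩
    exact boostMap_mem_forwardCone s t hx
  · intro x hx
    exact ⟨boostMap s (-t) x, boostMap_mem_forwardCone s (-t) hx,
      (boostEquiv s t).apply_symm_apply x⟩

/-- The boost `Λ_{W₁}(t)` as an element of the Poincaré group. -/
def boost (s : ℕ) [NeZero s] (t : ℝ) : poincareGroup s :=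
  ⟨(boostEquiv s t).toAffineEquiv, boostEquiv_mem s t⟩

/-- The group `G_W` generated by the translations and by the Poincaré transformations that
preserve `W`. If the edge of `W` contains the origin, the latter are the compositions of
translations along the edge with Lorentz transformations preserving `W`, so `G_W` is then generated
by the translations and the Lorentz transformations preserving `W`; and `G_{gW} = g G_W g⁻¹`. -/
def wedgeGroup {s : ℕ} (W : Set (Spacetime s)) : Subgroup (poincareGroup s) :=
  Subgroup.closure
    ({g | ∃ a, ∀ x, (g : Spacetime s ≃ᵃ[ℝ] Spacetime s) x = x + a} ∪ {g | act g W = W})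

/-! ### Scalar representations -/

/-- The energy `ω_m(p) = √(m² + |p|²)`. -/
def energy {s : ℕ} (m : ℝ≥0) (p : Fin s → ℝ) : ℝ := √((m : ℝ) ^ 2 + ∑ i, p i ^ 2)

/-- The point `(ω_m(p), p)` of the mass hyperboloid. -/
def shellPoint {s : ℕ} (m : ℝ≥0) (p : Fin s → ℝ) : Spacetime s := Fin.cons (energy m p) p

/-- The measure `d^s p / (2 ω_m(p))` on momentum space. -/
def momentumMeasure (s : ℕ) (m : ℝ≥0) : Measure (Fin s → ℝ) :=
  volume.withDensity fun p => ENNReal.ofReal (1 / (2 * energy m p))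

/-- The Lorentz invariant measure on the mass hyperboloid (the boundary of the forward light cone
if `m = 0`), as a measure on `ℝ^{1+s}`. -/
def massShellMeasure (s : ℕ) (m : ℝ≥0) : Measure (Spacetime s) :=
  (momentumMeasure s m).map (shellPoint m)

section invariance

variable {s : ℕ}

theorem energy_nonneg (m : ℝ≥0) (p : Fin s → ℝ) : 0 ≤ energy m p := Real.sqrt_nonneg _

theorem energy_sq (m : ℝ≥0) (p : Fin s → ℝ) :
    energy m p ^ 2 = (m : ℝ) ^ 2 + ∑ i, p i ^ 2 :=
  Real.sq_sqrt (add_nonneg (sq_nonneg _) (Finset.sum_nonneg fun _ _ => sq_nonneg _))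

theorem continuous_energy (m : ℝ≥0) : Continuous (energy (s := s) m) := by
  unfold energy
  fun_prop

theorem continuous_shellPoint (m : ℝ≥0) : Continuous (shellPoint (s := s) m) := by
  refine continuous_pi fun i => ?_
  refine Fin.cases ?_ (fun j => ?_) i
  · exact continuous_energy m
  · exact continuous_apply j

theorem minkowski_shellPoint (m : ℝ≥0) (p : Fin s → ℝ) :
    minkowski (shellPoint m p) (shellPoint m p) = (m : ℝ) ^ 2 := by
  have := energy_sq m p
  simp only [minkowski, shellPoint, Fin.cons_zero, Fin.cons_succ]
  simp only [pow_two] at this ⊢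
  linarith

theorem eq_shellPoint (m : ℝ≥0) (x : Spacetime s) (h0 : 0 ≤ x 0)
    (h : minkowski x x = (m : ℝ) ^ 2) : x = shellPoint m (fun i => x i.succ) := by
  funext i
  refine Fin.cases ?_ (fun j => rfl) i
  change x 0 = energy m _
  rw [energy, ← Real.sqrt_sq h0]
  congr 1
  simp only [minkowski] at h
  simp only [pow_two] at h ⊢
  linarith

theorem lorentz_zero_nonneg {Λ : Spacetime s ≃ₗ[ℝ] Spacetime s} (hΛ : Λ ∈ lorentzGroup s)
    (m : ℝ≥0) (p : Fin s → ℝ) : 0 ≤ Λ (shellPoint m p) 0 := by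
  by_contra! hneg
  let e : Spacetime s := Fin.cons 1 0
  have key : ∀ ε : ℝ, 0 < ε → 0 < Λ (shellPoint m p) 0 + ε * Λ e 0 := by
    intro ε hε
    have hmem : shellPoint m p + ε • e ∈ forwardCone s := by
      have h1 := energy_sq m p
      have h2 := energy_nonneg m p
      constructor
      · simp only [minkowski, shellPoint, e, Pi.add_apply, Pi.smul_apply, Fin.cons_zero,
          Fin.cons_succ, Pi.zero_apply, smul_eq_mul, mul_zero, add_zero, mul_one]
        simp only [pow_two] at h1
        nlinarith [mul_self_nonneg (m : ℝ), mul_nonneg h2 hε.le, mul_pos hε hε]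
      · simp only [shellPoint, e, Pi.add_apply, Pi.smul_apply, Fin.cons_zero, smul_eq_mul, mul_one]
        linarith
    have : Λ (shellPoint m p + ε • e) ∈ forwardCone s := by
      rw [← hΛ.2.2]
      exact Set.mem_image_of_mem _ hmem
    have := this.2
    simpa using this
  have hpos : 0 < |Λ e 0| + 1 := by positivity
  have := key (-Λ (shellPoint m p) 0 / (|Λ e 0| + 1)) (div_pos (by linarith) hpos)
  have h3 : -Λ (shellPoint m p) 0 / (|Λ e 0| + 1) * Λ e 0 ≤
      -Λ (shellPoint m p) 0 / (|Λ e 0| + 1) * (|Λ e 0| + 1) := by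
    refine mul_le_mul_of_nonneg_left ?_ (div_pos (by linarith) hpos).le
    linarith [le_abs_self (Λ e 0)]
  rw [div_mul_cancel₀ _ hpos.ne'] at h3
  linarith

/-- The action of a Lorentz transformation on momentum space. -/
def momentumMap (Λ : Spacetime s ≃ₗ[ℝ] Spacetime s) (m : ℝ≥0) (p : Fin s → ℝ) : Fin s → ℝ :=
  fun i => Λ (shellPoint m p) i.succ

theorem lorentz_shellPoint {Λ : Spacetime s ≃ₗ[ℝ] Spacetime s} (hΛ : Λ ∈ lorentzGroup s)
    (m : ℝ≥0) (p : Fin s → ℝ) : Λ (shellPoint m p) = shellPoint m (momentumMap Λ m p) :=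
  eq_shellPoint m _ (lorentz_zero_nonneg hΛ m p) (by rw [hΛ.1, minkowski_shellPoint])

theorem momentumMap_inv {Λ : Spacetime s ≃ₗ[ℝ] Spacetime s} (hΛ : Λ ∈ lorentzGroup s)
    (m : ℝ≥0) (p : Fin s → ℝ) : momentumMap Λ⁻¹ m (momentumMap Λ m p) = p := by
  funext i
  rw [momentumMap, ← lorentz_shellPoint hΛ]
  change Λ.symm (Λ _) _ = _
  rw [Λ.symm_apply_apply]
  rfl

theorem continuous_momentumMap (Λ : Spacetime s ≃ₗ[ℝ] Spacetime s) (m : ℝ≥0) :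
    Continuous (momentumMap Λ m) := by
  have h : Continuous Λ := (Λ : Spacetime s →ₗ[ℝ] Spacetime s).continuous_of_finiteDimensional
  exact continuous_pi fun i => (continuous_apply i.succ).comp (h.comp (continuous_shellPoint m))

theorem energy_momentumMap_ne {Λ : Spacetime s ≃ₗ[ℝ] Spacetime s} (hΛ : Λ ∈ lorentzGroup s)
    (m : ℝ≥0) {p : Fin s → ℝ} (hp : energy m p ≠ 0) : energy m (momentumMap Λ m p) ≠ 0 := by
  intro h
  have h1 := energy_sq m (momentumMap Λ m p)
  rw [h] at h1
  have hs : 0 ≤ ∑ i, momentumMap Λ m p i ^ 2 := Finset.sum_nonneg fun i _ => sq_nonneg _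
  have hz : ∀ i, momentumMap Λ m p i = 0 := by
    have : ∑ i, momentumMap Λ m p i ^ 2 = 0 := by nlinarith [sq_nonneg (m : ℝ)]
    intro i
    have := (Finset.sum_eq_zero_iff_of_nonneg fun i _ => sq_nonneg _).1 this i (Finset.mem_univ i)
    exact pow_eq_zero_iff two_ne_zero |>.1 this
  have hq : shellPoint m (momentumMap Λ m p) = 0 := by
    funext i
    refine Fin.cases ?_ (fun j => ?_) i
    · exact h
    · exact hz j
  rw [← lorentz_shellPoint hΛ] at hq
  have := (LinearEquiv.map_eq_zero_iff Λ).1 hq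
  exact hp (congrFun this 0)

/-- The inclusion of `ℝ^s` as the tangent space of the mass hyperboloid at a point, for the
conormal `w`. -/
def tangentMap (w : Fin s → ℝ) : (Fin s → ℝ) →L[ℝ] Spacetime s :=
  ContinuousLinearMap.pi fun i => Fin.cases (∑ j, w j • ContinuousLinearMap.proj j)
    (fun j => ContinuousLinearMap.proj j) i

theorem hasFDerivAt_shellPoint (m : ℝ≥0) {p : Fin s → ℝ} (hp : energy m p ≠ 0) :
    HasFDerivAt (shellPoint m) (tangentMap fun i => p i / energy m p) p := by
  rw [hasFDerivAt_pi']
  intro i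
  refine Fin.cases ?_ (fun j => ?_) i
  · have harg : (m : ℝ) ^ 2 + ∑ i, p i ^ 2 ≠ 0 := by
      rw [← energy_sq]; exact pow_ne_zero _ hp
    have h1 : HasFDerivAt (fun p : Fin s → ℝ => (m : ℝ) ^ 2 + ∑ i, p i ^ 2)
        (∑ i, (2 * p i) • (ContinuousLinearMap.proj i : (Fin s → ℝ) →L[ℝ] ℝ)) p := by
      refine HasFDerivAt.const_add _ ?_
      refine HasFDerivAt.fun_sum fun i _ => ?_
      have := (hasFDerivAt_apply (𝕜 := ℝ) i p).pow 2
      simpa using this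
    have h2 := h1.sqrt harg
    refine h2.congr_fderiv ?_
    ext v
    simp only [tangentMap, FunLike.coe_smul, Pi.smul_apply,
      ContinuousLinearMap.proj_apply, sum_apply, smul_eq_mul, Fin.cases_zero,
      ContinuousLinearMap.proj_pi]
    rw [Finset.mul_sum]
    refine Finset.sum_congr rfl fun i _ => ?_
    change 1 / (2 * energy m p) * _ = _
    field_simp
  · have := hasFDerivAt_apply (𝕜 := ℝ) j p
    exact this

theorem det_of_zero_row (N : Spacetime s →ₗ[ℝ] Spacetime s) (c : ℝ) (h : ∀ x, N x 0 = c * x 0)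
    (D : (Fin s → ℝ) →ₗ[ℝ] (Fin s → ℝ))
    (hD : ∀ v i, D v i = N (Fin.cons 0 v) i.succ) : LinearMap.det N = c * LinearMap.det D := by
  rw [← LinearMap.det_toMatrix', ← LinearMap.det_toMatrix', Matrix.det_succ_row_zero,
    Finset.sum_eq_single 0]
  · simp only [Fin.val_zero, pow_zero, one_mul, LinearMap.toMatrix'_apply, h]
    simp only [Pi.single_eq_same, mul_one]
    congr 2
    ext i j
    simp only [Matrix.submatrix_apply, LinearMap.toMatrix'_apply, hD, Fin.succAbove_zero]
    refine congrFun (congrArg N (funext fun k => ?_)) i.succ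
    refine Fin.cases ?_ (fun k => ?_) k
    · simp
    · simp [Pi.single_apply]
  · intro j _ hj
    simp [LinearMap.toMatrix'_apply, h, hj.symm]
  · simp

theorem det_momentumMap {Λ : Spacetime s ≃ₗ[ℝ] Spacetime s} (hΛ : Λ ∈ lorentzGroup s)
    (m : ℝ≥0) {p : Fin s → ℝ} (hp : energy m p ≠ 0)
    (D : (Fin s → ℝ) →ₗ[ℝ] (Fin s → ℝ))
    (hD : ∀ v i, D v i = Λ (tangentMap (fun i => p i / energy m p) v) i.succ) :
    LinearMap.det D = energy m (momentumMap Λ m p) / energy m p := by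
  have hq := energy_momentumMap_ne hΛ m hp
  set q := momentumMap Λ m p with hqdef
  let fn : (Fin s → ℝ) → Module.Dual ℝ (Spacetime s) := fun w =>
    ∑ j, w j • LinearMap.proj j.succ
  have hfn : ∀ w x, fn w x = ∑ j, w j * x j.succ := by
    intro w x
    simp [fn]
  let e : Spacetime s := Fin.cons 1 0
  have hdet : ∀ w, LinearMap.det (LinearMap.transvection (fn w) e) = 1 := by
    intro w
    rw [LinearMap.transvection.det, hfn]
    simp [e]
  have happ : ∀ w x, LinearMap.transvection (fn w) e x = x + (∑ j, w j * x j.succ) • e := by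
    intro w x
    rw [← hfn]
    rfl
  let N : Spacetime s →ₗ[ℝ] Spacetime s :=
    LinearMap.transvection (fn fun i => -(q i / energy m q)) e *
      (Λ : Spacetime s →ₗ[ℝ] Spacetime s) *
      LinearMap.transvection (fn fun i => p i / energy m p) e
  have hN1 : LinearMap.det N = 1 := by
    simp only [N, map_mul, hdet, hΛ.2.1, mul_one]
  have hNapp : ∀ x, N x = LinearMap.transvection (fn fun i => -(q i / energy m q)) e
      (Λ (LinearMap.transvection (fn fun i => p i / energy m p) e x)) := fun _ => rfl
  have hN0 : ∀ x, N x 0 = (energy m p / energy m q) * x 0 := by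
    intro x
    rw [hNapp]
    set y := LinearMap.transvection (fn fun i => p i / energy m p) e x with hy
    have hmq : minkowski (shellPoint m q) (Λ y) = minkowski (shellPoint m p) y := by
      rw [← lorentz_shellPoint hΛ, hΛ.1]
    have hL : energy m q * (LinearMap.transvection (fn fun i => -(q i / energy m q)) e (Λ y) 0) =
        minkowski (shellPoint m q) (Λ y) := by
      rw [happ]
      simp only [minkowski, shellPoint, e, Pi.add_apply, Pi.smul_apply, Fin.cons_zero,
        Fin.cons_succ, smul_eq_mul, mul_one, mul_add, Finset.mul_sum]
      rw [sub_eq_add_neg, ← Finset.sum_neg_distrib]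
      congr 1
      refine Finset.sum_congr rfl fun i _ => ?_
      field_simp
    have hR : minkowski (shellPoint m p) y = energy m p * x 0 := by
      rw [hy, happ]
      simp only [minkowski, shellPoint, e, Pi.add_apply, Pi.smul_apply, Fin.cons_zero,
        Fin.cons_succ, smul_eq_mul, mul_one, mul_add, Finset.mul_sum, Pi.zero_apply, mul_zero,
        add_zero]
      rw [add_sub_assoc, add_eq_left, sub_eq_zero]
      refine Finset.sum_congr rfl fun i _ => ?_
      field_simp
    rw [hmq, hR] at hL
    rw [div_mul_eq_mul_div, eq_div_iff hq, ← hL]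
    ring
  have hdN := det_of_zero_row N _ hN0 D (by
    intro v i
    rw [hD, hNapp, happ]
    have : LinearMap.transvection (fn fun i => p i / energy m p) e (Fin.cons 0 v) =
        tangentMap (fun i => p i / energy m p) v := by
      rw [happ]
      funext k
      refine Fin.cases ?_ (fun k => ?_) k
      · simp [e, tangentMap]
      · simp [e, tangentMap]
    rw [this]
    simp [e])
  rw [hN1] at hdN
  rw [eq_div_iff hp]
  have : energy m p / energy m q * energy m q = energy m p := div_mul_cancel₀ _ hq
  calc LinearMap.det D * energy m p
      = (energy m p / energy m q * LinearMap.det D) * energy m q := by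
        conv_lhs => rw [← this]
        ring
    _ = energy m q := by rw [← hdN, one_mul]

theorem momentumMeasure_apply (m : ℝ≥0) {A : Set (Fin s → ℝ)} (hA : MeasurableSet A) :
    momentumMeasure s m A = ∫⁻ p in A ∩ {p | energy m p ≠ 0},
      ENNReal.ofReal (1 / (2 * energy m p)) := by
  have hS : MeasurableSet {p : Fin s → ℝ | energy m p ≠ 0} :=
    ((continuous_energy m).measurable (measurableSet_singleton 0)).compl
  rw [momentumMeasure, withDensity_apply _ hA, ← lintegral_inter_add_sdiff _ A hS]
  have : ∫⁻ p in A \ {p | energy m p ≠ 0}, ENNReal.ofReal (1 / (2 * energy m p)) = 0 := by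
    rw [setLIntegral_congr_fun (g := fun _ => 0) (hA.diff hS)]
    · simp
    · intro p hp
      have : energy m p = 0 := by simpa using hp.2
      simp [this]
  rw [this, add_zero]

theorem measurePreserving_momentumMap {Λ : Spacetime s ≃ₗ[ℝ] Spacetime s}
    (hΛ : Λ ∈ lorentzGroup s) (m : ℝ≥0) :
    MeasurePreserving (momentumMap Λ m) (momentumMeasure s m) (momentumMeasure s m) := by
  have hmeas := (continuous_momentumMap Λ m).measurable
  refine ⟨hmeas, Measure.ext fun A hA => ?_⟩
  have hS : MeasurableSet {p : Fin s → ℝ | energy m p ≠ 0} :=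
    ((continuous_energy m).measurable (measurableSet_singleton 0)).compl
  have hinv : ∀ p, momentumMap Λ m (momentumMap Λ⁻¹ m p) = p := by
    intro p
    have := momentumMap_inv (inv_mem hΛ) m p
    rwa [inv_inv] at this
  rw [Measure.map_apply hmeas hA, momentumMeasure_apply m (hmeas hA), momentumMeasure_apply m hA]
  set T := momentumMap Λ m ⁻¹' A ∩ {p | energy m p ≠ 0} with hT
  have himg : A ∩ {p | energy m p ≠ 0} = momentumMap Λ m '' T := by
    ext q
    constructor
    · rintro ⟨hq, hq'⟩
      refine ⟨momentumMap Λ⁻¹ m q, ⟨?_, energy_momentumMap_ne (inv_mem hΛ) m hq'⟩, hinv q⟩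
      change momentumMap Λ m (momentumMap Λ⁻¹ m q) ∈ A
      rwa [hinv]
    · rintro ⟨p, ⟨hp, hp'⟩, rfl⟩
      exact ⟨hp, energy_momentumMap_ne hΛ m hp'⟩
  let L : Spacetime s →L[ℝ] Spacetime s :=
    LinearMap.toContinuousLinearMap (Λ : Spacetime s →ₗ[ℝ] Spacetime s)
  let tail : Spacetime s →L[ℝ] (Fin s → ℝ) :=
    ContinuousLinearMap.pi fun i => ContinuousLinearMap.proj i.succ
  let φ' : (Fin s → ℝ) → (Fin s → ℝ) →L[ℝ] (Fin s → ℝ) := fun p =>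
    (tail.comp L).comp (tangentMap fun i => p i / energy m p)
  have hderiv : ∀ p ∈ T, HasFDerivWithinAt (momentumMap Λ m) (φ' p) T p := by
    intro p hp
    have h1 := hasFDerivAt_shellPoint m hp.2
    exact ((tail.comp L).hasFDerivAt.comp p h1).hasFDerivWithinAt
  have hinj : Set.InjOn (momentumMap Λ m) T := by
    intro p _ q _ h
    rw [← momentumMap_inv hΛ m p, h, momentumMap_inv hΛ]
  rw [himg, lintegral_image_eq_lintegral_abs_det_fderiv_mul volume ((hmeas hA).inter hS) hderiv hinj]
  refine setLIntegral_congr_fun ((hmeas hA).inter hS) fun p hp => ?_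
  have hd : (φ' p).det = energy m (momentumMap Λ m p) / energy m p :=
    det_momentumMap hΛ m hp.2 (φ' p : (Fin s → ℝ) →ₗ[ℝ] (Fin s → ℝ)) fun v i => rfl
  have hq := energy_momentumMap_ne hΛ m hp.2
  have hp2 : energy m p ≠ 0 := hp.2
  rw [hd, abs_of_nonneg (div_nonneg (energy_nonneg _ _) (energy_nonneg _ _)),
    ← ENNReal.ofReal_mul (div_nonneg (energy_nonneg _ _) (energy_nonneg _ _))]
  congr 1
  field_simp

/-- Lorentz invariance of the measure on the mass hyperboloid. -/
theorem measurePreserving_lorentz {Λ : Spacetime s ≃ₗ[ℝ] Spacetime s}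
    (hΛ : Λ ∈ lorentzGroup s) (m : ℝ≥0) :
    MeasurePreserving Λ (massShellMeasure s m) (massShellMeasure s m) := by
  have hc : Continuous Λ := (Λ : Spacetime s →ₗ[ℝ] Spacetime s).continuous_of_finiteDimensional
  refine ⟨hc.measurable, ?_⟩
  have hs := (continuous_shellPoint (s := s) m).measurable
  rw [massShellMeasure, Measure.map_map hc.measurable hs]
  have : ⇑Λ ∘ shellPoint m = shellPoint m ∘ momentumMap Λ m :=
    funext fun p => lorentz_shellPoint hΛ m p
  rw [this, ← Measure.map_map hs (continuous_momentumMap Λ m).measurable,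
    (measurePreserving_momentumMap hΛ m).map_eq]

end invariance

section scalar

variable {s : ℕ}

/-- The linear part of a Poincaré transformation. -/
abbrev linearPart (g : poincareGroup s) : Spacetime s ≃ₗ[ℝ] Spacetime s :=
  (g : Spacetime s ≃ᵃ[ℝ] Spacetime s).linear

/-- The translation part `a` of the Poincaré transformation `x ↦ Λ x + a`. -/
abbrev translationPart (g : poincareGroup s) : Spacetime s :=
  (g : Spacetime s ≃ᵃ[ℝ] Spacetime s) 0

/-- The function `p ↦ e^{i a·p} f(Λ⁻¹ p)`. -/
def scalarFun (g : poincareGroup s) (f : Spacetime s → ℂ) (p : Spacetime s) : ℂ :=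
  Complex.exp (Complex.I * (minkowski (translationPart g) p : ℝ)) * f ((linearPart g).symm p)

theorem continuous_minkowski_right (a : Spacetime s) : Continuous (minkowski a) := by
  unfold minkowski
  fun_prop

theorem measurePreserving_linearPart_symm (g : poincareGroup s) (m : ℝ≥0) :
    MeasurePreserving (linearPart g).symm (massShellMeasure s m) (massShellMeasure s m) :=
  measurePreserving_lorentz (inv_mem (show linearPart g ∈ lorentzGroup s from g.2)) m

theorem scalarFun_ae_congr (g : poincareGroup s) (m : ℝ≥0) {f f' : Spacetime s → ℂ}
    (h : f =ᵐ[massShellMeasure s m] f') :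
    scalarFun g f =ᵐ[massShellMeasure s m] scalarFun g f' := by
  have := (measurePreserving_linearPart_symm g m).quasiMeasurePreserving.ae_eq_comp h
  filter_upwards [this] with p hp
  simp only [Function.comp_apply] at hp
  simp only [scalarFun, hp]

theorem memLp_scalarFun (g : poincareGroup s) (m : ℝ≥0) {f : Spacetime s → ℂ}
    (hf : MemLp f 2 (massShellMeasure s m)) :
    MemLp (scalarFun g f) 2 (massShellMeasure s m) := by
  have h := hf.comp_measurePreserving (measurePreserving_linearPart_symm g m)
  refine (memLp_congr_norm ?_ h.1 (ae_of_all _ fun p => ?_)).2 h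
  · refine AEStronglyMeasurable.mul (Continuous.aestronglyMeasurable ?_) h.1
    have := continuous_minkowski_right (translationPart g)
    fun_prop
  · simp [scalarFun]

theorem eLpNorm_scalarFun (g : poincareGroup s) (m : ℝ≥0) {f : Spacetime s → ℂ}
    (hf : AEStronglyMeasurable f (massShellMeasure s m)) :
    eLpNorm (scalarFun g f) 2 (massShellMeasure s m) = eLpNorm f 2 (massShellMeasure s m) := by
  rw [← eLpNorm_comp_measurePreserving hf (measurePreserving_linearPart_symm g m)]
  exact eLpNorm_congr_norm_ae (ae_of_all _ fun p => by simp [scalarFun])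

theorem scalarFun_mul (g h : poincareGroup s) (f : Spacetime s → ℂ) :
    scalarFun (g * h) f = scalarFun g (scalarFun h f) := by
  funext p
  have h1 : translationPart (g * h) = translationPart g + linearPart g (translationPart h) := by
    change (g : Spacetime s ≃ᵃ[ℝ] Spacetime s) ((h : Spacetime s ≃ᵃ[ℝ] Spacetime s) 0) = _
    have := (g : Spacetime s ≃ᵃ[ℝ] Spacetime s).map_vadd 0
      ((h : Spacetime s ≃ᵃ[ℝ] Spacetime s) 0)
    simp only [vadd_eq_add, add_zero] at this
    rw [this, add_comm]
  have h2 : minkowski (translationPart (g * h)) p = minkowski (translationPart g) p +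
      minkowski (translationPart h) ((linearPart g).symm p) := by
    have h3 : minkowski (translationPart h) ((linearPart g).symm p) =
        minkowski (linearPart g (translationPart h)) p := by
      have hg : linearPart g ∈ lorentzGroup s := g.2
      rw [← hg.1, LinearEquiv.apply_symm_apply]
    rw [h3, h1]
    simp only [minkowski, Pi.add_apply, add_mul, Finset.sum_add_distrib]
    ring
  have h4 : (linearPart (g * h)).symm p = (linearPart h).symm ((linearPart g).symm p) := rfl
  simp only [scalarFun, h2, h4]
  push_cast
  rw [mul_add, Complex.exp_add]
  ring

theorem scalarFun_one (f : Spacetime s → ℂ) : scalarFun 1 f = f := by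
  funext p
  have h1 : translationPart (1 : poincareGroup s) = 0 := rfl
  have h2 : (linearPart (1 : poincareGroup s)).symm p = p := rfl
  simp only [scalarFun, h2, h1]
  simp [minkowski]

/-- The operator `(U_m(a,Λ) f)(p) = e^{i a·p} f(Λ⁻¹ p)` on `L²` of the mass hyperboloid. -/
def scalarIsometry (m : ℝ≥0) (g : poincareGroup s) :
    Lp ℂ 2 (massShellMeasure s m) →ₗᵢ[ℂ] Lp ℂ 2 (massShellMeasure s m) where
  toFun f := (memLp_scalarFun g m (Lp.memLp f)).toLp
  map_add' f f' := by
    apply Lp.ext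
    refine (MemLp.coeFn_toLp _).trans ((scalarFun_ae_congr g m (Lp.coeFn_add f f')).trans ?_)
    filter_upwards [Lp.coeFn_add (memLp_scalarFun g m (Lp.memLp f)).toLp
      (memLp_scalarFun g m (Lp.memLp f')).toLp,
      MemLp.coeFn_toLp (memLp_scalarFun g m (Lp.memLp f)),
      MemLp.coeFn_toLp (memLp_scalarFun g m (Lp.memLp f'))] with p h1 h2 h3
    rw [h1, Pi.add_apply, h2, h3]
    simp only [scalarFun, Pi.add_apply, mul_add]
  map_smul' c f := by
    apply Lp.ext
    refine (MemLp.coeFn_toLp _).trans ((scalarFun_ae_congr g m (Lp.coeFn_smul c f)).trans ?_)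
    filter_upwards [Lp.coeFn_smul c (memLp_scalarFun g m (Lp.memLp f)).toLp,
      MemLp.coeFn_toLp (memLp_scalarFun g m (Lp.memLp f))] with p h1 h2
    rw [RingHom.id_apply, h1, Pi.smul_apply, h2]
    simp only [scalarFun, Pi.smul_apply, smul_eq_mul]
    ring
  norm_map' f := by
    change ‖(memLp_scalarFun g m (Lp.memLp f)).toLp (scalarFun g f)‖ = ‖f‖
    rw [Lp.norm_toLp, eLpNorm_scalarFun g m (Lp.memLp f).1, Lp.norm_def]

theorem scalarIsometry_ae (m : ℝ≥0) (g : poincareGroup s) (f : Lp ℂ 2 (massShellMeasure s m)) :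
    scalarIsometry m g f =ᵐ[massShellMeasure s m] scalarFun g f :=
  MemLp.coeFn_toLp (memLp_scalarFun g m (Lp.memLp f))

theorem scalarIsometry_mul (m : ℝ≥0) (g h : poincareGroup s)
    (f : Lp ℂ 2 (massShellMeasure s m)) :
    scalarIsometry m (g * h) f = scalarIsometry m g (scalarIsometry m h f) := by
  apply Lp.ext
  refine (scalarIsometry_ae m _ f).trans ?_
  rw [scalarFun_mul]
  exact ((scalarIsometry_ae m g _).trans
    (scalarFun_ae_congr g m (scalarIsometry_ae m h f))).symm

theorem scalarIsometry_one (m : ℝ≥0) (f : Lp ℂ 2 (massShellMeasure s m)) :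
    scalarIsometry m (1 : poincareGroup s) f = f := by
  apply Lp.ext
  refine (scalarIsometry_ae m _ f).trans ?_
  rw [scalarFun_one]

/-- The scalar (spin zero) representation of mass `m` of the Poincaré group. -/
def scalarRep (s : ℕ) (m : ℝ≥0) : poincareGroup s →*
    (Lp ℂ 2 (massShellMeasure s m) ≃ₗᵢ[ℂ] Lp ℂ 2 (massShellMeasure s m)) where
  toFun g :=
    { (scalarIsometry m g) with
      invFun := scalarIsometry m g⁻¹
      left_inv := fun f => by
        change scalarIsometry m g⁻¹ (scalarIsometry m g f) = f
        rw [← scalarIsometry_mul, inv_mul_cancel, scalarIsometry_one]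
      right_inv := fun f => by
        change scalarIsometry m g (scalarIsometry m g⁻¹ f) = f
        rw [← scalarIsometry_mul, mul_inv_cancel, scalarIsometry_one] }
  map_one' := LinearIsometryEquiv.ext fun f => scalarIsometry_one m f
  map_mul' g h := LinearIsometryEquiv.ext fun f => scalarIsometry_mul m g h f

end scalar

/-! ### Multiples and direct integrals of representations -/

section directIntegral

universe v

variable {G : Type*} [Group G]

/-- `V` is unitarily equivalent to a (finite or infinite) multiple of `V₀`, that is, to a Hilbert
space direct sum of copies of `V₀`. -/
def IsMultipleOf {E₀ : Type*} {E : Type v} [NormedAddCommGroup E₀] [InnerProductSpace ℂ E₀]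
    [NormedAddCommGroup E] [InnerProductSpace ℂ E] [CompleteSpace E]
    (V₀ : G →* (E₀ ≃ₗᵢ[ℂ] E₀)) (V : G →* (E ≃ₗᵢ[ℂ] E)) : Prop :=
  ∃ (ι : Type v) (J : ι → E₀ →ₗᵢ[ℂ] E), IsHilbertSum ℂ (fun _ => E₀) J ∧
    ∀ i g f, V g (J i f) = J i (V₀ g f)

variable {X : Type*} [MeasurableSpace X] {E : X → Type*} [∀ x, NormedAddCommGroup (E x)]
  [∀ x, InnerProductSpace ℂ (E x)]

/-- A measurable field structure on a family of Hilbert spaces: a vector space of sections,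
called measurable, such that the norm of a measurable section is a measurable function, a section
having measurable inner products with all measurable sections is itself measurable, and there is a
sequence of measurable sections which is total at each point. -/
structure MeasurableField (E : X → Type*) [∀ x, NormedAddCommGroup (E x)]
    [∀ x, InnerProductSpace ℂ (E x)] where
  sections : Submodule ℂ (∀ x, E x)
  measurable_norm : ∀ ξ ∈ sections, Measurable fun x => ‖ξ x‖
  mem_of_measurable_inner : ∀ η : ∀ x, E x,
    (∀ ξ ∈ sections, Measurable fun x => inner ℂ (ξ x) (η x)) → η ∈ sections
  exists_fundamental : ∃ e : ℕ → ∀ x, E x, (∀ n, e n ∈ sections) ∧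
    ∀ x, Dense (Submodule.span ℂ (Set.range fun n => e n x) : Set (E x))

/-- The measurable square integrable sections. -/
def MeasurableField.squareIntegrable (F : MeasurableField E) (μ : Measure X) :
    Submodule ℂ (∀ x, E x) where
  carrier := {ξ | ξ ∈ F.sections ∧ MemLp (fun x => ‖ξ x‖) 2 μ}
  zero_mem' := ⟨F.sections.zero_mem, by simp⟩
  add_mem' := by
    rintro ξ η ⟨hξ, hξ'⟩ ⟨hη, hη'⟩
    have h := F.sections.add_mem hξ hη
    refine ⟨h, (hξ'.add hη').mono (F.measurable_norm _ h).aestronglyMeasurable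
      (ae_of_all _ fun x => ?_)⟩
    rw [norm_norm]
    exact (norm_add_le _ _).trans (le_abs_self _)
  smul_mem' := by
    rintro c ξ ⟨hξ, hξ'⟩
    refine ⟨F.sections.smul_mem c hξ, ?_⟩
    simpa [norm_smul] using hξ'.const_mul ‖c‖

/-- The representation `U` is (unitarily equivalent to) the direct integral `∫ V_x dμ(x)`: the `V_x`
form a measurable field of representations, and there is a unitary identification `Φ` of the space
of square integrable measurable sections, modulo those vanishing almost everywhere, with the
Hilbert space of `U` under which `U` acts fibrewise by `V_x`. -/
def IsDirectIntegral (μ : Measure X) (F : MeasurableField E) (V : ∀ x, G →* (E x ≃ₗᵢ[ℂ] E x))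
    {𝓗 : Type*} [NormedAddCommGroup 𝓗] [InnerProductSpace ℂ 𝓗] (U : G →* (𝓗 ≃ₗᵢ[ℂ] 𝓗)) : Prop :=
  (∀ g, ∀ ξ ∈ F.sections, (fun x => V x g (ξ x)) ∈ F.sections) ∧
  ∃ Φ : F.squareIntegrable μ →ₗ[ℂ] 𝓗, Function.Surjective Φ ∧
    (∀ ξ η : F.squareIntegrable μ, inner ℂ (Φ ξ) (Φ η) = ∫ x, inner ℂ (ξ.1 x) (η.1 x) ∂μ) ∧
    ∀ g, ∀ ξ η : F.squareIntegrable μ, (∀ x, η.1 x = V x g (ξ.1 x)) → Φ η = U g (Φ ξ)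

end directIntegral

/-! ### The modularity condition and nets of standard subspaces -/

section nets

universe u

variable {s : ℕ} {𝓗 : Type u} [NormedAddCommGroup 𝓗] [InnerProductSpace ℂ 𝓗]

/-- The modularity condition (M): `U(r) ∈ U(G_W)''` for each wedge `W` and each Poincaré
transformation `r` with `r W = W'`. -/
def ModularityCondition (U : poincareGroup s →* (𝓗 ≃ₗᵢ[ℂ] 𝓗)) : Prop :=
  ∀ W : Set (Spacetime s), IsWedge W → ∀ r : poincareGroup s, act r W = causalComplement W →
    ((U r).toContinuousLinearEquiv : 𝓗 →L[ℂ] 𝓗) ∈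
      Set.centralizer (Set.centralizer
        ((fun g => ((U g).toContinuousLinearEquiv : 𝓗 →L[ℂ] 𝓗)) '' (wedgeGroup W)))

/-- A local `U`-covariant net of closed real subspaces on wedges. Only the values of `H` on wedges
matter. The subspaces are standard: they are separating because of locality and cyclicity. -/
structure IsLocalNet [CompleteSpace 𝓗] (U : poincareGroup s →* (𝓗 ≃ₗᵢ[ℂ] 𝓗))
    (H : Set (Spacetime s) → ClosedSubmodule ℝ 𝓗) : Prop where
  isotony : ∀ W₁ W₂, IsWedge W₁ → IsWedge W₂ → W₁ ⊆ W₂ → H W₁ ≤ H W₂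
  covariance : ∀ W, IsWedge W → ∀ g : poincareGroup s,
    U g '' (H W : Set 𝓗) = (H (act g W) : Set 𝓗)
  cyclic : ∀ W, IsWedge W → H W ⊔ (H W).mulI = ⊤
  locality : ∀ W₁ W₂, IsWedge W₁ → IsWedge W₂ → W₁ ⊆ causalComplement W₂ →
    H W₁ ≤ (H W₂).symplComp

/-- The graph of the Tomita operator `S_K`: the closure of the graph of the antilinear operator
`ξ + iη ↦ ξ - iη`, for `ξ, η ∈ K`. -/
def tomitaGraph (K : ClosedSubmodule ℝ 𝓗) : Set (𝓗 × 𝓗) :=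
  closure {z | ∃ ξ ∈ K, ∃ η ∈ K, z = (ξ + Complex.I • η, ξ - Complex.I • η)}

/-- The graph of the modular operator `Δ_K = S_K* S_K`, where the adjoint of the antilinear
operator `S_K` is given by `⟪S_K u, y⟫ = ⟪S_K* y, u⟫`. -/
def modularGraph (K : ClosedSubmodule ℝ 𝓗) : Set (𝓗 × 𝓗) :=
  {z | ∃ y, (z.1, y) ∈ tomitaGraph K ∧
    ∀ w ∈ tomitaGraph K, inner ℂ w.2 y = inner ℂ z.2 w.1}

/-- `T = f(A)` in the Borel functional calculus of the self-adjoint operator `A` with the given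
graph: some unitary `V : 𝓗 → L²(X, ν)` carries `A` to the operator of multiplication (with its
maximal domain) by a measurable real function `a`, and `T` to multiplication by `f ∘ a`. -/
def IsFunctionOf (A : Set (𝓗 × 𝓗)) (f : ℝ → ℂ) (T : 𝓗 → 𝓗) : Prop :=
  ∃ (X : Type u) (_ : MeasurableSpace X) (ν : Measure X) (V : 𝓗 ≃ₗᵢ[ℂ] Lp ℂ 2 ν) (a : X → ℝ),
    Measurable a ∧
    (∀ x z, (x, z) ∈ A ↔ V z =ᵐ[ν] fun k => (a k : ℂ) * V x k) ∧
    ∀ x, V (T x) =ᵐ[ν] fun k => f (a k) * V x k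

/-- The Bisognano-Wichmann property `U(Λ_W(2πt)) = Δ_{H(W)}^{-it}`. For the wedge `W = g W₁`, the
boosts preserving `W` are `Λ_W(t) = g Λ_{W₁}(t) g⁻¹`. -/
def BisognanoWichmann [NeZero s] (U : poincareGroup s →* (𝓗 ≃ₗᵢ[ℂ] 𝓗))
    (H : Set (Spacetime s) → ClosedSubmodule ℝ 𝓗) : Prop :=
  ∀ (g : poincareGroup s) (t : ℝ),
    IsFunctionOf (modularGraph (H (act g (standardWedge s))))
      (fun l => (l : ℂ) ^ (-(Complex.I * t))) (U (g * boost s (2 * Real.pi * t) * g⁻¹))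

/-- The duality property `H(W) = H(W')'`. -/
def Duality (H : Set (Spacetime s) → ClosedSubmodule ℝ 𝓗) : Prop :=
  ∀ W, IsWedge W → H W = (H (causalComplement W)).symplComp

end nets

end WedgeNets
end

open WedgeNets

/-! Let r be the rotation by π in the (x₁,x₃)-plane; it carries W₁ onto W₁'. The theorem rests on a
fact about momentum space: r does not belong to G_{W₁}, but pointwise it acts like elements that do.
If θ is the rapidity of p in the x₁-direction, the boost with parameter -2θ reverses the sign of p₁;
the rotation of the (x₂,x₃)-plane through minus twice the argument of p₂ + ip₃ reverses the sign of
p₃. So at a generic momentum p the point rp is the image of p under an element of G_{W₁} that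
depends on p. The second edge direction, hence s ≥ 3, is what leaves room for this.

Translations act on a mass shell by characters, and strong limits of their combinations give
multiplication by every bounded Borel function of the momentum (`IsBorelOk.of_bddMeas`). Cut
momentum space into small cells in rapidity and edge angle, use on each cell the element adapted to
it, and sum. The result is a contraction, because each cell goes onto its mirror cell, and it
converges strongly to the action of r (`norm_reflectionOp_le`, `tendsto_reflectionOp`); it is
essential that a scalar representation only moves momenta and has no spin to transform. The recipe
does not depend on the mass, so approximants and limit pass to multiples and to direct integrals
(`halfTurn_mem_centralizer`). Any other r with rW = W' differs from a conjugate of this one by an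
element preserving W, which gives (M) in `modularityCondition`.

For a net, put K = H(W₁) and Z(t) = Δ_K^{it} U(Λ(2πt)). By covariance Z(t) commutes with U(g)
whenever g preserves W₁ and commutes with the boosts. By Borchers' theorem (`borchers`), applied to
K and to K' along the two lightlike directions of the wedge, it commutes with the translations. By
(M) it therefore commutes with U(r) (`modularBoost_halfTurn`). As r inverts the boosts, this yields
Δ_K^{it} U(r) = U(r) Δ_K^{it} U(Λ(4πt)), so Δ_K^{it} leaves H(W₁') = U(r)K invariant. A cyclic
subspace of K' invariant under the modular group is all of K' (`eq_of_commute`): this is duality.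
Now U(r) maps K onto K', so it inverts Δ_K^{it} as well as the boosts; hence Z(t) = Z(-t), and
halving t gives Z = 1, the Bisognano–Wichmann property (`boost_eq_modular`).

Unbounded operators are avoided in the manner of Rieffel and van Daele. With P and Q the real
projections onto K and iK, the operator R = P + Q is complex linear, D = P - Q is antilinear, Δ_K =
(2 - R)/R and DR = (2 - R)D. The spectral theorem turns R into multiplication by 2/(1 + e^l) and
Δ_K^{it} into multiplication by e^{itl}. Borchers' theorem then says that a bounded holomorphic
function on the strip 0 < Im z < 1/2 with real boundary values is constant. -/

noncomputable section
namespace WedgeNets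

/-! ### The spectral theorem in multiplication form -/

section sigma

variable {ι : Type*} {Y : ι → Type*} [∀ i, MeasurableSpace (Y i)]

theorem measurableSet_sigma {s : Set (Σ i, Y i)} :
    MeasurableSet s ↔ ∀ i, MeasurableSet (Sigma.mk i ⁻¹' s) := by
  change MeasurableSet[⨅ i, _] s ↔ _
  rw [MeasurableSpace.measurableSet_iInf]
  rfl

theorem measurable_sigmaMk (i : ι) : Measurable (Sigma.mk i : Y i → Σ i, Y i) :=
  fun _ hs => measurableSet_sigma.1 hs i

theorem measurable_sigma {Z : Type*} [MeasurableSpace Z] {f : (Σ i, Y i) → Z}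
    (h : ∀ i, Measurable fun k => f ⟨i, k⟩) : Measurable f :=
  fun _ hs => measurableSet_sigma.2 fun i => h i hs

/-- The disjoint union of a family of measure spaces. -/
def sigmaMeasure (ν : ∀ i, Measure (Y i)) : Measure (Σ i, Y i) :=
  Measure.sum fun i => (ν i).map (Sigma.mk i)

variable (ν : ∀ i, Measure (Y i))

theorem lintegral_sigmaMeasure {f : (Σ i, Y i) → ℝ≥0∞} (hf : Measurable f) :
    ∫⁻ x, f x ∂sigmaMeasure ν = ∑' i, ∫⁻ k, f ⟨i, k⟩ ∂ν i := by
  rw [sigmaMeasure, lintegral_sum_measure]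
  exact tsum_congr fun i => lintegral_map hf (measurable_sigmaMk i)

theorem ae_sigmaMeasure_iff {p : (Σ i, Y i) → Prop} (hp : MeasurableSet {x | p x}) :
    (∀ᵐ x ∂sigmaMeasure ν, p x) ↔ ∀ i, ∀ᵐ k ∂ν i, p ⟨i, k⟩ := by
  rw [sigmaMeasure, Measure.ae_sum_iff' hp]
  exact forall_congr' fun i => ae_map_iff (measurable_sigmaMk i).aemeasurable hp

theorem lintegral_enorm_sq {X : Type*} [MeasurableSpace X] {ρ : Measure X} (f : Lp ℂ 2 ρ) :
    ∫⁻ x, ‖f x‖ₑ ^ (2 : ℝ) ∂ρ = ENNReal.ofReal (‖f‖ ^ (2 : ℝ)) := by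
  have h := eLpNorm_eq_lintegral_rpow_enorm_toReal (μ := ρ) (f := (f : X → ℂ))
    (p := 2) two_ne_zero ENNReal.ofNat_ne_top
  have h2 : (2 : ℝ≥0∞).toReal = 2 := rfl
  rw [h2] at h
  have h3 : (∫⁻ x, ‖f x‖ₑ ^ (2 : ℝ) ∂ρ) = eLpNorm f 2 ρ ^ (2 : ℝ) := by
    rw [h, ← ENNReal.rpow_mul]
    norm_num
  rw [h3, ← ENNReal.ofReal_rpow_of_nonneg (norm_nonneg _) zero_le_two, Lp.norm_def,
    ENNReal.ofReal_toReal (Lp.eLpNorm_ne_top f)]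

theorem memLp_two_of_lintegral {X : Type*} [MeasurableSpace X] {ρ : Measure X} {f : X → ℂ}
    (hf : Measurable f) (h : ∫⁻ x, ‖f x‖ₑ ^ (2 : ℝ) ∂ρ ≠ ∞) : MemLp f 2 ρ := by
  refine ⟨hf.aestronglyMeasurable, ?_⟩
  rw [eLpNorm_eq_lintegral_rpow_enorm_toReal two_ne_zero ENNReal.ofNat_ne_top]
  exact ENNReal.rpow_lt_top_of_nonneg (by norm_num) h

theorem lintegral_sigma_lp (g : lp (fun i => Lp ℂ 2 (ν i)) 2) :
    ∫⁻ x, ‖(g x.1 : Y x.1 → ℂ) x.2‖ₑ ^ (2 : ℝ) ∂sigmaMeasure ν =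
      ENNReal.ofReal (‖g‖ ^ (2 : ℝ)) := by
  have hm : Measurable fun x : Σ i, Y i => (g x.1 : Y x.1 → ℂ) x.2 :=
    measurable_sigma fun i => (Lp.stronglyMeasurable (g i)).measurable
  rw [lintegral_sigmaMeasure ν (hm.enorm.pow_const _)]
  simp only [lintegral_enorm_sq]
  have h2 : (2 : ℝ≥0∞).toReal = 2 := rfl
  have h3 := lp.hasSum_norm (p := 2) (by simp) g
  rw [h2] at h3
  rw [← h3.tsum_eq, ENNReal.ofReal_tsum_of_nonneg (fun i => by positivity) h3.summable]

theorem memLp_sigma_lp (g : lp (fun i => Lp ℂ 2 (ν i)) 2) :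
    MemLp (fun x : Σ i, Y i => (g x.1 : Y x.1 → ℂ) x.2) 2 (sigmaMeasure ν) :=
  memLp_two_of_lintegral (measurable_sigma fun i => (Lp.stronglyMeasurable (g i)).measurable)
    (by rw [lintegral_sigma_lp]; exact ENNReal.ofReal_ne_top)

/-- `L²` of a disjoint union of measure spaces is the Hilbert sum of the `L²` spaces. -/
def sigmaL2 : lp (fun i => Lp ℂ 2 (ν i)) 2 →ₗᵢ[ℂ] Lp ℂ 2 (sigmaMeasure ν) where
  toFun g := (memLp_sigma_lp ν g).toLp
  map_add' g h := by
    rw [← MemLp.toLp_add]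
    refine MemLp.toLp_congr _ _ ?_
    refine (ae_sigmaMeasure_iff ν (measurableSet_eq_fun
      (measurable_sigma fun i => (Lp.stronglyMeasurable ((g + h) i)).measurable)
      (Measurable.add (measurable_sigma fun i => (Lp.stronglyMeasurable (g i)).measurable)
        (measurable_sigma fun i => (Lp.stronglyMeasurable (h i)).measurable)))).2 fun i => ?_
    exact Lp.coeFn_add (g i) (h i)
  map_smul' c g := by
    rw [RingHom.id_apply, ← MemLp.toLp_const_smul]
    refine MemLp.toLp_congr _ _ ?_
    refine (ae_sigmaMeasure_iff ν (measurableSet_eq_fun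
      (measurable_sigma fun i => (Lp.stronglyMeasurable ((c • g) i)).measurable)
      (Measurable.const_smul
        (measurable_sigma fun i => (Lp.stronglyMeasurable (g i)).measurable) c))).2 fun i => ?_
    exact Lp.coeFn_smul c (g i)
  norm_map' g := by
    set G : Lp ℂ 2 (sigmaMeasure ν) := (memLp_sigma_lp ν g).toLp with hG
    change ‖G‖ = ‖g‖
    have h1 := lintegral_enorm_sq G
    have h2 : ∫⁻ x, ‖G x‖ₑ ^ (2 : ℝ) ∂sigmaMeasure ν =
        ∫⁻ x, ‖(g x.1 : Y x.1 → ℂ) x.2‖ₑ ^ (2 : ℝ) ∂sigmaMeasure ν := by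
      refine lintegral_congr_ae ?_
      filter_upwards [MemLp.coeFn_toLp (memLp_sigma_lp ν g)] with x hx
      rw [hG, hx]
    rw [h2, lintegral_sigma_lp, ENNReal.ofReal_eq_ofReal_iff (by positivity) (by positivity)] at h1
    exact ((Real.rpow_left_inj (norm_nonneg _) (norm_nonneg _) two_ne_zero).1 h1).symm

theorem sigmaL2_ae (g : lp (fun i => Lp ℂ 2 (ν i)) 2) :
    sigmaL2 ν g =ᵐ[sigmaMeasure ν] fun x => (g x.1 : Y x.1 → ℂ) x.2 :=
  MemLp.coeFn_toLp (memLp_sigma_lp ν g)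

theorem sigmaL2_surjective : Function.Surjective (sigmaL2 ν) := by
  intro f
  have hfm : Measurable f := (Lp.stronglyMeasurable f).measurable
  have hsum := lintegral_enorm_sq f
  rw [lintegral_sigmaMeasure ν (hfm.enorm.pow_const _)] at hsum
  have hfi : ∀ i, MemLp (fun k => f ⟨i, k⟩) 2 (ν i) := fun i =>
    memLp_two_of_lintegral (hfm.comp (measurable_sigmaMk i)) (ne_top_of_le_ne_top
      (hsum ▸ ENNReal.ofReal_ne_top) (ENNReal.le_tsum i))
  let g : ∀ i, Lp ℂ 2 (ν i) := fun i => (hfi i).toLp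
  have hg : ∀ i, ENNReal.ofReal (‖g i‖ ^ (2 : ℝ)) = ∫⁻ k, ‖f ⟨i, k⟩‖ₑ ^ (2 : ℝ) ∂ν i := by
    intro i
    rw [← lintegral_enorm_sq]
    refine lintegral_congr_ae ?_
    filter_upwards [MemLp.coeFn_toLp (hfi i)] with k hk
    rw [hk]
  have hmem : Memℓp g 2 := by
    refine memℓp_gen ?_
    have h2 : (2 : ℝ≥0∞).toReal = 2 := rfl
    rw [h2]
    have : ∑' i, ENNReal.ofReal (‖g i‖ ^ (2 : ℝ)) ≠ ∞ := by
      simp only [hg, hsum]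
      exact ENNReal.ofReal_ne_top
    have h3 := ENNReal.summable_toReal this
    refine h3.congr fun i => ?_
    rw [ENNReal.toReal_ofReal (by positivity)]
  refine ⟨⟨g, hmem⟩, Lp.ext ((sigmaL2_ae ν _).trans ?_)⟩
  refine (ae_sigmaMeasure_iff ν (measurableSet_eq_fun
      (measurable_sigma fun i => (Lp.stronglyMeasurable (g i)).measurable) hfm)).2 fun i => ?_
  exact MemLp.coeFn_toLp (hfi i)

end sigma

section spectral

universe u

variable {𝓗 : Type u} [NormedAddCommGroup 𝓗] [InnerProductSpace ℂ 𝓗] [CompleteSpace 𝓗]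
  {R : 𝓗 →L[ℂ] 𝓗} (hR : IsStarNormal R)

/-- Since the calculus is a star homomorphism, all inner products of vectors f(R)x reduce to a
single functional. This yields both the spectral measures and the orthogonality of cyclic subspaces.
-/
theorem inner_cfcHom (f g : C(spectrum ℂ R, ℂ)) (x y : 𝓗) :
    ⟪cfcHom hR f x, cfcHom hR g y⟫_ℂ = ⟪x, cfcHom hR (star f * g) y⟫_ℂ := by
  have h1 : cfcHom hR (star f * g) = star (cfcHom hR f) * cfcHom hR g :=
    (map_mul (cfcHom hR) (star f) g).trans (congrArg (· * cfcHom hR g) (map_star (cfcHom hR) f))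
  have h2 : cfcHom hR (star f * g) y =
      ContinuousLinearMap.adjoint (cfcHom hR f) (cfcHom hR g y) := by
    rw [h1]; rfl
  rw [h2, ContinuousLinearMap.adjoint_inner_right]

/-- The continuous function with real values, regarded as complex valued. -/
def complexify {X : Type*} [TopologicalSpace X] (f : C(X, ℝ)) : C(X, ℂ) :=
  ⟨fun k => (f k : ℂ), Complex.continuous_ofReal.comp f.continuous⟩

/-- The positive functional `f ↦ ⟪x, f(R) x⟫`. -/
def vectorFunctional (x : 𝓗) :
    CompactlySupportedContinuousMap (spectrum ℂ R) ℝ →ₚ[ℝ] ℝ :=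
  PositiveLinearMap.mk₀
    { toFun := fun f => (⟪x, cfcHom hR (complexify f) x⟫_ℂ).re
      map_add' := fun f g => by
        have : complexify ((f + g : CompactlySupportedContinuousMap (spectrum ℂ R) ℝ) :
            C(spectrum ℂ R, ℝ)) = complexify (f : C(spectrum ℂ R, ℝ)) + complexify g := by
          ext k; simp [complexify]
        rw [this, map_add]
        simp
      map_smul' := fun c f => by
        have : complexify ((c • f : CompactlySupportedContinuousMap (spectrum ℂ R) ℝ) :
            C(spectrum ℂ R, ℝ)) = (c : ℂ) • complexify (f : C(spectrum ℂ R, ℝ)) := by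
          ext k; simp [complexify]
        rw [this, map_smul]
        simp }
    (by
      intro f hf
      -- With f = |h|² the value of the functional is ‖h(R)x‖².
      let h : C(spectrum ℂ R, ℝ) := ⟨fun k => √(f k), by fun_prop⟩
      have : complexify (f : C(spectrum ℂ R, ℝ)) = star (complexify h) * complexify h := by
        ext k
        have hk : 0 ≤ f k := hf k
        simp only [complexify, h, ContinuousMap.coe_mk, ContinuousMap.mul_apply,
          ContinuousMap.star_apply, Complex.star_def, Complex.conj_ofReal]
        rw [← Complex.ofReal_mul, Real.mul_self_sqrt hk]
      change 0 ≤ (⟪x, cfcHom hR (complexify (f : C(spectrum ℂ R, ℝ))) x⟫_ℂ).re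
      rw [this, ← inner_cfcHom]
      exact inner_self_nonneg (𝕜 := ℂ))

/-- The spectral measure of a vector. -/
def vectorMeasure (x : 𝓗) : Measure (spectrum ℂ R) := RealRMK.rieszMeasure (vectorFunctional hR x)

instance (x : 𝓗) : (vectorMeasure hR x).WeaklyRegular := by
  unfold vectorMeasure; infer_instance

instance (x : 𝓗) : IsFiniteMeasure (vectorMeasure hR x) := by
  unfold vectorMeasure; infer_instance

/-- By the Riesz–Markov theorem both squares equal the value of the functional at |f|². This
isometry lets f ↦ f(R)x extend to L² of the spectral measure. -/
theorem norm_toLp_vectorMeasure (x : 𝓗) (f : C(spectrum ℂ R, ℂ)) :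
    ‖ContinuousMap.toLp 2 (vectorMeasure hR x) ℂ f‖ = ‖cfcHom hR f x‖ := by
  set F := ContinuousMap.toLp 2 (vectorMeasure hR x) ℂ f with hF
  have h1 : ‖F‖ ^ 2 = ∫ k, ‖f k‖ ^ 2 ∂vectorMeasure hR x := by
    rw [← inner_self_eq_norm_sq (𝕜 := ℂ), L2.inner_def]
    have : ∫ k, ⟪F k, F k⟫_ℂ ∂vectorMeasure hR x =
        ∫ k, ((‖f k‖ ^ 2 : ℝ) : ℂ) ∂vectorMeasure hR x := by
      refine integral_congr_ae ?_
      filter_upwards [ContinuousMap.coeFn_toLp (𝕜 := ℂ) (p := 2) (vectorMeasure hR x) f] with k hk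
      rw [hF, hk, inner_self_eq_norm_sq_to_K]
      push_cast
      rfl
    rw [this, integral_complex_ofReal]
    rfl
  let q : CompactlySupportedContinuousMap (spectrum ℂ R) ℝ :=
    CompactlySupportedContinuousMap.continuousMapEquiv ⟨fun k => ‖f k‖ ^ 2, by fun_prop⟩
  have h2 : ∫ k, q k ∂vectorMeasure hR x = vectorFunctional hR x q :=
    RealRMK.integral_rieszMeasure (vectorFunctional hR x) q
  have h3 : vectorFunctional hR x q = ‖cfcHom hR f x‖ ^ 2 := by
    rw [← inner_self_eq_norm_sq (𝕜 := ℂ), inner_cfcHom]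
    change (⟪x, cfcHom hR (complexify (q : C(spectrum ℂ R, ℝ))) x⟫_ℂ).re = _
    have : complexify (q : C(spectrum ℂ R, ℝ)) = star f * f := by
      ext k
      change ((‖f k‖ ^ 2 : ℝ) : ℂ) = star (f k) * f k
      rw [Complex.star_def, ← Complex.normSq_eq_conj_mul_self, Complex.normSq_eq_norm_sq]
    rw [this]
    rfl
  have h4 : ‖F‖ ^ 2 = ‖cfcHom hR f x‖ ^ 2 := by
    rw [h1, ← h3, ← h2]
    rfl
  exact (sq_eq_sq₀ (norm_nonneg _) (norm_nonneg _)).1 h4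

theorem dense_toLp_vectorMeasure (x : 𝓗) :
    DenseRange (ContinuousMap.toLp 2 (vectorMeasure hR x) ℂ (E := ℂ)).toLinearMap :=
  ContinuousMap.toLp_denseRange ℂ (vectorMeasure hR x) ℂ ENNReal.ofNat_ne_top

/-- The map `f ↦ f(R) x`. -/
def cyclicMap (x : 𝓗) : C(spectrum ℂ R, ℂ) →ₗ[ℂ] 𝓗 where
  toFun f := cfcHom hR f x
  map_add' f g := by rw [map_add]; rfl
  map_smul' c f := by rw [map_smul]; rfl

/-- The isometric embedding of `L²` of the spectral measure of `x` onto the cyclic subspace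
generated by `x`. -/
def cyclicIsometry (x : 𝓗) : Lp ℂ 2 (vectorMeasure hR x) →ₗᵢ[ℂ] 𝓗 where
  toLinearMap := ((cyclicMap hR x).extendOfNorm
    (ContinuousMap.toLp 2 (vectorMeasure hR x) ℂ (E := ℂ)).toLinearMap).toLinearMap
  norm_map' g := by
    have hd := dense_toLp_vectorMeasure hR x
    refine hd.induction_on (p := fun g => ‖((cyclicMap hR x).extendOfNorm
      (ContinuousMap.toLp 2 (vectorMeasure hR x) ℂ (E := ℂ)).toLinearMap) g‖ = ‖g‖) g
      (isClosed_eq (by fun_prop) (by fun_prop)) fun f => ?_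
    rw [LinearMap.extendOfNorm_eq hd]
    · exact (norm_toLp_vectorMeasure hR x f).symm
    · exact ⟨1, fun f => by rw [one_mul]; exact (norm_toLp_vectorMeasure hR x f).ge⟩

theorem cyclicIsometry_toLp (x : 𝓗) (f : C(spectrum ℂ R, ℂ)) :
    cyclicIsometry hR x (ContinuousMap.toLp 2 (vectorMeasure hR x) ℂ f) = cfcHom hR f x :=
  LinearMap.extendOfNorm_eq (dense_toLp_vectorMeasure hR x)
    ⟨1, fun f => by rw [one_mul]; exact (norm_toLp_vectorMeasure hR x f).ge⟩ f

theorem memLp_spectrum_mul (x : 𝓗) (g : Lp ℂ 2 (vectorMeasure hR x)) :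
    MemLp (fun k : spectrum ℂ R => (k : ℂ) * g k) 2 (vectorMeasure hR x) := by
  refine (Lp.memLp g).of_le_mul (c := ‖R‖ * ‖(1 : 𝓗 →L[ℂ] 𝓗)‖) ?_ (ae_of_all _ fun k => ?_)
  · exact AEStronglyMeasurable.mul continuous_subtype_val.aestronglyMeasurable (Lp.memLp g).1
  · rw [norm_mul]
    exact mul_le_mul_of_nonneg_right (spectrum.norm_le_norm_mul_of_mem k.2) (norm_nonneg _)

/-- For continuous f both sides are (k·f)(R)x; the general case follows by density, multiplication
by k being bounded on the spectrum. -/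
theorem apply_cyclicIsometry (x : 𝓗) (f g : Lp ℂ 2 (vectorMeasure hR x))
    (h : g =ᵐ[vectorMeasure hR x] fun k => (k : ℂ) * f k) :
    R (cyclicIsometry hR x f) = cyclicIsometry hR x g := by
  obtain ⟨C, hC⟩ : ∃ C : ℝ, ∀ k : spectrum ℂ R, ‖(k : ℂ)‖ ≤ C :=
    ⟨‖R‖ * ‖(1 : 𝓗 →L[ℂ] 𝓗)‖, fun k => spectrum.norm_le_norm_mul_of_mem k.2⟩
  have hmem := memLp_spectrum_mul hR x
  let M : Lp ℂ 2 (vectorMeasure hR x) →L[ℂ] Lp ℂ 2 (vectorMeasure hR x) :=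
    LinearMap.mkContinuous
      { toFun := fun f => (hmem f).toLp
        map_add' := fun f g => by
          rw [← MemLp.toLp_add]
          refine MemLp.toLp_congr _ _ ?_
          filter_upwards [Lp.coeFn_add f g] with k hk
          rw [hk, Pi.add_apply, Pi.add_apply, mul_add]
        map_smul' := fun c f => by
          rw [RingHom.id_apply, ← MemLp.toLp_const_smul]
          refine MemLp.toLp_congr _ _ ?_
          filter_upwards [Lp.coeFn_smul c f] with k hk
          rw [hk, Pi.smul_apply, Pi.smul_apply, smul_eq_mul, smul_eq_mul]
          ring } C fun f => by
      refine Lp.norm_le_mul_norm_of_ae_le_mul ?_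
      filter_upwards [MemLp.coeFn_toLp (hmem f)] with k hk
      change ‖((hmem f).toLp : Lp ℂ 2 (vectorMeasure hR x)) k‖ ≤ _
      rw [hk, norm_mul]
      exact mul_le_mul_of_nonneg_right (hC k) (norm_nonneg _)
  have hM : ∀ f, R (cyclicIsometry hR x f) = cyclicIsometry hR x (M f) := by
    intro f
    refine (dense_toLp_vectorMeasure hR x).induction_on
      (p := fun f => R (cyclicIsometry hR x f) = cyclicIsometry hR x (M f)) f
      (isClosed_eq (by fun_prop) (by fun_prop)) fun f => ?_
    let i : C(spectrum ℂ R, ℂ) := ContinuousMap.restrict (spectrum ℂ R) (ContinuousMap.id ℂ)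
    have h1 : M (ContinuousMap.toLp 2 (vectorMeasure hR x) ℂ f) =
        ContinuousMap.toLp 2 (vectorMeasure hR x) ℂ (i * f) := by
      apply Lp.ext
      refine (MemLp.coeFn_toLp (hmem _)).trans ?_
      filter_upwards [ContinuousMap.coeFn_toLp (𝕜 := ℂ) (p := 2) (vectorMeasure hR x) f,
        ContinuousMap.coeFn_toLp (𝕜 := ℂ) (p := 2) (vectorMeasure hR x) (i * f)] with k h1 h2
      rw [h1, h2]
      rfl
    change R (cyclicIsometry hR x (ContinuousMap.toLp 2 (vectorMeasure hR x) ℂ f)) =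
      cyclicIsometry hR x (M (ContinuousMap.toLp 2 (vectorMeasure hR x) ℂ f))
    rw [h1, cyclicIsometry_toLp, cyclicIsometry_toLp, map_mul, cfcHom_id]
    rfl
  rw [hM]
  congr 1
  apply Lp.ext
  exact (MemLp.coeFn_toLp (hmem f)).trans h.symm

/-- Zorn's lemma gives a maximal set of vectors with mutually orthogonal cyclic subspaces. A vector
orthogonal to all of these subspaces could be adjoined, so it already belongs to the set and is
orthogonal to itself. -/
theorem exists_cyclic_decomposition : ∃ s : Set 𝓗,
    IsHilbertSum ℂ (fun x : s => Lp ℂ 2 (vectorMeasure hR (x : 𝓗)))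
      (fun x : s => cyclicIsometry hR (x : 𝓗)) := by
  let r : 𝓗 → 𝓗 → Prop := fun x y => ∀ f : C(spectrum ℂ R, ℂ), ⟪cfcHom hR f x, y⟫_ℂ = 0
  have hrsymm : ∀ x y, r x y → r y x := by
    intro x y h f
    have := inner_cfcHom hR f 1 y x
    rw [map_one, mul_one] at this
    change ⟪cfcHom hR f y, x⟫_ℂ = _ at this
    rw [this, ← inner_conj_symm, h, map_zero]
  obtain ⟨s, hs⟩ := zorn_subset {s : Set 𝓗 | s.Pairwise r} (by
    intro c hc hchain
    refine ⟨⋃₀ c, ?_, fun _ => Set.subset_sUnion_of_mem⟩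
    exact (Set.pairwise_sUnion hchain.directedOn).2 fun t ht => hc ht)
  refine ⟨s, IsHilbertSum.mk ?_ ?_⟩
  · intro x y hxy f g
    have hr : r x y := hs.prop x.2 y.2 fun h => hxy (Subtype.ext h)
    refine (dense_toLp_vectorMeasure hR (x : 𝓗)).induction_on
      (p := fun f => ⟪cyclicIsometry hR (x : 𝓗) f, cyclicIsometry hR (y : 𝓗) g⟫_ℂ = 0) f
      (isClosed_eq (by fun_prop) continuous_const) fun f => ?_
    refine (dense_toLp_vectorMeasure hR (y : 𝓗)).induction_on
      (p := fun g => ⟪cyclicIsometry hR (x : 𝓗) _, cyclicIsometry hR (y : 𝓗) g⟫_ℂ = 0) g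
      (isClosed_eq (by fun_prop) continuous_const) fun g => ?_
    change ⟪cyclicIsometry hR (x : 𝓗) (ContinuousMap.toLp 2 _ ℂ f),
      cyclicIsometry hR (y : 𝓗) (ContinuousMap.toLp 2 _ ℂ g)⟫_ℂ = 0
    rw [cyclicIsometry_toLp, cyclicIsometry_toLp, inner_cfcHom, ← inner_conj_symm,
      hrsymm _ _ hr, map_zero]
  · rw [top_le_iff, Submodule.topologicalClosure_eq_top_iff, Submodule.eq_bot_iff]
    intro y hy
    have hy' : ∀ x ∈ s, r x y := by
      intro x hx f
      rw [← cyclicIsometry_toLp]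
      refine (Submodule.mem_orthogonal _ _).1 hy _ ?_
      exact Submodule.mem_iSup_of_mem (⟨x, hx⟩ : s) ⟨_, rfl⟩
    have hins : insert y s ∈ {s : Set 𝓗 | s.Pairwise r} := by
      refine (Set.pairwise_insert).2 ⟨hs.prop, fun x hx _ => ⟨hrsymm _ _ (hy' x hx), hy' x hx⟩⟩
    have hmem : y ∈ s := hs.le_of_ge hins (Set.subset_insert _ _) (Set.mem_insert _ _)
    have := hy' y hmem 1
    rw [map_one] at this
    exact inner_self_eq_zero.1 this

/-- The equality is tested weakly: R moves to the other factor by self-adjointness, acts there as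
multiplication by k, and returns because the spectrum is real. -/
theorem cyclic_component_ae (hR' : IsSelfAdjoint R) {s : Set 𝓗}
    (Θ : 𝓗 ≃ₗᵢ[ℂ] lp (fun x : s => Lp ℂ 2 (vectorMeasure hR (x : 𝓗))) 2)
    (hpair : ∀ (i : s) (y : 𝓗) (g : Lp ℂ 2 (vectorMeasure hR (i : 𝓗))),
      ⟪cyclicIsometry hR (i : 𝓗) g, y⟫_ℂ = ⟪g, Θ y i⟫_ℂ) (x : 𝓗) (i : s) :
    (Θ (R x) i : spectrum ℂ R → ℂ) =ᵐ[vectorMeasure hR (i : 𝓗)]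
      fun k => (k : ℂ) * (Θ x i : spectrum ℂ R → ℂ) k := by
  have key : Θ (R x) i = (memLp_spectrum_mul hR (i : 𝓗) (Θ x i)).toLp := by
    refine ext_inner_left ℂ fun g => ?_
    have hst : ∀ u v, ⟪u, R v⟫_ℂ = ⟪R u, v⟫_ℂ := fun u v =>
      ((ContinuousLinearMap.isSelfAdjoint_iff_isSymmetric.1 hR') u v).symm
    have hg := MemLp.coeFn_toLp (memLp_spectrum_mul hR (i : 𝓗) g)
    rw [← hpair, hst, apply_cyclicIsometry hR (i : 𝓗) g _ hg, hpair, L2.inner_def, L2.inner_def]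
    refine integral_congr_ae ?_
    filter_upwards [hg, MemLp.coeFn_toLp (memLp_spectrum_mul hR (i : 𝓗) (Θ x i))] with k h1 h2
    rw [h1, h2]
    have hk : (starRingEnd ℂ) (k : ℂ) = k := by
      rw [Complex.conj_eq_iff_re]
      exact (hR'.mem_spectrum_eq_re k.2).symm
    simp only [RCLike.inner_apply, map_mul, hk]
    ring
  rw [key]
  exact MemLp.coeFn_toLp (memLp_spectrum_mul hR (i : 𝓗) (Θ x i))

/-- A bounded self-adjoint operator is unitarily equivalent to multiplication by a bounded real
function. -/
theorem exists_multiplication_model (hR' : IsSelfAdjoint R) :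
    ∃ (X : Type u) (_ : MeasurableSpace X) (ν : Measure X) (V : 𝓗 ≃ₗᵢ[ℂ] Lp ℂ 2 ν) (a : X → ℝ),
      Measurable a ∧ ∀ x, V (R x) =ᵐ[ν] fun k => (a k : ℂ) * V x k := by
  have hR : IsStarNormal R := hR'.isStarNormal
  obtain ⟨s, hs⟩ := exists_cyclic_decomposition hR
  let ν : ∀ _ : s, Measure (spectrum ℂ R) := fun x => vectorMeasure hR (x : 𝓗)
  let Ψ : lp (fun x : s => Lp ℂ 2 (ν x)) 2 ≃ₗᵢ[ℂ] Lp ℂ 2 (sigmaMeasure ν) :=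
    LinearIsometryEquiv.ofSurjective (sigmaL2 ν) (sigmaL2_surjective ν)
  let Θ : 𝓗 ≃ₗᵢ[ℂ] lp (fun x : s => Lp ℂ 2 (ν x)) 2 := hs.linearIsometryEquiv
  have ha : Measurable fun k : (Σ _ : s, spectrum ℂ R) => (k.2 : ℂ).re :=
    measurable_sigma fun i => Complex.measurable_re.comp measurable_subtype_coe
  refine ⟨Σ _ : s, spectrum ℂ R, inferInstance, sigmaMeasure ν, Θ.trans Ψ,
    fun k => (k.2 : ℂ).re, ha, fun x => ?_⟩
  have hcomp := cyclic_component_ae hR hR' Θ fun i y g => by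
    classical
    have h1 : cyclicIsometry hR (i : 𝓗) g = Θ.symm (lp.single 2 i g) :=
      (hs.linearIsometryEquiv_symm_apply_single g).symm
    rw [h1, ← Θ.inner_map_map, Θ.apply_symm_apply, lp.inner_single_left]
  refine (sigmaL2_ae ν (Θ (R x))).trans ?_
  have h2 : (fun k : (Σ _ : s, spectrum ℂ R) => ((k.2 : ℂ).re : ℂ) *
      (Θ x k.1 : spectrum ℂ R → ℂ) k.2) =ᵐ[sigmaMeasure ν]
      fun k => ((k.2 : ℂ).re : ℂ) * (Θ.trans Ψ) x k := by
    filter_upwards [sigmaL2_ae ν (Θ x)] with k hk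
    rw [← hk]
    rfl
  refine EventuallyEq.trans ?_ h2
  refine (ae_sigmaMeasure_iff ν (measurableSet_eq_fun
    (measurable_sigma fun i => (Lp.stronglyMeasurable (Θ (R x) i)).measurable)
    ((Complex.measurable_ofReal.comp ha).mul
      (measurable_sigma fun i => (Lp.stronglyMeasurable (Θ x i)).measurable)))).2 fun i => ?_
  filter_upwards [hcomp x i] with k hk
  rw [hk, hR'.mem_spectrum_eq_re k.2]
  simp

end spectral

/-! ### The bounded operators attached to a real subspace -/

section realSubspace

open ClosedSubmodule Complex

variable {𝓗 : Type*} [NormedAddCommGroup 𝓗] [InnerProductSpace ℂ 𝓗] [CompleteSpace 𝓗]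
  (K : ClosedSubmodule ℝ 𝓗)

/-- The real orthogonal projection onto a closed real subspace. -/
def realProj : 𝓗 →L[ℝ] 𝓗 :=
  haveI : CompleteSpace K.toSubmodule := K.isClosed'.completeSpace_coe
  K.toSubmodule.starProjection

theorem realProj_mem (x : 𝓗) : realProj K x ∈ K := by
  have : CompleteSpace K.toSubmodule := K.isClosed'.completeSpace_coe
  exact K.toSubmodule.starProjection_apply_mem x

theorem realProj_eq_self_iff {x : 𝓗} : realProj K x = x ↔ x ∈ K := by
  have : CompleteSpace K.toSubmodule := K.isClosed'.completeSpace_coe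
  exact K.toSubmodule.starProjection_eq_self_iff

theorem realProj_idem (x : 𝓗) : realProj K (realProj K x) = realProj K x :=
  (realProj_eq_self_iff K).2 (realProj_mem K x)

theorem re_inner_realProj (x y : 𝓗) : (⟪realProj K x, y⟫_ℂ).re = (⟪x, realProj K y⟫_ℂ).re := by
  have : CompleteSpace K.toSubmodule := K.isClosed'.completeSpace_coe
  exact K.toSubmodule.inner_starProjection_left_eq_right x y

theorem realProj_eq_zero_iff {x : 𝓗} : realProj K x = 0 ↔ ∀ k ∈ K, (⟪k, x⟫_ℂ).re = 0 := by
  constructor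
  · intro h k hk
    rw [← (realProj_eq_self_iff K).2 hk, re_inner_realProj, h]
    simp
  · intro h
    have h2 := h _ (realProj_mem K x)
    have h3 : (⟪realProj K x, realProj K x⟫_ℂ).re = 0 := by
      rw [re_inner_realProj, realProj_idem, ← re_inner_realProj]; exact h2
    exact inner_self_eq_zero.1 (Complex.ext h3 (inner_self_im (𝕜 := ℂ) _))

/-- The real orthogonal projection onto `iK`. -/
def imagProj : 𝓗 →L[ℝ] 𝓗 :=
  -((((I : ℂ) • ContinuousLinearMap.id ℂ 𝓗).restrictScalars ℝ).comp ((realProj K).comp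
    (((I : ℂ) • ContinuousLinearMap.id ℂ 𝓗).restrictScalars ℝ)))

theorem imagProj_apply (x : 𝓗) : imagProj K x = -(I • realProj K (I • x)) := rfl

theorem I_smul_I_smul (x : 𝓗) : I • I • x = -x := by
  rw [smul_smul, I_mul_I, neg_one_smul]

theorem imagProj_I (x : 𝓗) : imagProj K (I • x) = I • realProj K x := by
  rw [imagProj_apply, I_smul_I_smul, map_neg, smul_neg, neg_neg]

theorem realProj_I (x : 𝓗) : realProj K (I • x) = I • imagProj K x := by
  rw [imagProj_apply, smul_neg, I_smul_I_smul, neg_neg]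

theorem imagProj_idem (x : 𝓗) : imagProj K (imagProj K x) = imagProj K x := by
  rw [imagProj_apply K x, map_neg, imagProj_I, realProj_idem]

theorem re_inner_I (x y : 𝓗) : (⟪I • x, y⟫_ℂ).re = -(⟪x, I • y⟫_ℂ).re := by
  rw [inner_smul_left, inner_smul_right]
  simp

theorem re_inner_imagProj (x y : 𝓗) : (⟪imagProj K x, y⟫_ℂ).re = (⟪x, imagProj K y⟫_ℂ).re := by
  rw [imagProj_apply, imagProj_apply, inner_neg_left, inner_neg_right, Complex.neg_re,
    Complex.neg_re, re_inner_I, re_inner_realProj, re_inner_I, neg_neg]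

/-- The operator `R = P + Q`, where `P`, `Q` are the real projections onto `K` and `iK`. -/
def sumProj : 𝓗 →L[ℂ] 𝓗 where
  toFun x := realProj K x + imagProj K x
  map_add' x y := by rw [map_add, map_add]; abel
  map_smul' c x := by
    have hr : ∀ (a : ℝ) (y : 𝓗), (a : ℂ) • y = a • y := fun a y => Complex.coe_smul a y
    have h : c • x = c.re • x + c.im • I • x := by
      rw [← hr, ← hr, smul_smul, ← add_smul, Complex.re_add_im]
    have h' : ∀ y : 𝓗, c • y = c.re • y + c.im • I • y := fun y => by
      rw [← hr, ← hr, smul_smul, ← add_smul, Complex.re_add_im]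
    -- Multiplication by i intertwines P and Q, each becoming the other, so their sum commutes with
    -- i and is complex linear.
    rw [RingHom.id_apply, h, map_add, map_add, (realProj K).map_smul,
      (realProj K).map_smul, (imagProj K).map_smul, (imagProj K).map_smul, realProj_I, imagProj_I, h' (realProj K x + imagProj K x)]
    simp only [smul_add]
    abel
  cont := (realProj K).continuous.add (imagProj K).continuous

/-- The operator `D = P - Q`, where `P`, `Q` are the real projections onto `K` and `iK`. -/
def diffProj : 𝓗 →L[ℝ] 𝓗 := realProj K - imagProj K

theorem sumProj_apply (x : 𝓗) : sumProj K x = realProj K x + imagProj K x := rfl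

theorem diffProj_apply (x : 𝓗) : diffProj K x = realProj K x - imagProj K x := rfl

theorem diffProj_I (x : 𝓗) : diffProj K (I • x) = -(I • diffProj K x) := by
  rw [diffProj_apply, diffProj_apply, realProj_I, imagProj_I, smul_sub]
  abel

/-- This relation DR = (2 - R)D and the next one, D² = R(2 - R), use only that P and Q are
idempotent. Since Δ = (2 - R)/R, the first says that D exchanges Δ and its inverse. -/
theorem diffProj_sumProj (x : 𝓗) :
    diffProj K (sumProj K x) = (2 : ℂ) • diffProj K x - sumProj K (diffProj K x) := by
  simp only [diffProj_apply, sumProj_apply, map_add, map_sub, realProj_idem, imagProj_idem,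
    two_smul]
  abel

theorem diffProj_diffProj (x : 𝓗) :
    diffProj K (diffProj K x) = (2 : ℂ) • sumProj K x - sumProj K (sumProj K x) := by
  simp only [diffProj_apply, sumProj_apply, map_add, map_sub, realProj_idem, imagProj_idem,
    two_smul]
  abel

theorem two_smul_realProj (x : 𝓗) : (2 : ℂ) • realProj K x = sumProj K x + diffProj K x := by
  simp only [diffProj_apply, sumProj_apply, two_smul]
  abel

theorem two_smul_imagProj (x : 𝓗) : (2 : ℂ) • imagProj K x = sumProj K x - diffProj K x := by
  simp only [diffProj_apply, sumProj_apply, two_smul]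
  abel

theorem re_inner_sumProj (x y : 𝓗) : (⟪sumProj K x, y⟫_ℂ).re = (⟪x, sumProj K y⟫_ℂ).re := by
  simp only [sumProj_apply, inner_add_left, inner_add_right, Complex.add_re, re_inner_realProj,
    re_inner_imagProj]

theorem re_inner_diffProj (x y : 𝓗) : (⟪diffProj K x, y⟫_ℂ).re = (⟪x, diffProj K y⟫_ℂ).re := by
  simp only [diffProj_apply, inner_sub_left, inner_sub_right, Complex.sub_re, re_inner_realProj,
    re_inner_imagProj]

theorem im_inner_eq (x y : 𝓗) : (⟪x, y⟫_ℂ).im = (⟪I • x, y⟫_ℂ).re := by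
  rw [inner_smul_left]
  simp

theorem isSelfAdjoint_sumProj : IsSelfAdjoint (sumProj K) := by
  rw [ContinuousLinearMap.isSelfAdjoint_iff_isSymmetric]
  intro x y
  change ⟪sumProj K x, y⟫_ℂ = ⟪x, sumProj K y⟫_ℂ
  refine Complex.ext (re_inner_sumProj K x y) ?_
  rw [im_inner_eq, im_inner_eq, ← map_smul, re_inner_sumProj]

/-- As 2P = R + D, membership in K becomes an equation between R and D, whose behaviour under
functions of R is known. -/
theorem mem_iff_diffProj {x : 𝓗} : x ∈ K ↔ diffProj K x = (2 : ℂ) • x - sumProj K x := by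
  have h := two_smul_realProj K x
  rw [← realProj_eq_self_iff]
  constructor
  · intro h1
    rw [h1] at h
    rw [h]; abel
  · intro h1
    rw [h1] at h
    have : (2 : ℂ) • realProj K x = (2 : ℂ) • x := by rw [h]; abel
    exact smul_right_injective 𝓗 (two_ne_zero (α := ℂ)) this

theorem mem_symplComp_iff_imagProj {x : 𝓗} : x ∈ K.symplComp ↔ imagProj K x = 0 := by
  rw [mem_symplComp_iff, imagProj_apply, neg_eq_zero, smul_eq_zero_iff_right I_ne_zero,
    realProj_eq_zero_iff]
  refine forall₂_congr fun k _ => ?_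
  rw [im_inner_eq, re_inner_I, neg_eq_zero]

theorem mem_symplComp_iff_diffProj {x : 𝓗} : x ∈ K.symplComp ↔ diffProj K x = sumProj K x := by
  have h := two_smul_imagProj K x
  rw [mem_symplComp_iff_imagProj]
  constructor
  · intro h1
    rw [h1, smul_zero] at h
    exact (sub_eq_zero.1 h.symm).symm
  · intro h1
    rw [h1, sub_self] at h
    exact (smul_eq_zero_iff_right two_ne_zero).1 h

/-- K' is the real orthogonal complement of iK. It follows that passing from K to K' replaces R by 2
- R, that is, Δ by its inverse. -/
theorem realProj_symplComp (x : 𝓗) : realProj K.symplComp x = x - imagProj K x := by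
  have h1 : x - imagProj K x ∈ K.symplComp := by
    rw [mem_symplComp_iff_imagProj, map_sub, imagProj_idem, sub_self]
  have h2 : realProj K.symplComp (imagProj K x) = 0 := by
    rw [realProj_eq_zero_iff]
    intro k hk
    rw [← re_inner_imagProj, (mem_symplComp_iff_imagProj K).1 hk]
    simp
  conv_lhs => rw [← sub_add_cancel x (imagProj K x)]
  rw [map_add, h2, add_zero, (realProj_eq_self_iff _).2 h1]

theorem imagProj_symplComp (x : 𝓗) : imagProj K.symplComp x = x - realProj K x := by
  rw [imagProj_apply, realProj_symplComp, imagProj_I, smul_sub, I_smul_I_smul, I_smul_I_smul]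
  abel

theorem sumProj_symplComp (x : 𝓗) : sumProj K.symplComp x = (2 : ℂ) • x - sumProj K x := by
  rw [sumProj_apply, sumProj_apply, realProj_symplComp, imagProj_symplComp, two_smul]
  abel

variable {K}

/-- A closed real subspace `K` is cyclic if `K + iK` is dense, that is, if no nonzero vector is
orthogonal to `K`. -/
def Cyclic (K : ClosedSubmodule ℝ 𝓗) : Prop := ∀ x, (∀ k ∈ K, ⟪k, x⟫_ℂ = 0) → x = 0

/-- A closed real subspace `K` is separating if `K ∩ iK = 0`. -/
def Separating (K : ClosedSubmodule ℝ 𝓗) : Prop := ∀ x ∈ K, I • x ∈ K → x = 0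

theorem cyclic_of_sup_eq_top (h : K ⊔ K.mulI = ⊤) : Cyclic K := by
  intro x hx
  have h1 : x ∈ (K ⊔ K.mulI).symplComp := by
    rw [symplComp_sup, mulI_symplComp.symm]
    refine ⟨?_, ?_⟩
    · exact (mem_symplComp_iff).2 fun k hk => by rw [hx k hk]; rfl
    · change x ∈ K.symplComp.mulI
      rw [mem_mapEquiv_iff, scalarSMulCLE_symm_apply]
      refine (mem_symplComp_iff).2 fun k hk => ?_
      rw [Units.smul_def, inner_smul_right, hx k hk]
      simp
  rw [h, mem_symplComp_iff] at h1
  -- Pairing with -ix turns the imaginary part into ‖x‖².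
  have h2 := h1 (-(I • x)) trivial
  rw [im_inner_eq, smul_neg, I_smul_I_smul, neg_neg] at h2
  exact inner_self_eq_zero.1 (Complex.ext h2 (inner_self_im (𝕜 := ℂ) _))

theorem Cyclic.symplComp_separating (h : Cyclic K) : Separating K.symplComp := by
  intro x hx hx'
  refine h x fun k hk => Complex.ext ?_ ((mem_symplComp_iff).1 hx k hk)
  have := (mem_symplComp_iff).1 hx' k hk
  rw [im_inner_eq, re_inner_I, I_smul_I_smul, inner_neg_right] at this
  simpa using this

theorem Separating.symplComp_cyclic (h : Separating K) : Cyclic K.symplComp := by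
  intro x hx
  have hmem : ∀ y, (∀ k ∈ K.symplComp, ⟪k, y⟫_ℂ = 0) → y ∈ K := by
    intro y hy
    have : y ∈ K.symplComp.symplComp := (mem_symplComp_iff).2 fun k hk => by rw [hy k hk]; rfl
    rwa [symplComp_symplComp_eq] at this
  refine h x (hmem x hx) (hmem _ fun k hk => ?_)
  rw [inner_smul_right, hx k hk, mul_zero]

theorem Separating.mono {L : ClosedSubmodule ℝ 𝓗} (h : Separating K) (hL : L ≤ K) :
    Separating L := fun x hx hx' => h x (hL hx) (hL hx')

/-- Here ⟪x, Rx⟫ = ‖Px‖² + ‖Qx‖², and both terms vanish only on the complex orthogonal complement of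
K. The inequality form later excludes spectral values of R that are ≤ 0. -/
theorem Cyclic.eq_zero_of_re_inner_nonpos (h : Cyclic K) {x : 𝓗}
    (h1 : (⟪x, sumProj K x⟫_ℂ).re ≤ 0) : x = 0 := by
  have hP : (⟪x, realProj K x⟫_ℂ).re = ‖realProj K x‖ ^ 2 := by
    rw [← realProj_idem, ← re_inner_realProj]
    rw [← inner_self_eq_norm_sq (𝕜 := ℂ), realProj_idem]; rfl
  have hQ : (⟪x, imagProj K x⟫_ℂ).re = ‖imagProj K x‖ ^ 2 := by
    rw [← imagProj_idem, ← re_inner_imagProj]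
    rw [← inner_self_eq_norm_sq (𝕜 := ℂ), imagProj_idem]; rfl
  rw [sumProj_apply, inner_add_right, Complex.add_re, hP, hQ] at h1
  have hP0 : realProj K x = 0 := by
    have := sq_nonneg ‖realProj K x‖
    have := sq_nonneg ‖imagProj K x‖
    exact norm_eq_zero.1 (pow_eq_zero_iff two_ne_zero |>.1 (by linarith))
  have hQ0 : imagProj K x = 0 := by
    have := sq_nonneg ‖realProj K x‖
    have := sq_nonneg ‖imagProj K x‖
    exact norm_eq_zero.1 (pow_eq_zero_iff two_ne_zero |>.1 (by linarith))
  refine h x fun k hk => Complex.ext ((realProj_eq_zero_iff K).1 hP0 k hk) ?_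
  exact mem_symplComp_iff.1 ((mem_symplComp_iff_imagProj K).2 hQ0) k hk

theorem Cyclic.sumProj_injective (h : Cyclic K) {x : 𝓗} (hx : sumProj K x = 0) : x = 0 :=
  h.eq_zero_of_re_inner_nonpos (by rw [hx]; simp)

theorem Separating.two_sub_sumProj_injective (h : Separating K) {x : 𝓗}
    (hx : (2 : ℂ) • x - sumProj K x = 0) : x = 0 := by
  rw [← sumProj_symplComp] at hx
  exact h.symplComp_cyclic.sumProj_injective hx

/-- A pair (ξ + iη, ξ - iη) is characterised by its sum lying in K and its difference in iK. These
conditions are closed, so taking the closure adds nothing. -/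
theorem mem_tomitaGraph_iff {u v : 𝓗} :
    (u, v) ∈ tomitaGraph K ↔ realProj K (u + v) = u + v ∧ imagProj K (u - v) = u - v := by
  have hset : {z : 𝓗 × 𝓗 | ∃ ξ ∈ K, ∃ η ∈ K, z = (ξ + I • η, ξ - I • η)} =
      {z | realProj K (z.1 + z.2) = z.1 + z.2 ∧ imagProj K (z.1 - z.2) = z.1 - z.2} := by
    ext ⟨u, v⟩
    constructor
    · rintro ⟨ξ, hξ, η, hη, h⟩
      obtain ⟨rfl, rfl⟩ := Prod.mk.inj h
      have h1 := (realProj_eq_self_iff K).2 hξ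
      have h2 := (realProj_eq_self_iff K).2 hη
      constructor
      · change realProj K (ξ + I • η + (ξ - I • η)) = _
        rw [show ξ + I • η + (ξ - I • η) = ξ + ξ by abel, map_add, h1]
      · change imagProj K (ξ + I • η - (ξ - I • η)) = _
        rw [show ξ + I • η - (ξ - I • η) = I • η + I • η by abel, map_add, imagProj_I, h2]
    · rintro ⟨h1, h2⟩
      refine ⟨(2⁻¹ : ℝ) • realProj K (u + v), K.smul_mem _ (realProj_mem K _),
        (2⁻¹ : ℝ) • -realProj K (I • (u - v)),
        K.smul_mem _ (neg_mem (realProj_mem K _)), ?_⟩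
      have h3 : I • -realProj K (I • (u - v)) = u - v := by
        rw [smul_neg]; exact h2
      rw [smul_comm I, h3, h1]
      refine Prod.ext ?_ ?_
      · change u = (2⁻¹ : ℝ) • (u + v) + (2⁻¹ : ℝ) • (u - v)
        module
      · change v = (2⁻¹ : ℝ) • (u + v) - (2⁻¹ : ℝ) • (u - v)
        module
  have hcl : IsClosed {z : 𝓗 × 𝓗 | realProj K (z.1 + z.2) = z.1 + z.2 ∧
      imagProj K (z.1 - z.2) = z.1 - z.2} :=
    (isClosed_eq (by fun_prop) (by fun_prop)).inter (isClosed_eq (by fun_prop) (by fun_prop))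
  rw [tomitaGraph, hset, hcl.closure_eq]
  rfl

/-- It suffices to test on pairs (k, k) with k ∈ K, where the condition says that ⟪k, y⟫ and ⟪k, z⟫
are complex conjugates. -/
theorem adjoint_tomita_iff {y z : 𝓗} :
    (∀ w ∈ tomitaGraph K, ⟪w.2, y⟫_ℂ = ⟪z, w.1⟫_ℂ) ↔
      realProj K (y - z) = 0 ∧ imagProj K (y + z) = 0 := by
  rw [realProj_eq_zero_iff, ← mem_symplComp_iff_imagProj, mem_symplComp_iff]
  have hconj : ∀ k : 𝓗, ⟪z, k⟫_ℂ = (starRingEnd ℂ) ⟪k, z⟫_ℂ := fun k => (inner_conj_symm z k).symm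
  constructor
  · intro h
    have hk : ∀ k ∈ K, ⟪k, y⟫_ℂ = (starRingEnd ℂ) ⟪k, z⟫_ℂ := by
      intro k hk
      rw [← hconj]
      refine h (k, k) (subset_closure ⟨k, hk, 0, K.zero_mem, ?_⟩)
      simp
    constructor
    · intro k h1
      rw [inner_sub_right, hk k h1, Complex.sub_re, Complex.conj_re, sub_self]
    · intro k h1
      rw [inner_add_right, hk k h1, Complex.add_im, Complex.conj_im, neg_add_cancel]
  · rintro ⟨h1, h2⟩ w hw
    have hk : ∀ k ∈ K, ⟪k, y⟫_ℂ = ⟪z, k⟫_ℂ := by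
      intro k hk
      have e1 := h1 k hk
      have e2 := h2 k hk
      rw [inner_sub_right, Complex.sub_re] at e1
      rw [inner_add_right, Complex.add_im] at e2
      rw [hconj]
      refine Complex.ext ?_ ?_
      · rw [Complex.conj_re]; linarith
      · rw [Complex.conj_im]; linarith
    have hcl : IsClosed {w : 𝓗 × 𝓗 | ⟪w.2, y⟫_ℂ = ⟪z, w.1⟫_ℂ} :=
      isClosed_eq (by fun_prop) (by fun_prop)
    refine hcl.closure_subset_iff.2 ?_ hw
    rintro _ ⟨ξ, hξ, η, hη, rfl⟩
    change ⟪ξ - I • η, y⟫_ℂ = ⟪z, ξ + I • η⟫_ℂ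
    rw [inner_sub_left, inner_add_right, inner_smul_left, inner_smul_right, hk ξ hξ, hk η hη]
    simp

/-- The modular operator of `K` is `(2 - R) / R`. -/
theorem mem_modularGraph_iff {x z : 𝓗} :
    (x, z) ∈ modularGraph K ↔ sumProj K (x + z) = (2 : ℂ) • x := by
  have h2 : ∀ u v : 𝓗, (2 : ℂ) • u = (2 : ℂ) • v → u = v := fun u v h =>
    smul_right_injective 𝓗 (two_ne_zero (α := ℂ)) h
  have hd : (x, z) ∈ modularGraph K ↔ ∃ y, (realProj K (x + y) = x + y ∧
      imagProj K (x - y) = x - y) ∧ realProj K (y - z) = 0 ∧ imagProj K (y + z) = 0 := by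
    refine exists_congr fun y => and_congr mem_tomitaGraph_iff adjoint_tomita_iff
  rw [hd]
  constructor
  · rintro ⟨y, ⟨h1, h2⟩, h3, h4⟩
    rw [map_add] at h1 h4
    rw [map_sub] at h2 h3
    have e1 := sub_eq_zero.1 h3
    have e2 : imagProj K z = -imagProj K y := by rw [eq_neg_iff_add_eq_zero, add_comm]; exact h4
    rw [sumProj_apply, map_add, map_add, ← e1, e2, h1, ← sub_eq_add_neg, h2, two_smul]
    abel
  · intro h
    -- The choice is forced: x + y ∈ K and Py = Pz give x + y = P(x + y) = P(x + z).
    refine ⟨realProj K (x + z) - x, ?_⟩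
    have hQ : imagProj K (x + z) = (2 : ℂ) • x - realProj K (x + z) := by
      rw [← h, sumProj_apply]; abel
    have hQQ := imagProj_idem K (x + z)
    have hPP := realProj_idem K (x + z)
    refine ⟨⟨?_, ?_⟩, ?_, ?_⟩
    · rw [add_sub_cancel, hPP]
    · rw [show x - (realProj K (x + z) - x) = imagProj K (x + z) by rw [hQ, two_smul]; abel, hQQ]
    · rw [show realProj K (x + z) - x - z = realProj K (x + z) - (x + z) by abel, map_sub, hPP,
        sub_self]
    · rw [show realProj K (x + z) - x + z = (x + z) - imagProj K (x + z) by
        rw [hQ, two_smul]; abel, map_sub, hQQ, sub_self]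

/-- Covariance of the real projection under unitaries. -/
theorem realProj_of_image {L : ClosedSubmodule ℝ 𝓗} (U : 𝓗 ≃ₗᵢ[ℂ] 𝓗)
    (h : U '' (K : Set 𝓗) = L) (x : 𝓗) : realProj L (U x) = U (realProj K x) := by
  have hmem : ∀ k ∈ K, U k ∈ L := fun k hk => by
    have : U k ∈ (L : Set 𝓗) := h ▸ Set.mem_image_of_mem U hk
    exact this
  have h1 : realProj L (U (realProj K x)) = U (realProj K x) :=
    (realProj_eq_self_iff L).2 (hmem _ (realProj_mem K x))
  have h2 : realProj L (U (x - realProj K x)) = 0 := by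
    rw [realProj_eq_zero_iff]
    intro l hl
    have : l ∈ U '' (K : Set 𝓗) := h ▸ hl
    obtain ⟨k, hk, rfl⟩ := this
    rw [U.inner_map_map]
    refine (realProj_eq_zero_iff K).1 ?_ k hk
    rw [map_sub, realProj_idem, sub_self]
  have h3 : U x = U (realProj K x) + U (x - realProj K x) := by rw [← map_add]; congr 1; abel
  rw [h3, map_add, h1, h2, add_zero]

theorem imagProj_of_image {L : ClosedSubmodule ℝ 𝓗} (U : 𝓗 ≃ₗᵢ[ℂ] 𝓗)
    (h : U '' (K : Set 𝓗) = L) (x : 𝓗) : imagProj L (U x) = U (imagProj K x) := by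
  rw [imagProj_apply, imagProj_apply, ← U.map_smul, realProj_of_image U h, map_neg, U.map_smul]

theorem sumProj_of_image {L : ClosedSubmodule ℝ 𝓗} (U : 𝓗 ≃ₗᵢ[ℂ] 𝓗)
    (h : U '' (K : Set 𝓗) = L) (x : 𝓗) : sumProj L (U x) = U (sumProj K x) := by
  rw [sumProj_apply, sumProj_apply, realProj_of_image U h, imagProj_of_image U h, map_add]

/-- A cyclic real subspace `L` of a separating subspace `K` coincides with `K` if their operators
`R` commute. -/
theorem eq_of_commute {L : ClosedSubmodule ℝ 𝓗} (hL : Cyclic L) (hK : Separating K) (hLK : L ≤ K)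
    (hcomm : ∀ x, sumProj L (sumProj K x) = sumProj K (sumProj L x)) : L = K := by
  -- `(2 - R_K) R_L = D_K D_L`, since `S_L ⊆ S_K`
  have h1 : ∀ w, (2 : ℂ) • sumProj L w - sumProj K (sumProj L w) = diffProj K (diffProj L w) := by
    intro w
    have e1 : realProj K (realProj L w) = realProj L w :=
      (realProj_eq_self_iff K).2 (hLK (realProj_mem L w))
    have e2 : imagProj K (imagProj L w) = imagProj L w := by
      rw [imagProj_apply L w, map_neg, imagProj_I, (realProj_eq_self_iff K).2
        (hLK (realProj_mem L _))]
    simp only [sumProj_apply, diffProj_apply, map_add, map_sub, e1, e2, two_smul]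
    abel
  -- D_L D_K is the adjoint of D_K D_L for the real inner product, and (2 - R_K)R_L is self-adjoint
  -- because its factors commute.
  have h2 : ∀ w, diffProj L (diffProj K w) = diffProj K (diffProj L w) := by
    intro w
    refine ext_inner_left ℂ fun v => ?_
    have hre : ∀ v w : 𝓗, (⟪v, diffProj L (diffProj K w)⟫_ℂ).re =
        (⟪v, diffProj K (diffProj L w)⟫_ℂ).re := by
      intro v w
      rw [← re_inner_diffProj, ← re_inner_diffProj, ← h1, ← h1, ← hcomm, inner_sub_left,
        inner_sub_right, Complex.sub_re, Complex.sub_re, re_inner_sumProj, re_inner_sumProj,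
        inner_smul_left, inner_smul_right]
      have := re_inner_sumProj L v w
      simp only [map_ofNat, Complex.mul_re, Complex.re_ofNat, Complex.im_ofNat, zero_mul, sub_zero,
        this]
    refine Complex.ext (hre v w) ?_
    rw [im_inner_eq, im_inner_eq, hre]
  -- Since the D's commute, (D_K D_L)² = D_K² D_L², i.e. ((2 - R_K)R_L)² = R_K(2 - R_K)R_L(2 - R_L).
  -- The injective factor (2 - R_K)R_L cancels, which leaves 2R_L = 2R_K.
  have h3 : ∀ w, sumProj L w = sumProj K w := by
    intro w
    have hsq : diffProj K (diffProj L (diffProj K (diffProj L w))) =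
        diffProj K (diffProj K (diffProj L (diffProj L w))) := by rw [h2 (diffProj L w)]
    rw [← h1, ← h1, diffProj_diffProj K, diffProj_diffProj L] at hsq
    have hkey : (2 : ℂ) • sumProj L ((2 : ℂ) • (sumProj L w - sumProj K w)) -
        sumProj K (sumProj L ((2 : ℂ) • (sumProj L w - sumProj K w))) = 0 := by
      simp only [map_sub, map_smul, smul_sub, hcomm] at hsq ⊢
      rw [← sub_eq_zero] at hsq
      rw [← hsq]
      module
    have := hL.sumProj_injective (hK.two_sub_sumProj_injective hkey)
    have := (smul_eq_zero_iff_right two_ne_zero).1 this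
    exact sub_eq_zero.1 this
  refine le_antisymm hLK fun x hx => ?_
  have h4 : (2 : ℂ) • realProj L x = (2 : ℂ) • realProj K x := by
    have hPL : ∀ w, realProj L (realProj K w) = realProj L w := by
      intro w
      rw [← sub_eq_zero, ← map_sub, realProj_eq_zero_iff]
      intro k hk
      have : realProj K (realProj K w - w) = 0 := by rw [map_sub, realProj_idem, sub_self]
      exact (realProj_eq_zero_iff K).1 this k (hLK hk)
    -- As L ⊆ K, the differences of the projections onto K and L, and onto iK and iL, are again
    -- projections, hence nonnegative. Their sum R_K - R_L vanishes, so each of them does.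
    have hn : ∀ w, ‖realProj K w - realProj L w‖ ^ 2 + ‖imagProj K w - imagProj L w‖ ^ 2 = 0 := by
      intro w
      have e1 : ∀ w, ‖realProj K w - realProj L w‖ ^ 2 =
          (⟪w, realProj K w - realProj L w⟫_ℂ).re := by
        intro w
        rw [← inner_self_eq_norm_sq (𝕜 := ℂ)]
        have hKL : realProj K (realProj L w) = realProj L w :=
          (realProj_eq_self_iff K).2 (hLK (realProj_mem L w))
        change (⟪realProj K w - realProj L w, realProj K w - realProj L w⟫_ℂ).re = _
        rw [inner_sub_left, Complex.sub_re, re_inner_realProj, re_inner_realProj, map_sub, map_sub,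
          realProj_idem, realProj_idem, hKL, hPL, sub_self]
        simp
      have e2 : ∀ w, ‖imagProj K w - imagProj L w‖ ^ 2 =
          (⟪w, imagProj K w - imagProj L w⟫_ℂ).re := by
        intro w
        have := e1 (I • w)
        rw [realProj_I, realProj_I, ← smul_sub, norm_smul, Complex.norm_I, one_mul] at this
        rw [this, re_inner_I, I_smul_I_smul, inner_neg_right, Complex.neg_re, neg_neg]
      rw [e1, e2, ← Complex.add_re, ← inner_add_right]
      have : realProj K w - realProj L w + (imagProj K w - imagProj L w) =
          sumProj K w - sumProj L w := by rw [sumProj_apply, sumProj_apply]; abel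
      rw [this, h3, sub_self]
      simp
    have := hn x
    have h5 : ‖realProj K x - realProj L x‖ ^ 2 = 0 := by
      have := sq_nonneg ‖realProj K x - realProj L x‖
      have := sq_nonneg ‖imagProj K x - imagProj L x‖
      linarith
    have h6 := sub_eq_zero.1 (norm_eq_zero.1 (pow_eq_zero_iff two_ne_zero |>.1 h5))
    rw [h6]
  have h7 := smul_right_injective 𝓗 (two_ne_zero (α := ℂ)) h4
  rw [(realProj_eq_self_iff K).2 hx] at h7
  exact (realProj_eq_self_iff L).1 h7

end realSubspace

/-! ### Multiplication operators -/

section mulOp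

variable {X : Type*} [MeasurableSpace X] {ν : Measure X}

/-- Bounded measurable functions. -/
structure BddMeas (f : X → ℂ) : Prop where
  measurable : Measurable f
  bdd : ∃ C : ℝ, ∀ x, ‖f x‖ ≤ C

theorem BddMeas.of_le {f : X → ℂ} (hf : Measurable f) (C : ℝ) (h : ∀ x, ‖f x‖ ≤ C) : BddMeas f :=
  ⟨hf, C, h⟩

theorem BddMeas.const (c : ℂ) : BddMeas fun _ : X => c := ⟨measurable_const, ‖c‖, fun _ => le_rfl⟩

theorem BddMeas.add {f g : X → ℂ} (hf : BddMeas f) (hg : BddMeas g) :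
    BddMeas fun x => f x + g x := by
  obtain ⟨C, hC⟩ := hf.bdd
  obtain ⟨D, hD⟩ := hg.bdd
  exact ⟨hf.measurable.add hg.measurable, C + D, fun x =>
    (norm_add_le _ _).trans (add_le_add (hC x) (hD x))⟩

theorem BddMeas.mul {f g : X → ℂ} (hf : BddMeas f) (hg : BddMeas g) :
    BddMeas fun x => f x * g x := by
  obtain ⟨C, hC⟩ := hf.bdd
  obtain ⟨D, hD⟩ := hg.bdd
  refine ⟨hf.measurable.mul hg.measurable, C * D, fun x => ?_⟩
  rw [norm_mul]
  exact mul_le_mul (hC x) (hD x) (norm_nonneg _) ((norm_nonneg _).trans (hC x))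

theorem BddMeas.const_mul {f : X → ℂ} (c : ℂ) (hf : BddMeas f) : BddMeas fun x => c * f x :=
  (BddMeas.const c).mul hf

theorem BddMeas.sub {f g : X → ℂ} (hf : BddMeas f) (hg : BddMeas g) :
    BddMeas fun x => f x - g x := by
  simpa [sub_eq_add_neg] using hf.add (hg.const_mul (-1))

theorem BddMeas.conj {f : X → ℂ} (hf : BddMeas f) : BddMeas fun x => (starRingEnd ℂ) (f x) := by
  obtain ⟨C, hC⟩ := hf.bdd
  exact ⟨Complex.continuous_conj.measurable.comp hf.measurable, C, fun x => by
    rw [RCLike.norm_conj]; exact hC x⟩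

theorem BddMeas.memLp_mul {f : X → ℂ} (hf : BddMeas f) (g : Lp ℂ 2 ν) :
    MemLp (fun k => f k * g k) 2 ν := by
  obtain ⟨C, hC⟩ := hf.bdd
  refine (Lp.memLp g).of_le_mul (c := C)
    (hf.measurable.aestronglyMeasurable.mul (Lp.memLp g).1) (ae_of_all _ fun k => ?_)
  rw [norm_mul]
  exact mul_le_mul_of_nonneg_right (hC k) (norm_nonneg _)

open Classical in
/-- Multiplication by a bounded measurable function on `L²`. -/
def mulOp (ν : Measure X) (f : X → ℂ) : Lp ℂ 2 ν →L[ℂ] Lp ℂ 2 ν :=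
  if hf : BddMeas f then
    LinearMap.mkContinuous
      { toFun := fun g => (hf.memLp_mul g).toLp
        map_add' := fun g h => by
          rw [← MemLp.toLp_add]
          refine MemLp.toLp_congr _ _ ?_
          filter_upwards [Lp.coeFn_add g h] with k hk
          rw [hk, Pi.add_apply, Pi.add_apply, mul_add]
        map_smul' := fun c g => by
          rw [RingHom.id_apply, ← MemLp.toLp_const_smul]
          refine MemLp.toLp_congr _ _ ?_
          filter_upwards [Lp.coeFn_smul c g] with k hk
          rw [hk, Pi.smul_apply, Pi.smul_apply, smul_eq_mul, smul_eq_mul]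
          ring } hf.bdd.choose fun g => by
      refine Lp.norm_le_mul_norm_of_ae_le_mul ?_
      filter_upwards [MemLp.coeFn_toLp (hf.memLp_mul g)] with k hk
      change ‖((hf.memLp_mul g).toLp : Lp ℂ 2 ν) k‖ ≤ _
      rw [hk, norm_mul]
      exact mul_le_mul_of_nonneg_right (hf.bdd.choose_spec k) (norm_nonneg _)
  else 0

theorem mulOp_ae {f : X → ℂ} (hf : BddMeas f) (g : Lp ℂ 2 ν) :
    mulOp ν f g =ᵐ[ν] fun k => f k * g k := by
  rw [mulOp, dif_pos hf]
  exact MemLp.coeFn_toLp (hf.memLp_mul g)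

theorem mulOp_apply_eq {f : X → ℂ} (hf : BddMeas f) {g h : Lp ℂ 2 ν}
    (hh : h =ᵐ[ν] fun k => f k * g k) : mulOp ν f g = h :=
  Lp.ext ((mulOp_ae hf g).trans hh.symm)

theorem norm_mulOp_le {f : X → ℂ} {C : ℝ} (hC : 0 ≤ C) (h : ∀ k, ‖f k‖ ≤ C) :
    ‖mulOp ν f‖ ≤ C := by
  by_cases hf : BddMeas f
  · refine ContinuousLinearMap.opNorm_le_bound _ hC fun g => ?_
    refine Lp.norm_le_mul_norm_of_ae_le_mul ?_
    filter_upwards [mulOp_ae hf g] with k hk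
    rw [hk, norm_mul]
    exact mul_le_mul_of_nonneg_right (h k) (norm_nonneg _)
  · rw [mulOp, dif_neg hf, norm_zero]
    exact hC

theorem mulOp_mul {f g : X → ℂ} (hf : BddMeas f) (hg : BddMeas g) (x : Lp ℂ 2 ν) :
    mulOp ν (fun k => f k * g k) x = mulOp ν f (mulOp ν g x) := by
  refine mulOp_apply_eq (hf.mul hg) ?_
  filter_upwards [mulOp_ae hf (mulOp ν g x), mulOp_ae hg x] with k h1 h2
  rw [h1, h2, mul_assoc]

theorem mulOp_add {f g : X → ℂ} (hf : BddMeas f) (hg : BddMeas g) :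
    mulOp ν (fun k => f k + g k) = mulOp ν f + mulOp ν g := by
  ext1 x
  refine mulOp_apply_eq (hf.add hg) ?_
  change (mulOp ν f x + mulOp ν g x : Lp ℂ 2 ν) =ᵐ[ν] _
  filter_upwards [Lp.coeFn_add (mulOp ν f x) (mulOp ν g x), mulOp_ae hf x, mulOp_ae hg x]
    with k h0 h1 h2
  rw [h0, Pi.add_apply, h1, h2, add_mul]

theorem mulOp_const_mul {f : X → ℂ} (c : ℂ) (hf : BddMeas f) :
    mulOp ν (fun k => c * f k) = c • mulOp ν f := by
  ext1 x
  refine mulOp_apply_eq (hf.const_mul c) ?_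
  change (c • mulOp ν f x : Lp ℂ 2 ν) =ᵐ[ν] _
  filter_upwards [Lp.coeFn_smul c (mulOp ν f x), mulOp_ae hf x] with k h0 h1
  rw [h0, Pi.smul_apply, h1, smul_eq_mul, mul_assoc]

theorem mulOp_one : mulOp ν (fun _ => 1) = ContinuousLinearMap.id ℂ _ := by
  ext1 x
  exact mulOp_apply_eq (BddMeas.const 1) (ae_of_all _ fun k => by simp)

theorem inner_mulOp {f : X → ℂ} (hf : BddMeas f) (x y : Lp ℂ 2 ν) :
    ⟪mulOp ν f x, y⟫_ℂ = ⟪x, mulOp ν (fun k => (starRingEnd ℂ) (f k)) y⟫_ℂ := by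
  rw [L2.inner_def, L2.inner_def]
  refine integral_congr_ae ?_
  filter_upwards [mulOp_ae hf x, mulOp_ae hf.conj y] with k h1 h2
  rw [h1, h2]
  simp only [RCLike.inner_apply, map_mul]
  ring

theorem norm_sq_eq_integral (f : Lp ℂ 2 ν) : ‖f‖ ^ 2 = ∫ k, ‖f k‖ ^ 2 ∂ν := by
  rw [← inner_self_eq_norm_sq (𝕜 := ℂ), L2.inner_def]
  have : ∫ k, ⟪f k, f k⟫_ℂ ∂ν = ∫ k, ((‖f k‖ ^ 2 : ℝ) : ℂ) ∂ν := by
    refine integral_congr_ae (ae_of_all _ fun k => ?_)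
    simp only [inner_self_eq_norm_sq_to_K]
    push_cast
    rfl
  rw [this, integral_complex_ofReal]
  rfl

/-- Dominated convergence in `L²`. -/
theorem tendsto_of_dominated {G : ℕ → Lp ℂ 2 ν} {G₀ : Lp ℂ 2 ν} {b : X → ℝ} (hb : MemLp b 2 ν)
    (h1 : ∀ n, ∀ᵐ k ∂ν, ‖G n k‖ ≤ b k) (h2 : ∀ᵐ k ∂ν, Tendsto (fun n => G n k) atTop (nhds (G₀ k))) :
    Tendsto G atTop (nhds G₀) := by
  rw [tendsto_iff_norm_sub_tendsto_zero]
  have hsq : Tendsto (fun n => ‖G n - G₀‖ ^ 2) atTop (nhds 0) := by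
    simp only [norm_sq_eq_integral]
    have hz : (∫ _ : X, (0 : ℝ) ∂ν) = 0 := integral_zero _ _
    rw [← hz]
    refine tendsto_integral_of_dominated_convergence (fun k => (2 * b k) ^ 2) ?_ ?_ ?_ ?_
    · intro n
      exact ((Lp.stronglyMeasurable (G n - G₀)).norm.pow 2).aestronglyMeasurable
    · exact (hb.const_mul 2).integrable_sq
    · intro n
      have h3 : ∀ᵐ k ∂ν, ∀ n, ‖G n k‖ ≤ b k := ae_all_iff.2 h1
      filter_upwards [h3, h2, Lp.coeFn_sub (G n) G₀] with k hk hk2 hk3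
      rw [hk3, Pi.sub_apply, Real.norm_of_nonneg (by positivity)]
      have h4 : ‖G₀ k‖ ≤ b k := le_of_tendsto hk2.norm (Eventually.of_forall hk)
      have h5 : ‖G n k - G₀ k‖ ≤ 2 * b k := (norm_sub_le _ _).trans (by linarith [hk n])
      exact pow_le_pow_left₀ (norm_nonneg _) h5 2
    · have h3 : ∀ᵐ k ∂ν, ∀ n, (G n - G₀ : Lp ℂ 2 ν) k = G n k - G₀ k :=
        ae_all_iff.2 fun n => Lp.coeFn_sub (G n) G₀
      filter_upwards [h2, h3] with k hk hk3
      simp only [hk3]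
      have : Tendsto (fun n => G n k - G₀ k) atTop (nhds 0) := by
        simpa using hk.sub_const (G₀ k)
      simpa using this.norm.pow 2
  have := hsq.sqrt
  simpa [Real.sqrt_sq (norm_nonneg _)] using this

theorem tendsto_mulOp {f : ℕ → X → ℂ} {f₀ : X → ℂ} {C : ℝ} (hf : ∀ n, Measurable (f n))
    (hf₀ : Measurable f₀) (hC : ∀ n k, ‖f n k‖ ≤ C)
    (hlim : ∀ k, Tendsto (fun n => f n k) atTop (nhds (f₀ k))) (g : Lp ℂ 2 ν) :
    Tendsto (fun n => mulOp ν (f n) g) atTop (nhds (mulOp ν f₀ g)) := by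
  have hC₀ : ∀ k, ‖f₀ k‖ ≤ C := fun k =>
    le_of_tendsto (hlim k).norm (Eventually.of_forall fun n => hC n k)
  refine tendsto_of_dominated ((Lp.memLp g).norm.const_mul C) (fun n => ?_) ?_
  · filter_upwards [mulOp_ae (BddMeas.of_le (hf n) C (hC n)) g] with k hk
    rw [hk, norm_mul]
    exact mul_le_mul_of_nonneg_right (hC n k) (norm_nonneg _)
  · have h3 : ∀ᵐ k ∂ν, ∀ n, mulOp ν (f n) g k = f n k * g k :=
      ae_all_iff.2 fun n => mulOp_ae (BddMeas.of_le (hf n) C (hC n)) g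
    filter_upwards [h3, mulOp_ae (BddMeas.of_le hf₀ C hC₀) g] with k h3 h4
    simp only [h3, h4]
    exact (hlim k).mul_const _

end mulOp

/-! ### Functional calculus carried over from multiplication operators -/

section calculus

variable {𝓗 : Type*} [NormedAddCommGroup 𝓗] [InnerProductSpace ℂ 𝓗]
  {X : Type*} [MeasurableSpace X] {ν : Measure X} (V : 𝓗 ≃ₗᵢ[ℂ] Lp ℂ 2 ν)

/-- The operator carried to multiplication by `φ` by the unitary `V`. -/
def mulBy (φ : X → ℂ) : 𝓗 →L[ℂ] 𝓗 :=
  (V.symm.toContinuousLinearEquiv : Lp ℂ 2 ν →L[ℂ] 𝓗).comp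
    ((mulOp ν φ).comp (V.toContinuousLinearEquiv : 𝓗 →L[ℂ] Lp ℂ 2 ν))

theorem apply_mulBy (φ : X → ℂ) (x : 𝓗) : V (mulBy V φ x) = mulOp ν φ (V x) :=
  V.apply_symm_apply _

theorem mulBy_eq_iff {φ : X → ℂ} (hφ : BddMeas φ) {x y : 𝓗} :
    mulBy V φ x = y ↔ V y =ᵐ[ν] fun k => φ k * V x k := by
  rw [← V.injective.eq_iff, apply_mulBy]
  constructor
  · intro h
    rw [← h]
    exact mulOp_ae hφ _
  · exact fun h => mulOp_apply_eq hφ h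

theorem norm_mulBy_le {φ : X → ℂ} {C : ℝ} (hC : 0 ≤ C) (h : ∀ k, ‖φ k‖ ≤ C) :
    ‖mulBy V φ‖ ≤ C := by
  refine ContinuousLinearMap.opNorm_le_bound _ hC fun x => ?_
  rw [← V.norm_map, apply_mulBy, ← V.norm_map x]
  exact ContinuousLinearMap.le_of_opNorm_le _ (norm_mulOp_le hC h) _

variable {φ ψ : X → ℂ}

theorem mulBy_mul (hφ : BddMeas φ) (hψ : BddMeas ψ) (x : 𝓗) :
    mulBy V (fun k => φ k * ψ k) x = mulBy V φ (mulBy V ψ x) := by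
  rw [← V.injective.eq_iff, apply_mulBy, apply_mulBy, apply_mulBy, mulOp_mul hφ hψ]

theorem mulBy_comm (hφ : BddMeas φ) (hψ : BddMeas ψ) (x : 𝓗) :
    mulBy V φ (mulBy V ψ x) = mulBy V ψ (mulBy V φ x) := by
  rw [← mulBy_mul V hφ hψ, ← mulBy_mul V hψ hφ]
  simp only [mul_comm]

theorem mulBy_add (hφ : BddMeas φ) (hψ : BddMeas ψ) :
    mulBy V (fun k => φ k + ψ k) = mulBy V φ + mulBy V ψ := by
  ext1 x
  rw [← V.injective.eq_iff, apply_mulBy, mulOp_add hφ hψ]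
  change _ = V (mulBy V φ x + mulBy V ψ x)
  rw [map_add, apply_mulBy, apply_mulBy]
  rfl

theorem mulBy_const_mul (c : ℂ) (hφ : BddMeas φ) :
    mulBy V (fun k => c * φ k) = c • mulBy V φ := by
  ext1 x
  rw [← V.injective.eq_iff, apply_mulBy, mulOp_const_mul c hφ]
  change _ = V (c • mulBy V φ x)
  rw [map_smul, apply_mulBy]
  rfl

theorem mulBy_sub (hφ : BddMeas φ) (hψ : BddMeas ψ) :
    mulBy V (fun k => φ k - ψ k) = mulBy V φ - mulBy V ψ := by
  have h := mulBy_add V hφ (hψ.const_mul (-1))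
  rw [mulBy_const_mul V (-1) hψ, neg_one_smul, ← sub_eq_add_neg] at h
  rw [← h]
  congr 1
  funext k
  ring

theorem mulBy_one (x : 𝓗) : mulBy V (fun _ => 1) x = x := by
  rw [← V.injective.eq_iff, apply_mulBy, mulOp_one]
  rfl

theorem inner_mulBy (hφ : BddMeas φ) (x y : 𝓗) :
    ⟪mulBy V φ x, y⟫_ℂ = ⟪x, mulBy V (fun k => (starRingEnd ℂ) (φ k)) y⟫_ℂ := by
  rw [← V.inner_map_map, apply_mulBy, inner_mulOp hφ, ← apply_mulBy, V.inner_map_map]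

theorem tendsto_mulBy {f : ℕ → X → ℂ} {f₀ : X → ℂ} {C : ℝ} (hf : ∀ n, Measurable (f n))
    (hf₀ : Measurable f₀) (hC : ∀ n k, ‖f n k‖ ≤ C)
    (hlim : ∀ k, Tendsto (fun n => f n k) atTop (nhds (f₀ k))) (x : 𝓗) :
    Tendsto (fun n => mulBy V (f n) x) atTop (nhds (mulBy V f₀ x)) :=
  (V.symm.continuous.tendsto _).comp (tendsto_mulOp hf hf₀ hC hlim (V x))

theorem bddMeas_ofReal {u : X → ℝ} (hu : Measurable u) {M : ℝ} (hM : ∀ k, |u k| ≤ M) :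
    BddMeas fun k => (u k : ℂ) :=
  BddMeas.of_le (Complex.measurable_ofReal.comp hu) M fun k => by simpa using hM k

theorem bddMeas_comp_ofReal {u : X → ℝ} (hu : Measurable u) {M : ℝ} (hM : ∀ k, |u k| ≤ M)
    {g : ℝ → ℝ} (hg : Continuous g) : BddMeas fun k => (g (u k) : ℂ) := by
  obtain ⟨C, hC⟩ := (isCompact_Icc (a := -M) (b := M)).exists_bound_of_continuousOn hg.continuousOn
  exact bddMeas_ofReal (hg.measurable.comp hu) (M := C) fun k => hC _ (abs_le.1 (hM k))

/-- An intertwiner of two multiplication operators intertwines all continuous functions of them. -/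
theorem intertwine_comp (T : 𝓗 →L[ℝ] 𝓗) {u v : X → ℝ} (hu : Measurable u) (hv : Measurable v)
    {M : ℝ} (huM : ∀ k, |u k| ≤ M) (hvM : ∀ k, |v k| ≤ M)
    (h : ∀ x, T (mulBy V (fun k => (u k : ℂ)) x) = mulBy V (fun k => (v k : ℂ)) (T x))
    {g : ℝ → ℝ} (hg : Continuous g) (x : 𝓗) :
    T (mulBy V (fun k => (g (u k) : ℂ)) x) = mulBy V (fun k => (g (v k) : ℂ)) (T x) := by
  -- Only real coefficients are allowed, because T is merely real linear; the result is meant to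
  -- apply to the antilinear D. Weierstrass approximation on [-M, M] then reaches every continuous
  -- g.
  have hpoly : ∀ (p : Polynomial ℝ) (x : 𝓗), T (mulBy V (fun k => ((p.eval (u k) : ℝ) : ℂ)) x) =
      mulBy V (fun k => ((p.eval (v k) : ℝ) : ℂ)) (T x) := by
    intro p
    induction p using Polynomial.induction_on' with
    | add p q hp hq =>
      intro x
      simp only [Polynomial.eval_add, Complex.ofReal_add]
      rw [mulBy_add V (bddMeas_comp_ofReal hu huM p.continuous)
        (bddMeas_comp_ofReal hu huM q.continuous), mulBy_add V
        (bddMeas_comp_ofReal hv hvM p.continuous) (bddMeas_comp_ofReal hv hvM q.continuous)]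
      simp only [add_apply, map_add, hp, hq]
    | monomial n c =>
      have hpow : ∀ (n : ℕ) (x : 𝓗), T (mulBy V (fun k => ((u k ^ n : ℝ) : ℂ)) x) =
          mulBy V (fun k => ((v k ^ n : ℝ) : ℂ)) (T x) := by
        intro n
        induction n with
        | zero =>
          intro x
          simp only [pow_zero, Complex.ofReal_one]
          rw [mulBy_one, mulBy_one]
        | succ n ih =>
          intro x
          simp only [pow_succ, Complex.ofReal_mul]
          rw [mulBy_mul V (bddMeas_comp_ofReal hu huM (continuous_pow n)) (bddMeas_ofReal hu huM),
            mulBy_mul V (bddMeas_comp_ofReal hv hvM (continuous_pow n)) (bddMeas_ofReal hv hvM),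
            ih, h]
      intro x
      simp only [Polynomial.eval_monomial, Complex.ofReal_mul]
      rw [mulBy_const_mul V _ (bddMeas_comp_ofReal hu huM (continuous_pow n)),
        mulBy_const_mul V _ (bddMeas_comp_ofReal hv hvM (continuous_pow n))]
      simp only [FunLike.coe_smul, Pi.smul_apply, Complex.coe_smul, map_smul, hpow]
  rw [← sub_eq_zero, ← norm_eq_zero]
  refine le_antisymm (le_of_forall_pos_le_add fun ε hε => ?_) (norm_nonneg _)
  rw [zero_add]
  set δ := ε / (‖T‖ * ‖x‖ + ‖T x‖ + 1) with hδ
  have hden : 0 < ‖T‖ * ‖x‖ + ‖T x‖ + 1 := by positivity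
  have hδ0 : 0 < δ := div_pos hε hden
  obtain ⟨p, hp⟩ := exists_polynomial_near_of_continuousOn (-M) M g hg.continuousOn δ hδ0
  have happ : ∀ (w : X → ℝ) (_ : Measurable w) (_ : ∀ k, |w k| ≤ M) (y : 𝓗),
      ‖mulBy V (fun k => (g (w k) : ℂ)) y - mulBy V (fun k => ((p.eval (w k) : ℝ) : ℂ)) y‖ ≤ δ * ‖y‖ := by
    intro w hw hwM y
    have := mulBy_sub V (bddMeas_comp_ofReal hw hwM hg) (bddMeas_comp_ofReal hw hwM p.continuous)
    have h2 : mulBy V (fun k => (g (w k) : ℂ)) y - mulBy V (fun k => ((p.eval (w k) : ℝ) : ℂ)) y =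
        mulBy V (fun k => (g (w k) : ℂ) - ((p.eval (w k) : ℝ) : ℂ)) y := by rw [this]; rfl
    rw [h2]
    refine ContinuousLinearMap.le_of_opNorm_le _ (norm_mulBy_le V hδ0.le fun k => ?_) _
    rw [← Complex.ofReal_sub, Complex.norm_real, norm_sub_rev]
    exact (hp _ (abs_le.1 (hwM k))).le
  have h1 := happ u hu huM x
  have h2 := happ v hv hvM (T x)
  calc ‖T (mulBy V (fun k => (g (u k) : ℂ)) x) - mulBy V (fun k => (g (v k) : ℂ)) (T x)‖
      = ‖T (mulBy V (fun k => (g (u k) : ℂ)) x - mulBy V (fun k => ((p.eval (u k) : ℝ) : ℂ)) x) -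
        (mulBy V (fun k => (g (v k) : ℂ)) (T x) - mulBy V (fun k => ((p.eval (v k) : ℝ) : ℂ)) (T x))‖ := by
        rw [map_sub, hpoly]; congr 1; abel
    _ ≤ ‖T‖ * (δ * ‖x‖) + δ * ‖T x‖ := by
        refine (norm_sub_le _ _).trans (add_le_add ?_ h2)
        exact (T.le_opNorm _).trans (mul_le_mul_of_nonneg_left h1 (norm_nonneg _))
    _ = δ * (‖T‖ * ‖x‖ + ‖T x‖) := by ring
    _ ≤ δ * (‖T‖ * ‖x‖ + ‖T x‖ + 1) := mul_le_mul_of_nonneg_left (by linarith) hδ0.le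
    _ = ε := by rw [hδ, div_mul_cancel₀ _ hden.ne']

end calculus

/-! ### Two facts from complex analysis -/

theorem hasDerivAt_of_quadratic {E : Type*} [NormedAddCommGroup E] [NormedSpace ℂ E] {f : ℂ → E}
    {f' : E} {z : ℂ} (C δ : ℝ) (hδ : 0 < δ)
    (h : ∀ w, ‖w‖ < δ → ‖f (z + w) - f z - w • f'‖ ≤ C * ‖w‖ ^ 2) : HasDerivAt f f' z := by
  rw [hasDerivAt_iff_isLittleO_nhds_zero]
  have h1 : (fun w : ℂ => f (z + w) - f z - w • f') =O[nhds 0] fun w : ℂ => ‖w‖ ^ 2 := by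
    refine Asymptotics.IsBigO.of_bound C ?_
    filter_upwards [Metric.ball_mem_nhds (0 : ℂ) hδ] with w hw
    rw [norm_pow, norm_norm]
    exact h w (by simpa using hw)
  refine h1.trans_isLittleO ?_
  have h2 : (fun w : ℂ => ‖w‖ ^ 2) =o[nhds 0] fun w : ℂ => ‖w‖ ^ 1 :=
    Asymptotics.IsLittleO.comp_tendsto (Asymptotics.isLittleO_pow_pow (𝕜 := ℝ) one_lt_two)
      (tendsto_norm_zero (E := ℂ))
  simp only [pow_one] at h2
  exact h2.of_norm_right

/-- A bounded holomorphic function on a strip with real boundary values is constant. -/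
theorem strip_constant {f : ℂ → ℂ} (hf : DiffContOnCl ℂ f (Complex.im ⁻¹' Set.Ioo 0 (1 / 2)))
    {C : ℝ} (hC : ∀ z : ℂ, 0 ≤ z.im → z.im ≤ 1 / 2 → ‖f z‖ ≤ C)
    (h0 : ∀ z : ℂ, z.im = 0 → (f z).im = 0) (h1 : ∀ z : ℂ, z.im = 1 / 2 → (f z).im = 0)
    (t : ℝ) : f t = f 0 := by
  set S : Set ℂ := Complex.im ⁻¹' Set.Ioo 0 (1 / 2) with hS
  -- For imaginary c the function exp(cf) has modulus 1 wherever f is real, in particular on both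
  -- edges. Phragmén–Lindelöf extends the bound inside, and c = ±i forces Im f = 0 there.
  have key : ∀ c : ℂ, c.re = 0 → ∀ z : ℂ, 0 ≤ z.im → z.im ≤ 1 / 2 → ‖Complex.exp (c * f z)‖ ≤ 1 := by
    intro c hc z hz0 hz1
    have hre : ∀ z : ℂ, (f z).im = 0 → ‖Complex.exp (c * f z)‖ ≤ 1 := by
      intro z hz
      rw [Complex.norm_exp, Complex.mul_re, hc, hz]
      simp
    refine PhragmenLindelof.horizontal_strip (a := 0) (b := 1 / 2)
      (f := fun z => Complex.exp (c * f z)) ?_ ?_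
      (fun z hz => hre z (h0 z hz)) (fun z hz => hre z (h1 z hz)) hz0 hz1
    · exact (Complex.differentiable_exp.diffContOnCl (s := Set.univ)).comp
        (hf.const_smul c) (Set.mapsTo_univ _ _)
    · refine ⟨0, by positivity, 0, ?_⟩
      refine Asymptotics.IsBigO.of_bound (Real.exp (‖c‖ * C)) ?_
      refine Filter.eventually_inf_principal.2 (Eventually.of_forall fun z hz => ?_)
      rw [zero_mul, Real.exp_zero, norm_one, mul_one, Complex.norm_exp]
      refine Real.exp_le_exp.2 ((Complex.re_le_norm _).trans ?_)
      rw [norm_mul]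
      exact mul_le_mul_of_nonneg_left (hC z hz.1.le hz.2.le) (norm_nonneg _)
  have him : ∀ z ∈ S, (f z).im = 0 := by
    intro z hz
    have e1 := key Complex.I Complex.I_re z hz.1.le hz.2.le
    have e2 := key (-Complex.I) (by simp) z hz.1.le hz.2.le
    rw [Complex.norm_exp, Real.exp_le_one_iff] at e1 e2
    simp at e1 e2
    linarith
  have hopen : IsOpen S := isOpen_Ioo.preimage Complex.continuous_im
  have hconv : Convex ℝ S := by
    have := (convex_Ioo (0 : ℝ) (1 / 2)).linear_preimage Complex.imLm
    exact this
  have hconst : ∃ w, ∀ z ∈ S, f z = w := by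
    -- A real-valued holomorphic function cannot be open, so the open mapping theorem leaves only
    -- constants.
    rcases (hf.differentiableOn.analyticOnNhd hopen).is_constant_or_isOpen hconv.isPreconnected with
      h | h
    · exact h
    · exfalso
      have ho := h S subset_rfl hopen
      have hz : (Complex.I / 4 : ℂ) ∈ S := by
        constructor <;> norm_num
      have hm : f (Complex.I / 4) ∈ f '' S := ⟨_, hz, rfl⟩
      obtain ⟨ε, hε, hb⟩ := Metric.isOpen_iff.1 ho _ hm
      have hmem : f (Complex.I / 4) + (ε / 2 : ℝ) * Complex.I ∈ f '' S := by
        refine hb ?_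
        rw [Metric.mem_ball, dist_eq_norm, add_sub_cancel_left, norm_mul, Complex.norm_I, mul_one,
          Complex.norm_real, Real.norm_of_nonneg (by positivity)]
        linarith
      obtain ⟨z, hz2, hz3⟩ := hmem
      have := him z hz2
      rw [hz3] at this
      simp [him _ hz] at this
      linarith
  obtain ⟨w, hw⟩ := hconst
  have hcl : ∀ z ∈ closure S, f z = w := by
    intro z hz
    have hclosed : IsClosed {z | z ∈ closure S ∧ f z = w} :=
      hf.continuousOn.preimage_isClosed_of_isClosed isClosed_closure isClosed_singleton
    exact (hclosed.closure_subset_iff.2 (fun z hz => ⟨subset_closure hz, hw z hz⟩) hz).2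
  have hreal : ∀ t : ℝ, (t : ℂ) ∈ closure S := by
    intro t
    have : Tendsto (fun n : ℕ => (t : ℂ) + (1 / ((n : ℝ) + 1) : ℝ) * (Complex.I / 4)) atTop
        (nhds ((t : ℂ) + (0 : ℝ) * (Complex.I / 4))) :=
      tendsto_const_nhds.add
        (((Complex.continuous_ofReal.tendsto _).comp tendsto_one_div_add_atTop_nhds_zero_nat).mul_const _)
    rw [Complex.ofReal_zero, zero_mul, add_zero] at this
    refine mem_closure_of_tendsto this (Eventually.of_forall fun n => ?_)
    have hn : 0 < 1 / ((n : ℝ) + 1) := by positivity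
    have hn1 : 1 / ((n : ℝ) + 1) ≤ 1 := by
      rw [div_le_one (by positivity)]
      linarith [n.cast_nonneg (α := ℝ)]
    have him : ((t : ℂ) + (1 / ((n : ℝ) + 1) : ℝ) * (Complex.I / 4)).im = 1 / ((n : ℝ) + 1) / 4 := by
      rw [Complex.add_im, Complex.ofReal_im, zero_add, Complex.im_ofReal_mul]
      norm_num
      ring
    change _ ∈ Set.Ioo _ _
    rw [him]
    constructor
    · positivity
    · linarith
  rw [hcl _ (hreal t)]
  have := hcl _ (hreal 0)
  rw [Complex.ofReal_zero] at this
  exact this.symm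

/-! ### The modular group of a standard subspace -/

/-- The function `2 / (1 + eʸ)`. -/
def logistic (y : ℝ) : ℝ := 2 / (1 + Real.exp y)

theorem logistic_pos (y : ℝ) : 0 < logistic y := by unfold logistic; positivity

theorem logistic_neg (y : ℝ) : logistic (-y) = 2 - logistic y := by
  unfold logistic
  rw [Real.exp_neg]
  have := Real.exp_pos y
  field_simp
  ring

theorem logistic_lt_two (y : ℝ) : logistic y < 2 := by
  have := logistic_pos (-y)
  rw [logistic_neg] at this
  linarith

theorem abs_logistic_le (y : ℝ) : |logistic y| ≤ 2 := by
  rw [abs_of_pos (logistic_pos y)]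
  exact (logistic_lt_two y).le

theorem continuous_logistic : Continuous logistic := by
  unfold logistic
  exact continuous_const.div (by fun_prop) fun y => by positivity

theorem logistic_mul_exp (y : ℝ) : logistic y * Real.exp y = 2 - logistic y := by
  unfold logistic
  have := Real.exp_pos y
  field_simp
  ring

theorem log_logistic (y : ℝ) : Real.log ((2 - logistic y) / logistic y) = y := by
  rw [← logistic_mul_exp, mul_div_cancel_left₀ _ (logistic_pos y).ne', Real.log_exp]

theorem antitone_logistic : Antitone logistic := by
  intro x y h
  unfold logistic
  have := Real.exp_pos x
  have h2 := Real.exp_le_exp.2 h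
  gcongr

theorem logistic_log {r : ℝ} (h0 : 0 < r) (h2 : r < 2) :
    logistic (Real.log ((2 - r) / r)) = r := by
  unfold logistic
  rw [Real.exp_log (div_pos (by linarith) h0)]
  field_simp
  ring

/-- Truncation to the interval `[-n, n]`. -/
def clamp (n : ℕ) (y : ℝ) : ℝ := min n (max y (-n))

theorem continuous_clamp (n : ℕ) : Continuous (clamp n) := by unfold clamp; fun_prop

theorem clamp_of_abs_le {n : ℕ} {y : ℝ} (h : |y| ≤ n) : clamp n y = y := by
  rw [clamp, max_eq_left (abs_le.1 h).1, min_eq_right (abs_le.1 h).2]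

theorem abs_clamp_le (n : ℕ) (y : ℝ) : |clamp n y| ≤ n := by
  have hn : (0 : ℝ) ≤ n := n.cast_nonneg
  rw [abs_le]
  exact ⟨le_min (by linarith) (le_max_right _ _), min_le_left _ _⟩

theorem clamp_neg (n : ℕ) (y : ℝ) : clamp n (-y) = -clamp n y := by
  have hn : (0 : ℝ) ≤ n := n.cast_nonneg
  by_cases h : |y| ≤ n
  · rw [clamp_of_abs_le h, clamp_of_abs_le (by rwa [abs_neg])]
  · rcases lt_abs.1 (not_le.1 h) with h | h
    · rw [clamp, clamp, max_eq_right (by linarith), max_eq_left (by linarith),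
        min_eq_left h.le, min_eq_right (by linarith)]
    · rw [clamp, clamp, max_eq_left (by linarith), max_eq_right (by linarith),
        min_eq_left h.le, min_eq_right (by linarith), neg_neg]

theorem tendsto_clamp (y : ℝ) : Tendsto (fun n => clamp n y) atTop (nhds y) := by
  refine tendsto_const_nhds.congr' ?_
  obtain ⟨N, hN⟩ := exists_nat_ge |y|
  filter_upwards [eventually_ge_atTop N] with n hn
  exact (clamp_of_abs_le (hN.trans (by exact_mod_cast hn))).symm

/-- An even cutoff function supported in `[-n, n]`. -/
def cutoff (n : ℕ) (y : ℝ) : ℝ := max 0 (min 1 (n - |y|))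

theorem continuous_cutoff (n : ℕ) : Continuous (cutoff n) := by unfold cutoff; fun_prop

theorem abs_cutoff_le (n : ℕ) (y : ℝ) : |cutoff n y| ≤ 1 := by
  rw [abs_of_nonneg (le_max_left _ _)]
  exact max_le zero_le_one (min_le_left _ _)

theorem cutoff_eq_zero {n : ℕ} {y : ℝ} (h : ¬ |y| ≤ n) : cutoff n y = 0 :=
  max_eq_left ((min_le_right _ _).trans (by linarith [not_le.1 h]))

theorem tendsto_cutoff (y : ℝ) : Tendsto (fun n => cutoff n y) atTop (nhds 1) := by
  refine tendsto_const_nhds.congr' ?_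
  obtain ⟨N, hN⟩ := exists_nat_ge (|y| + 1)
  filter_upwards [eventually_ge_atTop N] with n hn
  have : (N : ℝ) ≤ n := by exact_mod_cast hn
  rw [cutoff, min_eq_left (by linarith), max_eq_right zero_le_one]

section modular

universe u

variable {𝓗 : Type u} [NormedAddCommGroup 𝓗] [InnerProductSpace ℂ 𝓗]
  {X : Type*} [MeasurableSpace X] {ν : Measure X}

/-- The logarithm `l` of the modular operator of `K` in the spectral representation `V`. -/
structure IsLogModel [CompleteSpace 𝓗] (K : ClosedSubmodule ℝ 𝓗) (V : 𝓗 ≃ₗᵢ[ℂ] Lp ℂ 2 ν)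
    (l : X → ℝ) : Prop where
  measurable : Measurable l
  sumProj_eq : ∀ x, sumProj K x = mulBy V (fun k => (logistic (l k) : ℂ)) x

/-- In a multiplication model of R with multiplier a, a vector supported on {a ≤ 0} has ⟪y, Ry⟫ ≤ 0
and vanishes by cyclicity of K; likewise one supported on {a ≥ 2}, by cyclicity of K'. So only 0 < a
< 2 matters, where a = 2/(1 + e^l) can be solved for l. The exceptional sets are not claimed to be
null: it is enough that each vector vanishes on them. -/
theorem exists_isLogModel [CompleteSpace 𝓗] {K : ClosedSubmodule ℝ 𝓗} (hc : Cyclic K)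
    (hs : Separating K) :
    ∃ (X : Type u) (_ : MeasurableSpace X) (ν : Measure X) (V : 𝓗 ≃ₗᵢ[ℂ] Lp ℂ 2 ν) (l : X → ℝ),
      IsLogModel K V l := by
  obtain ⟨X, _, ν, V, a, ha, hV⟩ := exists_multiplication_model (isSelfAdjoint_sumProj K)
  refine ⟨X, _, ν, V, fun k => Real.log ((2 - a k) / a k),
    (Real.measurable_log.comp ((measurable_const.sub ha).div ha)), fun x => Eq.symm ?_⟩
  have hm : Measurable fun k => Real.log ((2 - a k) / a k) :=
    Real.measurable_log.comp ((measurable_const.sub ha).div ha)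
  refine (mulBy_eq_iff V (bddMeas_ofReal (continuous_logistic.measurable.comp hm)
    fun _ => abs_logistic_le _)).2 ?_
  have hvanish : ∀ B : Set X, MeasurableSet B → (∀ y, (V y =ᵐ[ν] fun k => B.indicator 1 k * V y k) →
      y = 0) → ∀ᵐ k ∂ν, k ∈ B → V x k = 0 := by
    intro B hB h
    have hi : BddMeas (B.indicator (1 : X → ℂ)) := by
      refine BddMeas.of_le (measurable_one.indicator hB) 1 fun k => ?_
      by_cases hk : k ∈ B <;> simp [hk]
    have h1 := (mulBy_eq_iff V hi (x := x) (y := mulBy V (B.indicator 1) x)).1 rfl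
    have h2 : mulBy V (B.indicator 1) x = 0 := by
      refine h _ ?_
      filter_upwards [h1] with k hk
      rw [hk]
      by_cases hk : k ∈ B <;> simp [hk]
    rw [h2, map_zero] at h1
    filter_upwards [h1, Lp.coeFn_zero ℂ 2 ν] with k h3 h4 hk
    rw [h4] at h3
    simpa [hk] using h3.symm
  have hpair : ∀ y, (⟪y, sumProj K y⟫_ℂ).re = ∫ k, a k * ‖V y k‖ ^ 2 ∂ν := by
    intro y
    rw [← V.inner_map_map, L2.inner_def]
    have : ∫ k, ⟪V y k, V (sumProj K y) k⟫_ℂ ∂ν = ∫ k, ((a k * ‖V y k‖ ^ 2 : ℝ) : ℂ) ∂ν := by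
      refine integral_congr_ae ?_
      filter_upwards [hV y] with k hk
      rw [hk]
      have := Complex.normSq_eq_conj_mul_self (z := V y k)
      rw [Complex.normSq_eq_norm_sq] at this
      simp only [RCLike.inner_apply]
      push_cast at this ⊢
      rw [this]
      ring
    rw [this, integral_complex_ofReal, Complex.ofReal_re]
  have h0 := hvanish {k | a k ≤ 0} (measurableSet_le ha measurable_const) fun y hy => by
    refine hc.eq_zero_of_re_inner_nonpos ?_
    rw [hpair]
    refine integral_nonpos_of_ae ?_
    filter_upwards [hy] with k hk
    by_cases hk' : k ∈ {k | a k ≤ 0}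
    · exact mul_nonpos_of_nonpos_of_nonneg hk' (by positivity)
    · rw [Set.indicator_of_notMem hk', zero_mul] at hk
      simp [hk]
  have h2 := hvanish {k | 2 ≤ a k} (measurableSet_le measurable_const ha) fun y hy => by
    refine hs.symplComp_cyclic.eq_zero_of_re_inner_nonpos ?_
    rw [sumProj_symplComp, inner_sub_right, Complex.sub_re, hpair, inner_smul_right,
      inner_self_eq_norm_sq_to_K]
    have e1 : ((2 : ℂ) * ((‖y‖ : ℝ) : ℂ) ^ 2).re = ∫ k, 2 * ‖V y k‖ ^ 2 ∂ν := by
      rw [integral_const_mul, ← norm_sq_eq_integral, V.norm_map]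
      norm_cast
    have hint : Integrable (fun k => ‖V y k‖ ^ 2) ν := (Lp.memLp (V y)).norm.integrable_sq
    have hint2 : Integrable (fun k => a k * ‖V y k‖ ^ 2) ν := by
      have hi := L2.integrable_inner (𝕜 := ℂ) (V y) (V (sumProj K y))
      refine hi.re.congr ?_
      filter_upwards [hV y] with k hk
      rw [hk]
      have := Complex.normSq_eq_conj_mul_self (z := V y k)
      rw [Complex.normSq_eq_norm_sq] at this
      have h3 : ⟪V y k, (a k : ℂ) * V y k⟫_ℂ = ((a k * ‖V y k‖ ^ 2 : ℝ) : ℂ) := by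
        simp only [RCLike.inner_apply]
        push_cast at this ⊢
        rw [this]
        ring
      rw [h3]
      rfl
    refine le_of_eq_of_le (congrArg (· - _) e1) ?_
    rw [← integral_sub (hint.const_mul 2) hint2]
    refine integral_nonpos_of_ae ?_
    filter_upwards [hy] with k hk
    by_cases hk' : k ∈ {k | 2 ≤ a k}
    · have : (2 : ℝ) ≤ a k := hk'
      have h3 : 0 ≤ ‖V y k‖ ^ 2 := by positivity
      change 2 * ‖V y k‖ ^ 2 - a k * ‖V y k‖ ^ 2 ≤ 0
      nlinarith
    · rw [Set.indicator_of_notMem hk', zero_mul] at hk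
      simp [hk]
  filter_upwards [hV x, h0, h2] with k hk h0 h2
  rw [hk]
  by_cases h3 : 0 < a k
  · by_cases h4 : a k < 2
    · rw [Function.comp_apply, logistic_log h3 h4]
    · rw [h2 (not_lt.1 h4), mul_zero, mul_zero]
  · rw [h0 (not_lt.1 h3), mul_zero, mul_zero]

variable (V : 𝓗 ≃ₗᵢ[ℂ] Lp ℂ 2 ν) {l : X → ℝ}

theorem bddMeas_comp_log (hl : Measurable l) {g : ℝ → ℝ} (hg : Continuous g) {M : ℝ}
    (hM : ∀ y, |g y| ≤ M) : BddMeas fun k => (g (l k) : ℂ) :=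
  bddMeas_ofReal (hg.measurable.comp hl) fun k => hM _

/-- An operator intertwining `R = ρ(l)` and `ρ(± l)` intertwines `g(l)` and `g(± l)`. -/
theorem intertwine_log (hl : Measurable l) (T : 𝓗 →L[ℝ] 𝓗) (ε : ℝ)
    (h : ∀ x, T (mulBy V (fun k => (logistic (l k) : ℂ)) x) =
      mulBy V (fun k => (logistic (ε * l k) : ℂ)) (T x))
    {g : ℝ → ℝ} (hg : Continuous g) {M : ℝ} (hM : ∀ y, |g y| ≤ M) (x : 𝓗) :
    T (mulBy V (fun k => (g (l k) : ℂ)) x) = mulBy V (fun k => (g (ε * l k) : ℂ)) (T x) := by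
  have hεl : Measurable fun k => ε * l k := hl.const_mul ε
  have happrox : ∀ n : ℕ, T (mulBy V (fun k => (g (clamp n (l k)) : ℂ)) x) =
      mulBy V (fun k => (g (clamp n (ε * l k)) : ℂ)) (T x) := by
    intro n
    -- Truncating the spectral value of R to a compact part of (0, 2) amounts to truncating l to
    -- [-n, n]. There l is a continuous function of R, so continuous calculus applies; n → ∞ removes
    -- the truncation.
    let c : ℝ → ℝ := fun r => max (logistic n) (min r (logistic (-n)))
    have hc : ∀ y, c (logistic y) = logistic (clamp n y) := by
      intro y
      change max (logistic n) (min (logistic y) (logistic (-n))) = _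
      rw [← antitone_logistic.map_max, ← antitone_logistic.map_min]
      rfl
    have hmono : logistic n ≤ logistic (-n) := by
      have hn : (0 : ℝ) ≤ n := n.cast_nonneg
      exact antitone_logistic (by linarith)
    have hcont : Continuous c := by fun_prop
    have hc0 : ∀ r, 0 < c r := fun r => lt_max_of_lt_left (logistic_pos _)
    have hc2 : ∀ r, c r < 2 := fun r =>
      max_lt (logistic_lt_two _) ((min_le_right _ _).trans_lt (logistic_lt_two _))
    have hG : Continuous fun r => g (Real.log ((2 - c r) / c r)) := by
      refine hg.comp (Continuous.log ?_ fun r => ?_)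
      · exact (continuous_const.sub hcont).div hcont fun r => (hc0 r).ne'
      · exact (div_pos (by linarith [hc2 r]) (hc0 r)).ne'
    have := intertwine_comp V T (continuous_logistic.measurable.comp hl)
      (continuous_logistic.measurable.comp hεl) (fun k => abs_logistic_le _)
      (fun k => abs_logistic_le _) h hG x
    simpa only [Function.comp_apply, hc, log_logistic] using this
  have hlim : ∀ (w : X → ℝ), Measurable w → ∀ y : 𝓗,
      Tendsto (fun n : ℕ => mulBy V (fun k => (g (clamp n (w k)) : ℂ)) y) atTop
        (nhds (mulBy V (fun k => (g (w k) : ℂ)) y)) := by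
    intro w hw y
    refine tendsto_mulBy V (C := M) (fun n => ?_) ?_ (fun n k => ?_) (fun k => ?_) y
    · exact Complex.measurable_ofReal.comp (hg.measurable.comp ((continuous_clamp n).measurable.comp hw))
    · exact Complex.measurable_ofReal.comp (hg.measurable.comp hw)
    · simpa using hM _
    · exact (Complex.continuous_ofReal.tendsto _).comp ((hg.tendsto _).comp (tendsto_clamp _))
  refine tendsto_nhds_unique ((T.continuous.tendsto _).comp (hlim l hl x)) ?_
  refine (hlim _ hεl (T x)).congr fun n => ?_
  exact (happrox n).symm

/-- The phase `e^{itl}`. -/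
def phase (l : X → ℝ) (t : ℝ) (k : X) : ℂ := Complex.exp (Complex.I * (t * l k : ℝ))

theorem norm_phase (t : ℝ) (k : X) : ‖phase l t k‖ = 1 := by
  rw [phase, mul_comm, Complex.norm_exp_ofReal_mul_I]

theorem bddMeas_phase (hl : Measurable l) (t : ℝ) : BddMeas (phase l t) :=
  BddMeas.of_le (Complex.measurable_exp.comp ((Complex.measurable_ofReal.comp
    (hl.const_mul t)).const_mul _)) 1 fun k => (norm_phase t k).le

theorem phase_eq (t : ℝ) : phase l t =
    fun k => (Real.cos (t * l k) : ℂ) + Complex.I * (Real.sin (t * l k) : ℂ) := by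
  funext k
  rw [phase, mul_comm Complex.I, Complex.exp_mul_I]
  push_cast
  ring

/-- The modular unitary `Δ^{it}`. -/
def modular (l : X → ℝ) (t : ℝ) : 𝓗 →L[ℂ] 𝓗 := mulBy V (phase l t)

theorem modular_add (hl : Measurable l) (s t : ℝ) (x : 𝓗) :
    modular V l (s + t) x = modular V l s (modular V l t x) := by
  rw [modular, modular, modular, ← mulBy_mul V (bddMeas_phase hl s) (bddMeas_phase hl t)]
  congr 2
  funext k
  simp only [phase]
  rw [← Complex.exp_add]
  push_cast
  ring_nf

theorem modular_zero (x : 𝓗) : modular V l 0 x = x := by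
  have : phase l 0 = fun _ => 1 := by
    funext k
    simp [phase]
  rw [modular, this, mulBy_one]

theorem modular_neg_self (hl : Measurable l) (t : ℝ) (x : 𝓗) :
    modular V l (-t) (modular V l t x) = x := by
  rw [← modular_add V hl, neg_add_cancel, modular_zero]

theorem modular_self_neg (hl : Measurable l) (t : ℝ) (x : 𝓗) :
    modular V l t (modular V l (-t) x) = x := by
  rw [← modular_add V hl, add_neg_cancel, modular_zero]

theorem phase_conj (t : ℝ) (k : X) : (starRingEnd ℂ) (phase l t k) = phase l (-t) k := by
  rw [phase, phase, ← Complex.exp_conj, map_mul, Complex.conj_I, Complex.conj_ofReal]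
  push_cast
  ring_nf

theorem inner_modular (hl : Measurable l) (t : ℝ) (x y : 𝓗) :
    ⟪modular V l t x, y⟫_ℂ = ⟪x, modular V l (-t) y⟫_ℂ := by
  rw [modular, inner_mulBy V (bddMeas_phase hl t)]
  simp only [phase_conj]
  rfl

theorem modular_apply (hl : Measurable l) (t : ℝ) (x : 𝓗) : modular V l t x =
    mulBy V (fun k => (Real.cos (t * l k) : ℂ)) x +
      Complex.I • mulBy V (fun k => (Real.sin (t * l k) : ℂ)) x := by
  have hc : BddMeas fun k => (Real.cos (t * l k) : ℂ) :=
    bddMeas_comp_log hl (g := fun y => Real.cos (t * y)) (by fun_prop) fun y => Real.abs_cos_le_one _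
  have hs : BddMeas fun k => (Real.sin (t * l k) : ℂ) :=
    bddMeas_comp_log hl (g := fun y => Real.sin (t * y)) (by fun_prop) fun y => Real.abs_sin_le_one _
  rw [modular, phase_eq, mulBy_add V hc (hs.const_mul _), mulBy_const_mul V _ hs]
  rfl

/-- A complex linear operator that intertwines `ρ(l)` and `ρ(± l)` intertwines the modular
unitaries accordingly. -/
theorem modular_intertwine (hl : Measurable l) (T : 𝓗 →L[ℂ] 𝓗) (ε : ℝ)
    (h : ∀ x, T (mulBy V (fun k => (logistic (l k) : ℂ)) x) =
      mulBy V (fun k => (logistic (ε * l k) : ℂ)) (T x)) (t : ℝ) (x : 𝓗) :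
    T (modular V l t x) = modular V l (ε * t) (T x) := by
  have hc := intertwine_log V hl (T.restrictScalars ℝ) ε h (g := fun y => Real.cos (t * y))
    (by fun_prop) (fun y => Real.abs_cos_le_one _) x
  have hs := intertwine_log V hl (T.restrictScalars ℝ) ε h (g := fun y => Real.sin (t * y))
    (by fun_prop) (fun y => Real.abs_sin_le_one _) x
  simp only [ContinuousLinearMap.coe_restrictScalars'] at hc hs
  rw [modular_apply V hl, modular_apply V hl, map_add, map_smul, hc, hs]
  simp only [mul_comm ε t, mul_assoc]

/-- An operator commuting with the modular group commutes with `R`. -/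
theorem commute_of_modular (hl : Measurable l) (T : 𝓗 →L[ℂ] 𝓗)
    (h : ∀ t x, T (modular V l t x) = modular V l t (T x)) (x : 𝓗) :
    T (mulBy V (fun k => (logistic (l k) : ℂ)) x) =
      mulBy V (fun k => (logistic (l k) : ℂ)) (T x) := by
  -- The bounded function sin(l/(n+1)) is a combination of two modular unitaries, so T commutes with
  -- it and with its continuous functions. Since (n+1) sin(l/(n+1)) → l, applying `logistic`
  -- recovers R in the limit.
  have hsin : ∀ n : ℕ, Measurable fun k => Real.sin (l k / (n + 1)) := fun n =>
    Real.measurable_sin.comp (hl.div_const _)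
  have h1 : ∀ (n : ℕ) (y : 𝓗), mulBy V (fun k => (Real.sin (l k / (n + 1)) : ℂ)) y =
      (-Complex.I / 2) • (modular V l (1 / (n + 1)) y - modular V l (-(1 / (n + 1))) y) := by
    intro n y
    have e1 := mulBy_sub V (bddMeas_phase hl (1 / (n + 1))) (bddMeas_phase hl (-(1 / (n + 1))))
    have e2 := mulBy_const_mul V (-Complex.I / 2)
      ((bddMeas_phase hl (1 / (n + 1))).sub (bddMeas_phase hl (-(1 / (n + 1)))))
    have e3 : (fun k => (Real.sin (l k / (n + 1)) : ℂ)) = fun k => (-Complex.I / 2) *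
        (phase l (1 / (n + 1)) k - phase l (-(1 / (n + 1))) k) := by
      funext k
      rw [phase_eq, phase_eq]
      simp only [neg_mul, Real.cos_neg, Real.sin_neg]
      have : 1 / ((n : ℝ) + 1) * l k = l k / (n + 1) := by ring
      rw [this]
      push_cast
      linear_combination (Complex.sin (l k / (n + 1))) * Complex.I_sq
    rw [e3, e2, e1]
    rfl
  have h2 : ∀ (n : ℕ) (y : 𝓗), T (mulBy V (fun k => (Real.sin (l k / (n + 1)) : ℂ)) y) =
      mulBy V (fun k => (Real.sin (l k / (n + 1)) : ℂ)) (T y) := by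
    intro n y
    rw [h1, h1, map_smul, map_sub, h, h]
  have h3 : ∀ n : ℕ,
      T (mulBy V (fun k => (logistic ((n + 1) * Real.sin (l k / (n + 1))) : ℂ)) x) =
      mulBy V (fun k => (logistic ((n + 1) * Real.sin (l k / (n + 1))) : ℂ)) (T x) := by
    intro n
    exact intertwine_comp V (T.restrictScalars ℝ) (hsin n) (hsin n) (M := 1)
      (fun k => Real.abs_sin_le_one _) (fun k => Real.abs_sin_le_one _) (h2 n)
      (g := fun y => logistic ((n + 1) * y)) (continuous_logistic.comp (by fun_prop)) x
  have hsinlim : ∀ y : ℝ, Tendsto (fun n : ℕ => ((n : ℝ) + 1) * Real.sin (y / (n + 1))) atTop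
      (nhds y) := by
    intro y
    have hd : HasDerivAt (fun u : ℝ => Real.sin (y * u)) y 0 := by
      have := ((hasDerivAt_id (0 : ℝ)).const_mul y).sin
      simpa using this
    have hslope := (hasDerivAt_iff_tendsto_slope_zero.1 hd)
    have hto : Tendsto (fun n : ℕ => 1 / ((n : ℝ) + 1)) atTop (nhdsWithin 0 {0}ᶜ) := by
      refine tendsto_nhdsWithin_iff.2 ⟨tendsto_one_div_add_atTop_nhds_zero_nat,
        Eventually.of_forall fun n => ?_⟩
      have : (0 : ℝ) < 1 / ((n : ℝ) + 1) := by positivity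
      exact this.ne'
    refine (hslope.comp hto).congr fun n => ?_
    simp [div_eq_mul_inv]
  have hlim : ∀ y : 𝓗, Tendsto (fun n : ℕ =>
      mulBy V (fun k => (logistic ((n + 1) * Real.sin (l k / (n + 1))) : ℂ)) y) atTop
        (nhds (mulBy V (fun k => (logistic (l k) : ℂ)) y)) := by
    intro y
    refine tendsto_mulBy V (C := 2) (fun n => ?_) ?_ (fun n k => ?_) (fun k => ?_) y
    · exact Complex.measurable_ofReal.comp (continuous_logistic.measurable.comp
        ((hsin n).const_mul _))
    · exact Complex.measurable_ofReal.comp (continuous_logistic.measurable.comp hl)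
    · simpa using abs_logistic_le _
    · exact (Complex.continuous_ofReal.tendsto _).comp
        ((continuous_logistic.tendsto _).comp (hsinlim _))
  refine tendsto_nhds_unique ((T.continuous.tendsto _).comp (hlim x)) ?_
  exact (hlim (T x)).congr fun n => (h3 n).symm

end modular

/-! ### Action of the modular group on K and K', and Borchers' theorem -/

section modularSubspace

open ClosedSubmodule

variable {𝓗 : Type*} [NormedAddCommGroup 𝓗] [InnerProductSpace ℂ 𝓗] [CompleteSpace 𝓗]
  {X : Type*} [MeasurableSpace X] {ν : Measure X} {V : 𝓗 ≃ₗᵢ[ℂ] Lp ℂ 2 ν} {l : X → ℝ}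
  {K : ClosedSubmodule ℝ 𝓗}

namespace IsLogModel

theorem bddMeas_logistic (hM : IsLogModel K V l) : BddMeas fun k => (logistic (l k) : ℂ) :=
  bddMeas_comp_log hM.measurable continuous_logistic abs_logistic_le

theorem mulBy_logistic_neg (hM : IsLogModel K V l) (x : 𝓗) :
    mulBy V (fun k => (logistic (-1 * l k) : ℂ)) x = (2 : ℂ) • x - sumProj K x := by
  have h1 : (fun k => (logistic (-1 * l k) : ℂ)) = fun k => 2 * 1 - (logistic (l k) : ℂ) := by
    funext k
    rw [neg_one_mul, logistic_neg]
    push_cast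
    ring
  rw [h1, mulBy_sub V ((BddMeas.const 1).const_mul 2) hM.bddMeas_logistic,
    mulBy_const_mul V 2 (BddMeas.const 1), hM.sumProj_eq]
  change (2 : ℂ) • mulBy V (fun _ => 1) x - _ = _
  rw [mulBy_one]
  rfl

theorem symplComp (hM : IsLogModel K V l) : IsLogModel K.symplComp V (fun k => -1 * l k) where
  measurable := hM.measurable.const_mul _
  sumProj_eq x := by rw [hM.mulBy_logistic_neg, sumProj_symplComp]

/-- The relation DR = (2 - R)D says that D reverses the sign of l, because 2 - R is the same
logistic function of -l. -/
theorem diffProj_mulBy (hM : IsLogModel K V l) {g : ℝ → ℝ} (hg : Continuous g) {M : ℝ}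
    (hgM : ∀ y, |g y| ≤ M) (x : 𝓗) : diffProj K (mulBy V (fun k => (g (l k) : ℂ)) x) =
      mulBy V (fun k => (g (-1 * l k) : ℂ)) (diffProj K x) := by
  refine intertwine_log V hM.measurable (diffProj K) (-1) (fun x => ?_) hg hgM x
  rw [← hM.sumProj_eq, hM.mulBy_logistic_neg, diffProj_sumProj]

theorem sumProj_mulBy (hM : IsLogModel K V l) {φ : X → ℂ} (hφ : BddMeas φ) (x : 𝓗) :
    sumProj K (mulBy V φ x) = mulBy V φ (sumProj K x) := by
  rw [hM.sumProj_eq, hM.sumProj_eq, mulBy_comm V hM.bddMeas_logistic hφ]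

/-- D reverses l, so real even functions of l commute with both R and D and preserve the equation
describing K. The case of interest is that of the cutoffs. -/
theorem mulBy_mem (hM : IsLogModel K V l) {g : ℝ → ℝ} (hg : Continuous g) {M : ℝ}
    (hgM : ∀ y, |g y| ≤ M) (heven : ∀ y, g (-y) = g y) {x : 𝓗} (hx : x ∈ K) :
    mulBy V (fun k => (g (l k) : ℂ)) x ∈ K := by
  rw [mem_iff_diffProj] at hx ⊢
  rw [hM.diffProj_mulBy hg hgM, hx, hM.sumProj_mulBy (bddMeas_comp_log hM.measurable hg hgM),
    map_sub, map_smul]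
  simp only [neg_one_mul, heven]

/-- D reverses l and is antilinear; the two signs cancel in e^{itl}, so the modular unitaries
commute with D as well as with R. -/
theorem modular_mem (hM : IsLogModel K V l) (t : ℝ) {x : 𝓗} (hx : x ∈ K) :
    modular V l t x ∈ K := by
  have hD : diffProj K (modular V l t x) = modular V l t (diffProj K x) := by
    rw [modular_apply V hM.measurable, modular_apply V hM.measurable, map_add, diffProj_I,
      hM.diffProj_mulBy (g := fun y => Real.cos (t * y)) (by fun_prop)
        (fun y => Real.abs_cos_le_one _),
      hM.diffProj_mulBy (g := fun y => Real.sin (t * y)) (by fun_prop)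
        (fun y => Real.abs_sin_le_one _)]
    simp only [neg_mul, one_mul, mul_neg, Real.cos_neg, Real.sin_neg, Complex.ofReal_neg]
    congr 1
    have hs : BddMeas fun k => (Real.sin (t * l k) : ℂ) :=
      bddMeas_comp_log hM.measurable (g := fun y => Real.sin (t * y)) (by fun_prop)
        fun y => Real.abs_sin_le_one _
    have := mulBy_const_mul V (-1) hs
    simp only [neg_one_mul, neg_one_smul] at this
    rw [this]
    simp
  rw [mem_iff_diffProj] at hx ⊢
  rw [hD, hx, modular, hM.sumProj_mulBy (bddMeas_phase hM.measurable t), map_sub, map_smul]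

theorem modular_neg_log (t : ℝ) : modular V (fun k => -1 * l k) t = modular V l (-t) := by
  rw [modular, modular]
  congr 1
  funext k
  simp only [phase]
  push_cast
  ring_nf

theorem modular_mem_symplComp (hM : IsLogModel K V l) (t : ℝ) {x : 𝓗} (hx : x ∈ K.symplComp) :
    modular V l t x ∈ K.symplComp := by
  have := hM.symplComp.modular_mem (-t) hx
  rwa [modular_neg_log, neg_neg] at this

theorem bddMeas_cutoff (hM : IsLogModel K V l) (n : ℕ) : BddMeas fun k => (cutoff n (l k) : ℂ) :=
  bddMeas_comp_log hM.measurable (continuous_cutoff n) (abs_cutoff_le n)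

theorem cutoff_mem (hM : IsLogModel K V l) (n : ℕ) {x : 𝓗} (hx : x ∈ K) :
    mulBy V (fun k => (cutoff n (l k) : ℂ)) x ∈ K :=
  hM.mulBy_mem (continuous_cutoff n) (abs_cutoff_le n) (fun y => by simp [cutoff]) hx

theorem cutoff_neg_log (n : ℕ) :
    (fun k => (cutoff n (-1 * l k) : ℂ)) = fun k => (cutoff n (l k) : ℂ) := by
  funext k
  simp [cutoff]

theorem tendsto_mulBy_cutoff (hM : IsLogModel K V l) (x : 𝓗) :
    Tendsto (fun n => mulBy V (fun k => (cutoff n (l k) : ℂ)) x) atTop (nhds x) := by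
  have := tendsto_mulBy V (f := fun n k => (cutoff n (l k) : ℂ)) (f₀ := fun _ => 1) (C := 1)
    (fun n => (hM.bddMeas_cutoff n).measurable) measurable_const
    (fun n k => by simpa using abs_cutoff_le n (l k))
    (fun k => by
      have := (Complex.continuous_ofReal.tendsto _).comp (tendsto_cutoff (l k))
      rw [Complex.ofReal_one] at this
      exact this) x
  rwa [mulBy_one] at this

/-- The function `e^{y/2}`, truncated. -/
def halfExp (n : ℕ) (y : ℝ) : ℝ := Real.exp (clamp n y / 2)

theorem continuous_halfExp (n : ℕ) : Continuous (halfExp n) := by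
  have := continuous_clamp n
  unfold halfExp
  fun_prop

theorem abs_halfExp_le (n : ℕ) (y : ℝ) : |halfExp n y| ≤ Real.exp (n / 2) := by
  rw [halfExp, abs_of_pos (Real.exp_pos _)]
  exact Real.exp_le_exp.2 (by linarith [(abs_le.1 (abs_clamp_le n y)).2])

theorem halfExp_neg (n : ℕ) (y : ℝ) : halfExp n (-y) = (halfExp n y)⁻¹ := by
  rw [halfExp, halfExp, clamp_neg, neg_div, Real.exp_neg]

/-- The operator `Δ^{1/2}` maps `K` into its symplectic complement. -/
theorem halfExp_mem (hM : IsLogModel K V l) (n : ℕ) {x : 𝓗} (hx : x ∈ K) :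
    mulBy V (fun k => (halfExp n (l k) : ℂ)) (mulBy V (fun k => (cutoff n (l k) : ℂ)) x) ∈
      K.symplComp := by
  have hm := hM.measurable
  have hχ := hM.bddMeas_cutoff n
  have he : BddMeas fun k => (halfExp n (l k) : ℂ) :=
    bddMeas_comp_log hm (continuous_halfExp n) (abs_halfExp_le n)
  have hl' : Measurable fun k => -1 * l k := hm.const_mul _
  have he' : BddMeas fun k => (halfExp n (-1 * l k) : ℂ) :=
    bddMeas_comp_log hl' (continuous_halfExp n) (abs_halfExp_le n)
  have hρ' : BddMeas fun k => (logistic (-1 * l k) : ℂ) :=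
    bddMeas_comp_log hl' continuous_logistic abs_logistic_le
  -- On K the operator D acts as 2 - R, and moving D past e^{l/2} gives e^{-l/2}. The claim thus
  -- reduces to e^{-l/2}(2 - ρ) = ρ e^{l/2} with ρ = 2/(1 + e^l). The cutoff confines it to |l| ≤ n,
  -- where the truncated exponential is the true one.
  rw [mem_symplComp_iff_diffProj, hM.diffProj_mulBy (continuous_halfExp n) (abs_halfExp_le n),
    (mem_iff_diffProj K).1 (hM.cutoff_mem n hx), ← hM.mulBy_logistic_neg, hM.sumProj_eq,
    ← mulBy_mul V hρ' hχ, ← mulBy_mul V he' (hρ'.mul hχ), ← mulBy_mul V he hχ,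
    ← mulBy_mul V hM.bddMeas_logistic (he.mul hχ)]
  congr 2
  funext k
  by_cases hk : |l k| ≤ n
  · simp only [← Complex.ofReal_mul]
    congr 1
    rw [neg_one_mul, halfExp_neg, logistic_neg, ← logistic_mul_exp, halfExp, clamp_of_abs_le hk]
    have h2 : Real.exp (l k) = Real.exp (l k / 2) * Real.exp (l k / 2) := by
      rw [← Real.exp_add, add_halves]
    rw [h2]
    field_simp
  · simp [cutoff_eq_zero hk]

end IsLogModel

/-- The truncated function `e^{izl}`. -/
def cexpLog (l : X → ℝ) (n : ℕ) (z : ℂ) (k : X) : ℂ :=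
  Complex.exp (Complex.I * z * (clamp n (l k) : ℝ))

theorem norm_cexpLog_le (n : ℕ) (z : ℂ) (k : X) : ‖cexpLog l n z k‖ ≤ Real.exp (|z.im| * n) := by
  rw [cexpLog, Complex.norm_exp]
  refine Real.exp_le_exp.2 ?_
  rw [Complex.re_mul_ofReal, Complex.I_mul_re]
  refine (le_abs_self _).trans ?_
  rw [abs_mul, abs_neg]
  exact mul_le_mul_of_nonneg_left (abs_clamp_le n _) (abs_nonneg _)

theorem bddMeas_cexpLog (hl : Measurable l) (n : ℕ) (z : ℂ) : BddMeas (cexpLog l n z) :=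
  BddMeas.of_le (Complex.measurable_exp.comp ((Complex.measurable_ofReal.comp
    ((continuous_clamp n).measurable.comp hl)).const_mul _)) _ (norm_cexpLog_le n z)

theorem differentiable_cexpLog (hl : Measurable l) (n : ℕ) :
    Differentiable ℂ fun z => mulBy V (cexpLog l n z) := by
  intro z
  have hc : BddMeas fun k => (clamp n (l k) : ℂ) :=
    bddMeas_comp_log hl (continuous_clamp n) (abs_clamp_le n)
  -- The truncated logarithm is bounded by n, so differentiability holds in operator norm. The
  -- radius 1/(n+1) keeps |w|n ≤ 1, as the quadratic remainder estimate for exp requires.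
  refine (hasDerivAt_of_quadratic (f' := mulBy V fun k => Complex.I *
    (clamp n (l k) * cexpLog l n z k)) (Real.exp (|z.im| * n) * n ^ 2) (1 / (n + 1))
    (by positivity) fun w hw => ?_).differentiableAt
  have h1 := bddMeas_cexpLog hl n (z + w)
  have h2 := bddMeas_cexpLog hl n z
  have h3 := (hc.mul h2).const_mul Complex.I
  rw [← mulBy_sub V h1 h2, ← mulBy_const_mul V w h3, ← mulBy_sub V (h1.sub h2) (h3.const_mul w)]
  refine norm_mulBy_le V (by positivity) fun k => ?_
  have hwc : ‖Complex.I * w * (clamp n (l k) : ℝ)‖ ≤ ‖w‖ * n := by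
    rw [norm_mul, norm_mul, Complex.norm_I, one_mul, Complex.norm_real]
    exact mul_le_mul_of_nonneg_left (abs_clamp_le n _) (norm_nonneg _)
  have hle1 : ‖w‖ * n ≤ 1 := by
    have hn : (0 : ℝ) < n + 1 := by positivity
    calc ‖w‖ * n ≤ 1 / (n + 1) * (n + 1) :=
          mul_le_mul hw.le (by linarith) (Nat.cast_nonneg n) (by positivity)
      _ = 1 := by rw [div_mul_cancel₀ _ hn.ne']
  have hquad := Complex.norm_exp_sub_one_sub_id_le (hwc.trans hle1)
  have heq : cexpLog l n (z + w) k - cexpLog l n z k - w * (Complex.I *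
      (clamp n (l k) * cexpLog l n z k)) = cexpLog l n z k *
      (Complex.exp (Complex.I * w * (clamp n (l k) : ℝ)) - 1 -
        Complex.I * w * (clamp n (l k) : ℝ)) := by
    have : cexpLog l n (z + w) k = cexpLog l n z k *
        Complex.exp (Complex.I * w * (clamp n (l k) : ℝ)) := by
      rw [cexpLog, cexpLog, ← Complex.exp_add]
      ring_nf
    rw [this]
    ring
  rw [heq, norm_mul]
  calc ‖cexpLog l n z k‖ * _ ≤ Real.exp (|z.im| * n) * (‖w‖ * n) ^ 2 :=
        mul_le_mul (norm_cexpLog_le n z k)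
          (hquad.trans (pow_le_pow_left₀ (norm_nonneg _) hwc 2)) (norm_nonneg _)
          (Real.exp_pos _).le
    _ = _ := by ring

theorem cexpLog_conj (n : ℕ) (z : ℂ) (k : X) : (starRingEnd ℂ) (cexpLog l n z k) =
    cexpLog l n (-(starRingEnd ℂ) z) k := by
  rw [cexpLog, cexpLog, ← Complex.exp_conj, map_mul, map_mul, Complex.conj_I, Complex.conj_ofReal]
  ring_nf

theorem cexpLog_add (n : ℕ) (z w : ℂ) (k : X) :
    cexpLog l n (z + w) k = cexpLog l n z k * cexpLog l n w k := by
  rw [cexpLog, cexpLog, cexpLog, ← Complex.exp_add]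
  ring_nf

theorem cexpLog_half (n : ℕ) (k : X) :
    cexpLog l n (-(Complex.I / 2)) k = (IsLogModel.halfExp n (l k) : ℂ) := by
  rw [cexpLog, IsLogModel.halfExp]
  push_cast
  congr 1
  linear_combination (-(clamp n (l k) : ℂ) / 2) * Complex.I_sq

theorem mulBy_cexpLog_ofReal (hM : IsLogModel K V l) (n : ℕ) (t : ℝ) (x : 𝓗) :
    mulBy V (cexpLog l n t) (mulBy V (fun k => (cutoff n (l k) : ℂ)) x) =
      modular V l t (mulBy V (fun k => (cutoff n (l k) : ℂ)) x) := by
  have hχ := hM.bddMeas_cutoff n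
  rw [modular, ← mulBy_mul V (bddMeas_cexpLog hM.measurable n t) hχ,
    ← mulBy_mul V (bddMeas_phase hM.measurable t) hχ]
  congr 2
  funext k
  by_cases hk : |l k| ≤ n
  · rw [cexpLog, phase, clamp_of_abs_le hk]
    push_cast
    ring_nf
  · simp [cutoff_eq_zero hk]

theorem inner_mulBy_cexpLog (hl : Measurable l) (n : ℕ) (z : ℂ) (x y : 𝓗) :
    ⟪x, mulBy V (cexpLog l n z) y⟫_ℂ = ⟪mulBy V (cexpLog l n (-(starRingEnd ℂ) z)) x, y⟫_ℂ := by
  rw [inner_mulBy V (bddMeas_cexpLog hl n _)]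
  congr 3
  funext k
  rw [cexpLog_conj, map_neg, Complex.conj_conj, neg_neg]

/-- The translation group `u` has a holomorphic extension `W` to the upper half plane by
contractions, that is, `u` has a positive generator. -/
structure PositiveExtension (u : ℝ → 𝓗 →L[ℂ] 𝓗) (W : ℂ → 𝓗 →L[ℂ] 𝓗) : Prop where
  norm_le : ∀ w : ℂ, 0 ≤ w.im → ‖W w‖ ≤ 1
  differentiableAt : ∀ w : ℂ, 0 < w.im → DifferentiableAt ℂ W w
  continuousOn : ∀ x, ContinuousOn (fun w => W w x) {w | 0 ≤ w.im}
  ofReal : ∀ s : ℝ, W s = u s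
  inner_eq : ∀ s x y, ⟪u s x, y⟫_ℂ = ⟪x, u (-s) y⟫_ℂ

/-- On the strip the argument 2π Im z runs through [0, π], so the scaled translation parameter stays
in the half plane where the extension of the translation group is controlled. -/
theorem im_exp_nonneg {z : ℂ} (h0 : 0 ≤ z.im) (h1 : z.im ≤ 1 / 2) {s : ℝ} (hs : 0 ≤ s) :
    0 ≤ (Complex.exp (2 * Real.pi * z) * s).im := by
  rw [Complex.im_mul_ofReal, Complex.exp_im]
  have him : (2 * Real.pi * z : ℂ).im = 2 * Real.pi * z.im := by
    rw [show (2 * Real.pi * z : ℂ) = ((2 * Real.pi : ℝ) : ℂ) * z by push_cast; ring,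
      Complex.im_ofReal_mul]
  rw [him]
  refine mul_nonneg (mul_nonneg (Real.exp_pos _).le (Real.sin_nonneg_of_nonneg_of_le_pi ?_ ?_)) hs
  · have := Real.pi_pos; positivity
  · nlinarith [Real.pi_pos]

theorem im_exp_pos {z : ℂ} (h0 : 0 < z.im) (h1 : z.im < 1 / 2) {s : ℝ} (hs : 0 < s) :
    0 < (Complex.exp (2 * Real.pi * z) * s).im := by
  rw [Complex.im_mul_ofReal, Complex.exp_im]
  have him : (2 * Real.pi * z : ℂ).im = 2 * Real.pi * z.im := by
    rw [show (2 * Real.pi * z : ℂ) = ((2 * Real.pi : ℝ) : ℂ) * z by push_cast; ring,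
      Complex.im_ofReal_mul]
  rw [him]
  refine mul_pos (mul_pos (Real.exp_pos _) (Real.sin_pos_of_pos_of_lt_pi ?_ ?_)) hs
  · have := Real.pi_pos; positivity
  · nlinarith [Real.pi_pos]

/-- The holomorphic function in the proof of Borchers' theorem. -/
def borchersFun (V : 𝓗 ≃ₗᵢ[ℂ] Lp ℂ 2 ν) (l : X → ℝ) (n : ℕ) (W : ℂ → 𝓗 →L[ℂ] 𝓗) (s : ℝ)
    (η ξ : 𝓗) (z : ℂ) : ℂ :=
  ⟪η, mulBy V (cexpLog l n z) (W (Complex.exp (2 * Real.pi * z) * s)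
    (mulBy V (cexpLog l n (-z)) ξ))⟫_ℂ

theorem diffContOnCl_borchersFun (hl : Measurable l) {u : ℝ → 𝓗 →L[ℂ] 𝓗} {W : ℂ → 𝓗 →L[ℂ] 𝓗}
    (hW : PositiveExtension u W) (n : ℕ) {s : ℝ} (hs : 0 < s) (η ξ : 𝓗) :
    DiffContOnCl ℂ (borchersFun V l n W s η ξ) (Complex.im ⁻¹' Set.Ioo 0 (1 / 2)) := by
  have hE := differentiable_cexpLog (V := V) hl n
  have hE' : Differentiable ℂ fun z => mulBy V (cexpLog l n (-z)) :=
    hE.comp differentiable_neg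
  have hexp : Differentiable ℂ fun z : ℂ => Complex.exp (2 * Real.pi * z) * s := by fun_prop
  constructor
  · intro z hz
    have hWz : DifferentiableAt ℂ (fun z : ℂ => W (Complex.exp (2 * Real.pi * z) * s)) z :=
      (hW.differentiableAt _ (im_exp_pos hz.1 hz.2 hs)).comp z (hexp z)
    have h1 := (hE z).clm_apply (hWz.clm_apply ((hE' z).clm_apply (differentiableAt_const ξ)))
    exact ((innerSL ℂ η).differentiableAt.comp z h1).differentiableWithinAt
  · rw [Complex.closure_preimage_im, closure_Ioo (by norm_num)]
    -- Up to the boundary W is only strongly continuous while its argument vector also moves; the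
    -- contraction bound makes the two limits compatible.
    have hinner : ContinuousOn (fun z : ℂ => W (Complex.exp (2 * Real.pi * z) * s)
        (mulBy V (cexpLog l n (-z)) ξ)) (Complex.im ⁻¹' Set.Icc 0 (1 / 2)) := by
      intro z hz
      have hy : ContinuousAt (fun z => mulBy V (cexpLog l n (-z)) ξ) z :=
        ((hE' z).clm_apply (differentiableAt_const ξ)).continuousAt
      rw [ContinuousWithinAt, tendsto_iff_norm_sub_tendsto_zero]
      have hc : ContinuousWithinAt (fun z' : ℂ => W (Complex.exp (2 * Real.pi * z') * s)
          (mulBy V (cexpLog l n (-z)) ξ)) (Complex.im ⁻¹' Set.Icc 0 (1 / 2)) z :=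
        ContinuousWithinAt.comp (t := {w : ℂ | 0 ≤ w.im})
          (g := fun w => W w (mulBy V (cexpLog l n (-z)) ξ))
          (f := fun z' : ℂ => Complex.exp (2 * Real.pi * z') * s)
          (hW.continuousOn _ _ (im_exp_nonneg hz.1 hz.2 hs.le))
          (hexp z).continuousAt.continuousWithinAt
          fun z' hz' => im_exp_nonneg hz'.1 hz'.2 hs.le
      have hc' := tendsto_iff_norm_sub_tendsto_zero.1 hc
      have hy' := (tendsto_iff_norm_sub_tendsto_zero.1
        (hy.continuousWithinAt (s := Complex.im ⁻¹' Set.Icc 0 (1 / 2))))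
      have hsum := hy'.add hc'
      rw [add_zero] at hsum
      refine squeeze_zero' (Eventually.of_forall fun _ => norm_nonneg _) ?_ hsum
      filter_upwards [self_mem_nhdsWithin] with z' hz'
      have hn := hW.norm_le _ (im_exp_nonneg hz'.1 hz'.2 hs.le)
      set A := W (Complex.exp (2 * Real.pi * z') * s)
      have h1 : A (mulBy V (cexpLog l n (-z')) ξ) -
          W (Complex.exp (2 * Real.pi * z) * s) (mulBy V (cexpLog l n (-z)) ξ) =
          A (mulBy V (cexpLog l n (-z')) ξ - mulBy V (cexpLog l n (-z)) ξ) +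
          (A (mulBy V (cexpLog l n (-z)) ξ) -
            W (Complex.exp (2 * Real.pi * z) * s) (mulBy V (cexpLog l n (-z)) ξ)) := by
        rw [map_sub]; abel
      rw [h1]
      refine (norm_add_le _ _).trans (add_le_add_left ?_ _)
      have := A.le_of_opNorm_le hn
        (mulBy V (cexpLog l n (-z')) ξ - mulBy V (cexpLog l n (-z)) ξ)
      rwa [one_mul] at this
    exact (innerSL ℂ η).continuous.comp_continuousOn (hE.continuous.continuousOn.clm_apply hinner)

theorem norm_borchersFun_le {u : ℝ → 𝓗 →L[ℂ] 𝓗} {W : ℂ → 𝓗 →L[ℂ] 𝓗}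
    (hW : PositiveExtension u W) (n : ℕ) {s : ℝ} (hs : 0 ≤ s) (η ξ : 𝓗) (z : ℂ) (h0 : 0 ≤ z.im)
    (h1 : z.im ≤ 1 / 2) :
    ‖borchersFun V l n W s η ξ z‖ ≤ ‖η‖ * (Real.exp n * (Real.exp n * ‖ξ‖)) := by
  have hE : ∀ z : ℂ, |z.im| ≤ 1 → ‖mulBy V (cexpLog l n z)‖ ≤ Real.exp n := fun z hz =>
    norm_mulBy_le V (Real.exp_pos _).le fun k => (norm_cexpLog_le n z k).trans
      (Real.exp_le_exp.2 (by nlinarith [n.cast_nonneg (α := ℝ)]))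
  have hz : |z.im| ≤ 1 := by rw [abs_of_nonneg h0]; linarith
  refine (norm_inner_le_norm _ _).trans (mul_le_mul_of_nonneg_left ?_ (norm_nonneg _))
  refine (ContinuousLinearMap.le_of_opNorm_le _ (hE z hz) _).trans
    (mul_le_mul_of_nonneg_left ?_ (Real.exp_pos _).le)
  refine (ContinuousLinearMap.le_of_opNorm_le _ (hW.norm_le _ (im_exp_nonneg h0 h1 hs)) _).trans ?_
  rw [one_mul]
  exact ContinuousLinearMap.le_of_opNorm_le _ (hE (-z) (by simpa using hz)) _

/-- Borchers' theorem for standard subspaces. -/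
theorem borchers (hM : IsLogModel K V l) (hc : Cyclic K) (hsep : Separating K)
    {u : ℝ → 𝓗 →L[ℂ] 𝓗} {W : ℂ → 𝓗 →L[ℂ] 𝓗}
    (hW : PositiveExtension u W) (hu : ∀ s, 0 ≤ s → ∀ x ∈ K, u s x ∈ K) {s : ℝ} (hs : 0 < s)
    (t : ℝ) (x : 𝓗) :
    modular V l t (u (Real.exp (2 * Real.pi * t) * s) (modular V l (-t) x)) = u s x := by
  have hl := hM.measurable
  have hreal : ∀ {k k' : 𝓗}, k ∈ K → k' ∈ K.symplComp → (⟪k, k'⟫_ℂ).im = 0 := fun hk hk' =>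
    mem_symplComp_iff.1 hk' _ hk
  have hreal' : ∀ {k k' : 𝓗}, k ∈ K → k' ∈ K.symplComp → (⟪k', k⟫_ℂ).im = 0 := fun hk hk' => by
    rw [← inner_conj_symm, Complex.conj_im, hreal hk hk', neg_zero]
  -- the relation between vectors of `K` and `K'`
  have key : ∀ ξ ∈ K, ∀ η ∈ K.symplComp,
      ⟪η, modular V l t (u (Real.exp (2 * Real.pi * t) * s) (modular V l (-t) ξ))⟫_ℂ =
        ⟪η, u s ξ⟫_ℂ := by
    intro ξ₀ hξ₀ η₀ hη₀
    have hn : ∀ n : ℕ, ⟪mulBy V (fun k => (cutoff n (l k) : ℂ)) η₀,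
        modular V l t (u (Real.exp (2 * Real.pi * t) * s) (modular V l (-t)
          (mulBy V (fun k => (cutoff n (l k) : ℂ)) ξ₀)))⟫_ℂ =
        ⟪mulBy V (fun k => (cutoff n (l k) : ℂ)) η₀,
          u s (mulBy V (fun k => (cutoff n (l k) : ℂ)) ξ₀)⟫_ℂ := by
      intro n
      set ξ := mulBy V (fun k => (cutoff n (l k) : ℂ)) ξ₀ with hξ
      set η := mulBy V (fun k => (cutoff n (l k) : ℂ)) η₀ with hη
      have hξK : ξ ∈ K := hM.cutoff_mem n hξ₀
      have hηK : η ∈ K.symplComp := by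
        have := hM.symplComp.cutoff_mem n hη₀
        rwa [IsLogModel.cutoff_neg_log] at this
      have hbot : ∀ t : ℝ, borchersFun V l n W s η ξ t =
          ⟪η, modular V l t (u (Real.exp (2 * Real.pi * t) * s) (modular V l (-t) ξ))⟫_ℂ := by
        intro t
        rw [borchersFun, inner_mulBy_cexpLog hl, Complex.conj_ofReal]
        have e1 : mulBy V (cexpLog l n (-(t : ℂ))) ξ = modular V l (-t) ξ := by
          have := mulBy_cexpLog_ofReal hM n (-t) ξ₀
          rwa [Complex.ofReal_neg] at this
        have e2 : mulBy V (cexpLog l n (-(t : ℂ))) η = modular V l (-t) η := by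
          have := mulBy_cexpLog_ofReal hM n (-t) η₀
          rwa [Complex.ofReal_neg] at this
        rw [e1, e2, inner_modular V hl, neg_neg]
        have e3 : Complex.exp (2 * Real.pi * t) * s = ((Real.exp (2 * Real.pi * t) * s : ℝ) : ℂ) := by
          push_cast; rfl
        rw [e3, hW.ofReal]
      have hcon := strip_constant (diffContOnCl_borchersFun (V := V) hl hW n hs η ξ)
        (norm_borchersFun_le hW n hs.le η ξ) ?_ ?_ t
      · rw [hbot, ← Complex.ofReal_zero, hbot] at hcon
        simpa [modular_zero] using hcon
      · intro z hz
        -- On the lower edge one pairs a vector of K', moved by the modular group, with one of K,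
        -- moved by the modular group and a forward translation. Such a pairing is real.
        have hzt : z = ((z.re : ℝ) : ℂ) := Complex.ext rfl (by simp [hz])
        rw [hzt, hbot, ← neg_neg z.re, ← inner_modular V hl, neg_neg]
        refine hreal' (hu _ (by positivity) _ (hM.modular_mem _ hξK)) (hM.modular_mem_symplComp _ hηK)
      · intro z hz
        -- On the upper edge each side acquires a half power of Δ or of its inverse, which sends ξ ∈
        -- K into K' and η ∈ K' into K. Moreover e^{2πz} = -e^{2πr}, and the backward translation so
        -- produced becomes a forward one on the other factor. The pairing is again between K and
        -- K', hence real.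
        set r := z.re
        have hzt : z = r + Complex.I / 2 := Complex.ext (by simp [r]) (by simp [hz])
        have e1 : mulBy V (cexpLog l n (-z)) ξ =
            modular V l (-r) (mulBy V (fun k => (IsLogModel.halfExp n (l k) : ℂ)) ξ) := by
          have h1 : cexpLog l n (-z) = fun k => cexpLog l n ((-r : ℝ) : ℂ) k *
              (IsLogModel.halfExp n (l k) : ℂ) := by
            funext k
            rw [← cexpLog_half, ← cexpLog_add, hzt]
            push_cast
            ring_nf
          have he : BddMeas fun k => (IsLogModel.halfExp n (l k) : ℂ) :=
            bddMeas_comp_log hl (IsLogModel.continuous_halfExp n) (IsLogModel.abs_halfExp_le n)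
          rw [h1, mulBy_mul V (bddMeas_cexpLog hl n _) he, hξ,
            mulBy_comm V he (hM.bddMeas_cutoff n), mulBy_cexpLog_ofReal hM]
        have e2 : mulBy V (cexpLog l n (-(starRingEnd ℂ) z)) η =
            modular V l (-r) (mulBy V (fun k => (IsLogModel.halfExp n (-1 * l k) : ℂ)) η) := by
          have h1 : cexpLog l n (-(starRingEnd ℂ) z) = fun k => cexpLog l n ((-r : ℝ) : ℂ) k *
              (IsLogModel.halfExp n (-1 * l k) : ℂ) := by
            funext k
            have h2 : (IsLogModel.halfExp n (-1 * l k) : ℂ) = cexpLog l n (Complex.I / 2) k := by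
              rw [neg_one_mul, IsLogModel.halfExp_neg, Complex.ofReal_inv, ← cexpLog_half, cexpLog,
                cexpLog, ← Complex.exp_neg]
              ring_nf
            rw [h2, ← cexpLog_add, hzt]
            congr 1
            rw [map_add, map_div₀, Complex.conj_I, Complex.conj_ofReal, map_ofNat]
            push_cast
            ring
          have he : BddMeas fun k => (IsLogModel.halfExp n (-1 * l k) : ℂ) :=
            bddMeas_comp_log (hl.const_mul (-1)) (IsLogModel.continuous_halfExp n)
              (IsLogModel.abs_halfExp_le n)
          rw [h1, mulBy_mul V (bddMeas_cexpLog hl n _) he, hη,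
            mulBy_comm V he (hM.bddMeas_cutoff n), mulBy_cexpLog_ofReal hM]
        have hξ' : mulBy V (fun k => (IsLogModel.halfExp n (l k) : ℂ)) ξ ∈ K.symplComp :=
          hM.halfExp_mem n hξ₀
        have hη' : mulBy V (fun k => (IsLogModel.halfExp n (-1 * l k) : ℂ)) η ∈ K := by
          have := hM.symplComp.halfExp_mem n hη₀
          rwa [IsLogModel.cutoff_neg_log, symplComp_symplComp_eq] at this
        have e3 : Complex.exp (2 * Real.pi * z) * s =
            ((-(Real.exp (2 * Real.pi * r) * s) : ℝ) : ℂ) := by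
          have : (2 * Real.pi * z : ℂ) = ((2 * Real.pi * r : ℝ) : ℂ) + Real.pi * Complex.I := by
            rw [hzt]; push_cast; ring
          rw [this, Complex.exp_add, Complex.exp_pi_mul_I]
          push_cast
          ring
        rw [borchersFun, inner_mulBy_cexpLog hl, e1, e2, e3, hW.ofReal, ← hW.inner_eq]
        exact hreal (hu _ (by positivity) _ (hM.modular_mem _ hη')) (hM.modular_mem_symplComp _ hξ')
    have hξl := hM.tendsto_mulBy_cutoff ξ₀
    have hηl := hM.tendsto_mulBy_cutoff η₀
    have hA : Tendsto (fun n => ⟪mulBy V (fun k => (cutoff n (l k) : ℂ)) η₀,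
        modular V l t (u (Real.exp (2 * Real.pi * t) * s) (modular V l (-t)
          (mulBy V (fun k => (cutoff n (l k) : ℂ)) ξ₀)))⟫_ℂ) atTop
        (nhds ⟪η₀, modular V l t (u (Real.exp (2 * Real.pi * t) * s) (modular V l (-t) ξ₀))⟫_ℂ) :=
      hηl.inner ((((modular V l t).comp ((u (Real.exp (2 * Real.pi * t) * s)).comp
        (modular V l (-t)))).continuous.tendsto _).comp hξl)
    have hB : Tendsto (fun n => ⟪mulBy V (fun k => (cutoff n (l k) : ℂ)) η₀,
        u s (mulBy V (fun k => (cutoff n (l k) : ℂ)) ξ₀)⟫_ℂ) atTop (nhds ⟪η₀, u s ξ₀⟫_ℂ) :=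
      hηl.inner (((u s).continuous.tendsto _).comp hξl)
    exact tendsto_nhds_unique (hA.congr hn) hB
  -- extension to all vectors
  have hK : ∀ ξ ∈ K, modular V l t (u (Real.exp (2 * Real.pi * t) * s) (modular V l (-t) ξ)) =
      u s ξ := by
    intro ξ hξ
    rw [← sub_eq_zero]
    refine hsep.symplComp_cyclic _ fun η hη => ?_
    rw [inner_sub_right, key ξ hξ η hη, sub_self]
  rw [← sub_eq_zero]
  refine ext_inner_left ℂ fun v => ?_
  rw [inner_zero_right]
  set A : 𝓗 →L[ℂ] 𝓗 := (modular V l t).comp ((u (Real.exp (2 * Real.pi * t) * s)).comp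
    (modular V l (-t))) - u s with hA
  have h0 : ContinuousLinearMap.adjoint A v = 0 := by
    refine hc _ fun ξ hξ => ?_
    rw [ContinuousLinearMap.adjoint_inner_right]
    have : A ξ = 0 := sub_eq_zero.2 (hK ξ hξ)
    rw [this, inner_zero_left]
  change ⟪v, A x⟫_ℂ = 0
  rw [← ContinuousLinearMap.adjoint_inner_left, h0, inner_zero_left]

end modularSubspace

/-! ### Direct integrals and decomposable operators -/

section decomposable

variable {X : Type*} [MeasurableSpace X] {E : X → Type*} [∀ x, NormedAddCommGroup (E x)]
  [∀ x, InnerProductSpace ℂ (E x)]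

namespace MeasurableField

variable (F : MeasurableField E)

theorem measurable_inner {ξ η : ∀ x, E x} (hξ : ξ ∈ F.sections) (hη : η ∈ F.sections) :
    Measurable fun x => ⟪ξ x, η x⟫_ℂ := by
  have h1 := F.measurable_norm _ (F.sections.add_mem hξ hη)
  have h2 := F.measurable_norm _ (F.sections.sub_mem hξ hη)
  have h3 := F.measurable_norm _ (F.sections.sub_mem hξ (F.sections.smul_mem Complex.I hη))
  have h4 := F.measurable_norm _ (F.sections.add_mem hξ (F.sections.smul_mem Complex.I hη))
  simp only [Pi.add_apply, Pi.sub_apply, Pi.smul_apply] at h1 h2 h3 h4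
  simp only [inner_eq_sum_norm_sq_div_four]
  have := Complex.measurable_ofReal
  exact ((((this.comp h1).pow_const 2).sub ((this.comp h2).pow_const 2)).add
    ((((this.comp h3).pow_const 2).sub ((this.comp h4).pow_const 2)).mul_const _)).div_const _

open Classical in
theorem indicator_mem {ξ : ∀ x, E x} (hξ : ξ ∈ F.sections) {s : Set X} (hs : MeasurableSet s) :
    (fun x => if x ∈ s then ξ x else 0) ∈ F.sections := by
  refine F.mem_of_measurable_inner _ fun χ hχ => ?_
  have : (fun x => ⟪χ x, if x ∈ s then ξ x else 0⟫_ℂ) =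
      s.indicator fun x => ⟪χ x, ξ x⟫_ℂ := by
    funext x
    by_cases hx : x ∈ s <;> simp [hx]
  rw [this]
  exact (F.measurable_inner hχ hξ).indicator hs

theorem mem_of_tendsto {ξ : ℕ → ∀ x, E x} (hξ : ∀ n, ξ n ∈ F.sections) {η : ∀ x, E x}
    (h : ∀ x, Tendsto (fun n => ξ n x) atTop (nhds (η x))) : η ∈ F.sections := by
  refine F.mem_of_measurable_inner _ fun χ hχ => ?_
  refine measurable_of_tendsto_metrizable (fun n => F.measurable_inner hχ (hξ n)) ?_
  rw [tendsto_pi_nhds]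
  exact fun x => tendsto_const_nhds.inner (h x)

end MeasurableField

variable {μ : Measure X} {F : MeasurableField E} {𝓗 : Type*} [NormedAddCommGroup 𝓗]
  [InnerProductSpace ℂ 𝓗]

/-- `Φ` identifies `𝓗` with the direct integral of the Hilbert spaces `E x`. -/
structure IsIntegralModel (Φ : F.squareIntegrable μ →ₗ[ℂ] 𝓗) : Prop where
  surjective : Function.Surjective Φ
  inner_eq : ∀ ξ η : F.squareIntegrable μ, ⟪Φ ξ, Φ η⟫_ℂ = ∫ x, ⟪ξ.1 x, η.1 x⟫_ℂ ∂μ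

/-- The operator `A` is decomposable, with components `b x`. -/
def Decomposes (Φ : F.squareIntegrable μ →ₗ[ℂ] 𝓗) (A : 𝓗 →L[ℂ] 𝓗)
    (b : ∀ x, E x →L[ℂ] E x) : Prop :=
  ∀ ξ : F.squareIntegrable μ, ∃ η : F.squareIntegrable μ, Φ η = A (Φ ξ) ∧
    ∀ᵐ x ∂μ, η.1 x = b x (ξ.1 x)

variable {Φ : F.squareIntegrable μ →ₗ[ℂ] 𝓗}

namespace IsIntegralModel

theorem norm_sq_eq (hΦ : IsIntegralModel Φ) (ξ : F.squareIntegrable μ) :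
    ‖Φ ξ‖ ^ 2 = ∫ x, ‖ξ.1 x‖ ^ 2 ∂μ := by
  have h := hΦ.inner_eq ξ ξ
  simp only [inner_self_eq_norm_sq_to_K] at h
  have h2 : (∫ x, ((‖ξ.1 x‖ : ℂ)) ^ 2 ∂μ) = ((∫ x, ‖ξ.1 x‖ ^ 2 ∂μ : ℝ) : ℂ) := by
    have := integral_ofReal (𝕜 := ℂ) (μ := μ) (f := fun x => ‖ξ.1 x‖ ^ 2)
    simpa using this
  have h3 : ((‖Φ ξ‖ ^ 2 : ℝ) : ℂ) = ((∫ x, ‖ξ.1 x‖ ^ 2 ∂μ : ℝ) : ℂ) := by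
    rw [← h2]; push_cast; exact h
  exact_mod_cast h3

theorem integrable_norm_sq (ξ : F.squareIntegrable μ) : Integrable (fun x => ‖ξ.1 x‖ ^ 2) μ :=
  ξ.2.2.integrable_sq

theorem norm_le (hΦ : IsIntegralModel Φ) {ξ η : F.squareIntegrable μ} {C : ℝ} (hC : 0 ≤ C)
    (h : ∀ᵐ x ∂μ, ‖ξ.1 x‖ ≤ C * ‖η.1 x‖) : ‖Φ ξ‖ ≤ C * ‖Φ η‖ := by
  refine le_of_sq_le_sq ?_ (by positivity)
  rw [mul_pow, hΦ.norm_sq_eq, hΦ.norm_sq_eq, ← integral_const_mul]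
  refine integral_mono_ae (integrable_norm_sq ξ) ((integrable_norm_sq η).const_mul _) ?_
  filter_upwards [h] with x hx
  rw [← mul_pow]
  exact pow_le_pow_left₀ (norm_nonneg _) hx 2

theorem congr (hΦ : IsIntegralModel Φ) {ξ η : F.squareIntegrable μ}
    (h : ∀ᵐ x ∂μ, ξ.1 x = η.1 x) : Φ ξ = Φ η := by
  have := hΦ.norm_le (ξ := ξ - η) (η := 0) le_rfl (by
    filter_upwards [h] with x hx
    simp [hx])
  rw [zero_mul, norm_le_zero_iff, map_sub, sub_eq_zero] at this
  exact this

theorem tendsto (hΦ : IsIntegralModel Φ) {ξ : ℕ → F.squareIntegrable μ}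
    {η χ : F.squareIntegrable μ} {C : ℝ} (hb : ∀ n, ∀ᵐ x ∂μ, ‖(ξ n).1 x‖ ≤ C * ‖χ.1 x‖)
    (h : ∀ᵐ x ∂μ, Tendsto (fun n => (ξ n).1 x) atTop (nhds (η.1 x))) :
    Tendsto (fun n => Φ (ξ n)) atTop (nhds (Φ η)) := by
  rw [tendsto_iff_norm_sub_tendsto_zero]
  have hsq : Tendsto (fun n => ‖Φ (ξ n) - Φ η‖ ^ 2) atTop (nhds 0) := by
    simp only [← map_sub, hΦ.norm_sq_eq]
    have hz : (∫ _ : X, (0 : ℝ) ∂μ) = 0 := integral_zero _ _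
    rw [← hz]
    refine tendsto_integral_of_dominated_convergence (fun x => (2 * C) ^ 2 * ‖χ.1 x‖ ^ 2)
      (fun n => (integrable_norm_sq (ξ n - η)).1) ((integrable_norm_sq χ).const_mul _) ?_ ?_
    · intro n
      filter_upwards [h, ae_all_iff.2 hb] with x hx hbx
      have h1 : ‖η.1 x‖ ≤ C * ‖χ.1 x‖ := le_of_tendsto hx.norm (Eventually.of_forall hbx)
      have h2 : ‖(ξ n - η).1 x‖ ≤ 2 * C * ‖χ.1 x‖ :=
        (norm_sub_le _ _).trans (by linarith [hbx n])
      rw [norm_pow, norm_norm, ← mul_pow]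
      exact pow_le_pow_left₀ (norm_nonneg _) h2 2
    · filter_upwards [h] with x hx
      have := (tendsto_iff_norm_sub_tendsto_zero.1 hx).pow 2
      simpa using this
  have := hsq.sqrt
  simpa [Real.sqrt_sq (norm_nonneg _)] using this

end IsIntegralModel

namespace Decomposes

variable {A A' : 𝓗 →L[ℂ] 𝓗} {b b' : ∀ x, E x →L[ℂ] E x}

theorem unique (hΦ : IsIntegralModel Φ) (h : Decomposes Φ A b) (h' : Decomposes Φ A' b')
    (hb : ∀ᵐ x ∂μ, b x = b' x) : A = A' := by
  ext v
  obtain ⟨ξ, rfl⟩ := hΦ.surjective v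
  obtain ⟨η, h1, h2⟩ := h ξ
  obtain ⟨η', h1', h2'⟩ := h' ξ
  rw [← h1, ← h1']
  refine hΦ.congr ?_
  filter_upwards [h2, h2', hb] with x e e' e''
  rw [e, e', e'']

theorem opNorm_le (hΦ : IsIntegralModel Φ) (h : Decomposes Φ A b) {C : ℝ} (hC : 0 ≤ C)
    (hb : ∀ᵐ x ∂μ, ‖b x‖ ≤ C) : ‖A‖ ≤ C := by
  refine A.opNorm_le_bound hC fun v => ?_
  obtain ⟨ξ, rfl⟩ := hΦ.surjective v
  obtain ⟨η, h1, h2⟩ := h ξ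
  rw [← h1]
  refine hΦ.norm_le hC ?_
  filter_upwards [h2, hb] with x e e'
  rw [e]
  exact (b x).le_of_opNorm_le e' _

theorem comp (h : Decomposes Φ A b) (h' : Decomposes Φ A' b') :
    Decomposes Φ (A.comp A') fun x => (b x).comp (b' x) := by
  intro ξ
  obtain ⟨η', h1', h2'⟩ := h' ξ
  obtain ⟨η, h1, h2⟩ := h η'
  refine ⟨η, by rw [h1, h1']; rfl, ?_⟩
  filter_upwards [h2, h2'] with x e e'
  rw [e, e']
  rfl

theorem add (h : Decomposes Φ A b) (h' : Decomposes Φ A' b') :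
    Decomposes Φ (A + A') fun x => b x + b' x := by
  intro ξ
  obtain ⟨η', h1', h2'⟩ := h' ξ
  obtain ⟨η, h1, h2⟩ := h ξ
  refine ⟨η + η', by rw [map_add, h1, h1']; rfl, ?_⟩
  filter_upwards [h2, h2'] with x e e'
  change η.1 x + η'.1 x = _
  rw [e, e']
  rfl

theorem const_smul (c : ℂ) (h : Decomposes Φ A b) : Decomposes Φ (c • A) fun x => c • b x := by
  intro ξ
  obtain ⟨η, h1, h2⟩ := h ξ
  refine ⟨c • η, by rw [map_smul, h1]; rfl, ?_⟩
  filter_upwards [h2] with x e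
  change c • η.1 x = _
  rw [e]
  rfl

theorem sub (h : Decomposes Φ A b) (h' : Decomposes Φ A' b') :
    Decomposes Φ (A - A') fun x => b x - b' x := by
  have := h.add (h'.const_smul (-1))
  simpa only [neg_one_smul, ← sub_eq_add_neg] using this

theorem congr_ae (h : Decomposes Φ A b) (hb : ∀ᵐ x ∂μ, b x = b' x) : Decomposes Φ A b' := by
  intro ξ
  obtain ⟨η, h1, h2⟩ := h ξ
  refine ⟨η, h1, ?_⟩
  filter_upwards [h2, hb] with x e e'
  rw [e, e']

open Classical in
/-- Bounded strong limits of decomposable operators are decomposable. -/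
theorem exists_limit [CompleteSpace 𝓗] (hΦ : IsIntegralModel Φ) {A : ℕ → 𝓗 →L[ℂ] 𝓗}
    {b : ℕ → ∀ x, E x →L[ℂ] E x} {b' : ∀ x, E x →L[ℂ] E x} (h : ∀ n, Decomposes Φ (A n) (b n))
    {C : ℝ} (hC : ∀ n, ∀ᵐ x ∂μ, ‖b n x‖ ≤ C)
    (hlim : ∀ᵐ x ∂μ, ∀ v, Tendsto (fun n => b n x v) atTop (nhds (b' x v))) :
    ∃ A', Decomposes Φ A' b' ∧ ∀ v, Tendsto (fun n => A n v) atTop (nhds (A' v)) := by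
  have key : ∀ ξ : F.squareIntegrable μ, ∃ η : F.squareIntegrable μ,
      Tendsto (fun n => A n (Φ ξ)) atTop (nhds (Φ η)) ∧ ∀ᵐ x ∂μ, η.1 x = b' x (ξ.1 x) := by
    intro ξ
    choose η h1 h2 using fun n => h n ξ
    -- All almost-everywhere conditions are collected in one measurable null set. Putting the limit
    -- equal to 0 there makes the sections converge at every point, so the limit section is
    -- measurable.
    obtain ⟨s, hs, hsm, hs0⟩ := exists_measurable_superset_of_null
      ((ae_all_iff.2 h2).and ((ae_all_iff.2 hC).and hlim))
    have hgood : ∀ x, x ∉ s → (∀ n, (η n).1 x = b n x (ξ.1 x)) ∧ (∀ n, ‖b n x‖ ≤ C) ∧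
        ∀ v, Tendsto (fun n => b n x v) atTop (nhds (b' x v)) := by
      intro x hx
      by_contra hne
      exact hx (hs hne)
    have hae : ∀ᵐ x ∂μ, x ∉ s := measure_eq_zero_iff_ae_notMem.1 hs0
    let ζ : ∀ x, E x := fun x => if x ∈ sᶜ then b' x (ξ.1 x) else 0
    have hζm : ζ ∈ F.sections := by
      refine F.mem_of_tendsto (fun n => F.indicator_mem (η n).2.1 hsm.compl) fun x => ?_
      by_cases hx : x ∈ s
      · simp [ζ, hx]
      · have := (hgood x hx).2.2 (ξ.1 x)
        simpa [ζ, hx, (hgood x hx).1] using this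
    have hζ2 : MemLp (fun x => ‖ζ x‖) 2 μ := by
      refine (ξ.2.2.const_mul C).mono (F.measurable_norm _ hζm).aestronglyMeasurable ?_
      filter_upwards [hae] with x hx
      have h3 : ‖b' x (ξ.1 x)‖ ≤ C * ‖ξ.1 x‖ :=
        le_of_tendsto ((hgood x hx).2.2 (ξ.1 x)).norm (Eventually.of_forall fun n =>
          (b n x).le_of_opNorm_le ((hgood x hx).2.1 n) _)
      have h4 : ζ x = b' x (ξ.1 x) := if_pos hx
      rw [norm_norm, h4]
      exact h3.trans (le_abs_self _)
    refine ⟨⟨ζ, hζm, hζ2⟩, ?_, ?_⟩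
    · simp only [← h1]
      refine hΦ.tendsto (χ := ξ) (C := C) (fun n => ?_) ?_
      · filter_upwards [hae] with x hx
        rw [(hgood x hx).1 n]
        exact (b n x).le_of_opNorm_le ((hgood x hx).2.1 n) _
      · filter_upwards [hae] with x hx
        have h4 : ζ x = b' x (ξ.1 x) := if_pos hx
        simp only [(hgood x hx).1]
        rw [h4]
        exact (hgood x hx).2.2 _
    · filter_upwards [hae] with x hx
      exact if_pos hx
  have hex : ∀ v, ∃ w, Tendsto (fun n => A n v) atTop (nhds w) := by
    intro v
    obtain ⟨ξ, rfl⟩ := hΦ.surjective v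
    obtain ⟨η, h1, -⟩ := key ξ
    exact ⟨_, h1⟩
  choose f hf using hex
  refine ⟨continuousLinearMapOfTendsto A (tendsto_pi_nhds.2 hf), fun ξ => ?_, hf⟩
  obtain ⟨η, h1, h2⟩ := key ξ
  exact ⟨η, tendsto_nhds_unique h1 (hf _), h2⟩

end Decomposes

end decomposable

/-! ### Amplification of operators to multiples of a representation -/

section amplification

variable {G E ι : Type*} [NormedAddCommGroup G] [InnerProductSpace ℂ G]
  [NormedAddCommGroup E] [InnerProductSpace ℂ E]

open Classical in
/-- The amplification of an operator on `G` to a multiple `E` of `G`. -/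
def amplification (J : ι → G →ₗᵢ[ℂ] E) (a : G →L[ℂ] G) : E →L[ℂ] E :=
  if h : ∃ b : E →L[ℂ] E, ‖b‖ ≤ ‖a‖ ∧ ∀ i f, b (J i f) = J i (a f) then h.choose else 0

/-- The default value 0 makes the bound unconditional, so it is available at every mass and not just
at almost every one. -/
theorem norm_amplification_le (J : ι → G →ₗᵢ[ℂ] E) (a : G →L[ℂ] G) :
    ‖amplification J a‖ ≤ ‖a‖ := by
  unfold amplification
  split_ifs with h
  · exact h.choose_spec.1
  · simp

/-- A uniformly bounded sequence of operators converging strongly on a dense set converges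
strongly. -/
theorem tendsto_of_dense {E' : Type*} [NormedAddCommGroup E'] [NormedSpace ℂ E'] {S : Set E'}
    (hS : Dense S) {b : ℕ → E' →L[ℂ] E} {b' : E' →L[ℂ] E} {C : ℝ} (hC : ∀ n, ‖b n‖ ≤ C)
    (h : ∀ v ∈ S, Tendsto (fun n => b n v) atTop (nhds (b' v))) (v : E') :
    Tendsto (fun n => b n v) atTop (nhds (b' v)) := by
  have hC0 : 0 ≤ C := (norm_nonneg _).trans (hC 0)
  rw [Metric.tendsto_atTop]
  intro ε hε
  set δ := ε / (2 * (C + ‖b'‖ + 1)) with hδ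
  have hpos : 0 < C + ‖b'‖ + 1 := by positivity
  obtain ⟨w, hw, hvw⟩ := Metric.dense_iff.1 hS v δ (by positivity)
  obtain ⟨N, hN⟩ := Metric.tendsto_atTop.1 (h w hvw) (ε / 2) (half_pos hε)
  refine ⟨N, fun n hn => ?_⟩
  have hwv : ‖v - w‖ < δ := by rw [← dist_eq_norm, dist_comm]; exact hw
  have h1 : b n v - b' v = b n (v - w) + (b n w - b' w) - b' (v - w) := by
    rw [map_sub, map_sub]; abel
  rw [dist_eq_norm, h1]
  have h2 : ‖b n (v - w)‖ ≤ C * ‖v - w‖ := (b n).le_of_opNorm_le (hC n) _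
  have h3 := b'.le_opNorm (v - w)
  have h4 := hN n hn
  rw [dist_eq_norm] at h4
  have h5 : (C + ‖b'‖) * ‖v - w‖ ≤ ε / 2 := by
    have : (C + ‖b'‖ + 1) * δ = ε / 2 := by rw [hδ]; field_simp
    rw [← this]
    exact mul_le_mul (by linarith) hwv.le (norm_nonneg _) hpos.le
  calc _ ≤ ‖b n (v - w)‖ + ‖b n w - b' w‖ + ‖b' (v - w)‖ :=
        (norm_sub_le _ _).trans (add_le_add_left (norm_add_le _ _) _)
    _ < ε := by linarith

variable [CompleteSpace E] {J : ι → G →ₗᵢ[ℂ] E}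

/-- The operator acts componentwise on the ℓ² sum of copies of G, which the Hilbert sum identifies
with E. -/
theorem exists_amplification (hJ : IsHilbertSum ℂ (fun _ => G) J) (a : G →L[ℂ] G) :
    ∃ b : E →L[ℂ] E, ‖b‖ ≤ ‖a‖ ∧ ∀ i f, b (J i f) = J i (a f) := by
  classical
  have h2 : 0 < (2 : ℝ≥0∞).toReal := by norm_num
  have hle : ∀ (f : lp (fun _ : ι => G) 2) i,
      ‖a (f i)‖ ^ (2 : ℝ≥0∞).toReal ≤ ‖a‖ ^ (2 : ℝ≥0∞).toReal * ‖f i‖ ^ (2 : ℝ≥0∞).toReal := by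
    intro f i
    rw [← Real.mul_rpow (norm_nonneg _) (norm_nonneg _)]
    exact Real.rpow_le_rpow (norm_nonneg _) (a.le_opNorm _) h2.le
  have hmem : ∀ f : lp (fun _ : ι => G) 2, Memℓp (fun i => a (f i)) 2 := fun f =>
    memℓp_gen (Summable.of_nonneg_of_le (fun i => by positivity) (hle f)
      (((lp.memℓp f).summable h2).mul_left _))
  let L : lp (fun _ : ι => G) 2 →ₗ[ℂ] lp (fun _ : ι => G) 2 :=
    { toFun := fun f => ⟨fun i => a (f i), hmem f⟩
      map_add' := fun f g => by ext i; exact map_add a _ _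
      map_smul' := fun c f => by ext i; exact map_smul a _ _ }
  have hL : ∀ f, ‖L f‖ ≤ ‖a‖ * ‖f‖ := by
    intro f
    refine lp.norm_le_of_forall_sum_le h2 (by positivity) fun s => ?_
    rw [Real.mul_rpow (norm_nonneg _) (norm_nonneg _), lp.norm_rpow_eq_tsum h2 f, ← tsum_mul_left]
    exact (Finset.sum_le_sum fun i _ => hle f i).trans
      ((((lp.memℓp f).summable h2).mul_left _).sum_le_tsum s fun i _ => by positivity)
  let W := hJ.linearIsometryEquiv
  let b : E →ₗ[ℂ] E := W.symm.toLinearEquiv.toLinearMap ∘ₗ L ∘ₗ W.toLinearEquiv.toLinearMap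
  have hb : ∀ v, b v = W.symm (L (W v)) := fun _ => rfl
  refine ⟨b.mkContinuous ‖a‖ fun v => ?_, LinearMap.mkContinuous_norm_le _ (norm_nonneg _) _, ?_⟩
  · rw [hb, LinearIsometryEquiv.norm_map]
    simpa using hL (W v)
  · intro i f
    rw [LinearMap.mkContinuous_apply, hb]
    have h1 : W (J i f) = lp.single 2 i f := by
      rw [← hJ.linearIsometryEquiv_symm_apply_single, LinearIsometryEquiv.apply_symm_apply]
    have h3 : L (lp.single 2 i f) = lp.single 2 i (a f) := by
      ext j
      change a ((lp.single 2 i f : lp (fun _ : ι => G) 2) j) = _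
      rw [lp.single_apply, lp.single_apply]
      by_cases hij : j = i
      · subst hij; simp
      · simp [hij]
    rw [h1, h3, hJ.linearIsometryEquiv_symm_apply_single]

theorem amplification_apply (hJ : IsHilbertSum ℂ (fun _ => G) J) (a : G →L[ℂ] G) (i : ι) (f : G) :
    amplification J a (J i f) = J i (a f) := by
  have h := exists_amplification hJ a
  rw [amplification, dif_pos h]
  exact h.choose_spec.2 i f

theorem mem_of_isHilbertSum (hJ : IsHilbertSum ℂ (fun _ => G) J) {S : Submodule ℂ E}
    (hS : IsClosed (S : Set E)) (h : ∀ i f, J i f ∈ S) (v : E) : v ∈ S := by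
  have hs := hJ.hasSum_linearIsometryEquiv_symm (hJ.linearIsometryEquiv v)
  rw [LinearIsometryEquiv.symm_apply_apply] at hs
  exact hS.mem_of_tendsto hs (Eventually.of_forall fun s => S.sum_mem fun i _ => h i _)

/-- A bounded operator is determined by its values on the copies, since they span a dense subspace.
The algebraic rules below are instances of this uniqueness. -/
theorem eq_amplification (hJ : IsHilbertSum ℂ (fun _ => G) J) {b : E →L[ℂ] E} {a : G →L[ℂ] G}
    (h : ∀ i f, b (J i f) = J i (a f)) : b = amplification J a := by
  ext v
  have := mem_of_isHilbertSum hJ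
    (S := LinearMap.ker (b - amplification J a : E →L[ℂ] E).toLinearMap)
    (b - amplification J a).isClosed_ker (fun i f => by simp [h, amplification_apply hJ]) v
  simpa [sub_eq_zero] using this

theorem amplification_comp (hJ : IsHilbertSum ℂ (fun _ => G) J) (a a' : G →L[ℂ] G) :
    (amplification J a).comp (amplification J a') = amplification J (a.comp a') :=
  eq_amplification hJ fun i f => by simp [amplification_apply hJ]

theorem amplification_add (hJ : IsHilbertSum ℂ (fun _ => G) J) (a a' : G →L[ℂ] G) :
    amplification J a + amplification J a' = amplification J (a + a') :=
  eq_amplification hJ fun i f => by simp [amplification_apply hJ]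

theorem amplification_smul (hJ : IsHilbertSum ℂ (fun _ => G) J) (c : ℂ) (a : G →L[ℂ] G) :
    c • amplification J a = amplification J (c • a) :=
  eq_amplification hJ fun i f => by simp [amplification_apply hJ]

theorem tendsto_amplification (hJ : IsHilbertSum ℂ (fun _ => G) J) {a : ℕ → G →L[ℂ] G}
    {a' : G →L[ℂ] G} {C : ℝ} (hC : ∀ n, ‖a n‖ ≤ C)
    (h : ∀ f, Tendsto (fun n => a n f) atTop (nhds (a' f))) (v : E) :
    Tendsto (fun n => amplification J (a n) v) atTop (nhds (amplification J a' v)) := by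
  have hd : Dense (Submodule.span ℂ (⋃ i, Set.range (J i)) : Set E) := by
    intro v
    have := mem_of_isHilbertSum hJ
      (S := (Submodule.span ℂ (⋃ i, Set.range (J i))).topologicalClosure)
      (Submodule.isClosed_topologicalClosure _) (fun i f => Submodule.le_topologicalClosure _
        (Submodule.subset_span (Set.mem_iUnion.2 ⟨i, f, rfl⟩))) v
    exact this
  refine tendsto_of_dense hd (fun n => (norm_amplification_le J (a n)).trans (hC n))
    (fun w hw => ?_) v
  induction hw using Submodule.span_induction with
  | mem w hw =>
    obtain ⟨i, f, rfl⟩ := Set.mem_iUnion.1 hw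
    simp only [amplification_apply hJ]
    exact ((J i).continuous.tendsto _).comp (h f)
  | zero => simp
  | add x y _ _ hx hy => simpa using hx.add hy
  | smul c x _ hx => simpa using hx.const_smul c

end amplification

/-! ### Step functions as limits of polynomials and sines -/

section signApproximation

/-- A polynomial whose iterates on `[-1, 1]` converge to the sign function. -/
def smoothStep (y : ℝ) : ℝ := (3 * y - y ^ 3) / 2

theorem abs_smoothStep_le {y : ℝ} (h : |y| ≤ 1) : |smoothStep y| ≤ 1 := by
  obtain ⟨h1, h2⟩ := abs_le.1 h
  rw [smoothStep, abs_le]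
  constructor
  · nlinarith [mul_nonneg (sq_nonneg (1 + y)) (by linarith : 0 ≤ 2 - y)]
  · nlinarith [mul_nonneg (sq_nonneg (1 - y)) (by linarith : 0 ≤ 2 + y)]

theorem abs_iterate_smoothStep_le (k : ℕ) {y : ℝ} (h : |y| ≤ 1) : |smoothStep^[k] y| ≤ 1 := by
  induction k with
  | zero => exact h
  | succ k ih =>
    rw [Function.iterate_succ_apply']
    exact abs_smoothStep_le ih

theorem iterate_smoothStep_neg (k : ℕ) (y : ℝ) : smoothStep^[k] (-y) = -smoothStep^[k] y := by
  induction k with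
  | zero => rfl
  | succ k ih =>
    rw [Function.iterate_succ_apply', Function.iterate_succ_apply', ih, smoothStep, smoothStep]
    ring

/-- One step multiplies the gap 1 - z by 1 - (z + z²)/2. The iterates never drop below y, so this
factor is at most 1 - y/2 and the convergence is geometric. -/
theorem tendsto_iterate_smoothStep {y : ℝ} (h0 : 0 < y) (h1 : y ≤ 1) :
    Tendsto (fun k => smoothStep^[k] y) atTop (nhds 1) := by
  have key : ∀ k, y ≤ smoothStep^[k] y ∧ smoothStep^[k] y ≤ 1 ∧
      1 - smoothStep^[k] y ≤ (1 - y / 2) ^ k := by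
    intro k
    induction k with
    | zero => exact ⟨le_rfl, h1, by simpa using h0.le⟩
    | succ k ih =>
      obtain ⟨i1, i2, i3⟩ := ih
      rw [Function.iterate_succ_apply']
      set z := smoothStep^[k] y
      have hz0 : 0 < z := h0.trans_le i1
      refine ⟨?_, ?_, ?_⟩
      · rw [smoothStep]
        nlinarith [mul_nonneg hz0.le (mul_nonneg (sub_nonneg.2 i2) (by linarith : 0 ≤ 1 + z))]
      · rw [smoothStep]
        nlinarith [mul_nonneg (sq_nonneg (1 - z)) (by linarith : 0 ≤ 2 + z)]
      · have e : 1 - smoothStep z = (1 - (z + z ^ 2) / 2) * (1 - z) := by rw [smoothStep]; ring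
        rw [e, pow_succ' (1 - y / 2)]
        exact mul_le_mul (a := 1 - (z + z ^ 2) / 2) (b := 1 - y / 2) (by nlinarith) i3 (by linarith)
          (by linarith)
  have hlim : Tendsto (fun k => 1 - (1 - y / 2) ^ k) atTop (nhds 1) := by
    have := tendsto_pow_atTop_nhds_zero_of_lt_one (r := 1 - y / 2) (by linarith) (by linarith)
    simpa using (tendsto_const_nhds (x := (1 : ℝ))).sub this
  exact tendsto_of_tendsto_of_tendsto_of_le_of_le hlim tendsto_const_nhds
    (fun k => by linarith [(key k).2.2]) (fun k => (key k).2.1)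

/-- The polynomial (σ + σ²)/2 sends the signs 1, 0, -1 to 1, 0, 0. -/
theorem tendsto_positive_indicator {y : ℝ} (h : |y| ≤ 1) :
    Tendsto (fun k => (smoothStep^[k] y + smoothStep^[k] y ^ 2) / 2) atTop
      (nhds (if 0 < y then 1 else 0)) := by
  obtain ⟨h1, h2⟩ := abs_le.1 h
  rcases lt_trichotomy y 0 with hy | hy | hy
  · rw [if_neg hy.not_gt]
    have h3 := (tendsto_iterate_smoothStep (y := -y) (by linarith) (by linarith)).neg
    simp only [iterate_smoothStep_neg, neg_neg] at h3
    have := (h3.add (h3.pow 2)).div_const 2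
    norm_num at this
    exact this
  · subst hy
    have h4 : ∀ k, smoothStep^[k] 0 = 0 := fun k => by
      induction k with
      | zero => rfl
      | succ k ih => rw [Function.iterate_succ_apply', ih]; simp [smoothStep]
    simp [h4]
  · rw [if_pos hy]
    have h3 := tendsto_iterate_smoothStep hy h2
    have := (h3.add (h3.pow 2)).div_const 2
    norm_num at this
    exact this

/-- Once n > |x| the angle x/(n+1) lies in (-1, 1), where the sine has the sign of its argument. In
this way unbounded linear functions are tested through bounded ones. -/
theorem tendsto_positive_sin (x : ℝ) :
    Tendsto (fun n : ℕ => if 0 < Real.sin (x / (n + 1)) then (1 : ℝ) else 0) atTop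
      (nhds (if 0 < x then 1 else 0)) := by
  refine tendsto_const_nhds.congr' ?_
  obtain ⟨N, hN⟩ := exists_nat_gt |x|
  filter_upwards [eventually_ge_atTop N] with n hn
  have hn' : (N : ℝ) ≤ n := by exact_mod_cast hn
  have hpos : (0 : ℝ) < n + 1 := by positivity
  have hlt : |x / (n + 1)| < 1 := by
    rw [abs_div, abs_of_pos hpos, div_lt_one hpos]
    linarith
  obtain ⟨h1, h2⟩ := abs_lt.1 hlt
  have hpi := Real.pi_gt_three
  by_cases hx : 0 < x
  · rw [if_pos hx, if_pos (Real.sin_pos_of_pos_of_lt_pi (div_pos hx hpos) (by linarith))]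
  · rw [if_neg hx, if_neg]
    exact (Real.sin_nonpos_of_nonpos_of_neg_pi_le
      (div_nonpos_of_nonpos_of_nonneg (not_lt.1 hx) hpos.le) (by linarith)).not_gt

end signApproximation

/-! ### Translations acting by characters on the mass shells -/

section translations

variable {s : ℕ}

/-- Translations as Poincaré transformations. -/
def translation (a : Spacetime s) : poincareGroup s :=
  ⟨AffineEquiv.constVAdd ℝ (Spacetime s) a, (lorentzGroup s).one_mem⟩

theorem translation_apply (a x : Spacetime s) :
    (translation a : Spacetime s ≃ᵃ[ℝ] Spacetime s) x = a + x := rfl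

theorem translation_add (a b : Spacetime s) : translation (a + b) = translation a * translation b :=
  Subtype.ext (AffineEquiv.ext fun x => add_assoc a b x)

theorem translation_zero : translation (0 : Spacetime s) = 1 :=
  Subtype.ext (AffineEquiv.ext fun x => zero_add x)

theorem scalarFun_translation (a : Spacetime s) (f : Spacetime s → ℂ) (p : Spacetime s) :
    scalarFun (translation a) f p = Complex.exp (Complex.I * (minkowski a p : ℝ)) * f p := by
  have h : translationPart (translation a) = a := add_zero a
  rw [scalarFun, h]
  rfl

theorem bddMeas_exp_minkowski (a : Spacetime s) :
    BddMeas fun p : Spacetime s => Complex.exp (Complex.I * (minkowski a p : ℝ)) := by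
  refine BddMeas.of_le ?_ 1 fun p => ?_
  · have := continuous_minkowski_right a
    exact Continuous.measurable (by fun_prop)
  · rw [mul_comm, Complex.norm_exp_ofReal_mul_I]

theorem scalarRep_translation (a : Spacetime s) (m : ℝ≥0) :
    ((scalarRep s m (translation a)).toContinuousLinearEquiv :
      Lp ℂ 2 (massShellMeasure s m) →L[ℂ] Lp ℂ 2 (massShellMeasure s m)) =
      mulOp (massShellMeasure s m) fun p => Complex.exp (Complex.I * (minkowski a p : ℝ)) := by
  ext1 f
  refine (mulOp_apply_eq (bddMeas_exp_minkowski a) ?_).symm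
  refine (scalarIsometry_ae m (translation a) f).trans (ae_of_all _ fun p => ?_)
  exact scalarFun_translation a f p

end translations

/-! ### Borel functions of the momentum generated by translations -/

section borelCalculus

variable {s : ℕ} {μ : Measure ℝ≥0} {E : ℝ≥0 → Type*} [∀ m, NormedAddCommGroup (E m)]
  [∀ m, InnerProductSpace ℂ (E m)] {F : MeasurableField E}
  {𝓗 : Type*} [NormedAddCommGroup 𝓗] [InnerProductSpace ℂ 𝓗]

/-- `Φ` and `J` identify `U` with a direct integral of multiples of scalar representations. -/
structure IsScalarModel (Φ : F.squareIntegrable μ →ₗ[ℂ] 𝓗) {ι : ℝ≥0 → Type*}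
    (J : ∀ m, ι m → Lp ℂ 2 (massShellMeasure s m) →ₗᵢ[ℂ] E m) [∀ m, CompleteSpace (E m)]
    (U : poincareGroup s →* (𝓗 ≃ₗᵢ[ℂ] 𝓗)) : Prop extends IsIntegralModel Φ where
  isHilbertSum : ∀ᵐ m ∂μ, IsHilbertSum ℂ (fun _ => Lp ℂ 2 (massShellMeasure s m)) (J m)
  decomposes : ∀ g, Decomposes Φ ((U g).toContinuousLinearEquiv : 𝓗 →L[ℂ] 𝓗) fun m =>
    amplification (J m) ((scalarRep s m g).toContinuousLinearEquiv :
      Lp ℂ 2 (massShellMeasure s m) →L[ℂ] Lp ℂ 2 (massShellMeasure s m))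

/-- The field of operators `a m` on the mass shells defines an operator commuting with `N`. -/
def IsInAlgebra (Φ : F.squareIntegrable μ →ₗ[ℂ] 𝓗) {ι : ℝ≥0 → Type*}
    (J : ∀ m, ι m → Lp ℂ 2 (massShellMeasure s m) →ₗᵢ[ℂ] E m) (N : Set (𝓗 →L[ℂ] 𝓗))
    (a : ∀ m, Lp ℂ 2 (massShellMeasure s m) →L[ℂ] Lp ℂ 2 (massShellMeasure s m)) : Prop :=
  ∃ A ∈ Set.centralizer N, Decomposes Φ A fun m => amplification (J m) (a m)

variable [∀ m, CompleteSpace (E m)] {Φ : F.squareIntegrable μ →ₗ[ℂ] 𝓗} {ι : ℝ≥0 → Type*}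
  {J : ∀ m, ι m → Lp ℂ 2 (massShellMeasure s m) →ₗᵢ[ℂ] E m}
  {U : poincareGroup s →* (𝓗 ≃ₗᵢ[ℂ] 𝓗)} {N : Set (𝓗 →L[ℂ] 𝓗)}
  {a b : ∀ m, Lp ℂ 2 (massShellMeasure s m) →L[ℂ] Lp ℂ 2 (massShellMeasure s m)}

namespace IsInAlgebra

theorem comp (hU : IsScalarModel Φ J U) (ha : IsInAlgebra Φ J N a) (hb : IsInAlgebra Φ J N b) :
    IsInAlgebra Φ J N fun m => (a m).comp (b m) := by
  obtain ⟨A, hA, hA'⟩ := ha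
  obtain ⟨B, hB, hB'⟩ := hb
  refine ⟨A.comp B, Set.mul_mem_centralizer hA hB, (hA'.comp hB').congr_ae ?_⟩
  filter_upwards [hU.isHilbertSum] with m hm
  rw [amplification_comp hm]

theorem add (hU : IsScalarModel Φ J U) (ha : IsInAlgebra Φ J N a) (hb : IsInAlgebra Φ J N b) :
    IsInAlgebra Φ J N fun m => a m + b m := by
  obtain ⟨A, hA, hA'⟩ := ha
  obtain ⟨B, hB, hB'⟩ := hb
  refine ⟨A + B, Set.add_mem_centralizer hA hB, (hA'.add hB').congr_ae ?_⟩
  filter_upwards [hU.isHilbertSum] with m hm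
  rw [amplification_add hm]

theorem const_smul (hU : IsScalarModel Φ J U) (c : ℂ) (ha : IsInAlgebra Φ J N a) :
    IsInAlgebra Φ J N fun m => c • a m := by
  obtain ⟨A, hA, hA'⟩ := ha
  refine ⟨c • A, fun T hT => ?_, (hA'.const_smul c).congr_ae ?_⟩
  · rw [mul_smul_comm, smul_mul_assoc, hA T hT]
  · filter_upwards [hU.isHilbertSum] with m hm
    rw [amplification_smul hm]

theorem limit [CompleteSpace 𝓗] (hU : IsScalarModel Φ J U)
    {a : ℕ → ∀ m, Lp ℂ 2 (massShellMeasure s m) →L[ℂ] Lp ℂ 2 (massShellMeasure s m)}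
    (ha : ∀ n, IsInAlgebra Φ J N (a n)) {C : ℝ} (hC : ∀ n m, ‖a n m‖ ≤ C)
    (hlim : ∀ m f, Tendsto (fun n => a n m f) atTop (nhds (b m f))) : IsInAlgebra Φ J N b := by
  choose A hA hA' using ha
  obtain ⟨B, hB, hB'⟩ := Decomposes.exists_limit hU.toIsIntegralModel hA'
    (b' := fun m => amplification (J m) (b m)) (C := C)
    (fun n => ae_of_all _ fun m => (norm_amplification_le _ _).trans (hC n m)) (by
      filter_upwards [hU.isHilbertSum] with m hm
      exact tendsto_amplification hm (fun n => hC n m) (hlim m))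
  refine ⟨B, fun T hT => ?_, hB⟩
  ext x
  refine tendsto_nhds_unique ((T.continuous.tendsto _).comp (hB' x)) ((hB' (T x)).congr fun n => ?_)
  exact (DFunLike.congr_fun (hA n T hT) x).symm

end IsInAlgebra

/-- All operators in `N` commute with the translations. -/
def CommutesWithTranslations (U : poincareGroup s →* (𝓗 ≃ₗᵢ[ℂ] 𝓗)) (N : Set (𝓗 →L[ℂ] 𝓗)) : Prop :=
  ∀ a, ((U (translation a)).toContinuousLinearEquiv : 𝓗 →L[ℂ] 𝓗) ∈ Set.centralizer N

/-- The operator of multiplication by the bounded Borel function `f` of the momentum is defined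
and commutes with `N`. -/
def IsBorelOk (Φ : F.squareIntegrable μ →ₗ[ℂ] 𝓗) {ι : ℝ≥0 → Type*}
    (J : ∀ m, ι m → Lp ℂ 2 (massShellMeasure s m) →ₗᵢ[ℂ] E m) (N : Set (𝓗 →L[ℂ] 𝓗))
    (f : Spacetime s → ℂ) : Prop :=
  BddMeas f ∧ IsInAlgebra Φ J N fun m => mulOp (massShellMeasure s m) f

namespace IsBorelOk

variable {f g : Spacetime s → ℂ}

theorem mul (hU : IsScalarModel Φ J U) (hf : IsBorelOk Φ J N f) (hg : IsBorelOk Φ J N g) :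
    IsBorelOk Φ J N fun p => f p * g p := by
  refine ⟨hf.1.mul hg.1, ?_⟩
  have := hf.2.comp hU hg.2
  have e : (fun m => (mulOp (massShellMeasure s m) f).comp (mulOp (massShellMeasure s m) g)) =
      fun m => mulOp (massShellMeasure s m) fun p => f p * g p := by
    funext m
    ext1 x
    exact (mulOp_mul hf.1 hg.1 x).symm
  rwa [e] at this

theorem add (hU : IsScalarModel Φ J U) (hf : IsBorelOk Φ J N f) (hg : IsBorelOk Φ J N g) :
    IsBorelOk Φ J N fun p => f p + g p := by
  refine ⟨hf.1.add hg.1, ?_⟩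
  have := hf.2.add hU hg.2
  simp only [← mulOp_add hf.1 hg.1] at this
  exact this

theorem const_mul (hU : IsScalarModel Φ J U) (c : ℂ) (hf : IsBorelOk Φ J N f) :
    IsBorelOk Φ J N fun p => c * f p := by
  refine ⟨hf.1.const_mul c, ?_⟩
  have := hf.2.const_smul hU c
  simp only [← mulOp_const_mul c hf.1] at this
  exact this

theorem limit [CompleteSpace 𝓗] (hU : IsScalarModel Φ J U) {f : ℕ → Spacetime s → ℂ}
    (hf : ∀ n, IsBorelOk Φ J N (f n)) {C : ℝ} (hC : ∀ n p, ‖f n p‖ ≤ C)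
    (hlim : ∀ p, Tendsto (fun n => f n p) atTop (nhds (g p))) : IsBorelOk Φ J N g := by
  have hg : Measurable g := measurable_of_tendsto_metrizable (fun n => (hf n).1.measurable)
    (tendsto_pi_nhds.2 hlim)
  have hC0 : 0 ≤ C := (norm_nonneg _).trans (hC 0 0)
  refine ⟨BddMeas.of_le hg C fun p => le_of_tendsto (hlim p).norm
    (Eventually.of_forall fun n => hC n p), ?_⟩
  exact IsInAlgebra.limit hU (fun n => (hf n).2) (fun n m => norm_mulOp_le hC0 (hC n))
    fun m x => tendsto_mulOp (fun n => (hf n).1.measurable) hg hC hlim x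

theorem exp (hU : IsScalarModel Φ J U) (hN : CommutesWithTranslations U N) (a : Spacetime s) :
    IsBorelOk Φ J N fun p => Complex.exp (Complex.I * (minkowski a p : ℝ)) := by
  refine ⟨bddMeas_exp_minkowski a, _, hN a, ?_⟩
  have := hU.decomposes (translation a)
  simp only [scalarRep_translation] at this
  exact this

theorem one (hU : IsScalarModel Φ J U) (hN : CommutesWithTranslations U N) :
    IsBorelOk Φ J N fun _ => 1 := by
  have := exp hU hN 0
  simpa [minkowski] using this

theorem sin (hU : IsScalarModel Φ J U) (hN : CommutesWithTranslations U N) (a : Spacetime s) (c : ℝ) :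
    IsBorelOk Φ J N fun p => ((Real.sin (minkowski a p - c) : ℝ) : ℂ) := by
  have h := ((exp hU hN a).const_mul hU (-(Complex.I / 2) * Complex.exp (-(Complex.I * c)))).add hU
    ((exp hU hN (-a)).const_mul hU (Complex.I / 2 * Complex.exp (Complex.I * c)))
  refine (iff_of_eq (congrArg _ (funext fun p => ?_))).1 h
  have hm : minkowski (-a) p = -minkowski a p := by
    simp only [minkowski, Pi.neg_apply, neg_mul, Finset.sum_neg_distrib]
    ring
  rw [hm, Complex.ofReal_sin, Complex.sin, mul_assoc, mul_assoc, ← Complex.exp_add,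
    ← Complex.exp_add]
  push_cast
  have e1 : -(Complex.I * c) + Complex.I * (minkowski a p : ℂ) =
      (minkowski a p - c : ℂ) * Complex.I := by ring
  have e2 : Complex.I * (c : ℂ) + Complex.I * -(minkowski a p : ℂ) =
      -(minkowski a p - c : ℂ) * Complex.I := by ring
  rw [e1, e2]
  ring

theorem iterate (hU : IsScalarModel Φ J U) {u : Spacetime s → ℝ}
    (hu : IsBorelOk Φ J N fun p => (u p : ℂ)) (k : ℕ) :
    IsBorelOk Φ J N fun p => ((smoothStep^[k] (u p) : ℝ) : ℂ) := by
  induction k with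
  | zero => exact hu
  | succ k ih =>
    have h := (ih.const_mul hU (3 / 2)).add hU (((ih.mul hU ih).mul hU ih).const_mul hU (-1 / 2))
    refine (iff_of_eq (congrArg _ (funext fun p => ?_))).1 h
    rw [Function.iterate_succ_apply', smoothStep]
    push_cast
    ring

variable [CompleteSpace 𝓗]

theorem positive (hU : IsScalarModel Φ J U) {u : Spacetime s → ℝ}
    (hu : IsBorelOk Φ J N fun p => (u p : ℂ)) (h1 : ∀ p, |u p| ≤ 1) :
    IsBorelOk Φ J N fun p => ((if 0 < u p then (1 : ℝ) else 0 : ℝ) : ℂ) := by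
  refine limit hU (f := fun k p => (((smoothStep^[k] (u p) + smoothStep^[k] (u p) ^ 2) / 2 : ℝ) : ℂ))
    (C := 1) (fun k => ?_) (fun k p => ?_) (fun p => ?_)
  · have h := iterate hU hu k
    have h' := (h.const_mul hU (1 / 2)).add hU ((h.mul hU h).const_mul hU (1 / 2))
    refine (iff_of_eq (congrArg _ (funext fun p => ?_))).1 h'
    push_cast
    ring
  · rw [Complex.norm_real, Real.norm_eq_abs]
    have := abs_iterate_smoothStep_le k (h1 p)
    rw [abs_le] at this ⊢
    constructor <;> nlinarith
  · exact (Complex.continuous_ofReal.tendsto _).comp (tendsto_positive_indicator (h1 p))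

/-- The sign of a·p - c is the eventual sign of sin((a·p - c)/(n+1)), which comes from translations
by ±a/(n+1). -/
theorem halfSpace (hU : IsScalarModel Φ J U) (hN : CommutesWithTranslations U N) (a : Spacetime s) (c : ℝ) :
    IsBorelOk Φ J N ({p | c < minkowski a p}.indicator 1) := by
  refine limit hU (C := 1) (f := fun (n : ℕ) p =>
    ((if 0 < Real.sin ((minkowski a p - c) / (n + 1)) then (1 : ℝ) else 0 : ℝ) : ℂ))
    (fun n => ?_) (fun n p => ?_) (fun p => ?_)
  · refine positive hU ?_ fun p => Real.abs_sin_le_one _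
    have := sin hU hN ((1 / ((n : ℝ) + 1)) • a) (c / (n + 1))
    refine (iff_of_eq (congrArg _ (funext fun p => ?_))).1 this
    congr 2
    have hm : minkowski ((1 / ((n : ℝ) + 1)) • a) p = 1 / ((n : ℝ) + 1) * minkowski a p := by
      simp only [minkowski, Pi.smul_apply, smul_eq_mul, mul_assoc, ← Finset.mul_sum]
      ring
    rw [hm]
    ring
  · split_ifs <;> simp
  · have h := (Complex.continuous_ofReal.tendsto _).comp (tendsto_positive_sin (minkowski a p - c))
    have e : ({p | c < minkowski a p}.indicator 1 p : ℂ) =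
        ((if 0 < minkowski a p - c then (1 : ℝ) else 0 : ℝ) : ℂ) := by
      by_cases hp : c < minkowski a p
      · rw [Set.indicator_of_mem (by exact hp), if_pos (sub_pos.2 hp)]; simp
      · rw [Set.indicator_of_notMem (by exact hp), if_neg (by linarith)]; simp
    rw [e]
    exact h

theorem compl (hU : IsScalarModel Φ J U) (hN : CommutesWithTranslations U N)
    {B : Set (Spacetime s)} (hB : IsBorelOk Φ J N (B.indicator 1)) :
    IsBorelOk Φ J N (Bᶜ.indicator 1) := by
  have := (one hU hN).add hU (hB.const_mul hU (-1))
  refine (iff_of_eq (congrArg _ (funext fun p => ?_))).1 this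
  by_cases hp : p ∈ B <;> simp [hp]

open Classical in
theorem iUnion (hU : IsScalarModel Φ J U) (hN : CommutesWithTranslations U N)
    {B : ℕ → Set (Spacetime s)} (hB : ∀ n, IsBorelOk Φ J N ((B n).indicator 1)) :
    IsBorelOk Φ J N ((⋃ n, B n).indicator 1) := by
  -- The indicator of an intersection is the limit of finite products of indicators, so complements
  -- are easier to treat.
  suffices h : IsBorelOk Φ J N ((⋃ n, B n)ᶜ.indicator 1) by
    simpa using compl hU hN h
  have hprod : ∀ n p, ∏ k ∈ Finset.range n, ((B k)ᶜ.indicator 1 p : ℂ) =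
      if ∀ k < n, p ∉ B k then 1 else 0 := by
    intro n p
    split_ifs with h
    · exact Finset.prod_eq_one fun k hk => by
        rw [Set.indicator_of_mem (by exact h k (Finset.mem_range.1 hk))]; rfl
    · push Not at h
      obtain ⟨k, hk, hp⟩ := h
      exact Finset.prod_eq_zero (Finset.mem_range.2 hk) (by simp [hp])
  refine limit hU (C := 1) (f := fun n p => ∏ k ∈ Finset.range n, ((B k)ᶜ.indicator 1 p : ℂ))
    (fun n => ?_) (fun n p => ?_) (fun p => ?_)
  · induction n with
    | zero => simpa using one hU hN
    | succ n ih =>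
      simp only [Finset.prod_range_succ]
      exact ih.mul hU (compl hU hN (hB n))
  · rw [hprod]
    split_ifs <;> simp
  · refine tendsto_const_nhds.congr' ?_
    by_cases hp : p ∈ ⋃ n, B n
    · obtain ⟨j, hj⟩ := Set.mem_iUnion.1 hp
      filter_upwards [eventually_gt_atTop j] with n hn
      change _ = ∏ k ∈ Finset.range n, ((B k)ᶜ.indicator 1 p : ℂ)
      rw [hprod, if_neg (fun h => h j hn hj), Set.indicator_of_notMem (by simpa using ⟨j, hj⟩)]
    · refine Eventually.of_forall fun n => ?_
      rw [Set.mem_iUnion, not_exists] at hp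
      change _ = ∏ k ∈ Finset.range n, ((B k)ᶜ.indicator 1 p : ℂ)
      rw [hprod, if_pos (fun k _ => hp k), Set.indicator_of_mem (by simpa using hp)]
      rfl

/-- The sets whose indicator is admissible form a σ-algebra. It contains the coordinate half spaces,
hence every Borel set. -/
theorem indicator (hU : IsScalarModel Φ J U) (hN : CommutesWithTranslations U N)
    {B : Set (Spacetime s)} (hB : MeasurableSet B) : IsBorelOk Φ J N (B.indicator 1) := by
  let 𝓜 : MeasurableSpace (Spacetime s) :=
    { MeasurableSet' := fun B => IsBorelOk Φ J N (B.indicator 1)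
      measurableSet_empty := by
        have := (one hU hN).const_mul hU 0
        simpa [Set.indicator_empty] using this
      measurableSet_compl := fun B hB => compl hU hN hB
      measurableSet_iUnion := fun B hB => iUnion hU hN hB }
  have hc : ∀ i, @Measurable (Spacetime s) ℝ 𝓜 _ fun p => p i := by
    intro i
    apply measurable_of_Ioi
    intro c
    -- For a spatial coordinate the signature forces the entry -1.
    obtain ⟨a, ha⟩ : ∃ a : Spacetime s, ∀ p, minkowski a p = p i := by
      refine Fin.cases ⟨Pi.single 0 1, fun p => ?_⟩ (fun j => ⟨Pi.single j.succ (-1), fun p => ?_⟩) i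
      · simp [minkowski, Pi.single_apply]
      · simp [minkowski, Pi.single_apply]
    have := halfSpace hU hN a c
    simp only [ha] at this
    exact this
  have hle : (MeasurableSpace.pi : MeasurableSpace (Spacetime s)) ≤ 𝓜 :=
    iSup_le fun i => (hc i).comap_le
  exact hle B hB

/-- Bounded limits of simple functions finish the Borel calculus. One and the same f is used on all
mass shells, so the operator makes sense on the whole direct integral. -/
theorem of_bddMeas (hU : IsScalarModel Φ J U) (hN : CommutesWithTranslations U N)
    (hf : BddMeas f) : IsBorelOk Φ J N f := by
  obtain ⟨C, hC⟩ := hf.bdd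
  have hC0 : 0 ≤ C := (norm_nonneg _).trans (hC 0)
  have hs := hf.measurable.stronglyMeasurable
  refine limit hU (f := fun n p => hs.approxBounded C n p) (C := C) (fun n => ?_)
    (fun n p => hs.norm_approxBounded_le hC0 n p)
    (fun p => hs.tendsto_approxBounded_of_norm_le (hC p))
  induction hs.approxBounded C n using SimpleFunc.induction with
  | const c hB =>
    have := (indicator hU hN hB).const_mul hU c
    refine (iff_of_eq (congrArg _ (funext fun p => ?_))).1 this
    simp only [SimpleFunc.coe_piecewise, SimpleFunc.coe_const, Set.piecewise, Set.indicator]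
    split_ifs <;> simp
  | add _ hf hg => exact IsBorelOk.add hU hf hg

end IsBorelOk

end borelCalculus

/-! ### The direct integral model and positivity of the energy -/

section scalarModel

universe v

variable {s : ℕ} {μ : Measure ℝ≥0} {E : ℝ≥0 → Type v} [∀ m, NormedAddCommGroup (E m)]
  [∀ m, InnerProductSpace ℂ (E m)] {F : MeasurableField E} [∀ m, CompleteSpace (E m)]
  {𝓗 : Type*} [NormedAddCommGroup 𝓗] [InnerProductSpace ℂ 𝓗]

theorem exists_isScalarModel {V : ∀ m, poincareGroup s →* (E m ≃ₗᵢ[ℂ] E m)}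
    (hV : ∀ᵐ m ∂μ, IsMultipleOf (scalarRep s m) (V m)) {U : poincareGroup s →* (𝓗 ≃ₗᵢ[ℂ] 𝓗)}
    (hU : IsDirectIntegral μ F V U) :
    ∃ (Φ : F.squareIntegrable μ →ₗ[ℂ] 𝓗) (ι : ℝ≥0 → Type v)
      (J : ∀ m, ι m → Lp ℂ 2 (massShellMeasure s m) →ₗᵢ[ℂ] E m), IsScalarModel Φ J U := by
  have hex : ∀ m, ∃ (ι : Type v) (J : ι → Lp ℂ 2 (massShellMeasure s m) →ₗᵢ[ℂ] E m),
      IsMultipleOf (scalarRep s m) (V m) →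
        IsHilbertSum ℂ (fun _ => Lp ℂ 2 (massShellMeasure s m)) J ∧
          ∀ i g f, V m g (J i f) = J i (scalarRep s m g f) := by
    intro m
    by_cases h : IsMultipleOf (scalarRep s m) (V m)
    · obtain ⟨ι, J, hJ⟩ := h
      exact ⟨ι, J, fun _ => hJ⟩
    -- The exceptional masses form a null set; the empty family is an arbitrary choice there.
    · exact ⟨PEmpty, PEmpty.elim, fun h' => absurd h' h⟩
  choose ι J hJ using hex
  obtain ⟨hsec, Φ, hsurj, hinner, hact⟩ := hU
  refine ⟨Φ, ι, J, ⟨hsurj, hinner⟩, hV.mono fun m hm => (hJ m hm).1, fun g ξ => ?_⟩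
  refine ⟨⟨fun m => V m g (ξ.1 m), hsec g _ ξ.2.1, by simpa using ξ.2.2⟩, hact g ξ _ fun _ => rfl, ?_⟩
  filter_upwards [hV] with m hm
  obtain ⟨h1, h2⟩ := hJ m hm
  have : ((V m g).toContinuousLinearEquiv : E m →L[ℂ] E m) = amplification (J m)
      ((scalarRep s m g).toContinuousLinearEquiv :
        Lp ℂ 2 (massShellMeasure s m) →L[ℂ] Lp ℂ 2 (massShellMeasure s m)) :=
    eq_amplification h1 fun i f => h2 i g f
  rw [← this]
  rfl

/-- The function `e^{iwℓ}` where `ℓ ≥ 0`, and `0` elsewhere. -/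
def halfPlaneExp (ℓ : Spacetime s → ℝ) (w : ℂ) (p : Spacetime s) : ℂ :=
  if 0 ≤ ℓ p then Complex.exp (Complex.I * w * (ℓ p : ℝ)) else 0

variable {ℓ : Spacetime s → ℝ}

theorem norm_exp_I_mul (w : ℂ) (y : ℝ) :
    ‖Complex.exp (Complex.I * w * (y : ℝ))‖ = Real.exp (-(w.im * y)) := by
  rw [Complex.norm_exp]
  congr 1
  simp [Complex.mul_re]

theorem norm_halfPlaneExp_le (w : ℂ) (hw : 0 ≤ w.im) (p : Spacetime s) :
    ‖halfPlaneExp ℓ w p‖ ≤ 1 := by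
  unfold halfPlaneExp
  split_ifs with h
  · rw [norm_exp_I_mul, Real.exp_le_one_iff]
    exact neg_nonpos.2 (mul_nonneg hw h)
  · simp

theorem measurable_halfPlaneExp (hℓ : Measurable ℓ) (w : ℂ) : Measurable (halfPlaneExp ℓ w) := by
  refine Measurable.ite (measurableSet_le measurable_const hℓ) ?_ measurable_const
  exact Complex.measurable_exp.comp ((Complex.measurable_ofReal.comp hℓ).const_mul _)

theorem bddMeas_halfPlaneExp (hℓ : Measurable ℓ) {w : ℂ} (hw : 0 ≤ w.im) :
    BddMeas (halfPlaneExp ℓ w) :=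
  BddMeas.of_le (measurable_halfPlaneExp hℓ w) 1 (norm_halfPlaneExp_le w hw)

theorem bddMeas_halfPlaneExp_deriv (hℓ : Measurable ℓ) {w : ℂ} (hw : 0 < w.im) :
    BddMeas fun p => Complex.I * (ℓ p : ℝ) * halfPlaneExp ℓ w p := by
  refine BddMeas.of_le (((Complex.measurable_ofReal.comp hℓ).const_mul _).mul
    (measurable_halfPlaneExp hℓ w)) (1 / w.im) fun p => ?_
  unfold halfPlaneExp
  split_ifs with h
  · rw [norm_mul, norm_exp_I_mul, norm_mul, Complex.norm_I, one_mul, Complex.norm_real,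
      Real.norm_of_nonneg h, Real.exp_neg, ← div_eq_mul_inv, div_le_div_iff₀ (Real.exp_pos _) hw]
    nlinarith [Real.add_one_le_exp (w.im * ℓ p)]
  · simp [hw.le]

/-- With y the value of ℓ, the Taylor remainder is at most |w|²y² e^{|w|y} e^{-y Im z} ≤ |w|²y²
e^{-x} for x = y Im z/2. Since e^x ≥ x²/2, y²e^{-x} ≤ 8/(Im z)². The bound is uniform in p, which
gives differentiability in norm. -/
theorem norm_halfPlaneExp_sub_le {z w : ℂ} (hz : 0 < z.im) (hw : ‖w‖ < z.im / 2)
    (p : Spacetime s) : ‖halfPlaneExp ℓ (z + w) p - halfPlaneExp ℓ z p -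
      w * (Complex.I * (ℓ p : ℝ) * halfPlaneExp ℓ z p)‖ ≤ 8 / z.im ^ 2 * ‖w‖ ^ 2 := by
  unfold halfPlaneExp
  split_ifs with h
  · set y := ℓ p
    have e : Complex.exp (Complex.I * (z + w) * y) - Complex.exp (Complex.I * z * y) -
        w * (Complex.I * y * Complex.exp (Complex.I * z * y)) = Complex.exp (Complex.I * z * y) *
        (Complex.exp (Complex.I * w * y) - 1 - Complex.I * w * y) := by
      rw [show Complex.I * (z + w) * y = Complex.I * z * y + Complex.I * w * y by ring,
        Complex.exp_add]
      ring
    have hu : ‖Complex.I * w * (y : ℂ)‖ = ‖w‖ * y := by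
      rw [norm_mul, norm_mul, Complex.norm_I, one_mul, Complex.norm_real, Real.norm_of_nonneg h]
    have h1 : ‖Complex.exp (Complex.I * w * y) - 1 - Complex.I * w * y‖ ≤
        (‖w‖ * y) ^ 2 * Real.exp (‖w‖ * y) := by
      have := Complex.norm_exp_sub_sum_le_norm_mul_exp (Complex.I * w * y) 2
      rw [hu] at this
      simpa [Finset.sum_range_succ, sub_sub] using this
    have h2 : Real.exp (‖w‖ * y) ≤ Real.exp (z.im / 2 * y) :=
      Real.exp_le_exp.2 (mul_le_mul_of_nonneg_right hw.le h)
    have h3 := Real.quadratic_le_exp_of_nonneg (x := z.im / 2 * y) (by positivity)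
    rw [e, norm_mul, norm_exp_I_mul]
    have h4 : Real.exp (-(z.im * y)) = (Real.exp (z.im / 2 * y))⁻¹ * (Real.exp (z.im / 2 * y))⁻¹ := by
      rw [← Real.exp_neg, ← Real.exp_add]
      ring_nf
    set x := Real.exp (z.im / 2 * y)
    have hx : 0 < x := Real.exp_pos _
    calc Real.exp (-(z.im * y)) * _ ≤ x⁻¹ * x⁻¹ * ((‖w‖ * y) ^ 2 * x) := by
          rw [h4]
          refine mul_le_mul_of_nonneg_left (h1.trans ?_) (by positivity)
          exact mul_le_mul_of_nonneg_left h2 (by positivity)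
      _ = y ^ 2 * x⁻¹ * ‖w‖ ^ 2 := by field_simp
      _ ≤ 8 / z.im ^ 2 * ‖w‖ ^ 2 := by
          refine mul_le_mul_of_nonneg_right ?_ (by positivity)
          rw [← div_eq_mul_inv, div_le_div_iff₀ hx (by positivity)]
          have : 0 ≤ z.im / 2 * y := by positivity
          nlinarith
  · simp
    positivity

variable {Φ : F.squareIntegrable μ →ₗ[ℂ] 𝓗} {ι : ℝ≥0 → Type*}
  {J : ∀ m, ι m → Lp ℂ 2 (massShellMeasure s m) →ₗᵢ[ℂ] E m}
  {U : poincareGroup s →* (𝓗 ≃ₗᵢ[ℂ] 𝓗)} [CompleteSpace 𝓗]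

/-- The spectrum condition: translations in a direction which is nonnegative on the mass shells
have a positive generator. -/
theorem exists_positiveExtension (hU : IsScalarModel Φ J U) {a : Spacetime s}
    (ha : ∀ m, ∀ᵐ p ∂massShellMeasure s m, 0 ≤ minkowski a p) :
    ∃ W, PositiveExtension
      (fun t : ℝ => ((U (translation (t • a))).toContinuousLinearEquiv : 𝓗 →L[ℂ] 𝓗)) W := by
  have hℓ : Measurable (minkowski a) := (continuous_minkowski_right a).measurable
  have hok : ∀ f : Spacetime s → ℂ, BddMeas f → ∃ A : 𝓗 →L[ℂ] 𝓗, Decomposes Φ A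
      fun m => amplification (J m) (mulOp (massShellMeasure s m) f) := by
    intro f hf
    -- With N empty the commutation condition is void, and only the existence of the operator is
    -- extracted.
    obtain ⟨A, -, hA⟩ := (IsBorelOk.of_bddMeas hU (N := ∅) (fun a => by simp) hf).2
    exact ⟨A, hA⟩
  have hex : ∀ w : ℂ, ∃ A : 𝓗 →L[ℂ] 𝓗, 0 ≤ w.im → Decomposes Φ A
      fun m => amplification (J m) (mulOp (massShellMeasure s m) (halfPlaneExp (minkowski a) w)) := by
    intro w
    by_cases hw : 0 ≤ w.im
    · obtain ⟨A, hA⟩ := hok _ (bddMeas_halfPlaneExp hℓ hw)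
      exact ⟨A, fun _ => hA⟩
    · exact ⟨0, fun h => absurd h hw⟩
  choose W hW using hex
  have hΦ := hU.toIsIntegralModel
  refine ⟨W, ?_, ?_, ?_, ?_, ?_⟩
  · intro w hw
    exact (hW w hw).opNorm_le hΦ zero_le_one (ae_of_all _ fun m => (norm_amplification_le _ _).trans
      (norm_mulOp_le zero_le_one (norm_halfPlaneExp_le w hw)))
  · intro z hz
    have hF' := bddMeas_halfPlaneExp_deriv hℓ hz
    obtain ⟨A', hA'⟩ := hok _ hF'
    refine (hasDerivAt_of_quadratic (f' := A') (8 / z.im ^ 2) (z.im / 2) (half_pos hz)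
      fun w hw => ?_).differentiableAt
    have hzw : 0 ≤ (z + w).im := by
      have := (abs_le.1 ((Complex.abs_im_le_norm w).trans hw.le)).1
      rw [Complex.add_im]
      linarith
    have hb1 := bddMeas_halfPlaneExp hℓ hzw
    have hb2 := bddMeas_halfPlaneExp hℓ hz.le
    have hd := ((hW _ hzw).sub (hW z hz.le)).sub (hA'.const_smul w)
    refine hd.opNorm_le hΦ (by positivity) ?_
    filter_upwards [hU.isHilbertSum] with m hm
    have e : amplification (J m) (mulOp (massShellMeasure s m) (halfPlaneExp (minkowski a) (z + w))) -
        amplification (J m) (mulOp (massShellMeasure s m) (halfPlaneExp (minkowski a) z)) -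
        w • amplification (J m) (mulOp (massShellMeasure s m) fun p =>
          Complex.I * (minkowski a p : ℝ) * halfPlaneExp (minkowski a) z p) =
        amplification (J m) (mulOp (massShellMeasure s m) fun p =>
          halfPlaneExp (minkowski a) (z + w) p + -1 * halfPlaneExp (minkowski a) z p +
            -w * (Complex.I * (minkowski a p : ℝ) * halfPlaneExp (minkowski a) z p)) := by
      rw [mulOp_add (hb1.add (hb2.const_mul (-1))) (hF'.const_mul (-w)),
        mulOp_add hb1 (hb2.const_mul (-1)), mulOp_const_mul _ hb2, mulOp_const_mul _ hF',
        ← amplification_add hm, ← amplification_add hm, ← amplification_smul hm,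
        ← amplification_smul hm]
      module
    rw [e]
    refine (norm_amplification_le _ _).trans (norm_mulOp_le (by positivity) fun p => ?_)
    refine le_trans (le_of_eq ?_) (norm_halfPlaneExp_sub_le (ℓ := minkowski a) hz hw p)
    congr 1
    ring
  · intro x w hw
    rw [ContinuousWithinAt]
    -- Sequences are enough and are needed, because dominated convergence is used; the shift by n₀
    -- keeps every term in the closed half plane.
    refine tendsto_of_seq_tendsto fun u hu => ?_
    have hmem := (tendsto_nhdsWithin_iff.1 hu).2
    have hlim := (tendsto_nhdsWithin_iff.1 hu).1
    obtain ⟨n₀, hn₀⟩ := eventually_atTop.1 hmem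
    rw [← tendsto_add_atTop_iff_nat n₀]
    have hu' : ∀ n, 0 ≤ (u (n + n₀)).im := fun n => hn₀ _ (by omega)
    have hlim' : Tendsto (fun n => u (n + n₀)) atTop (nhds w) :=
      (tendsto_add_atTop_iff_nat n₀).2 hlim
    obtain ⟨A, hA, hA'⟩ := Decomposes.exists_limit hΦ (fun n => hW _ (hu' n))
      (b' := fun m => amplification (J m)
        (mulOp (massShellMeasure s m) (halfPlaneExp (minkowski a) w))) (C := 1)
      (fun n => ae_of_all _ fun m => (norm_amplification_le _ _).trans
        (norm_mulOp_le zero_le_one (norm_halfPlaneExp_le _ (hu' n)))) (by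
        filter_upwards [hU.isHilbertSum] with m hm
        refine tendsto_amplification hm (fun n => norm_mulOp_le zero_le_one
          (norm_halfPlaneExp_le _ (hu' n))) fun f => ?_
        refine tendsto_mulOp (fun n => measurable_halfPlaneExp hℓ _) (measurable_halfPlaneExp hℓ _)
          (fun n => norm_halfPlaneExp_le _ (hu' n)) (fun p => ?_) f
        unfold halfPlaneExp
        split_ifs
        · exact (Complex.continuous_exp.tendsto _).comp ((hlim'.const_mul _).mul_const _)
        · exact tendsto_const_nhds)
    have : A = W w := hA.unique hΦ (hW w hw) (ae_of_all _ fun _ => rfl)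
    rw [← this]
    exact hA' x
  · intro t
    refine (hW t (by simp)).unique hΦ (hU.decomposes (translation (t • a))) (ae_of_all _ fun m => ?_)
    congr 1
    rw [scalarRep_translation]
    ext1 f
    refine mulOp_apply_eq (bddMeas_halfPlaneExp hℓ (by simp)) ?_
    filter_upwards [mulOp_ae (bddMeas_exp_minkowski (t • a)) f, ha m] with p h1 h2
    rw [h1, halfPlaneExp, if_pos h2]
    have hm : minkowski (t • a) p = t * minkowski a p := by
      simp only [minkowski, Pi.smul_apply, smul_eq_mul, mul_assoc, ← Finset.mul_sum]
      ring
    rw [hm]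
    push_cast
    ring_nf
  · intro t x y
    have h1 : U (translation ((-t) • a)) = (U (translation (t • a)))⁻¹ := by
      rw [← map_inv]
      congr 1
      rw [eq_inv_iff_mul_eq_one, ← translation_add, neg_smul, neg_add_cancel, translation_zero]
    change ⟪U (translation (t • a)) x, y⟫_ℂ = ⟪x, U (translation ((-t) • a)) y⟫_ℂ
    rw [h1]
    have h2 : y = U (translation (t • a)) ((U (translation (t • a)))⁻¹ y) :=
      ((U (translation (t • a))).apply_symm_apply y).symm
    conv_lhs => rw [h2]
    rw [LinearIsometryEquiv.inner_map_map]

end scalarModel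

/-! ### Rotations and boosts as Poincaré transformations -/

section rotations

variable {s : ℕ}

theorem minkowski_eq_sum (x y : Spacetime s) :
    minkowski x y = 2 * (x 0 * y 0) - ∑ k, x k * y k := by
  rw [minkowski, Fin.sum_univ_succ]
  ring

/-- The rotation by the angle `α` in the `(x i, x j)`-plane, as a linear map. -/
def rotationMap (i j : Fin (s + 1)) (α : ℝ) : Spacetime s →ₗ[ℝ] Spacetime s where
  toFun x k :=
    if k = i then Real.cos α * x i - Real.sin α * x j
    else if k = j then Real.sin α * x i + Real.cos α * x j
    else x k
  map_add' x y := by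
    ext k
    simp only [Pi.add_apply]
    split_ifs <;> ring
  map_smul' c x := by
    ext k
    simp only [Pi.smul_apply, smul_eq_mul, RingHom.id_apply]
    split_ifs <;> ring

theorem rotationMap_apply (i j : Fin (s + 1)) (α : ℝ) (x : Spacetime s) (k : Fin (s + 1)) :
    rotationMap i j α x k = if k = i then Real.cos α * x i - Real.sin α * x j
      else if k = j then Real.sin α * x i + Real.cos α * x j else x k := rfl

variable {i j : Fin (s + 1)}

theorem rotationMap_add (hij : i ≠ j) (α β : ℝ) (x : Spacetime s) :
    rotationMap i j α (rotationMap i j β x) = rotationMap i j (α + β) x := by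
  ext k
  simp only [rotationMap_apply, if_neg hij.symm, if_true]
  split_ifs
  · rw [Real.cos_add, Real.sin_add]; ring
  · rw [Real.cos_add, Real.sin_add]; ring
  · rfl

theorem rotationMap_zero (x : Spacetime s) : rotationMap i j 0 x = x := by
  ext k
  simp only [rotationMap_apply, Real.cos_zero, Real.sin_zero]
  split_ifs with h h'
  · simp [h]
  · simp [h']
  · rfl

theorem minkowski_rotationMap (hij : i ≠ j) (hi : i ≠ 0) (hj : j ≠ 0) (α : ℝ) (x y : Spacetime s) :
    minkowski (rotationMap i j α x) (rotationMap i j α y) = minkowski x y := by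
  have h0 : ∀ x : Spacetime s, rotationMap i j α x 0 = x 0 := fun x => by
    rw [rotationMap_apply, if_neg hi.symm, if_neg hj.symm]
  have hsum : ∑ k, (rotationMap i j α x k * rotationMap i j α y k - x k * y k) = 0 := by
    rw [Finset.sum_eq_add i j hij]
    · simp only [rotationMap_apply, if_true, if_neg hij.symm]
      linear_combination (x i * y i + x j * y j) * Real.sin_sq_add_cos_sq α
    · intro k _ hk
      simp [rotationMap_apply, hk.1, hk.2]
    · simp
    · simp
  rw [Finset.sum_sub_distrib, sub_eq_zero] at hsum
  rw [minkowski_eq_sum, minkowski_eq_sum, hsum, h0, h0]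

/-- Conjugation by the reflection of the j-th axis turns α into -α, so the determinant squares to 1.
It is also the square of the determinant at α/2, hence nonnegative. -/
theorem det_rotationMap (hij : i ≠ j) (α : ℝ) : LinearMap.det (rotationMap i j α) = 1 := by
  have hmul : ∀ t u, LinearMap.det (rotationMap i j t) * LinearMap.det (rotationMap i j u) =
      LinearMap.det (rotationMap i j (t + u)) := by
    intro t u
    rw [← map_mul]
    exact congrArg _ (LinearMap.ext (rotationMap_add hij t u))
  have h0 : LinearMap.det (rotationMap i j 0) = 1 := by
    rw [show rotationMap i j 0 = 1 from LinearMap.ext rotationMap_zero, map_one]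
  let R : Spacetime s →ₗ[ℝ] Spacetime s :=
    { toFun := fun x k => if k = j then - x k else x k
      map_add' := fun x y => by
        ext k; simp only [Pi.add_apply]; split_ifs <;> ring
      map_smul' := fun c x => by
        ext k; simp only [Pi.smul_apply, smul_eq_mul, RingHom.id_apply]; split_ifs <;> ring }
  have hR : R * R = 1 := by
    refine LinearMap.ext fun x => funext fun k => ?_
    change (if k = j then - (if k = j then - x k else x k) else (if k = j then - x k else x k)) = x k
    split_ifs <;> ring
  have hRb : R * rotationMap i j α * R = rotationMap i j (-α) := by
    refine LinearMap.ext fun x => funext fun k => ?_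
    change (if k = j then - rotationMap i j α (R x) k else rotationMap i j α (R x) k) = _
    have e0 : R x i = x i := if_neg hij
    have e1 : R x j = - x j := if_pos rfl
    simp only [rotationMap_apply, e0, e1, Real.cos_neg, Real.sin_neg]
    split_ifs with h h' h'
    · exact absurd (h'.symm.trans h) hij
    · ring
    · ring
    · exact if_neg h
  have hneg : LinearMap.det (rotationMap i j (-α)) = LinearMap.det (rotationMap i j α) := by
    have hRR : LinearMap.det R * LinearMap.det R = 1 := by rw [← map_mul, hR, map_one]
    rw [← hRb, map_mul, map_mul]
    linear_combination LinearMap.det (rotationMap i j α) * hRR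
  have hsq : LinearMap.det (rotationMap i j α) * LinearMap.det (rotationMap i j α) = 1 := by
    have := hmul α (-α)
    rwa [hneg, add_neg_cancel, h0] at this
  have hpos : 0 ≤ LinearMap.det (rotationMap i j α) := by
    have := hmul (α / 2) (α / 2)
    rw [add_halves] at this
    rw [← this]
    exact mul_self_nonneg _
  nlinarith

/-- Two distinct spatial coordinates. -/
def IsSpatialPlane (i j : Fin (s + 1)) : Prop := i ≠ j ∧ i ≠ 0 ∧ j ≠ 0

/-- The rotation as a linear equivalence. -/
def rotationEquiv (h : IsSpatialPlane i j) (α : ℝ) : Spacetime s ≃ₗ[ℝ] Spacetime s :=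
  LinearEquiv.ofLinearMap (rotationMap i j α) (rotationMap i j (-α))
    (LinearMap.ext fun x => by
      change rotationMap i j α (rotationMap i j (-α) x) = x
      rw [rotationMap_add h.1, add_neg_cancel, rotationMap_zero])
    (LinearMap.ext fun x => by
      change rotationMap i j (-α) (rotationMap i j α x) = x
      rw [rotationMap_add h.1, neg_add_cancel, rotationMap_zero])

theorem rotationEquiv_mem (h : IsSpatialPlane i j) (α : ℝ) : rotationEquiv h α ∈ lorentzGroup s := by
  have hc : ∀ α, ∀ x ∈ forwardCone s, rotationMap i j α x ∈ forwardCone s := by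
    intro α x hx
    refine ⟨by rw [minkowski_rotationMap h.1 h.2.1 h.2.2]; exact hx.1, ?_⟩
    rw [rotationMap_apply, if_neg h.2.1.symm, if_neg h.2.2.symm]
    exact hx.2
  refine ⟨minkowski_rotationMap h.1 h.2.1 h.2.2 α, det_rotationMap h.1 α,
    Set.Subset.antisymm ?_ ?_⟩
  · rintro _ ⟨x, hx, rfl⟩
    exact hc α x hx
  · intro x hx
    exact ⟨rotationMap i j (-α) x, hc (-α) x hx, (rotationEquiv h α).apply_symm_apply x⟩

/-- The rotation as a Poincaré transformation. -/
def rotation (h : IsSpatialPlane i j) (α : ℝ) : poincareGroup s :=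
  ⟨(rotationEquiv h α).toAffineEquiv, rotationEquiv_mem h α⟩

theorem rotation_apply (h : IsSpatialPlane i j) (α : ℝ) (x : Spacetime s) :
    (rotation h α : Spacetime s ≃ᵃ[ℝ] Spacetime s) x = rotationMap i j α x := rfl

theorem rotation_mul (h : IsSpatialPlane i j) (α β : ℝ) :
    rotation h α * rotation h β = rotation h (α + β) :=
  Subtype.ext (AffineEquiv.ext fun x => rotationMap_add h.1 α β x)

theorem rotation_inv (h : IsSpatialPlane i j) (α : ℝ) : (rotation h α)⁻¹ = rotation h (-α) := by
  rw [inv_eq_iff_mul_eq_one, rotation_mul, add_neg_cancel]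
  exact Subtype.ext (AffineEquiv.ext fun x => rotationMap_zero x)

variable [NeZero s]

theorem boost_mul (t u : ℝ) : boost s t * boost s u = boost s (t + u) :=
  Subtype.ext (AffineEquiv.ext fun x => boostMap_add s t u x)

theorem boost_zero : boost s 0 = 1 :=
  Subtype.ext (AffineEquiv.ext fun x => boostMap_zero s x)

theorem boost_inv (t : ℝ) : (boost s t)⁻¹ = boost s (-t) := by
  rw [inv_eq_iff_mul_eq_one, boost_mul, add_neg_cancel, boost_zero]

theorem one_ne_zero_fin : (1 : Fin (s + 1)) ≠ 0 := by simp

theorem boostMap_zero_coord (t : ℝ) (x : Spacetime s) :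
    boostMap s t x 0 = Real.cosh t * x 0 + Real.sinh t * x 1 := rfl

theorem boostMap_one_coord (t : ℝ) (x : Spacetime s) :
    boostMap s t x 1 = Real.sinh t * x 0 + Real.cosh t * x 1 := by
  simp [boostMap]

theorem boostMap_other_coord (t : ℝ) (x : Spacetime s) {k : Fin (s + 1)} (h0 : k ≠ 0) (h1 : k ≠ 1) :
    boostMap s t x k = x k := by
  simp [boostMap, h0, h1]

theorem boostMap_plus (t : ℝ) (x : Spacetime s) :
    boostMap s t x 0 + boostMap s t x 1 = Real.exp t * (x 0 + x 1) := by
  rw [boostMap_zero_coord, boostMap_one_coord, ← Real.cosh_add_sinh]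
  ring

theorem boostMap_minus (t : ℝ) (x : Spacetime s) :
    boostMap s t x 0 - boostMap s t x 1 = Real.exp (-t) * (x 0 - x 1) := by
  rw [boostMap_zero_coord, boostMap_one_coord, ← Real.cosh_sub_sinh]
  ring

end rotations

/-! ### The half turn and the edge rotations in coordinates -/

section coordinates

/-- Numerals in `Fin (s + 1)` are read modulo s + 1; the bound s ≥ 3 keeps 0, 1, 2, 3 distinct. -/
theorem val_fin {s : ℕ} (hs : 3 ≤ s) : ((1 : Fin (s + 1)) : ℕ) = 1 ∧ ((2 : Fin (s + 1)) : ℕ) = 2 ∧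
    ((3 : Fin (s + 1)) : ℕ) = 3 :=
  ⟨Nat.mod_eq_of_lt (a := 1) (by omega), Nat.mod_eq_of_lt (a := 2) (by omega),
    Nat.mod_eq_of_lt (a := 3) (by omega)⟩

theorem one_ne_two_fin {s : ℕ} (hs : 3 ≤ s) : (1 : Fin (s + 1)) ≠ 2 := by
  rw [Ne, Fin.ext_iff, (val_fin hs).1, (val_fin hs).2.1]
  simp

theorem isSpatialPlane_two_three {s : ℕ} (hs : 3 ≤ s) : IsSpatialPlane (2 : Fin (s + 1)) 3 := by
  obtain ⟨h1, h2, h3⟩ := val_fin hs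
  refine ⟨?_, ?_, ?_⟩ <;> rw [Ne, Fin.ext_iff] <;> simp only [h2, h3, Fin.val_zero] <;> norm_num

theorem isSpatialPlane_one_three {s : ℕ} (hs : 3 ≤ s) : IsSpatialPlane (1 : Fin (s + 1)) 3 := by
  obtain ⟨h1, h2, h3⟩ := val_fin hs
  refine ⟨?_, ?_, ?_⟩ <;> rw [Ne, Fin.ext_iff] <;> simp only [h1, h3, Fin.val_zero] <;> norm_num

variable {s : ℕ}

/-- The rotation by `π` in the `(x₁, x₃)`-plane. -/
def halfTurn (hs : 3 ≤ s) : poincareGroup s := rotation (isSpatialPlane_one_three hs) Real.pi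

/-- Rotations in the `(x₂, x₃)`-plane. -/
def edgeRotation (hs : 3 ≤ s) (α : ℝ) : poincareGroup s :=
  rotation (isSpatialPlane_two_three hs) α

theorem halfTurn_apply (hs : 3 ≤ s) (x : Spacetime s) (k : Fin (s + 1)) :
    (halfTurn hs : Spacetime s ≃ᵃ[ℝ] Spacetime s) x k = if k = 1 ∨ k = 3 then - x k else x k := by
  have h13 := (isSpatialPlane_one_three hs).1
  rw [halfTurn, rotation_apply, rotationMap_apply]
  by_cases h1 : k = 1
  · subst h1; simp
  · by_cases h3 : k = 3
    · subst h3; simp [h13.symm]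
    · simp [h1, h3]

theorem halfTurn_mul_self (hs : 3 ≤ s) : halfTurn hs * halfTurn hs = 1 := by
  refine Subtype.ext (AffineEquiv.ext fun x => funext fun k => ?_)
  change (halfTurn hs : Spacetime s ≃ᵃ[ℝ] Spacetime s)
    ((halfTurn hs : Spacetime s ≃ᵃ[ℝ] Spacetime s) x) k = x k
  rw [halfTurn_apply, halfTurn_apply]
  split_ifs <;> simp

theorem halfTurn_inv (hs : 3 ≤ s) : (halfTurn hs)⁻¹ = halfTurn hs :=
  inv_eq_of_mul_eq_one_left (halfTurn_mul_self hs)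

end coordinates

/-! ### Subdivision of the line into cells with mirror images -/

section cells

/-- The index of the interval `((i - 1) π / (n + 1), i π / (n + 1)]` containing `x`. -/
def cellOf (n : ℕ) (x : ℝ) : ℤ := ⌈x * ((n + 1) / Real.pi)⌉

/-- The shift mapping the `i`-th interval onto its mirror image. -/
def cellShift (n : ℕ) (i : ℤ) : ℝ := -(2 * i - 1) * (Real.pi / (n + 1))

/-- In units of the mesh π/(n+1) the shift is minus twice the midpoint i - 1/2 of the cell, an
integer. Hence whole cells go to whole cells, with index i going to 1 - i. -/
theorem add_cellShift_mul (n : ℕ) (x : ℝ) (i : ℤ) :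
    (x + cellShift n i) * ((n + 1) / Real.pi) =
      x * ((n + 1) / Real.pi) - ((2 * i - 1 : ℤ) : ℝ) := by
  have := Real.pi_pos.ne'
  have hn : (n : ℝ) + 1 ≠ 0 := by positivity
  rw [cellShift]
  push_cast
  field_simp
  ring

theorem cellOf_add_cellShift (n : ℕ) (x : ℝ) :
    cellOf n (x + cellShift n (cellOf n x)) = 1 - cellOf n x := by
  rw [cellOf, add_cellShift_mul, Int.ceil_sub_intCast]
  change cellOf n x - (2 * cellOf n x - 1) = _
  ring

/-- A point is within half a mesh of the midpoint of its cell, so the shift is within one mesh of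
-2x, the shift that would reflect x exactly. -/
theorem abs_cellShift_add_le (n : ℕ) (x : ℝ) :
    |cellShift n (cellOf n x) + 2 * x| ≤ Real.pi / (n + 1) := by
  have hpos : 0 < ((n : ℝ) + 1) / Real.pi := div_pos (by positivity) Real.pi_pos
  have h := add_cellShift_mul n (2 * x) (cellOf n x)
  have h1 : x * ((n + 1) / Real.pi) ≤ cellOf n x := Int.le_ceil _
  have h2 : (cellOf n x : ℝ) < x * ((n + 1) / Real.pi) + 1 := Int.ceil_lt_add_one _
  push_cast at h
  have h3 : |(2 * x + cellShift n (cellOf n x)) * ((n + 1) / Real.pi)| ≤ 1 := by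
    rw [h, abs_le]
    constructor <;> linarith
  rw [abs_mul, abs_of_pos hpos, ← le_div_iff₀ hpos, one_div_div] at h3
  rwa [add_comm]

/-- The mesh divides (-π, π] exactly, into the cells with indices -n, …, n + 1, and i ↦ 1 - i
permutes them. So shifted angles remain principal arguments and never wrap around. -/
theorem add_cellShift_mem (n : ℕ) {x : ℝ} (hx : x ∈ Set.Ioc (-Real.pi) Real.pi) :
    x + cellShift n (cellOf n x) ∈ Set.Ioc (-Real.pi) Real.pi := by
  have hpi := Real.pi_pos
  have hpos : 0 < ((n : ℝ) + 1) / Real.pi := div_pos (by positivity) hpi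
  have e1 : Real.pi * ((n + 1) / Real.pi) = n + 1 := by field_simp
  have h := add_cellShift_mul n x (cellOf n x)
  have h1 : x * ((n + 1) / Real.pi) ≤ cellOf n x := Int.le_ceil _
  have h2 : (cellOf n x : ℝ) < x * ((n + 1) / Real.pi) + 1 := Int.ceil_lt_add_one _
  have h3 : cellOf n x ≤ n + 1 := by
    refine Int.ceil_le.2 ?_
    push_cast
    exact (mul_le_mul_of_nonneg_right hx.2 hpos.le).trans_eq e1
  have h4 : -((n : ℤ) + 1) < cellOf n x := by
    refine Int.lt_ceil.2 ?_
    push_cast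
    have := mul_lt_mul_of_pos_right hx.1 hpos
    rwa [neg_mul, e1] at this
  have h3' : (cellOf n x : ℝ) ≤ n + 1 := by exact_mod_cast h3
  have h4' : (-(n : ℝ)) ≤ cellOf n x := by
    have : -(n : ℤ) ≤ cellOf n x := by omega
    exact_mod_cast this
  push_cast at h
  constructor
  · refine lt_of_mul_lt_mul_right ?_ hpos.le
    rw [h, neg_mul, e1]
    linarith
  · refine le_of_mul_le_mul_right ?_ hpos
    rw [h, e1]
    linarith

theorem tendsto_cellShift (x : ℝ) :
    Tendsto (fun n => cellShift n (cellOf n x)) atTop (nhds (-2 * x)) := by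
  have h0 : Tendsto (fun n : ℕ => Real.pi / ((n : ℝ) + 1)) atTop (nhds 0) := by
    have := (tendsto_one_div_add_atTop_nhds_zero_nat (𝕜 := ℝ)).const_mul Real.pi
    simpa [div_eq_mul_inv] using this
  have h1 : Tendsto (fun n => cellShift n (cellOf n x) + 2 * x) atTop (nhds 0) :=
    squeeze_zero_norm (fun n => abs_cellShift_add_le n x) h0
  have := h1.sub_const (2 * x)
  simpa using this

/-- The index grows linearly in n, so a box of size (n+1)² eventually contains it; this permits
finite sums over cells. -/
theorem eventually_abs_cellOf_le (x : ℝ) :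
    ∀ᶠ n : ℕ in atTop, |cellOf n x| ≤ ((n : ℤ) + 1) ^ 2 := by
  obtain ⟨N, hN⟩ := exists_nat_gt |x|
  filter_upwards [eventually_ge_atTop N] with n hn
  have hn' : (N : ℝ) ≤ n := by exact_mod_cast hn
  have h1 : x * ((n + 1) / Real.pi) ≤ cellOf n x := Int.le_ceil _
  have h2 : (cellOf n x : ℝ) < x * ((n + 1) / Real.pi) + 1 := Int.ceil_lt_add_one _
  have h3 : |x * ((n + 1) / Real.pi)| ≤ n * (n + 1) := by
    rw [abs_mul]
    refine mul_le_mul (by linarith) ?_ (abs_nonneg _) (by positivity)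
    rw [abs_of_nonneg (by have := Real.pi_pos; positivity)]
    exact div_le_self (by positivity) (by linarith [Real.pi_gt_three])
  have h4 : |(cellOf n x : ℝ)| ≤ ((n : ℝ) + 1) ^ 2 := by
    rw [abs_le] at h3 ⊢
    have : (0 : ℝ) ≤ n := by positivity
    constructor <;> nlinarith
  exact_mod_cast h4

theorem measurable_cellOf (n : ℕ) : Measurable (cellOf n) :=
  Int.measurable_ceil.comp (measurable_id.mul_const _)

end cells

/-! ### Integrals under piecewise measure-preserving maps -/

section piecewise

/-- A map which is piecewise measure preserving with disjoint images does not increase integrals. -/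
theorem lintegral_piecewise_le {P C : Type*} [MeasurableSpace P] {ν : Measure P} (I : Finset C)
    {G : Set P} {cell : P → C} (hG : ∀ c, MeasurableSet {p | p ∈ G ∧ cell p = c}) {h : C → P → P}
    (hh : ∀ c, MeasurePreserving (h c) ν ν) {ρ : C → C} (hρ : Function.Involutive ρ)
    (hmap : ∀ p ∈ G, h (cell p) p ∈ G ∧ cell (h (cell p) p) = ρ (cell p)) {F : P → ℝ≥0∞}
    (hF : Measurable F) :
    ∫⁻ p, ∑ c ∈ I, {p | p ∈ G ∧ cell p = c}.indicator (fun p => F (h c p)) p ∂ν ≤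
      ∫⁻ p, F p ∂ν := by
  classical
  have hm : ∀ c, Measurable ({p | p ∈ G ∧ cell p = ρ c}.indicator F) := fun c =>
    hF.indicator (hG _)
  have hm' : ∀ c, Measurable ({p | p ∈ G ∧ cell p = c}.indicator fun p => F (h c p)) := fun c =>
    (hF.comp (hh c).measurable).indicator (hG c)
  rw [lintegral_finsetSum I fun c _ => hm' c]
  calc ∑ c ∈ I, ∫⁻ p, {p | p ∈ G ∧ cell p = c}.indicator (fun p => F (h c p)) p ∂ν
      ≤ ∑ c ∈ I, ∫⁻ p, {p | p ∈ G ∧ cell p = ρ c}.indicator F p ∂ν := by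
        refine Finset.sum_le_sum fun c _ => ?_
        -- The change of variables carries the piece with label c into the piece with label ρ c.
        rw [← (hh c).lintegral_comp (hm c)]
        refine lintegral_mono fun p => ?_
        by_cases hp : p ∈ G ∧ cell p = c
        · have h1 := hmap p hp.1
          rw [hp.2] at h1
          rw [Set.indicator_of_mem (by exact hp), Set.indicator_of_mem (by exact h1)]
        · rw [Set.indicator_of_notMem (by exact hp)]
          exact zero_le
    _ = ∫⁻ p, ∑ c ∈ I, {p | p ∈ G ∧ cell p = ρ c}.indicator F p ∂ν :=
        (lintegral_finsetSum I fun c _ => hm c).symm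
    _ ≤ ∫⁻ p, F p ∂ν := by
        refine lintegral_mono fun p => ?_
        calc ∑ c ∈ I, {p | p ∈ G ∧ cell p = ρ c}.indicator F p
            ≤ ∑ c ∈ I, if c = ρ (cell p) then F p else 0 := by
              refine Finset.sum_le_sum fun c _ => ?_
              by_cases hc : c = ρ (cell p)
              · rw [if_pos hc]
                exact Set.indicator_le_self _ _ _
              · rw [if_neg hc, Set.indicator_of_notMem]
                rintro ⟨-, hc'⟩
                -- As ρ is an involution, each point lies in the image piece of at most one label.
                exact hc (by rw [hc', hρ])
          _ ≤ F p := by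
              rw [Finset.sum_ite_eq']
              split_ifs
              · exact le_rfl
              · exact zero_le

open Classical in
theorem sum_indicator_cell {P C M : Type*} [AddCommMonoid M] (I : Finset C) (G : Set P)
    (cell : P → C) (F : C → P → M) (p : P) :
    ∑ c ∈ I, {p | p ∈ G ∧ cell p = c}.indicator (F c) p =
      if p ∈ G ∧ cell p ∈ I then F (cell p) p else 0 := by
  by_cases hp : p ∈ G
  · simp [Set.indicator, hp]
  · simp [Set.indicator, hp]

end piecewise

/-! ### Reaching the half turn by boosts and edge rotations -/

section reflection

variable {s : ℕ}

/-- The rapidity in the `x₁`-direction. -/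
def rapidity (p : Spacetime s) : ℝ := (Real.log (p 0 + p 1) - Real.log (p 0 - p 1)) / 2

/-- The components in the `(x₂, x₃)`-plane. -/
def edgePoint (p : Spacetime s) : ℂ := ⟨p 2, p 3⟩

/-- The set of momenta at which rapidity and edge angle are well defined. -/
def regularSet (s : ℕ) : Set (Spacetime s) := {p | |p 1| < p 0 ∧ edgePoint p ≠ 0}

theorem measurable_rapidity : Measurable (rapidity (s := s)) := by
  unfold rapidity
  fun_prop

theorem measurable_edgePoint : Measurable (edgePoint (s := s)) := by
  have : (edgePoint (s := s)) = fun p => ((p 2 : ℝ) : ℂ) + (p 3 : ℝ) * Complex.I := by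
    funext p
    exact Complex.mk_eq_add_mul_I _ _
  rw [this]
  fun_prop

theorem measurableSet_regularSet : MeasurableSet (regularSet s) := by
  have h1 : Measurable fun p : Spacetime s => |p 1| := (measurable_pi_apply 1).abs
  have h0 : Measurable fun p : Spacetime s => p 0 := measurable_pi_apply 0
  exact (measurableSet_lt h1 h0).inter (measurable_edgePoint (measurableSet_singleton 0).compl)

variable [NeZero s] (hs : 3 ≤ s)

/-- Boosts composed with rotations of the edge. -/
def boostRotation (hs : 3 ≤ s) (t β : ℝ) : poincareGroup s := boost s t * edgeRotation hs β

theorem boostRotation_apply (t β : ℝ) (p : Spacetime s) :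
    linearPart (boostRotation hs t β) p = boostMap s t (rotationMap 2 3 β p) := rfl

theorem boostRotation_coords (t β : ℝ) (p : Spacetime s) :
    linearPart (boostRotation hs t β) p 0 + linearPart (boostRotation hs t β) p 1 =
      Real.exp t * (p 0 + p 1) ∧
    linearPart (boostRotation hs t β) p 0 - linearPart (boostRotation hs t β) p 1 =
      Real.exp (-t) * (p 0 - p 1) := by
  have h23 := isSpatialPlane_two_three hs
  have h0 : rotationMap 2 3 β p 0 = p 0 := by
    rw [rotationMap_apply, if_neg h23.2.1.symm, if_neg h23.2.2.symm]
  have h1 : rotationMap 2 3 β p 1 = p 1 := by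
    rw [rotationMap_apply, if_neg (one_ne_two_fin hs), if_neg (isSpatialPlane_one_three hs).1]
  rw [boostRotation_apply, boostMap_plus, boostMap_minus, h0, h1]
  exact ⟨rfl, rfl⟩

theorem edgePoint_boostRotation (t β : ℝ) (p : Spacetime s) :
    edgePoint (linearPart (boostRotation hs t β) p) =
      Complex.exp (β * Complex.I) * edgePoint p := by
  have h23 := isSpatialPlane_two_three hs
  rw [boostRotation_apply, edgePoint, boostMap_other_coord _ _ h23.2.1 (one_ne_two_fin hs).symm,
    boostMap_other_coord _ _ h23.2.2 (isSpatialPlane_one_three hs).1.symm, rotationMap_apply,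
    rotationMap_apply, if_pos rfl, if_neg h23.1.symm, if_pos rfl, edgePoint]
  apply Complex.ext
  · rw [Complex.mul_re, Complex.exp_ofReal_mul_I_re, Complex.exp_ofReal_mul_I_im]
  · rw [Complex.mul_im, Complex.exp_ofReal_mul_I_re, Complex.exp_ofReal_mul_I_im]
    ring

theorem rapidity_boostRotation (t β : ℝ) {p : Spacetime s} (hp : |p 1| < p 0) :
    rapidity (linearPart (boostRotation hs t β) p) = rapidity p + t := by
  obtain ⟨h1, h2⟩ := abs_lt.1 hp
  obtain ⟨e1, e2⟩ := boostRotation_coords hs t β p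
  rw [rapidity, e1, e2, Real.log_mul (Real.exp_pos _).ne' (by linarith),
    Real.log_mul (Real.exp_pos _).ne' (by linarith), Real.log_exp, Real.log_exp, rapidity]
  ring

theorem boostRotation_mem_regularSet (t β : ℝ) {p : Spacetime s} (hp : p ∈ regularSet s) :
    linearPart (boostRotation hs t β) p ∈ regularSet s := by
  obtain ⟨h1, h2⟩ := abs_lt.1 hp.1
  obtain ⟨e1, e2⟩ := boostRotation_coords hs t β p
  constructor
  · have h3 := mul_pos (Real.exp_pos t) (by linarith : 0 < p 0 + p 1)
    have h4 := mul_pos (Real.exp_pos (-t)) (by linarith : 0 < p 0 - p 1)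
    rw [abs_lt]
    constructor <;> linarith
  · rw [edgePoint_boostRotation]
    exact mul_ne_zero (Complex.exp_ne_zero _) hp.2

theorem arg_boostRotation (t β : ℝ) {p : Spacetime s} (hp : edgePoint p ≠ 0)
    (h : (edgePoint p).arg + β ∈ Set.Ioc (-Real.pi) Real.pi) :
    (edgePoint (linearPart (boostRotation hs t β) p)).arg = (edgePoint p).arg + β := by
  rw [edgePoint_boostRotation]
  have e : Complex.exp (β * Complex.I) * edgePoint p = (‖edgePoint p‖ : ℝ) *
      (Complex.cos (((edgePoint p).arg + β : ℝ) : ℂ) +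
        Complex.sin (((edgePoint p).arg + β : ℝ) : ℂ) * Complex.I) := by
    rw [← Complex.exp_mul_I]
    conv_lhs => rw [← Complex.norm_mul_exp_arg_mul_I (edgePoint p)]
    push_cast
    rw [add_mul, Complex.exp_add]
    ring
  rw [e, Complex.arg_mul_cos_add_sin_mul_I (norm_pos_iff.2 hp) h]

/-- The pair of cell indices of a momentum. -/
def momentumCell (n : ℕ) (p : Spacetime s) : ℤ × ℤ :=
  (cellOf n (rapidity p), cellOf n (edgePoint p).arg)

/-- The Poincaré transformation mapping a cell onto its mirror image. -/
def cellMap (n : ℕ) (c : ℤ × ℤ) : poincareGroup s :=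
  boostRotation hs (cellShift n c.1) (cellShift n c.2)

theorem measurable_momentumCell (n : ℕ) : Measurable (momentumCell (s := s) n) :=
  ((measurable_cellOf n).comp measurable_rapidity).prodMk
    ((measurable_cellOf n).comp (Complex.measurable_arg.comp measurable_edgePoint))

theorem cellMap_mem (n : ℕ) {p : Spacetime s} (hp : p ∈ regularSet s) :
    linearPart (cellMap hs n (momentumCell n p)) p ∈ regularSet s ∧
      momentumCell n (linearPart (cellMap hs n (momentumCell n p)) p) =
        (1 - (momentumCell n p).1, 1 - (momentumCell n p).2) := by
  refine ⟨boostRotation_mem_regularSet hs _ _ hp, ?_⟩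
  change (cellOf n (rapidity (linearPart (boostRotation hs (cellShift n (cellOf n (rapidity p)))
    (cellShift n (cellOf n (edgePoint p).arg))) p)), cellOf n (edgePoint (linearPart (boostRotation hs
    (cellShift n (cellOf n (rapidity p))) (cellShift n (cellOf n (edgePoint p).arg))) p)).arg) = _
  rw [rapidity_boostRotation hs _ _ hp.1, arg_boostRotation hs _ _ hp.2
    (add_cellShift_mem n (Complex.arg_mem_Ioc _))]
  simp only [momentumCell, cellOf_add_cellShift]

/-- The shifts converge to -2 times the rapidity and -2 times the edge angle. That boost exchanges
p₀ + p₁ and p₀ - p₁, and that rotation conjugates p₂ + ip₃, so together they act on p as the half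
turn. -/
theorem tendsto_cellMap {p : Spacetime s} (hp : p ∈ regularSet s) :
    Tendsto (fun n => linearPart (cellMap hs n (momentumCell n p)) p) atTop
      (nhds (linearPart (halfTurn hs) p)) := by
  have hcont : Continuous fun q : ℝ × ℝ => boostMap s q.1 (rotationMap 2 3 q.2 p) := by
    refine continuous_pi fun k => ?_
    have hr : ∀ k, Continuous fun q : ℝ × ℝ => rotationMap 2 3 q.2 p k := by
      intro k
      simp only [rotationMap_apply]
      split_ifs <;> fun_prop
    have h0 := hr 0
    have h1 := hr 1
    have hk := hr k
    simp only [boostMap, LinearMap.coe_mk, AddHom.coe_mk]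
    split_ifs <;> fun_prop
  have hlim := (hcont.tendsto (-2 * rapidity p, -2 * (edgePoint p).arg)).comp
    ((tendsto_cellShift (rapidity p)).prodMk_nhds (tendsto_cellShift (edgePoint p).arg))
  have e : boostMap s (-2 * rapidity p) (rotationMap 2 3 (-2 * (edgePoint p).arg) p) =
      linearPart (halfTurn hs) p := by
    obtain ⟨h1, h2⟩ := abs_lt.1 hp.1
    have h13 := isSpatialPlane_one_three hs
    have h23 := isSpatialPlane_two_three hs
    have hT : ∀ k, linearPart (halfTurn hs) p k = if k = 1 ∨ k = 3 then - p k else p k :=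
      halfTurn_apply hs p
    obtain ⟨e1, e2⟩ := boostRotation_coords hs (-2 * rapidity p) (-2 * (edgePoint p).arg) p
    have e3 := edgePoint_boostRotation hs (-2 * rapidity p) (-2 * (edgePoint p).arg) p
    rw [boostRotation_apply] at e1 e2 e3
    have hexp : Real.exp (-2 * rapidity p) = (p 0 - p 1) / (p 0 + p 1) := by
      rw [rapidity, show -2 * ((Real.log (p 0 + p 1) - Real.log (p 0 - p 1)) / 2) =
        Real.log (p 0 - p 1) - Real.log (p 0 + p 1) by ring, Real.exp_sub,
        Real.exp_log (by linarith), Real.exp_log (by linarith)]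
    have hexp' : Real.exp (-(-2 * rapidity p)) = (p 0 + p 1) / (p 0 - p 1) := by
      rw [Real.exp_neg, hexp, inv_div]
    have hconj : Complex.exp (((-2 * (edgePoint p).arg : ℝ) : ℂ) * Complex.I) * edgePoint p =
        (starRingEnd ℂ) (edgePoint p) := by
      have hz := Complex.norm_mul_exp_arg_mul_I (edgePoint p)
      have hc : (starRingEnd ℂ) (edgePoint p) =
          ‖edgePoint p‖ * Complex.exp (-((edgePoint p).arg * Complex.I)) := by
        conv_lhs => rw [← hz]
        rw [map_mul, Complex.conj_ofReal, ← Complex.exp_conj, map_mul, Complex.conj_I,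
          Complex.conj_ofReal, mul_neg]
      have hgen : ∀ (r a : ℝ) (z : ℂ), r * Complex.exp (a * Complex.I) = z →
          Complex.exp (((-2 * a : ℝ) : ℂ) * Complex.I) * z =
            r * Complex.exp (-(a * Complex.I)) := by
        rintro r a _ rfl
        rw [mul_left_comm, ← Complex.exp_add]
        congr 2
        push_cast
        ring
      rw [hc, hgen _ _ _ hz]
    rw [hexp, div_mul_cancel₀ _ (by linarith)] at e1
    rw [hexp', div_mul_cancel₀ _ (by linarith)] at e2
    rw [hconj] at e3
    funext k
    rw [hT]
    by_cases k0 : k = 0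
    · subst k0
      rw [if_neg (by rintro (h | h); exacts [h13.2.1 h.symm, h13.2.2 h.symm])]
      linarith
    by_cases k1 : k = 1
    · subst k1
      rw [if_pos (Or.inl rfl)]
      linarith
    by_cases k2 : k = 2
    · subst k2
      rw [if_neg (by rintro (h | h); exacts [one_ne_two_fin hs h.symm, h23.1 h])]
      exact congrArg Complex.re e3
    by_cases k3 : k = 3
    · subst k3
      rw [if_pos (Or.inr rfl)]
      exact congrArg Complex.im e3
    · rw [if_neg (by tauto), boostMap_other_coord _ _ k0 k1, rotationMap_apply, if_neg k2, if_neg k3]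
  rw [← e]
  exact hlim

/-- The boost parameter differs from -2 times the rapidity by at most one mesh, hence by at most π.
So p₀ ± p₁ are exchanged up to factors between e^{-π} and e^{π}; these bounds, uniform in n, provide
the dominating function later. -/
theorem cellMap_energy (n : ℕ) {p : Spacetime s} (hp : p ∈ regularSet s) :
    Real.exp (-Real.pi) * p 0 ≤ linearPart (cellMap hs n (momentumCell n p)) p 0 ∧
      linearPart (cellMap hs n (momentumCell n p)) p 0 ≤ Real.exp Real.pi * p 0 := by
  obtain ⟨h1, h2⟩ := abs_lt.1 hp.1
  obtain ⟨e1, e2⟩ := boostRotation_coords hs (cellShift n (momentumCell n p).1)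
    (cellShift n (momentumCell n p).2) p
  change linearPart (cellMap hs n (momentumCell n p)) p 0 + _ = _ at e1
  change linearPart (cellMap hs n (momentumCell n p)) p 0 - _ = _ at e2
  have hδ := abs_cellShift_add_le n (rapidity p)
  set δ := cellShift n (cellOf n (rapidity p)) + 2 * rapidity p with hδ'
  have hδpi : |δ| ≤ Real.pi := hδ.trans (div_le_self Real.pi_pos.le (by
    have : (0 : ℝ) ≤ n := by positivity
    linarith))
  obtain ⟨d1, d2⟩ := abs_le.1 hδpi
  have ht : cellShift n (momentumCell n p).1 = δ - 2 * rapidity p := by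
    rw [hδ', momentumCell]; ring
  have hexp : Real.exp (2 * rapidity p) = (p 0 + p 1) / (p 0 - p 1) := by
    rw [rapidity, show 2 * ((Real.log (p 0 + p 1) - Real.log (p 0 - p 1)) / 2) =
      Real.log (p 0 + p 1) - Real.log (p 0 - p 1) by ring, Real.exp_sub,
      Real.exp_log (by linarith), Real.exp_log (by linarith)]
  have hu : 0 < p 0 + p 1 := by linarith
  have hv : 0 < p 0 - p 1 := by linarith
  have f1 : Real.exp (cellShift n (momentumCell n p).1) * (p 0 + p 1) =
      Real.exp δ * (p 0 - p 1) := by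
    rw [ht, Real.exp_sub, hexp]
    field_simp
  have f2 : Real.exp (-cellShift n (momentumCell n p).1) * (p 0 - p 1) =
      Real.exp (-δ) * (p 0 + p 1) := by
    rw [ht, neg_sub, Real.exp_sub, hexp, Real.exp_neg]
    field_simp
  rw [f1] at e1
  rw [f2] at e2
  have g1 := Real.exp_le_exp.2 d1
  have g2 := Real.exp_le_exp.2 d2
  have g3 := Real.exp_le_exp.2 (neg_le_neg d1)
  have g4 := Real.exp_le_exp.2 (neg_le_neg d2)
  rw [neg_neg] at g3
  constructor <;> nlinarith [mul_le_mul_of_nonneg_right g1 hv.le, mul_le_mul_of_nonneg_right g2 hv.le,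
    mul_le_mul_of_nonneg_right g3 hu.le, mul_le_mul_of_nonneg_right g4 hu.le]

end reflection

/-! ### Null sets and test functions on the mass shells -/

section massShell

variable {s : ℕ}

theorem ae_massShell_of_forall (m : ℝ≥0) {S : Set (Spacetime s)} (hS : MeasurableSet S)
    {i : Fin s} (h : ∀ q : Fin s → ℝ, q i ≠ 0 → shellPoint m q ∈ S) :
    ∀ᵐ p ∂massShellMeasure s m, p ∈ S := by
  rw [massShellMeasure]
  refine (ae_map_iff (p := fun p => p ∈ S) (continuous_shellPoint m).measurable.aemeasurable hS).2 ?_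
  refine (withDensity_absolutelyContinuous _ _).ae_le ?_
  have hker : LinearMap.ker (LinearMap.proj i : (Fin s → ℝ) →ₗ[ℝ] ℝ) ≠ ⊤ := by
    intro htop
    have : (Pi.single i 1 : Fin s → ℝ) ∈
      LinearMap.ker (LinearMap.proj i : (Fin s → ℝ) →ₗ[ℝ] ℝ) := by rw [htop]; trivial
    simp at this
  have hnull := Measure.addHaar_submodule (volume : Measure (Fin s → ℝ)) _ hker
  filter_upwards [measure_eq_zero_iff_ae_notMem.1 hnull] with q hq
  exact h q fun h0 => hq h0

theorem ae_mem_regularSet (hs : 3 ≤ s) (m : ℝ≥0) :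
    ∀ᵐ p ∂massShellMeasure s m, p ∈ regularSet s := by
  -- The momentum component with index 1 is the spacetime coordinate x₂. That it is nonzero gives
  -- both a nonzero edge point and |p₁| < p₀, even for mass zero.
  let i : Fin s := ⟨1, by omega⟩
  let i₀ : Fin s := ⟨0, by omega⟩
  have hi : i.succ = 2 := Fin.ext (by rw [(val_fin hs).2.1]; rfl)
  have hi₀ : i₀.succ = 1 := Fin.ext (by rw [(val_fin hs).1]; rfl)
  refine ae_massShell_of_forall m measurableSet_regularSet (i := i) fun q hq => ⟨?_, ?_⟩
  · have h1 : shellPoint m q 1 = q i₀ := by rw [← hi₀]; rfl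
    rw [h1]
    refine abs_lt_of_sq_lt_sq ?_ (energy_nonneg m q)
    change _ < energy m q ^ 2
    rw [energy_sq]
    have h2 : q i₀ ^ 2 + q i ^ 2 ≤ ∑ k, q k ^ 2 := by
      have hne : i₀ ≠ i := by simp [i, i₀]
      rw [← Finset.sum_pair (f := fun k => q k ^ 2) hne]
      exact Finset.sum_le_sum_of_subset_of_nonneg (Finset.subset_univ _) fun _ _ _ => sq_nonneg _
    have h3 : 0 < q i ^ 2 := by positivity
    nlinarith [sq_nonneg (m : ℝ)]
  · intro h
    have h2 := congrArg Complex.re h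
    change shellPoint m q 2 = 0 at h2
    rw [← hi] at h2
    exact hq h2

/-- The upper energy bound confines the momenta to a ball, and the lower one bounds the density
1/(2ω), which is singular at the origin when m = 0. -/
theorem massShellMeasure_slab_lt_top (m : ℝ≥0) {c D : ℝ} (hc : 0 < c) :
    massShellMeasure s m {p | c ≤ p 0 ∧ p 0 ≤ D} < ∞ := by
  have h0 : Measurable fun p : Spacetime s => p 0 := measurable_pi_apply 0
  have hS : MeasurableSet {p : Spacetime s | c ≤ p 0 ∧ p 0 ≤ D} :=
    (measurableSet_le measurable_const h0).inter (measurableSet_le h0 measurable_const)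
  have hsm := (continuous_shellPoint (s := s) m).measurable
  rw [massShellMeasure, Measure.map_apply hsm hS, momentumMeasure,
    withDensity_apply _ (hsm hS)]
  calc ∫⁻ q in shellPoint m ⁻¹' {p | c ≤ p 0 ∧ p 0 ≤ D}, ENNReal.ofReal (1 / (2 * energy m q))
      ≤ ∫⁻ q in shellPoint m ⁻¹' {p | c ≤ p 0 ∧ p 0 ≤ D}, ENNReal.ofReal (1 / (2 * c)) := by
        refine setLIntegral_mono' (hsm hS) fun q hq => ENNReal.ofReal_le_ofReal ?_
        have : c ≤ energy m q := hq.1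
        exact one_div_le_one_div_of_le (by positivity) (by linarith)
    _ ≤ ENNReal.ofReal (1 / (2 * c)) * volume (Metric.closedBall (0 : Fin s → ℝ) |D|) := by
        rw [setLIntegral_const]
        refine mul_le_mul_right (measure_mono fun q hq => ?_) _
        rw [mem_closedBall_zero_iff, pi_norm_le_iff_of_nonneg (abs_nonneg _)]
        intro k
        have hE : energy m q ≤ D := hq.2
        refine le_trans (abs_le_of_sq_le_sq ?_ (energy_nonneg m q)) (hE.trans (le_abs_self _))
        rw [energy_sq]
        have := Finset.single_le_sum (f := fun k => q k ^ 2) (fun k _ => sq_nonneg _)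
          (Finset.mem_univ k)
        nlinarith [sq_nonneg (m : ℝ)]
    _ < ∞ := ENNReal.mul_lt_top ENNReal.ofReal_lt_top measure_closedBall_lt_top

/-- A continuous cutoff to energies in `[1 / (k + 1), k + 2]`. -/
def energyCutoff (k : ℕ) (p : Spacetime s) : ℝ :=
  max 0 (min 1 (min ((k + 1) * p 0 - 1) (k + 2 - p 0)))

theorem continuous_energyCutoff (k : ℕ) : Continuous (energyCutoff (s := s) k) := by
  unfold energyCutoff
  fun_prop

theorem energyCutoff_nonneg (k : ℕ) (p : Spacetime s) : 0 ≤ energyCutoff k p := le_max_left _ _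

theorem energyCutoff_le_one (k : ℕ) (p : Spacetime s) : energyCutoff k p ≤ 1 :=
  max_le zero_le_one (min_le_left _ _)

theorem energyCutoff_support (k : ℕ) {p : Spacetime s} (h : energyCutoff k p ≠ 0) :
    1 / ((k : ℝ) + 1) ≤ p 0 ∧ p 0 ≤ k + 2 := by
  have hk : (0 : ℝ) < k + 1 := by positivity
  have h1 : 0 < min 1 (min ((k + 1) * p 0 - 1) (k + 2 - p 0)) := by
    by_contra hle
    exact h (max_eq_left (not_lt.1 hle))
  obtain ⟨h2, h3⟩ := lt_min_iff.1 (lt_min_iff.1 h1).2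
  refine ⟨?_, by linarith⟩
  rw [div_le_iff₀ hk]
  linarith

theorem tendsto_energyCutoff {p : Spacetime s} (hp : 0 < p 0) :
    Tendsto (fun k => energyCutoff k p) atTop (nhds 1) := by
  refine tendsto_const_nhds.congr' ?_
  obtain ⟨N, hN⟩ := exists_nat_gt (max (2 / p 0) (p 0))
  filter_upwards [eventually_ge_atTop N] with k hk
  have hk' : (N : ℝ) ≤ k := by exact_mod_cast hk
  have h1 : 2 / p 0 < N := (le_max_left _ _).trans_lt hN
  have h2 : p 0 < N := (le_max_right _ _).trans_lt hN
  rw [div_lt_iff₀ hp] at h1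
  rw [energyCutoff, min_eq_left, max_eq_right zero_le_one]
  refine le_min ?_ (by linarith)
  nlinarith

/-- Functions on momentum space which are continuous and bounded, with energies bounded and bounded
away from zero on their support. -/
structure IsTestFunction (g : Spacetime s → ℂ) : Prop where
  continuous : Continuous g
  bounded : ∃ C, ∀ p, ‖g p‖ ≤ C
  support : ∃ c D : ℝ, 0 < c ∧ ∀ p, g p ≠ 0 → c ≤ p 0 ∧ p 0 ≤ D

/-- Energy cutoffs approximate f by functions living on slabs of finite measure. On a slab, bounded
continuous functions are dense, and multiplying them by the cutoff gives test functions. -/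
theorem dense_testFunctions (hs : 3 ≤ s) (m : ℝ≥0) :
    Dense {f : Lp ℂ 2 (massShellMeasure s m) |
      ∃ g, IsTestFunction g ∧ f =ᵐ[massShellMeasure s m] g} := by
  set σ := massShellMeasure s m
  rw [Metric.dense_iff]
  intro f ε hε
  have hχ : ∀ k, BddMeas fun p : Spacetime s => (energyCutoff k p : ℂ) := fun k =>
    bddMeas_ofReal (continuous_energyCutoff k).measurable (M := 1) fun p => by
      rw [abs_of_nonneg (energyCutoff_nonneg k p)]; exact energyCutoff_le_one k p
  have hlim : Tendsto (fun k => mulOp σ (fun p => (energyCutoff k p : ℂ)) f) atTop (nhds f) := by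
    refine tendsto_of_dominated (Lp.memLp f).norm (fun k => ?_) ?_
    · filter_upwards [mulOp_ae (hχ k) f] with p hp
      rw [hp, norm_mul, Complex.norm_real, Real.norm_of_nonneg (energyCutoff_nonneg k p)]
      exact mul_le_of_le_one_left (norm_nonneg _) (energyCutoff_le_one k p)
    · filter_upwards [ae_all_iff.2 fun k => mulOp_ae (hχ k) f, ae_mem_regularSet hs m] with p hp hreg
      simp only [hp]
      have h0 : 0 < p 0 := (abs_nonneg _).trans_lt hreg.1
      have := ((Complex.continuous_ofReal.tendsto _).comp (tendsto_energyCutoff h0)).mul_const (f p)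
      rw [Complex.ofReal_one, one_mul] at this
      exact this
  obtain ⟨k, hk⟩ := (Metric.tendsto_atTop.1 hlim (ε / 2) (half_pos hε))
  have hk := hk k le_rfl
  have hc : (0 : ℝ) < 1 / ((k : ℝ) + 1) := by positivity
  set D : Set (Spacetime s) := {p | 1 / ((k : ℝ) + 1) ≤ p 0 ∧ p 0 ≤ k + 2} with hD
  have h0 : Measurable fun p : Spacetime s => p 0 := measurable_pi_apply 0
  have hDm : MeasurableSet D :=
    (measurableSet_le measurable_const h0).inter (measurableSet_le h0 measurable_const)
  have hfin : σ D < ∞ := massShellMeasure_slab_lt_top m hc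
  have : IsFiniteMeasure (σ.restrict D) := ⟨by rwa [Measure.restrict_apply_univ]⟩
  obtain ⟨g₀, hg₀, hg₀'⟩ := ((Lp.memLp f).restrict D).exists_boundedContinuous_eLpNorm_sub_le
    (by simp) (ε := ENNReal.ofReal (ε / 4)) (by simpa using hε)
  let g : Spacetime s → ℂ := fun p => (energyCutoff k p : ℂ) * g₀ p
  have hgtest : IsTestFunction g := by
    refine ⟨?_, ⟨‖g₀‖, fun p => ?_⟩, ⟨_, _, hc, fun p hp => energyCutoff_support k (p := p) ?_⟩⟩
    · exact (Complex.continuous_ofReal.comp (continuous_energyCutoff k)).mul g₀.continuous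
    · rw [norm_mul, Complex.norm_real, Real.norm_of_nonneg (energyCutoff_nonneg k p)]
      exact (mul_le_of_le_one_left (norm_nonneg _) (energyCutoff_le_one k p)).trans
        (g₀.norm_coe_le_norm p)
    · intro h
      exact hp (by simp [g, h])
  have hle : ∀ (φ : Spacetime s → ℂ) p, ‖(energyCutoff k p : ℂ) * φ p‖ ≤ ‖D.indicator φ p‖ := by
    intro φ p
    by_cases hp : energyCutoff k p = 0
    · simp [hp]
    · rw [Set.indicator_of_mem (show p ∈ D from energyCutoff_support k hp), norm_mul,
        Complex.norm_real, Real.norm_of_nonneg (energyCutoff_nonneg k p)]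
      exact mul_le_of_le_one_left (norm_nonneg _) (energyCutoff_le_one k p)
  have hgL : MemLp g 2 σ :=
    ((memLp_indicator_iff_restrict hDm).2 hg₀').mono hgtest.continuous.aestronglyMeasurable
      (ae_of_all _ (hle g₀))
  refine ⟨hgL.toLp, ?_, g, hgtest, hgL.coeFn_toLp⟩
  rw [Metric.mem_ball, dist_comm]
  have hdist : dist (mulOp σ (fun p => (energyCutoff k p : ℂ)) f) hgL.toLp ≤ ε / 4 := by
    rw [Lp.dist_def]
    refine ENNReal.toReal_le_of_le_ofReal (by positivity) (le_trans ?_ hg₀)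
    rw [← eLpNorm_indicator_eq_eLpNorm_restrict hDm]
    refine eLpNorm_mono_ae ?_
    filter_upwards [mulOp_ae (hχ k) f, hgL.coeFn_toLp] with p h1 h2
    rw [Pi.sub_apply, h1, h2, ← mul_sub]
    exact hle (⇑f - ⇑g₀) p
  calc dist f hgL.toLp ≤ dist f (mulOp σ (fun p => (energyCutoff k p : ℂ)) f) +
        dist (mulOp σ (fun p => (energyCutoff k p : ℂ)) f) hgL.toLp := dist_triangle _ _ _
    _ < ε := by rw [dist_comm] at hk; linarith

end massShell

/-! ### The half turn as a strong limit of cellwise group elements -/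

section reflectionOperator

variable {s : ℕ} [NeZero s] (hs : 3 ≤ s)

/-- A finite set of cells. -/
def cellBox (n : ℕ) : Finset (ℤ × ℤ) :=
  Finset.Icc (-((n : ℤ) + 1) ^ 2) (((n : ℤ) + 1) ^ 2) ×ˢ
    Finset.Icc (-((n : ℤ) + 1) ^ 2) (((n : ℤ) + 1) ^ 2)

/-- The regular momenta in a given cell. -/
def cellSet (s n : ℕ) (c : ℤ × ℤ) : Set (Spacetime s) := {p | p ∈ regularSet s ∧ momentumCell n p = c}

theorem measurableSet_cellSet (n : ℕ) (c : ℤ × ℤ) : MeasurableSet (cellSet s n c) :=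
  measurableSet_regularSet.inter (measurable_momentumCell n (measurableSet_singleton c))

/-- Approximations to the half turn by piecewise boosts and edge rotations. -/
def reflectionOp (hs : 3 ≤ s) (n : ℕ) (m : ℝ≥0) :
    Lp ℂ 2 (massShellMeasure s m) →L[ℂ] Lp ℂ 2 (massShellMeasure s m) :=
  ∑ c ∈ cellBox n, (mulOp (massShellMeasure s m) ((cellSet s n c).indicator 1)).comp
    ((scalarRep s m (cellMap hs n c)⁻¹).toContinuousLinearEquiv :
      Lp ℂ 2 (massShellMeasure s m) →L[ℂ] Lp ℂ 2 (massShellMeasure s m))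

theorem bddMeas_indicator {P : Type*} [MeasurableSpace P] {B : Set P} (hB : MeasurableSet B) :
    BddMeas (B.indicator 1 : P → ℂ) :=
  BddMeas.of_le (measurable_one.indicator hB) 1 fun p => by
    by_cases hp : p ∈ B <;> simp [hp]

theorem scalarRep_inv_ae (g : poincareGroup s)
    (hg : (g : Spacetime s ≃ᵃ[ℝ] Spacetime s) 0 = 0) (m : ℝ≥0)
    (f : Lp ℂ 2 (massShellMeasure s m)) :
    scalarRep s m g⁻¹ f =ᵐ[massShellMeasure s m] fun p => f (linearPart g p) := by
  refine (scalarIsometry_ae m g⁻¹ f).trans (ae_of_all _ fun p => ?_)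
  have h1 : translationPart g⁻¹ = 0 := by
    change (g : Spacetime s ≃ᵃ[ℝ] Spacetime s).symm 0 = 0
    rw [AffineEquiv.symm_apply_eq, hg]
  have h2 : (linearPart g⁻¹).symm p = linearPart g p := rfl
  rw [scalarFun, h1, h2]
  simp [minkowski]

theorem measurePreserving_linearPart (g : poincareGroup s) (m : ℝ≥0) :
    MeasurePreserving (linearPart g) (massShellMeasure s m) (massShellMeasure s m) :=
  measurePreserving_lorentz g.2 m

theorem cellMap_zero (n : ℕ) (c : ℤ × ℤ) :
    (cellMap hs n c : Spacetime s ≃ᵃ[ℝ] Spacetime s) 0 = 0 :=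
  (linearPart (cellMap hs n c)).map_zero

theorem reflectionOp_ae (n : ℕ) (m : ℝ≥0) (f : Lp ℂ 2 (massShellMeasure s m)) :
    reflectionOp hs n m f =ᵐ[massShellMeasure s m] fun p => ∑ c ∈ cellBox n,
      (cellSet s n c).indicator (fun p => f (linearPart (cellMap hs n c) p)) p := by
  have h1 : reflectionOp hs n m f = ∑ c ∈ cellBox n, mulOp (massShellMeasure s m)
      ((cellSet s n c).indicator 1) (scalarRep s m (cellMap hs n c)⁻¹ f) := by
    rw [reflectionOp, ContinuousLinearMap.sum_apply]
    rfl
  rw [h1]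
  refine (Lp.coeFn_finsetSum _ _).trans ?_
  have h2 : ∀ᵐ p ∂massShellMeasure s m, ∀ c : ℤ × ℤ, mulOp (massShellMeasure s m)
      ((cellSet s n c).indicator 1) (scalarRep s m (cellMap hs n c)⁻¹ f) p =
      (cellSet s n c).indicator 1 p * scalarRep s m (cellMap hs n c)⁻¹ f p :=
    ae_all_iff.2 fun c => mulOp_ae (bddMeas_indicator (measurableSet_cellSet n c)) _
  filter_upwards [h2, ae_all_iff.2 fun c : ℤ × ℤ =>
    scalarRep_inv_ae (cellMap hs n c) (cellMap_zero hs n c) m f] with p h3 h4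
  rw [Finset.sum_apply]
  refine Finset.sum_congr rfl fun c _ => ?_
  rw [h3 c, h4 c]
  by_cases hp : p ∈ cellSet s n c <;> simp [hp]

/-- Distinct cells are carried by measure-preserving maps into distinct mirror cells, so no part of
f is counted twice. -/
theorem norm_reflectionOp_le (n : ℕ) (m : ℝ≥0) : ‖reflectionOp hs n m‖ ≤ 1 := by
  classical
  refine ContinuousLinearMap.opNorm_le_bound _ zero_le_one fun f => ?_
  rw [one_mul]
  have hF : Measurable fun p => ‖f p‖ₑ ^ (2 : ℝ) :=
    (Lp.stronglyMeasurable f).enorm.pow_const _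
  have h := lintegral_piecewise_le (ν := massShellMeasure s m) (cellBox n) (G := regularSet s)
    (cell := momentumCell n) (measurableSet_cellSet n) (h := fun c => linearPart (cellMap hs n c))
    (fun c => measurePreserving_linearPart _ m) (ρ := fun c => (1 - c.1, 1 - c.2))
    (fun c => by simp) (fun p hp => cellMap_mem hs n hp) hF
  have h2 : ∫⁻ p, ‖reflectionOp hs n m f p‖ₑ ^ (2 : ℝ) ∂massShellMeasure s m ≤
      ∫⁻ p, ‖f p‖ₑ ^ (2 : ℝ) ∂massShellMeasure s m := by
    refine le_trans (le_of_eq (lintegral_congr_ae ?_)) h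
    filter_upwards [reflectionOp_ae hs n m f] with p hp
    rw [hp]
    unfold cellSet
    rw [sum_indicator_cell, sum_indicator_cell (F := fun c p => ‖f (linearPart (cellMap hs n c) p)‖ₑ ^ (2 : ℝ))]
    split_ifs <;> simp
  rw [lintegral_enorm_sq, lintegral_enorm_sq, ENNReal.ofReal_le_ofReal_iff (by positivity)] at h2
  exact le_of_sq_le_sq (by simpa using h2) (norm_nonneg _)

/-- By the uniform bound it suffices to treat test functions. For these the values converge
pointwise by continuity, and the energy estimates place all supports in one slab of finite measure,
so dominated convergence applies. -/
theorem tendsto_reflectionOp (m : ℝ≥0) (f : Lp ℂ 2 (massShellMeasure s m)) :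
    Tendsto (fun n => reflectionOp hs n m f) atTop (nhds (scalarRep s m (halfTurn hs) f)) := by
  classical
  refine tendsto_of_dense (dense_testFunctions hs m) (b := fun n => reflectionOp hs n m)
    (b' := ((scalarRep s m (halfTurn hs)).toContinuousLinearEquiv :
      Lp ℂ 2 (massShellMeasure s m) →L[ℂ] Lp ℂ 2 (massShellMeasure s m)))
    (norm_reflectionOp_le hs · m) ?_ f
  rintro f ⟨g, hg, hfg⟩
  obtain ⟨C, hC⟩ := hg.bounded
  obtain ⟨c, D, hc, hD⟩ := hg.support
  have hC0 : 0 ≤ C := (norm_nonneg _).trans (hC 0)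
  have hT : ∀ᵐ p ∂massShellMeasure s m, ∀ n, reflectionOp hs n m f p =
      if p ∈ regularSet s ∧ momentumCell n p ∈ cellBox n then
        g (linearPart (cellMap hs n (momentumCell n p)) p) else 0 := by
    have h1 : ∀ᵐ p ∂massShellMeasure s m, ∀ n, ∀ c : ℤ × ℤ, f (linearPart (cellMap hs n c) p) =
        g (linearPart (cellMap hs n c) p) :=
      ae_all_iff.2 fun n => ae_all_iff.2 fun c =>
        (measurePreserving_linearPart (cellMap hs n c) m).quasiMeasurePreserving.ae_eq_comp hfg
    filter_upwards [h1, ae_all_iff.2 fun n => reflectionOp_ae hs n m f] with p h2 h3 n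
    rw [h3 n]
    unfold cellSet
    rw [sum_indicator_cell]
    simp only [h2]
  have hr : ∀ᵐ p ∂massShellMeasure s m, scalarRep s m (halfTurn hs) f p =
      g (linearPart (halfTurn hs) p) := by
    have h1 := scalarRep_inv_ae (halfTurn hs) (linearPart (halfTurn hs)).map_zero m f
    rw [halfTurn_inv] at h1
    filter_upwards [h1, (measurePreserving_linearPart (halfTurn hs)
      m).quasiMeasurePreserving.ae_eq_comp hfg] with p h2 h3
    rw [h2]
    exact h3
  set S : Set (Spacetime s) :=
    {p | Real.exp (-Real.pi) * c ≤ p 0 ∧ p 0 ≤ Real.exp Real.pi * D} with hS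
  have h0 : Measurable fun p : Spacetime s => p 0 := measurable_pi_apply 0
  have hSm : MeasurableSet S :=
    (measurableSet_le measurable_const h0).inter (measurableSet_le h0 measurable_const)
  have hSfin := massShellMeasure_slab_lt_top (s := s) m (c := Real.exp (-Real.pi) * c)
    (D := Real.exp Real.pi * D) (by positivity)
  refine tendsto_of_dominated (memLp_indicator_const 2 hSm C (Or.inr hSfin.ne)) (fun n => ?_) ?_
  · filter_upwards [hT] with p hp
    rw [hp n]
    split_ifs with hreg
    · by_cases hz : g (linearPart (cellMap hs n (momentumCell n p)) p) = 0
      · rw [hz, norm_zero]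
        exact Set.indicator_nonneg (fun _ _ => hC0) _
      · obtain ⟨h1, h2⟩ := hD _ hz
        obtain ⟨h3, h4⟩ := cellMap_energy hs n hreg.1
        have e : Real.exp (-Real.pi) * Real.exp Real.pi = 1 := by
          rw [← Real.exp_add, neg_add_cancel, Real.exp_zero]
        have e1 := Real.exp_pos Real.pi
        have e2 := Real.exp_pos (-Real.pi)
        rw [Set.indicator_of_mem]
        · exact hC _
        · constructor
          · calc Real.exp (-Real.pi) * c ≤ Real.exp (-Real.pi) * (Real.exp Real.pi * p 0) :=
                mul_le_mul_of_nonneg_left (h1.trans h4) e2.le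
              _ = p 0 := by rw [← mul_assoc, e, one_mul]
          · have e' : p 0 = Real.exp Real.pi * (Real.exp (-Real.pi) * p 0) := by
              rw [← mul_assoc, mul_comm (Real.exp Real.pi), e, one_mul]
            calc p 0 = Real.exp Real.pi * (Real.exp (-Real.pi) * p 0) := e'
              _ ≤ _ := mul_le_mul_of_nonneg_left (h3.trans h2) e1.le
    · rw [norm_zero]
      exact Set.indicator_nonneg (fun _ _ => hC0) _
  · filter_upwards [hT, hr, ae_mem_regularSet hs m] with p h1 h2 hreg
    change Tendsto _ _ (nhds (scalarRep s m (halfTurn hs) f p))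
    rw [h2]
    refine ((hg.continuous.tendsto _).comp (tendsto_cellMap hs hreg)).congr' ?_
    filter_upwards [eventually_abs_cellOf_le (rapidity p),
      eventually_abs_cellOf_le (edgePoint p).arg] with n hn1 hn2
    rw [h1 n, if_pos]
    · rfl
    · refine ⟨hreg, Finset.mem_product.2 ⟨Finset.mem_Icc.2 ?_, Finset.mem_Icc.2 ?_⟩⟩
      · exact abs_le.1 hn1
      · exact abs_le.1 hn2

variable {μ : Measure ℝ≥0} {E : ℝ≥0 → Type*} [∀ m, NormedAddCommGroup (E m)]
  [∀ m, InnerProductSpace ℂ (E m)] {F : MeasurableField E} [∀ m, CompleteSpace (E m)]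
  {𝓗 : Type*} [NormedAddCommGroup 𝓗] [InnerProductSpace ℂ 𝓗] [CompleteSpace 𝓗]
  {Φ : F.squareIntegrable μ →ₗ[ℂ] 𝓗} {ι : ℝ≥0 → Type*}
  {J : ∀ m, ι m → Lp ℂ 2 (massShellMeasure s m) →ₗᵢ[ℂ] E m}
  {U : poincareGroup s →* (𝓗 ≃ₗᵢ[ℂ] 𝓗)} {N : Set (𝓗 →L[ℂ] 𝓗)}

theorem IsInAlgebra.zero : IsInAlgebra Φ J N fun _ => 0 := by
  refine ⟨0, fun T _ => by simp, fun ξ => ⟨0, by simp, ae_of_all _ fun m => ?_⟩⟩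
  have : amplification (J m) 0 = 0 := by
    rw [← norm_le_zero_iff]
    exact (norm_amplification_le _ _).trans_eq norm_zero
  change (0 : E m) = amplification (J m) 0 (ξ.1 m)
  rw [this]
  rfl

theorem IsInAlgebra.sum (hU : IsScalarModel Φ J U) {κ : Type*} (I : Finset κ)
    {a : κ → ∀ m, Lp ℂ 2 (massShellMeasure s m) →L[ℂ] Lp ℂ 2 (massShellMeasure s m)}
    (ha : ∀ c, IsInAlgebra Φ J N (a c)) : IsInAlgebra Φ J N fun m => ∑ c ∈ I, a c m := by
  classical
  induction I using Finset.induction_on with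
  | empty => simpa using IsInAlgebra.zero
  | insert c I hc ih =>
    simp only [Finset.sum_insert hc]
    exact (ha c).add hU ih

/-- Operators commuting with translations, boosts and edge rotations commute with the half turn. -/
theorem halfTurn_mem_centralizer (hU : IsScalarModel Φ J U) (hN : CommutesWithTranslations U N)
    (hb : ∀ t, ((U (boost s t)).toContinuousLinearEquiv : 𝓗 →L[ℂ] 𝓗) ∈ Set.centralizer N)
    (hr : ∀ β, ((U (edgeRotation hs β)).toContinuousLinearEquiv : 𝓗 →L[ℂ] 𝓗) ∈
      Set.centralizer N) :
    ((U (halfTurn hs)).toContinuousLinearEquiv : 𝓗 →L[ℂ] 𝓗) ∈ Set.centralizer N := by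
  -- Each approximant is a finite sum of momentum multiplications and group elements chosen
  -- independently of the mass, so it acts on the direct integral and commutes with N; the strong
  -- limit inherits this.
  have hlim : IsInAlgebra Φ J N fun m =>
      ((scalarRep s m (halfTurn hs)).toContinuousLinearEquiv :
        Lp ℂ 2 (massShellMeasure s m) →L[ℂ] Lp ℂ 2 (massShellMeasure s m)) := by
    refine IsInAlgebra.limit hU (a := fun n m => reflectionOp hs n m) (fun n => ?_)
      (fun n m => norm_reflectionOp_le hs n m) (fun m f => tendsto_reflectionOp hs m f)
    refine IsInAlgebra.sum hU _ fun c => ?_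
    refine (IsBorelOk.indicator hU hN (measurableSet_cellSet n c)).2.comp hU ⟨_, ?_, hU.decomposes _⟩
    have e : (cellMap hs n c)⁻¹ = edgeRotation hs (-cellShift n c.2) * boost s (-cellShift n c.1) := by
      rw [cellMap, boostRotation, mul_inv_rev, boost_inv, edgeRotation, rotation_inv]
      rfl
    rw [e, map_mul]
    exact Set.mul_mem_centralizer (hr _) (hb _)
  obtain ⟨A, hA, hA'⟩ := hlim
  have := hA'.unique hU.toIsIntegralModel (hU.decomposes (halfTurn hs)) (ae_of_all _ fun _ => rfl)
  rwa [← this]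

end reflectionOperator

/-! ### Geometry of wedges -/

section geometry

variable {s : ℕ}

theorem act_mul (g h : poincareGroup s) (W : Set (Spacetime s)) : act (g * h) W = act g (act h W) :=
  Set.image_comp (g : Spacetime s ≃ᵃ[ℝ] Spacetime s) (h : Spacetime s ≃ᵃ[ℝ] Spacetime s) W

theorem act_one (W : Set (Spacetime s)) : act 1 W = W := Set.image_id W

theorem act_inv_act (g : poincareGroup s) (W : Set (Spacetime s)) : act g⁻¹ (act g W) = W := by
  rw [← act_mul, inv_mul_cancel, act_one]

theorem IsWedge.act {W : Set (Spacetime s)} (hW : IsWedge W) (g : poincareGroup s) :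
    IsWedge (act g W) := by
  obtain ⟨h, rfl⟩ := hW
  exact ⟨g * h, (act_mul g h _).symm⟩

theorem isWedge_standardWedge : IsWedge (standardWedge s) := ⟨1, (act_one _).symm⟩

theorem minkowski_apply_sub (g : poincareGroup s) (x y : Spacetime s) :
    minkowski ((g : Spacetime s ≃ᵃ[ℝ] Spacetime s) x - (g : Spacetime s ≃ᵃ[ℝ] Spacetime s) y)
      ((g : Spacetime s ≃ᵃ[ℝ] Spacetime s) x - (g : Spacetime s ≃ᵃ[ℝ] Spacetime s) y) =
      minkowski (x - y) (x - y) := by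
  have h : (g : Spacetime s ≃ᵃ[ℝ] Spacetime s) x - (g : Spacetime s ≃ᵃ[ℝ] Spacetime s) y =
      linearPart g (x - y) :=
    ((g : Spacetime s ≃ᵃ[ℝ] Spacetime s).toAffineMap.linearMap_vsub x y).symm
  have hg : linearPart g ∈ lorentzGroup s := g.2
  rw [h, hg.1]

theorem act_causalComplement (g : poincareGroup s) (W : Set (Spacetime s)) :
    act g (causalComplement W) = causalComplement (act g W) := by
  let e : Spacetime s ≃ₜ Spacetime s :=
    (AffineEquiv.toContinuousAffineEquiv (g : Spacetime s ≃ᵃ[ℝ] Spacetime s)).toHomeomorph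
  have he : ∀ x, e x = (g : Spacetime s ≃ᵃ[ℝ] Spacetime s) x := fun _ => rfl
  change e '' interior _ = interior _
  rw [e.image_interior]
  congr 1
  ext x
  constructor
  · rintro ⟨x, hx, rfl⟩ _ ⟨y, hy, rfl⟩
    rw [he, minkowski_apply_sub]
    exact hx y hy
  · intro hx
    refine ⟨e.symm x, fun y hy => ?_, e.apply_symm_apply x⟩
    rw [← minkowski_apply_sub g, ← he, ← he, e.apply_symm_apply]
    exact hx _ ⟨y, hy, rfl⟩

variable [NeZero s]

theorem minkowski_eq_first (x y : Spacetime s) : ∃ i : Fin s, i.succ = 1 ∧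
    minkowski x y = x 0 * y 0 - (x 1 * y 1 + ∑ k ∈ Finset.univ.erase i, x k.succ * y k.succ) := by
  have hs : 0 < s := Nat.pos_of_ne_zero (NeZero.ne s)
  have hi : (⟨0, hs⟩ : Fin s).succ = 1 :=
    Fin.ext (Nat.mod_eq_of_lt (a := 1) (by omega : 1 < s + 1)).symm
  refine ⟨⟨0, hs⟩, hi, ?_⟩
  rw [minkowski, ← Finset.add_sum_erase _ _ (Finset.mem_univ (⟨0, hs⟩ : Fin s)), hi]

theorem causalComplement_standardWedge :
    causalComplement (standardWedge s) = {x | |x 0| < - x 1} := by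
  have h10 : (1 : Fin (s + 1)) ≠ 0 := one_ne_zero_fin
  apply Set.Subset.antisymm
  · have hsub : ∀ x ∈ {x : Spacetime s | ∀ y ∈ standardWedge s, minkowski (x - y) (x - y) < 0},
        |x 0| ≤ - x 1 := by
      intro x hx
      by_contra! hlt
      -- This point lies in the wedge when -x₁ < |x₀|, and its difference from x is lightlike,
      -- contradicting spacelike separation.
      let y : Spacetime s := fun k => if k = 0 then 0 else if k = 1 then x 1 + |x 0| else x k
      have hy0 : y 0 = 0 := if_pos rfl
      have hy1 : y 1 = x 1 + |x 0| := by simp [y]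
      have hy : y ∈ standardWedge s := by
        change |y 0| < y 1
        rw [hy0, hy1, abs_zero]
        linarith
      have h := hx y hy
      obtain ⟨i, hi, e⟩ := minkowski_eq_first (x - y) (x - y)
      have hsum : ∑ k ∈ Finset.univ.erase i, (x - y) k.succ * (x - y) k.succ = 0 := by
        refine Finset.sum_eq_zero fun k hk => ?_
        have hk1 : k.succ ≠ 1 := fun hk1 =>
          Finset.ne_of_mem_erase hk (Fin.succ_injective _ (hk1.trans hi.symm))
        simp [y, hk1]
      rw [e, hsum, Pi.sub_apply, Pi.sub_apply, hy0, hy1] at h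
      nlinarith [sq_abs (x 0)]
    intro x hx
    -- Interior points may be pushed slightly in the x₁-direction, which makes the inequality
    -- strict.
    let c : ℝ → Spacetime s := fun ε => x + ε • Pi.single 1 1
    have hc : Continuous c := by fun_prop
    have hc0 : c 0 = x := by simp [c]
    have hopen : IsOpen (c ⁻¹' causalComplement (standardWedge s)) := isOpen_interior.preimage hc
    have h0 : (0 : ℝ) ∈ c ⁻¹' causalComplement (standardWedge s) := by
      change c 0 ∈ causalComplement (standardWedge s)
      rwa [hc0]
    obtain ⟨ε, hε, hball⟩ := Metric.isOpen_iff.1 hopen 0 h0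
    have hmem : c (ε / 2) ∈ causalComplement (standardWedge s) := hball (by
      rw [Metric.mem_ball, dist_zero_right, Real.norm_of_nonneg (by linarith)]
      linarith)
    have := hsub _ (interior_subset hmem)
    have e0 : c (ε / 2) 0 = x 0 := by simp [c]
    have e1 : c (ε / 2) 1 = x 1 + ε / 2 := by simp [c]
    rw [e0, e1] at this
    change |x 0| < - x 1
    linarith
  · refine interior_maximal (fun x hx y hy => ?_) ?_
    · have hx : |x 0| < - x 1 := hx
      have hy : |y 0| < y 1 := hy
      obtain ⟨i, hi, e⟩ := minkowski_eq_first (x - y) (x - y)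
      have hsum : 0 ≤ ∑ k ∈ Finset.univ.erase i, (x - y) k.succ * (x - y) k.succ :=
        Finset.sum_nonneg fun k _ => mul_self_nonneg _
      rw [e, Pi.sub_apply, Pi.sub_apply]
      have h1 : |x 0 - y 0| < y 1 - x 1 := (abs_sub _ _).trans_lt (by linarith)
      have h2 := mul_self_lt_mul_self (abs_nonneg _) h1
      rw [abs_mul_abs_self] at h2
      nlinarith
    · exact isOpen_lt (by fun_prop) (by fun_prop)

theorem act_eq_of_maps {g : poincareGroup s} {W W' : Set (Spacetime s)}
    (h : ∀ x ∈ W, (g : Spacetime s ≃ᵃ[ℝ] Spacetime s) x ∈ W')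
    (h' : ∀ x ∈ W', ((g⁻¹ : poincareGroup s) : Spacetime s ≃ᵃ[ℝ] Spacetime s) x ∈ W) :
    act g W = W' := by
  apply Set.Subset.antisymm
  · rintro _ ⟨x, hx, rfl⟩
    exact h x hx
  · intro x hx
    exact ⟨_, h' x hx, (g : Spacetime s ≃ᵃ[ℝ] Spacetime s).apply_symm_apply x⟩

theorem mem_standardWedge_iff (x : Spacetime s) :
    x ∈ standardWedge s ↔ 0 < x 1 + x 0 ∧ 0 < x 1 - x 0 := by
  change |x 0| < x 1 ↔ _
  rw [abs_lt]
  constructor <;> rintro ⟨h1, h2⟩ <;> constructor <;> linarith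

theorem act_boost_standardWedge (t : ℝ) : act (boost s t) (standardWedge s) = standardWedge s := by
  have h : ∀ t, ∀ x ∈ standardWedge s, boostMap s t x ∈ standardWedge s := by
    intro t x hx
    rw [mem_standardWedge_iff] at hx ⊢
    have h1 := boostMap_plus t x
    have h2 := boostMap_minus t x
    have h3 := mul_pos (Real.exp_pos t) hx.1
    have h4 := mul_pos (Real.exp_pos (-t)) hx.2
    constructor <;> nlinarith
  refine act_eq_of_maps (fun x hx => h t x hx) fun x hx => ?_
  rw [boost_inv]
  exact h (-t) x hx

theorem act_edgeRotation_standardWedge (hs : 3 ≤ s) (β : ℝ) :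
    act (edgeRotation hs β) (standardWedge s) = standardWedge s := by
  have h23 := isSpatialPlane_two_three hs
  have h : ∀ β, ∀ x ∈ standardWedge s, rotationMap 2 3 β x ∈ standardWedge s := by
    intro β x hx
    change |rotationMap 2 3 β x 0| < rotationMap 2 3 β x 1
    rw [rotationMap_apply, rotationMap_apply, if_neg h23.2.1.symm, if_neg h23.2.2.symm,
      if_neg (one_ne_two_fin hs), if_neg (isSpatialPlane_one_three hs).1]
    exact hx
  refine act_eq_of_maps (fun x hx => h β x hx) fun x hx => ?_
  rw [edgeRotation, rotation_inv]
  exact h (-β) x hx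

theorem act_halfTurn_standardWedge (hs : 3 ≤ s) :
    act (halfTurn hs) (standardWedge s) = causalComplement (standardWedge s) := by
  have h13 := isSpatialPlane_one_three hs
  have e0 : ∀ x, (halfTurn hs : Spacetime s ≃ᵃ[ℝ] Spacetime s) x 0 = x 0 := fun x => by
    rw [halfTurn_apply, if_neg (by rintro (h | h); exacts [h13.2.1 h.symm, h13.2.2 h.symm])]
  have e1 : ∀ x, (halfTurn hs : Spacetime s ≃ᵃ[ℝ] Spacetime s) x 1 = - x 1 := fun x => by
    rw [halfTurn_apply, if_pos (Or.inl rfl)]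
  rw [causalComplement_standardWedge]
  refine act_eq_of_maps (fun x hx => ?_) fun x hx => ?_
  · change |(halfTurn hs : Spacetime s ≃ᵃ[ℝ] Spacetime s) x 0| < -(halfTurn hs : Spacetime s ≃ᵃ[ℝ] Spacetime s) x 1
    rw [e0, e1, neg_neg]
    exact hx
  · rw [halfTurn_inv]
    change |(halfTurn hs : Spacetime s ≃ᵃ[ℝ] Spacetime s) x 0| < (halfTurn hs : Spacetime s ≃ᵃ[ℝ] Spacetime s) x 1
    rw [e0, e1]
    exact hx

theorem causalComplement_causalComplement (hs : 3 ≤ s) :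
    causalComplement (causalComplement (standardWedge s)) = standardWedge s := by
  rw [← act_halfTurn_standardWedge hs, ← act_causalComplement, ← act_halfTurn_standardWedge hs,
    ← act_mul, halfTurn_mul_self, act_one]

theorem act_translation_subset {a : Spacetime s} (h : |a 0| ≤ a 1) :
    act (translation a) (standardWedge s) ⊆ standardWedge s := by
  rintro _ ⟨x, hx, rfl⟩
  change |a 0 + x 0| < a 1 + x 1
  have : |x 0| < x 1 := hx
  exact (abs_add_le _ _).trans_lt (by linarith)

theorem act_translation_eq {a : Spacetime s} (h0 : a 0 = 0) (h1 : a 1 = 0) :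
    act (translation a) (standardWedge s) = standardWedge s := by
  have hinv : (translation a)⁻¹ = translation (-a) := by
    rw [inv_eq_iff_mul_eq_one, ← translation_add, add_neg_cancel, translation_zero]
  refine act_eq_of_maps (fun x hx => ?_) fun x hx => ?_
  · change |a 0 + x 0| < a 1 + x 1
    rw [h0, h1, zero_add, zero_add]
    exact hx
  · rw [hinv]
    change |(-a) 0 + x 0| < (-a) 1 + x 1
    rw [Pi.neg_apply, Pi.neg_apply, h0, h1, neg_zero, zero_add, zero_add]
    exact hx

theorem conj_translation (g : poincareGroup s) (a : Spacetime s) :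
    g * translation a = translation (linearPart g a) * g := by
  refine Subtype.ext (AffineEquiv.ext fun x => ?_)
  change (g : Spacetime s ≃ᵃ[ℝ] Spacetime s) (a + x) =
    linearPart g a + (g : Spacetime s ≃ᵃ[ℝ] Spacetime s) x
  exact (g : Spacetime s ≃ᵃ[ℝ] Spacetime s).map_vadd x a

/-- Reversing x₁ while keeping x₀ inverts boosts in the (x₀,x₁)-plane. Duality and the
Bisognano–Wichmann property are both deduced from this relation. -/
theorem halfTurn_boost (hs : 3 ≤ s) (t : ℝ) :
    halfTurn hs * boost s t = boost s (-t) * halfTurn hs := by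
  have h13 := isSpatialPlane_one_three hs
  refine Subtype.ext (AffineEquiv.ext fun x => funext fun k => ?_)
  change (halfTurn hs : Spacetime s ≃ᵃ[ℝ] Spacetime s) (boostMap s t x) k =
    boostMap s (-t) ((halfTurn hs : Spacetime s ≃ᵃ[ℝ] Spacetime s) x) k
  have e0 : ∀ x, (halfTurn hs : Spacetime s ≃ᵃ[ℝ] Spacetime s) x 0 = x 0 := fun x => by
    rw [halfTurn_apply, if_neg (by rintro (h | h); exacts [h13.2.1 h.symm, h13.2.2 h.symm])]
  have e1 : ∀ x, (halfTurn hs : Spacetime s ≃ᵃ[ℝ] Spacetime s) x 1 = - x 1 := fun x => by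
    rw [halfTurn_apply, if_pos (Or.inl rfl)]
  by_cases k0 : k = 0
  · subst k0
    rw [e0, boostMap_zero_coord, boostMap_zero_coord, e0, e1, Real.cosh_neg, Real.sinh_neg]
    ring
  by_cases k1 : k = 1
  · subst k1
    rw [e1, boostMap_one_coord, boostMap_one_coord, e0, e1, Real.cosh_neg, Real.sinh_neg]
    ring
  rw [halfTurn_apply, boostMap_other_coord _ _ k0 k1, boostMap_other_coord _ _ k0 k1,
    halfTurn_apply]

theorem boost_edgeRotation (hs : 3 ≤ s) (t β : ℝ) :
    boost s t * edgeRotation hs β = edgeRotation hs β * boost s t := by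
  have h23 := isSpatialPlane_two_three hs
  have h13 := isSpatialPlane_one_three hs
  have h12 := one_ne_two_fin hs
  refine Subtype.ext (AffineEquiv.ext fun x => funext fun k => ?_)
  change boostMap s t (rotationMap 2 3 β x) k = rotationMap 2 3 β (boostMap s t x) k
  have r0 : ∀ x : Spacetime s, rotationMap 2 3 β x 0 = x 0 := fun x => by
    rw [rotationMap_apply, if_neg h23.2.1.symm, if_neg h23.2.2.symm]
  have r1 : ∀ x : Spacetime s, rotationMap 2 3 β x 1 = x 1 := fun x => by
    rw [rotationMap_apply, if_neg h12, if_neg h13.1]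
  by_cases k0 : k = 0
  · subst k0
    rw [boostMap_zero_coord, r0, r0, r1, boostMap_zero_coord]
  by_cases k1 : k = 1
  · subst k1
    rw [boostMap_one_coord, r1, r0, r1, boostMap_one_coord]
  rw [boostMap_other_coord _ _ k0 k1, rotationMap_apply, rotationMap_apply,
    boostMap_other_coord _ _ k0 k1, boostMap_other_coord _ _ h23.2.1 h12.symm,
    boostMap_other_coord _ _ h23.2.2 h13.1.symm]

/-- The lightlike vectors `(1, ε, 0, …)`. -/
def lightVector (s : ℕ) (ε : ℝ) : Spacetime s := fun k => if k = 0 then 1 else if k = 1 then ε else 0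

theorem lightVector_zero (ε : ℝ) : lightVector s ε 0 = 1 := if_pos rfl

theorem lightVector_one (ε : ℝ) : lightVector s ε 1 = ε := by simp [lightVector]

theorem lightVector_other (ε : ℝ) {k : Fin (s + 1)} (h0 : k ≠ 0) (h1 : k ≠ 1) :
    lightVector s ε k = 0 := by simp [lightVector, h0, h1]

theorem boostMap_lightVector_one (t : ℝ) :
    boostMap s t (lightVector s 1) = Real.exp t • lightVector s 1 := by
  funext k
  rw [Pi.smul_apply, smul_eq_mul]
  by_cases k0 : k = 0
  · subst k0
    rw [boostMap_zero_coord, lightVector_zero, lightVector_one, ← Real.cosh_add_sinh]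
    ring
  by_cases k1 : k = 1
  · subst k1
    rw [boostMap_one_coord, lightVector_zero, lightVector_one, ← Real.cosh_add_sinh]
    ring
  rw [boostMap_other_coord _ _ k0 k1, lightVector_other _ k0 k1, mul_zero]

theorem boostMap_lightVector_neg_one (t : ℝ) :
    boostMap s t (lightVector s (-1)) = Real.exp (-t) • lightVector s (-1) := by
  funext k
  rw [Pi.smul_apply, smul_eq_mul]
  by_cases k0 : k = 0
  · subst k0
    rw [boostMap_zero_coord, lightVector_zero, lightVector_one, ← Real.cosh_sub_sinh]
    ring
  by_cases k1 : k = 1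
  · subst k1
    rw [boostMap_one_coord, lightVector_zero, lightVector_one, ← Real.cosh_sub_sinh]
    ring
  rw [boostMap_other_coord _ _ k0 k1, lightVector_other _ k0 k1, mul_zero]

theorem boostMap_transverse (t : ℝ) {a : Spacetime s} (h0 : a 0 = 0) (h1 : a 1 = 0) :
    boostMap s t a = a := by
  funext k
  by_cases k0 : k = 0
  · subst k0
    rw [boostMap_zero_coord, h0, h1, mul_zero, mul_zero, add_zero]
  by_cases k1 : k = 1
  · subst k1
    rw [boostMap_one_coord, h0, h1, mul_zero, mul_zero, add_zero]
  exact boostMap_other_coord _ _ k0 k1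

theorem minkowski_lightVector (ε : ℝ) (p : Spacetime s) :
    minkowski (lightVector s ε) p = p 0 - ε * p 1 := by
  obtain ⟨i, hi, e⟩ := minkowski_eq_first (lightVector s ε) p
  rw [e, lightVector_zero, lightVector_one, Finset.sum_eq_zero]
  · ring
  · intro k hk
    rw [lightVector_other _ (Fin.succ_ne_zero k), zero_mul]
    intro h
    exact Finset.ne_of_mem_erase hk (Fin.succ_injective _ (h.trans hi.symm))

theorem minkowski_lightVector_nonneg (hs : 3 ≤ s) {ε : ℝ} (hε : |ε| ≤ 1) (m : ℝ≥0) :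
    ∀ᵐ p ∂massShellMeasure s m, 0 ≤ minkowski (lightVector s ε) p := by
  filter_upwards [ae_mem_regularSet hs m] with p hp
  rw [minkowski_lightVector]
  have h1 : ε * p 1 ≤ |ε| * |p 1| := by rw [← abs_mul]; exact le_abs_self _
  have h2 := mul_le_mul_of_nonneg_right hε (abs_nonneg (p 1))
  linarith [hp.1]

theorem exists_lightcone_decomposition (a : Spacetime s) : ∃ b : Spacetime s, b 0 = 0 ∧ b 1 = 0 ∧
    a = ((a 0 + a 1) / 2) • lightVector s 1 + (((a 0 - a 1) / 2) • lightVector s (-1) + b) := by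
  refine ⟨a - ((a 0 + a 1) / 2) • lightVector s 1 - ((a 0 - a 1) / 2) • lightVector s (-1),
    ?_, ?_, by abel⟩
  · simp only [Pi.sub_apply, Pi.smul_apply, smul_eq_mul, lightVector_zero]
    ring
  · simp only [Pi.sub_apply, Pi.smul_apply, smul_eq_mul, lightVector_one]
    ring

end geometry

/-! ### The modularity condition -/

section modularity

variable {s : ℕ} [NeZero s] {μ : Measure ℝ≥0} {E : ℝ≥0 → Type*} [∀ m, NormedAddCommGroup (E m)]
  [∀ m, InnerProductSpace ℂ (E m)] {F : MeasurableField E} [∀ m, CompleteSpace (E m)]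
  {𝓗 : Type*} [NormedAddCommGroup 𝓗] [InnerProductSpace ℂ 𝓗] [CompleteSpace 𝓗]
  {Φ : F.squareIntegrable μ →ₗ[ℂ] 𝓗} {ι : ℝ≥0 → Type*}
  {J : ∀ m, ι m → Lp ℂ 2 (massShellMeasure s m) →ₗᵢ[ℂ] E m}
  {U : poincareGroup s →* (𝓗 ≃ₗᵢ[ℂ] 𝓗)}

/-- An operator commuting with translations, boosts and edge rotations commutes with the half
turn. -/
theorem commute_halfTurn (hs : 3 ≤ s) (hU : IsScalarModel Φ J U) {T : 𝓗 →L[ℂ] 𝓗}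
    (ht : ∀ a x, T (U (translation a) x) = U (translation a) (T x))
    (hb : ∀ t x, T (U (boost s t) x) = U (boost s t) (T x))
    (hr : ∀ β x, T (U (edgeRotation hs β) x) = U (edgeRotation hs β) (T x)) (x : 𝓗) :
    T (U (halfTurn hs) x) = U (halfTurn hs) (T x) := by
  have hmem : ∀ g : poincareGroup s, (∀ x, T (U g x) = U g (T x)) →
      ((U g).toContinuousLinearEquiv : 𝓗 →L[ℂ] 𝓗) ∈ Set.centralizer {T} := by
    rintro g hg _ rfl
    ext x
    exact hg x
  have := halfTurn_mem_centralizer hs hU (N := {T}) (fun a => hmem _ (ht a)) (fun t => hmem _ (hb t))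
    (fun β => hmem _ (hr β)) T rfl
  exact DFunLike.congr_fun this x

theorem modularityCondition (hs : 3 ≤ s) (hU : IsScalarModel Φ J U) : ModularityCondition U := by
  rintro W ⟨g, rfl⟩ r hr T hT
  have hTc : ∀ k ∈ wedgeGroup (act g (standardWedge s)), ∀ x, T (U k x) = U k (T x) := by
    intro k hk x
    exact (DFunLike.congr_fun (hT _ ⟨k, hk, rfl⟩) x).symm
  -- transport to the standard wedge
  let T' : 𝓗 →L[ℂ] 𝓗 := ((U g⁻¹).toContinuousLinearEquiv : 𝓗 →L[ℂ] 𝓗) * T *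
    ((U g).toContinuousLinearEquiv : 𝓗 →L[ℂ] 𝓗)
  have hT'app : ∀ x, T' x = U g⁻¹ (T (U g x)) := fun _ => rfl
  have hUmul : ∀ (a b : poincareGroup s) x, U (a * b) x = U a (U b x) := fun a b x => by
    rw [map_mul]; rfl
  have hT' : ∀ k, g * k * g⁻¹ ∈ wedgeGroup (act g (standardWedge s)) →
      ∀ x, T' (U k x) = U k (T' x) := by
    intro k hk x
    rw [hT'app, hT'app]
    have h1 : U g (U k x) = U (g * k * g⁻¹) (U g x) := by
      rw [← hUmul, ← hUmul, inv_mul_cancel_right]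
    rw [h1, hTc _ hk, ← hUmul, ← hUmul]
    congr 2
    group
  have hstab : ∀ k, act k (standardWedge s) = standardWedge s →
      g * k * g⁻¹ ∈ wedgeGroup (act g (standardWedge s)) := by
    intro k hk
    refine Subgroup.subset_closure (Or.inr ?_)
    change act (g * k * g⁻¹) (act g (standardWedge s)) = _
    rw [act_mul, act_inv_act, act_mul, hk]
  have hflip := commute_halfTurn hs hU (T := T')
    (fun a => hT' _ (Subgroup.subset_closure (Or.inl ⟨linearPart g a, fun x => by
      rw [conj_translation, mul_inv_cancel_right, translation_apply, add_comm]⟩)))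
    (fun t => hT' _ (hstab _ (act_boost_standardWedge t)))
    (fun β => hT' _ (hstab _ (act_edgeRotation_standardWedge hs β)))
  -- After conjugation to W₁, any r exchanging the wedge with its complement is the half turn times
  -- an element preserving W₁, and T' commutes with both factors.
  have hh : act (halfTurn hs * (g⁻¹ * r * g)) (standardWedge s) = standardWedge s := by
    rw [act_mul, act_mul, act_mul, hr, ← act_causalComplement, act_inv_act,
      ← act_halfTurn_standardWedge hs, ← act_mul, halfTurn_mul_self, act_one]
  have hk := hT' _ (hstab _ hh)
  have hr' : ∀ x, T' (U (g⁻¹ * r * g) x) = U (g⁻¹ * r * g) (T' x) := by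
    intro x
    have e : g⁻¹ * r * g = halfTurn hs * (halfTurn hs * (g⁻¹ * r * g)) := by
      rw [← mul_assoc, halfTurn_mul_self, one_mul]
    rw [e, hUmul, hflip, hk, ← hUmul]
  ext x
  have h2 := hr' (U g⁻¹ x)
  rw [hT'app, hT'app] at h2
  have e1 : U g (U (g⁻¹ * r * g) (U g⁻¹ x)) = U r x := by
    rw [← hUmul, ← hUmul]
    congr 2
    group
  have e2 : U g (U g⁻¹ x) = x := by
    rw [← hUmul, mul_inv_cancel, map_one]; rfl
  rw [e1, e2] at h2
  have h3 := congrArg (U g) h2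
  rw [← hUmul, mul_inv_cancel, map_one, ← hUmul, ← hUmul] at h3
  have e3 : g * (g⁻¹ * r * g) * g⁻¹ = r := by group
  rw [e3] at h3
  exact h3

end modularity

/-! ### Modular unitaries and symplectic complements under unitaries -/

section modularUnitary

open ClosedSubmodule

variable {𝓗 : Type*} [NormedAddCommGroup 𝓗] [InnerProductSpace ℂ 𝓗]
  {X : Type*} [MeasurableSpace X] {ν : Measure X} (V : 𝓗 ≃ₗᵢ[ℂ] Lp ℂ 2 ν) {l : X → ℝ}

/-- The modular unitaries as isometric equivalences. -/
def modularEquiv (hl : Measurable l) (t : ℝ) : 𝓗 ≃ₗᵢ[ℂ] 𝓗 where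
  toFun := modular V l t
  map_add' := map_add _
  map_smul' := map_smul _
  invFun := modular V l (-t)
  left_inv := modular_neg_self V hl t
  right_inv := modular_self_neg V hl t
  norm_map' x := by
    change ‖modular V l t x‖ = ‖x‖
    rw [@norm_eq_sqrt_re_inner ℂ, @norm_eq_sqrt_re_inner ℂ _ _ _ _ x, inner_modular V hl,
      modular_neg_self V hl]

variable [CompleteSpace 𝓗] {K : ClosedSubmodule ℝ 𝓗}

theorem symplComp_image {L : ClosedSubmodule ℝ 𝓗} (U : 𝓗 ≃ₗᵢ[ℂ] 𝓗) (h : U '' (K : Set 𝓗) = L) :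
    U '' (K.symplComp : Set 𝓗) = L.symplComp := by
  have hK : ∀ k, U k ∈ L ↔ k ∈ K := fun k => by
    rw [← SetLike.mem_coe, ← h, U.injective.mem_set_image, SetLike.mem_coe]
  ext y
  obtain ⟨x, rfl⟩ := U.surjective y
  rw [U.injective.mem_set_image, SetLike.mem_coe, SetLike.mem_coe, mem_symplComp_iff,
    mem_symplComp_iff]
  constructor
  · intro hx k hk
    obtain ⟨k, rfl⟩ := U.surjective k
    rw [U.inner_map_map]
    exact hx k ((hK k).1 hk)
  · intro hx k hk
    rw [← U.inner_map_map]
    exact hx _ ((hK k).2 hk)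

end modularUnitary

/-! ### Identification of the modular operator with e^l -/

section functionalCalculus

universe u

variable {𝓗 : Type u} [NormedAddCommGroup 𝓗] [InnerProductSpace ℂ 𝓗] [CompleteSpace 𝓗]
  {X : Type u} [MeasurableSpace X] {ν : Measure X} {V : 𝓗 ≃ₗᵢ[ℂ] Lp ℂ 2 ν} {l : X → ℝ}
  {K : ClosedSubmodule ℝ 𝓗}

/-- With R = 2/(1 + e^l), the equation R(x + z) = 2x reads z = e^l x pointwise; the domain is
automatically maximal. -/
theorem IsLogModel.mem_modularGraph_iff (hM : IsLogModel K V l) (x z : 𝓗) :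
    (x, z) ∈ modularGraph K ↔ V z =ᵐ[ν] fun k => (Real.exp (l k) : ℂ) * V x k := by
  have hp : ∀ k, (1 + Real.exp (l k) : ℂ) ≠ 0 := fun k => by
    have : (0 : ℝ) < 1 + Real.exp (l k) := by positivity
    exact_mod_cast this.ne'
  have hρ : ∀ k, (logistic (l k) : ℂ) = 2 / (1 + Real.exp (l k)) := fun k => by
    rw [logistic]; push_cast; rfl
  rw [WedgeNets.mem_modularGraph_iff, hM.sumProj_eq, mulBy_eq_iff V hM.bddMeas_logistic, map_smul,
    map_add]
  refine Filter.eventually_congr ?_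
  filter_upwards [Lp.coeFn_smul (2 : ℂ) (V x), Lp.coeFn_add (V x) (V z)] with k h1 h2
  rw [h1, h2, Pi.smul_apply, Pi.add_apply, smul_eq_mul, hρ, div_mul_eq_mul_div, eq_div_iff (hp k)]
  constructor
  · intro h
    linear_combination (-1 / 2) * h
  · intro h
    linear_combination (-2) * h

theorem IsLogModel.isFunctionOf_modular (hM : IsLogModel K V l) (t : ℝ) :
    IsFunctionOf (modularGraph K) (fun r => (r : ℂ) ^ (-(Complex.I * t))) (modular V l (-t)) := by
  refine ⟨X, _, ν, V, fun k => Real.exp (l k), Real.measurable_exp.comp hM.measurable,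
    hM.mem_modularGraph_iff, fun x => ?_⟩
  have h := (mulBy_eq_iff V (bddMeas_phase hM.measurable (-t)) (x := x)).1 rfl
  filter_upwards [h] with k hk
  rw [modular, hk, phase, Complex.cpow_def_of_ne_zero (by exact_mod_cast (Real.exp_pos _).ne'),
    ← Complex.ofReal_log (Real.exp_pos _).le, Real.log_exp]
  congr 2
  push_cast
  ring

theorem IsLogModel.of_image (hM : IsLogModel K V l) {L : ClosedSubmodule ℝ 𝓗} (U : 𝓗 ≃ₗᵢ[ℂ] 𝓗)
    (h : U '' (K : Set 𝓗) = L) : IsLogModel L (U.symm.trans V) l where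
  measurable := hM.measurable
  sumProj_eq x := by
    obtain ⟨x, rfl⟩ := U.surjective x
    rw [sumProj_of_image U h, hM.sumProj_eq]
    simp [mulBy]

end functionalCalculus

/-! ### Modular group, boosts and translations for a local net -/

section net

open ClosedSubmodule

universe u

variable {s : ℕ} {𝓗 : Type u} [NormedAddCommGroup 𝓗] [InnerProductSpace ℂ 𝓗] [CompleteSpace 𝓗]
  {U : poincareGroup s →* (𝓗 ≃ₗᵢ[ℂ] 𝓗)} {H : Set (Spacetime s) → ClosedSubmodule ℝ 𝓗}
  {X : Type u} [MeasurableSpace X] {ν : Measure X} {V : 𝓗 ≃ₗᵢ[ℂ] Lp ℂ 2 ν} {l : X → ℝ}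

theorem rep_mul_apply (U : poincareGroup s →* (𝓗 ≃ₗᵢ[ℂ] 𝓗)) (g h : poincareGroup s) (x : 𝓗) :
    U (g * h) x = U g (U h x) := by
  rw [map_mul]; rfl

theorem IsLocalNet.map_mem (hH : IsLocalNet U H) {W : Set (Spacetime s)} (hW : IsWedge W)
    (g : poincareGroup s) {x : 𝓗} (hx : x ∈ H W) : U g x ∈ H (WedgeNets.act g W) := by
  rw [← SetLike.mem_coe, ← hH.covariance W hW g]
  exact Set.mem_image_of_mem _ hx

/-- By covariance U(g) preserves K = H(W₁), hence commutes with R and with its functions. -/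
theorem IsLocalNet.modular_commute (hH : IsLocalNet U H)
    (hM : IsLogModel (H (standardWedge s)) V l) {g : poincareGroup s}
    (hg : act g (standardWedge s) = standardWedge s) (t : ℝ) (x : 𝓗) :
    U g (modular V l t x) = modular V l t (U g x) := by
  have h := modular_intertwine V hM.measurable
    ((U g).toContinuousLinearEquiv : 𝓗 →L[ℂ] 𝓗) 1 (fun x => ?_) t x
  · rwa [one_mul] at h
  · simp only [one_mul]
    rw [← hM.sumProj_eq, ← hM.sumProj_eq]
    have := hH.covariance _ isWedge_standardWedge g
    rw [hg] at this
    exact (sumProj_of_image (U g) this x).symm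

/-- Borchers' theorem provides only positive parameters; inverse translations supply the others. -/
theorem commute_translation_of_pos {T : 𝓗 →L[ℂ] 𝓗} {a : Spacetime s}
    (h : ∀ r : ℝ, 0 < r → ∀ x, T (U (translation (r • a)) x) = U (translation (r • a)) (T x))
    (r : ℝ) (x : 𝓗) : T (U (translation (r • a)) x) = U (translation (r • a)) (T x) := by
  have hone : ∀ x, U (1 : poincareGroup s) x = x := fun x => by rw [map_one]; rfl
  rcases lt_trichotomy r 0 with hr | rfl | hr
  · have e1 : translation ((-r) • a) * translation (r • a) = 1 := by
      rw [← translation_add, ← add_smul, neg_add_cancel, zero_smul, translation_zero]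
    have e2 : translation (r • a) * translation ((-r) • a) = 1 := by
      rw [← translation_add, ← add_smul, add_neg_cancel, zero_smul, translation_zero]
    have h1 := h (-r) (neg_pos.2 hr) (U (translation (r • a)) x)
    rw [← rep_mul_apply, e1, hone] at h1
    rw [h1, ← rep_mul_apply, e2, hone]
  · rw [zero_smul, translation_zero, hone, hone]
  · exact h r hr x

variable [NeZero s]

/-- The product `Δ^{it} U(Λ(2πt))` of the modular group of `H(W₁)` and the boosts. -/
def modularBoost (V : 𝓗 ≃ₗᵢ[ℂ] Lp ℂ 2 ν) (l : X → ℝ) (U : poincareGroup s →* (𝓗 ≃ₗᵢ[ℂ] 𝓗)) (t : ℝ) :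
    𝓗 →L[ℂ] 𝓗 :=
  (modular V l t).comp ((U (boost s (2 * Real.pi * t))).toContinuousLinearEquiv : 𝓗 →L[ℂ] 𝓗)

theorem modularBoost_apply (t : ℝ) (x : 𝓗) :
    modularBoost V l U t x = modular V l t (U (boost s (2 * Real.pi * t)) x) := rfl

theorem modularBoost_commute (hH : IsLocalNet U H) (hM : IsLogModel (H (standardWedge s)) V l)
    {g : poincareGroup s} (hg : act g (standardWedge s) = standardWedge s)
    (hb : ∀ t, boost s t * g = g * boost s t) (t : ℝ) (x : 𝓗) :
    modularBoost V l U t (U g x) = U g (modularBoost V l U t x) := by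
  rw [modularBoost_apply, modularBoost_apply, hH.modular_commute hM hg, ← rep_mul_apply, hb,
    rep_mul_apply]

theorem boost_translation (t : ℝ) (a : Spacetime s) (x : 𝓗) :
    U (boost s t) (U (translation a) x) = U (translation (boostMap s t a)) (U (boost s t) x) := by
  rw [← rep_mul_apply, conj_translation, rep_mul_apply]
  rfl

/-- The boost stretches the lightlike vector by e^{2πt}, and Borchers' theorem says that the modular
unitary undoes exactly this stretching. -/
theorem modularBoost_lightVector_one (hH : IsLocalNet U H)
    (hM : IsLogModel (H (standardWedge s)) V l) (hc : Cyclic (H (standardWedge s)))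
    (hsep : Separating (H (standardWedge s))) {W : ℂ → 𝓗 →L[ℂ] 𝓗}
    (hW : PositiveExtension (fun t : ℝ =>
      ((U (translation (t • lightVector s 1))).toContinuousLinearEquiv : 𝓗 →L[ℂ] 𝓗)) W)
    (t r : ℝ) (x : 𝓗) : modularBoost V l U t (U (translation (r • lightVector s 1)) x) =
      U (translation (r • lightVector s 1)) (modularBoost V l U t x) := by
  refine commute_translation_of_pos (fun r hr x => ?_) r x
  have hu : ∀ r : ℝ, 0 ≤ r → ∀ x ∈ H (standardWedge s),
      U (translation (r • lightVector s 1)) x ∈ H (standardWedge s) := by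
    intro r hr x hx
    refine hH.isotony _ _ (isWedge_standardWedge.act _) isWedge_standardWedge
      (act_translation_subset ?_) (hH.map_mem isWedge_standardWedge _ hx)
    rw [Pi.smul_apply, Pi.smul_apply, lightVector_zero, lightVector_one, smul_eq_mul, mul_one,
      abs_of_nonneg hr]
  have h := borchers hM hc hsep hW hu hr t
    (modular V l t (U (boost s (2 * Real.pi * t)) x))
  rw [modular_neg_self V hM.measurable] at h
  rw [modularBoost_apply, modularBoost_apply, boost_translation, map_smul, boostMap_lightVector_one,
    smul_smul, mul_comm]
  exact h

/-- Along (1, -1) it is the negative translations that map W₁ into itself, so the positive ones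
preserve K'. Borchers' theorem is applied to K', whose modular logarithm is -l; this accounts for
the parameter -t. -/
theorem modularBoost_lightVector_neg_one (hH : IsLocalNet U H)
    (hM : IsLogModel (H (standardWedge s)) V l) (hc : Cyclic (H (standardWedge s)))
    (hsep : Separating (H (standardWedge s))) {W : ℂ → 𝓗 →L[ℂ] 𝓗}
    (hW : PositiveExtension (fun t : ℝ =>
      ((U (translation (t • lightVector s (-1)))).toContinuousLinearEquiv : 𝓗 →L[ℂ] 𝓗)) W)
    (t r : ℝ) (x : 𝓗) : modularBoost V l U t (U (translation (r • lightVector s (-1))) x) =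
      U (translation (r • lightVector s (-1))) (modularBoost V l U t x) := by
  refine commute_translation_of_pos (fun r hr x => ?_) r x
  have hu : ∀ r : ℝ, 0 ≤ r → ∀ x ∈ (H (standardWedge s)).symplComp,
      U (translation (r • lightVector s (-1))) x ∈ (H (standardWedge s)).symplComp := by
    intro r hr x hx
    rw [mem_symplComp_iff] at hx ⊢
    intro k hk
    have h1 : U (translation ((-r) • lightVector s (-1))) k ∈ H (standardWedge s) := by
      refine hH.isotony _ _ (isWedge_standardWedge.act _) isWedge_standardWedge
        (act_translation_subset ?_) (hH.map_mem isWedge_standardWedge _ hk)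
      rw [Pi.smul_apply, Pi.smul_apply, lightVector_zero, lightVector_one, smul_eq_mul, mul_one,
        smul_eq_mul, abs_neg, abs_of_nonneg hr]
      linarith
    have h2 := hx _ h1
    have h3 := hW.inner_eq (-r) k x
    rw [neg_neg] at h3
    exact (congrArg Complex.im h3).symm.trans h2
  have h := borchers hM.symplComp hsep.symplComp_cyclic hc.symplComp_separating hW hu hr (-t)
    (modular V l t (U (boost s (2 * Real.pi * t)) x))
  rw [IsLogModel.modular_neg_log, IsLogModel.modular_neg_log, neg_neg,
    modular_neg_self V hM.measurable] at h
  rw [modularBoost_apply, modularBoost_apply, boost_translation, map_smul,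
    boostMap_lightVector_neg_one, smul_smul, mul_comm, ← mul_neg]
  exact h

end net

/-! ### Duality and the Bisognano–Wichmann property -/

section main

open ClosedSubmodule

universe u

variable {s : ℕ} {𝓗 : Type u} [NormedAddCommGroup 𝓗] [InnerProductSpace ℂ 𝓗] [CompleteSpace 𝓗]
  {U : poincareGroup s →* (𝓗 ≃ₗᵢ[ℂ] 𝓗)} {H : Set (Spacetime s) → ClosedSubmodule ℝ 𝓗}

theorem IsLocalNet.standard_cyclic (hH : IsLocalNet U H) : Cyclic (H (standardWedge s)) :=
  cyclic_of_sup_eq_top (hH.cyclic _ isWedge_standardWedge)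

variable [NeZero s]

theorem isWedge_causalComplement (hs : 3 ≤ s) : IsWedge (causalComplement (standardWedge s)) := by
  rw [← act_halfTurn_standardWedge hs]
  exact isWedge_standardWedge.act _

theorem IsLocalNet.le_symplComp (hs : 3 ≤ s) (hH : IsLocalNet U H) :
    H (causalComplement (standardWedge s)) ≤ (H (standardWedge s)).symplComp :=
  hH.locality _ _ (isWedge_causalComplement hs) isWedge_standardWedge subset_rfl

theorem IsLocalNet.standard_separating (hs : 3 ≤ s) (hH : IsLocalNet U H) :
    Separating (H (standardWedge s)) := by
  refine (cyclic_of_sup_eq_top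
    (hH.cyclic _ (isWedge_causalComplement hs))).symplComp_separating.mono ?_
  refine hH.locality _ _ isWedge_standardWedge (isWedge_causalComplement hs) ?_
  rw [causalComplement_causalComplement hs]

theorem IsLocalNet.image_halfTurn (hs : 3 ≤ s) (hH : IsLocalNet U H) :
    U (halfTurn hs) '' (H (standardWedge s) : Set 𝓗) =
      H (causalComplement (standardWedge s)) := by
  rw [hH.covariance _ isWedge_standardWedge, act_halfTurn_standardWedge]

variable {X : Type u} [MeasurableSpace X] {ν : Measure X} {V : 𝓗 ≃ₗᵢ[ℂ] Lp ℂ 2 ν} {l : X → ℝ}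
  {μ : Measure ℝ≥0} {E : ℝ≥0 → Type*} [∀ m, NormedAddCommGroup (E m)]
  [∀ m, InnerProductSpace ℂ (E m)] {F : MeasurableField E} [∀ m, CompleteSpace (E m)]
  {Φ : F.squareIntegrable μ →ₗ[ℂ] 𝓗} {ι : ℝ≥0 → Type*}
  {J : ∀ m, ι m → Lp ℂ 2 (massShellMeasure s m) →ₗᵢ[ℂ] E m}

theorem modularBoost_translation (hs : 3 ≤ s) (hU : IsScalarModel Φ J U) (hH : IsLocalNet U H)
    (hM : IsLogModel (H (standardWedge s)) V l) (t : ℝ) (a : Spacetime s) (x : 𝓗) :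
    modularBoost V l U t (U (translation a) x) = U (translation a) (modularBoost V l U t x) := by
  have hc := hH.standard_cyclic
  have hsep := hH.standard_separating hs
  obtain ⟨W, hW⟩ := exists_positiveExtension hU
    (minkowski_lightVector_nonneg hs (ε := 1) (by simp))
  obtain ⟨W', hW'⟩ := exists_positiveExtension hU
    (minkowski_lightVector_nonneg hs (ε := -1) (by simp))
  obtain ⟨b, b0, b1, hab⟩ := exists_lightcone_decomposition a
  have hb : ∀ x, modularBoost V l U t (U (translation b) x) =
      U (translation b) (modularBoost V l U t x) :=
    modularBoost_commute hH hM (act_translation_eq b0 b1) (fun t => by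
      rw [conj_translation]
      exact congrArg (fun c => translation c * boost s t) (boostMap_transverse t b0 b1)) t
  rw [hab, translation_add, translation_add]
  simp only [rep_mul_apply]
  rw [modularBoost_lightVector_one hH hM hc hsep hW,
    modularBoost_lightVector_neg_one hH hM hc hsep hW', hb]

/-- The modularity argument enters here: commutation with translations, boosts and edge rotations
forces commutation with the half turn. -/
theorem modularBoost_halfTurn (hs : 3 ≤ s) (hU : IsScalarModel Φ J U) (hH : IsLocalNet U H)
    (hM : IsLogModel (H (standardWedge s)) V l) (t : ℝ) (x : 𝓗) :
    modularBoost V l U t (U (halfTurn hs) x) = U (halfTurn hs) (modularBoost V l U t x) :=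
  commute_halfTurn hs hU (modularBoost_translation hs hU hH hM t)
    (fun r => modularBoost_commute hH hM (act_boost_standardWedge r)
      (fun t => by rw [boost_mul, boost_mul, add_comm t r]) t)
    (fun β => modularBoost_commute hH hM (act_edgeRotation_standardWedge hs β)
      (fun t => boost_edgeRotation hs t β) t) x

theorem halfTurn_boost_apply (hs : 3 ≤ s) (t : ℝ) (x : 𝓗) :
    U (halfTurn hs) (U (boost s t) x) = U (boost s (-t)) (U (halfTurn hs) x) := by
  rw [← rep_mul_apply, halfTurn_boost, rep_mul_apply]

theorem boost_boost_neg (t : ℝ) (x : 𝓗) : U (boost s t) (U (boost s (-t)) x) = x := by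
  rw [← rep_mul_apply, boost_mul, add_neg_cancel, boost_zero, map_one]
  rfl

/-- The modular group of `H(W₁)` leaves `H(W₁')` invariant. -/
theorem modular_image (hs : 3 ≤ s) (hU : IsScalarModel Φ J U) (hH : IsLocalNet U H)
    (hM : IsLogModel (H (standardWedge s)) V l) (t : ℝ) :
    modularEquiv V hM.measurable t '' (H (causalComplement (standardWedge s)) : Set 𝓗) =
      H (causalComplement (standardWedge s)) := by
  have hmaps : ∀ t, ∀ y ∈ (H (causalComplement (standardWedge s)) : Set 𝓗),
      modular V l t y ∈ (H (causalComplement (standardWedge s)) : Set 𝓗) := by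
    intro t y hy
    rw [← hH.image_halfTurn hs] at hy ⊢
    obtain ⟨k, hk, rfl⟩ := hy
    set b : ℝ := 2 * Real.pi * t
    -- The half turn r inverts the boosts, so evaluating Z(t)U(r) = U(r)Z(t) on a boosted vector
    -- gives Δ^{it}U(r)k = U(r)Δ^{it}U(Λ(2b))k, and the vector behind U(r) lies in K.
    refine ⟨modular V l t (U (boost s b) (U (boost s b) k)), hM.modular_mem t ?_, ?_⟩
    · have h1 := hH.map_mem isWedge_standardWedge (boost s b) hk
      rw [act_boost_standardWedge] at h1
      have h2 := hH.map_mem isWedge_standardWedge (boost s b) h1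
      rwa [act_boost_standardWedge] at h2
    · have h := modularBoost_halfTurn hs hU hH hM t (U (boost s b) k)
      rw [modularBoost_apply, modularBoost_apply, halfTurn_boost_apply, boost_boost_neg] at h
      exact h.symm
  refine Set.Subset.antisymm ?_ fun y hy => ?_
  · rintro _ ⟨y, hy, rfl⟩
    exact hmaps t y hy
  · exact ⟨modular V l (-t) y, hmaps _ y hy, modular_self_neg V hM.measurable t y⟩

/-- By locality H(W₁') is a cyclic subspace of K'. It is invariant under the modular group of K, so
its R commutes with that of K', and a cyclic subspace with this property is everything. -/
theorem standard_duality (hs : 3 ≤ s) (hU : IsScalarModel Φ J U) (hH : IsLocalNet U H) :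
    H (causalComplement (standardWedge s)) = (H (standardWedge s)).symplComp := by
  have hc := hH.standard_cyclic
  have hsep := hH.standard_separating hs
  obtain ⟨X, _, ν, V, l, hM⟩ := exists_isLogModel hc hsep
  refine eq_of_commute (cyclic_of_sup_eq_top (hH.cyclic _ (isWedge_causalComplement hs)))
    hc.symplComp_separating (hH.le_symplComp hs) fun x => ?_
  have h := commute_of_modular V hM.measurable
    (sumProj (H (causalComplement (standardWedge s))))
    (fun t x => sumProj_of_image _ (modular_image hs hU hH hM t) x) x
  rw [← hM.sumProj_eq, ← hM.sumProj_eq] at h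
  rw [sumProj_symplComp, sumProj_symplComp, map_sub, map_smul, h]

theorem duality (hs : 3 ≤ s) (hU : IsScalarModel Φ J U) (hH : IsLocalNet U H) : Duality H := by
  rintro W ⟨g, rfl⟩
  have h0 : (H (causalComplement (standardWedge s))).symplComp = H (standardWedge s) := by
    rw [standard_duality hs hU hH, symplComp_symplComp_eq]
  have h := symplComp_image (U g) (hH.covariance _ (isWedge_causalComplement hs) g)
  rw [h0, hH.covariance _ isWedge_standardWedge, act_causalComplement] at h
  exact SetLike.coe_injective h

/-- By duality the half turn maps K onto K' and so inverts the modular group; it inverts the boosts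
too. As it commutes with Z(t), Z(t) = Z(-t). -/
theorem boost_eq_modular (hs : 3 ≤ s) (hU : IsScalarModel Φ J U) (hH : IsLocalNet U H)
    (hM : IsLogModel (H (standardWedge s)) V l) (t : ℝ) (x : 𝓗) :
    U (boost s (2 * Real.pi * t)) x = modular V l (-t) x := by
  have hr : ∀ t x, U (halfTurn hs) (modular V l t x) = modular V l (-t) (U (halfTurn hs) x) := by
    intro t x
    have h := modular_intertwine V hM.measurable
      ((U (halfTurn hs)).toContinuousLinearEquiv : 𝓗 →L[ℂ] 𝓗) (-1) (fun x => ?_) t x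
    · rwa [neg_one_mul] at h
    · have himg := hH.image_halfTurn hs
      rw [standard_duality hs hU hH] at himg
      rw [hM.mulBy_logistic_neg, ← hM.sumProj_eq, ← sumProj_symplComp]
      exact (sumProj_of_image (U (halfTurn hs)) himg x).symm
  have key : ∀ t x, modular V l t (U (boost s (2 * Real.pi * t)) x) =
      modular V l (-t) (U (boost s (-(2 * Real.pi * t))) x) := by
    intro t x
    obtain ⟨y, rfl⟩ := (U (halfTurn hs)).surjective x
    have h := modularBoost_halfTurn hs hU hH hM t y
    rwa [modularBoost_apply, modularBoost_apply, hr, halfTurn_boost_apply] at h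
  -- Evaluating Z(t/2) = Z(-t/2) on a boosted vector cancels the boosts on the right and doubles
  -- them on the left.
  have h := key (t / 2) (U (boost s (2 * Real.pi * (t / 2))) x)
  have e : U (boost s (-(2 * Real.pi * (t / 2)))) (U (boost s (2 * Real.pi * (t / 2))) x) = x := by
    have := boost_boost_neg (U := U) (-(2 * Real.pi * (t / 2))) x
    rwa [neg_neg] at this
  rw [e, ← rep_mul_apply, boost_mul] at h
  have h' := congrArg (modular V l (-(t / 2))) h
  rw [modular_neg_self V hM.measurable, ← modular_add V hM.measurable] at h'
  rw [show 2 * Real.pi * t = 2 * Real.pi * (t / 2) + 2 * Real.pi * (t / 2) by ring, h']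
  congr 2
  ring

theorem bisognanoWichmann (hs : 3 ≤ s) (hU : IsScalarModel Φ J U) (hH : IsLocalNet U H) :
    BisognanoWichmann U H := by
  intro g t
  obtain ⟨X, _, ν, V, l, hM⟩ := exists_isLogModel hH.standard_cyclic (hH.standard_separating hs)
  have hM' := hM.of_image (U g) (hH.covariance _ isWedge_standardWedge g)
  convert hM'.isFunctionOf_modular t using 1
  funext x
  rw [rep_mul_apply, rep_mul_apply, boost_eq_modular hs hU hH hM, map_inv]
  rfl

end main

end WedgeNets
end

theorem theorem4p2 (s : ℕ) [NeZero s] (hs : 3 ≤ s)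
    (μ : MeasureTheory.Measure ℝ≥0) [MeasureTheory.SigmaFinite μ]
    {E : ℝ≥0 → Type*} [∀ m, NormedAddCommGroup (E m)] [∀ m, InnerProductSpace ℂ (E m)]
    [∀ m, CompleteSpace (E m)] (F : MeasurableField E)
    (V : ∀ m, poincareGroup s →* (E m ≃ₗᵢ[ℂ] E m))
    (hV : ∀ᵐ m ∂μ, IsMultipleOf (scalarRep s m) (V m))
    {𝓗 : Type*} [NormedAddCommGroup 𝓗] [InnerProductSpace ℂ 𝓗] [CompleteSpace 𝓗]
    (U : poincareGroup s →* (𝓗 ≃ₗᵢ[ℂ] 𝓗)) (hU : IsDirectIntegral μ F V U) :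
    ModularityCondition U ∧
      ∀ H : Set (Spacetime s) → ClosedSubmodule ℝ 𝓗, IsLocalNet U H →
        BisognanoWichmann U H ∧ Duality H := by
  obtain ⟨Φ, ι, J, hM⟩ := exists_isScalarModel hV hU
  exact ⟨modularityCondition hs hM, fun H hH => ⟨bisognanoWichmann hs hM hH, duality hs hM hH⟩⟩
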